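/- **Setting.** Let $L\ge1$ be an integer. Let $g\in C^\infty(\mathbb R)$ be odd and $2\pi$-periodic with $g(0)=g(\pi)=0$, $g>0$ on $(0,\pi)$, $g'(0)=1$, $g'(\pi)=-1$; put $f=gg'$. Let $\chi\ge 0$ be a smooth nonincreasing cut-off with $\chi(y)=1$ for $y\le1$, $\chi(y)=0$ for $y\ge2$. Write $\Lambda u=yu'$, $\Delta u=u''+u'/y$ for functions of $y>0$, and $\int u=\int_0^\infty u(y)\,y\,dy$ (likewise over $y\le R$). Let $Q$ be the solution of $\Lambda Q=g(Q)$, $Q(0)=0$, $Q(y)\to\pi$ as $y\to\infty$, with the scaling normalized by $y(\pi-Q(y))\to2$. Let $Z=g'(Q)$, $$H=-\Delta+\frac{f'(Q)}{y^2},\quad A=-\partial_y+\frac Zy,\quad A^*=\partial_y+\frac{1+Z}y,\quad \Gamma(y)=\Lambda Q(y)\int_1^y\frac{dx}{x(\Lambda Q(x))^2},$$ $$H^{-1}u=-\Gamma(y)\int_0^y u\,\Lambda Q\,x\,dx+\Lambda Q(y)\int_0^y u\,\Gamma\,x\,dx,\qquad T_i=(-1)^iH^{-i}\Lambda Q ,$$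 and $u_0=u$, $u_{k+1}=Au_k$ for $k$ even, $u_{k+1}=A^*u_k$ for $k$ odd. For $b_1>0$ let $$B_0=\frac1{\sqrt{b_1}},\qquad B_1=\frac{|\log b_1|}{\sqrt{b_1}},\qquad c_{b_1}=\frac4{\int\chi\big(\tfrac{4y}{B_0}\big)(\Lambda Q)^2}.$$ **$b_1$-admissible functions.** For $l\in\mathbb Z$ let $$g_l=\begin{cases}\frac{1+|\log(\sqrt{b_1}y)|}{|\log b_1|}\mathbf 1_{y\le3B_0},&l\ge1,\\ \frac{1}{|\log b_1|}\mathbf 1_{y\le3B_0},&l\le0,\end{cases}\qquad \tilde g_l=\begin{cases}\frac{1+|\log y|}{|\log b_1|}\mathbf 1_{y\le3B_0},&l\ge1,\\ \frac{1}{|\log b_1|}\mathbf 1_{y\le3B_0}+\mathbf 1_{B_0/4\le y\le3B_0},&l\le0,\end{cases}$$ and let $F_{p_2,k,l}=\frac1{b_1^{l+1}|\log b_1|}$ if $2p_2-k-3\ge0$, and $F_{p_2,k,l}=0$ otherwise. A function $f(b_1,y)$, smooth on $(0,\infty)\times[0,\infty)$, is $b_1$-admissible of degree $(p_1,p_2)\in\mathbb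 N\times\mathbb Z$ if for some $b_0\in(0,1)$ and all $0<b_1<b_0$: (i) for $y\le1$, $f(b_1,y)=\sum_{j=1}^Jh_j(b_1)\tilde f_j(y)$ (a finite sum), with $h_j$ smooth on $(0,b_0)$, $|\partial_{b_1}^lh_j|\lesssim b_1^{-l}$ for all $l\ge0$, and $\tilde f_j$ smooth on $[0,1]$ with $\tilde f_j(y)=\sum_{k=p_1}^pc_{k,j}y^{2k+1}+O(y^{2p+3})$ on $[0,1]$ for all $p$; (ii) for some $c>0$, for all $y\ge2$, $k\ge0$ and $l\ge1$, with $f_k$ the functions above built from $f(b_1,\cdot)$, $$|f_k|\lesssim y^{2p_2-k-1}g_{2p_2-k}+y^{2p_2-k-3}|\log y|^{c}+F_{p_2,k,0}\,y^{2p_2-k-3}\mathbf 1_{y\ge3B_0},$$ $$|\partial_{b_1}^lf_k|\lesssim\frac1{b_1^l|\log b_1|}\Big\{y^{2p_2-k-1}\tilde g_{2p_2-k}+y^{2p_2-k-3}|\log y|^{c}\Big\}+F_{p_2,k,l}\,y^{2p_2-k-3}\mathbf 1_{y\ge3B_0},$$ with implied constants independent of $b_1,y$. A function $S(b,y)$ of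 $b=(b_1,\dots,b_L)$, $b_1>0$, and $y\ge0$ is homogeneous of degree $(p_1,p_2,p_3)$ if it is a finite sum of terms $c_J\big(\prod_kb_k^{j_k}\big)\tilde S_J(b_1,y)$ with $J\in\mathbb Z\times\mathbb N^{L-1}$, $\sum_kkj_k=p_3$, $c_J\in\mathbb R$, and $\tilde S_J$ $b_1$-admissible of degree $(p_1,p_2)$. **Proposition (construction of the approximate profile).** There are homogeneous profiles $S_i(b,y)$, $2\le i\le L+2$ (and $S_1=0$), depending only on $L,g,\chi$, with $\deg S_i=(i,i,i)$ and $\partial S_i/\partial b_j=0$ for $2\le i\le j\le L$, a constant $C>0$ depending only on $L$, and a constant $M_0>0$ such that the following holds for every $K>0$. There is $K'>0$, and for every $M\ge M_0$ there is $b^*>0$, such that for every $C^1$ map $b:[s_0,s_1]\to(-b^*,b^*)^L$ (where $s_0<s_1$) with $b_1>0$ and $|b_k|\le Kb_1^k$ for $2\le k\le L$, the function $$Q_b=Q+\sum_{i=1}^Lb_iT_i+\sum_{i=2}^{L+2}S_i$$ satisfies, with the convention $b_{L+1}=0$, $$\partial_sQ_b-\Delta Q_b+b_1\Lambda Q_b+\frac{f(Q_b)}{y^2}=\Psi_b+\mathrm{Mod},$$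 $$\mathrm{Mod}=\sum_{i=1}^L\big[(b_i)_s+(2i-1+c_{b_1})b_1b_i-b_{i+1}\big]\Big[T_i+\sum_{j=i+1}^{L+2}\frac{\partial S_j}{\partial b_i}\Big],$$ where for every $s\in[s_0,s_1]$: 1. $\int_{y\le2B_1}|H^k\Psi_b|^2\le K'b_1^{2k+2}|\log b_1|^C$ for $1\le k\le L$; 2. $\int_{y\le2B_1}\frac{1+|\log y|^2}{1+y^4}|H^L\Psi_b|^2+\int_{y\le2B_1}\frac{1+|\log y|^2}{1+y^2}|AH^L\Psi_b|^2\le K'\frac{b_1^{2L+3}}{|\log b_1|^2}$; 3. $\int_{y\le2B_1}|H^{L+1}\Psi_b|^2\le K'\frac{b_1^{2L+4}}{|\log b_1|^2}$; 4. (improved local control) $\int_{y\le2M}|H^k\Psi_b|^2\le K'M^Cb_1^{2L+6}$ for $0\le k\le L+1$. -/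

import Mathlib

open Set Filter Topology MeasureTheory
open scoped ContDiff ENNReal

namespace HarmonicHeatFlow

/-! ### The target, the cut off and the harmonic map -/

/-- The profile `g` of the target surface of revolution, with metric `du² + g(u)² dθ²`. -/
structure IsTargetProfile (g : ℝ → ℝ) : Prop where
  smooth : ContDiff ℝ ∞ g
  odd : ∀ u, g (-u) = -g u
  periodic : ∀ u, g (u + 2 * Real.pi) = g u
  zero : g 0 = 0
  pi : g Real.pi = 0
  pos : ∀ u ∈ Ioo 0 Real.pi, 0 < g u
  deriv_zero : deriv g 0 = 1
  deriv_pi : deriv g Real.pi = -1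

/-- The nonlinearity `f = g g'`. -/
noncomputable def nonlin (g : ℝ → ℝ) (u : ℝ) : ℝ := g u * deriv g u

/-- A nonnegative nonincreasing smooth cut off, `1` for `y ≤ 1` and `0` for `y ≥ 2`. -/
structure IsCutoff (χ : ℝ → ℝ) : Prop where
  smooth : ContDiff ℝ ∞ χ
  antitone : Antitone χ
  nonneg : ∀ y, 0 ≤ χ y
  eq_one : ∀ y, y ≤ 1 → χ y = 1
  eq_zero : ∀ y, 2 ≤ y → χ y = 0

/-- The degree one harmonic map `Q` on `[0, ∞)`: the solution of `y Q' = g(Q)`, `Q(0) = 0`,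
`Q(∞) = π`, which is unique up to scaling; the scaling is fixed by `Q(y) = π - 2 / y + o(1 / y)`. -/
structure IsHarmonicMap (g Q : ℝ → ℝ) : Prop where
  ode : ∀ y, 0 < y → HasDerivAt Q (g (Q y) / y) y
  zero : Q 0 = 0
  continuous_zero : ContinuousWithinAt Q (Ici 0) 0
  tendsto_pi : Tendsto Q atTop (𝓝 Real.pi)
  scaling : Tendsto (fun y => y * (Real.pi - Q y)) atTop (𝓝 2)

/-! ### Differential operators in the radial variable `y > 0` -/

/-- The scaling generator `Λ u = y u'`. -/
noncomputable def scal (u : ℝ → ℝ) (y : ℝ) : ℝ := y * deriv u y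

/-- The radial Laplacian in two dimensions. -/
noncomputable def lap (u : ℝ → ℝ) (y : ℝ) : ℝ := deriv (deriv u) y + deriv u y / y

/-- The linearized operator `H = -Δ + f'(Q) / y²`. -/
noncomputable def opH (g Q u : ℝ → ℝ) (y : ℝ) : ℝ :=
  -lap u y + deriv (nonlin g) (Q y) / y ^ 2 * u y

/-- `A = -∂_y + Z / y` with `Z = g'(Q)`. -/
noncomputable def opA (g Q u : ℝ → ℝ) (y : ℝ) : ℝ :=
  -deriv u y + deriv g (Q y) / y * u y

/-- `A* = ∂_y + (1 + Z) / y` with `Z = g'(Q)`. -/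
noncomputable def opAstar (g Q u : ℝ → ℝ) (y : ℝ) : ℝ :=
  deriv u y + (1 + deriv g (Q y)) / y * u y

/-- The suitable derivatives: `f_0 = f`, `f_{k+1} = A f_k` for `k` even and `A* f_k` for `k` odd. -/
noncomputable def suitable (g Q : ℝ → ℝ) : ℕ → (ℝ → ℝ) → (ℝ → ℝ)
  | 0, u => u
  | k + 1, u => if Even k then opA g Q (suitable g Q k u) else opAstar g Q (suitable g Q k u)

/-- The second solution `Γ(y) = ΛQ(y) ∫_1^y dx / (x (ΛQ(x))²)` of `H u = 0`. -/
noncomputable def Gam (Q : ℝ → ℝ) (y : ℝ) : ℝ :=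
  scal Q y * ∫ x in (1 : ℝ)..y, 1 / (x * (scal Q x) ^ 2)

/-- The inverse
`H⁻¹ u = -Γ(y) ∫_0^y u (ΛQ) x dx + ΛQ(y) ∫_0^y u Γ x dx`. -/
noncomputable def invH (Q u : ℝ → ℝ) (y : ℝ) : ℝ :=
  -Gam Q y * (∫ x in (0 : ℝ)..y, u x * scal Q x * x)
    + scal Q y * ∫ x in (0 : ℝ)..y, u x * Gam Q x * x

/-- `T_i = (-1)^i H^{-i} ΛQ`. -/
noncomputable def profT (Q : ℝ → ℝ) (i : ℕ) (y : ℝ) : ℝ :=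
  (-1) ^ i * ((invH Q)^[i] (scal Q)) y

/-- `B_0 = 1 / √b₁`. -/
noncomputable def B0 (b1 : ℝ) : ℝ := 1 / Real.sqrt b1

/-- `B_1 = |log b₁| / √b₁`. -/
noncomputable def B1 (b1 : ℝ) : ℝ := |Real.log b1| / Real.sqrt b1

/-- `c_{b₁} = 4 / ∫ χ_{B_0/4} (ΛQ)²`, the integral being over `(0, ∞)` against `y dy`. -/
noncomputable def cb (Q χ : ℝ → ℝ) (b1 : ℝ) : ℝ :=
  4 / ∫ y in Ioi (0 : ℝ), χ (y / (B0 b1 / 4)) * (scal Q y) ^ 2 * y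

/-! ### `b₁`-admissible and homogeneous functions -/

/-- The weight `g_l(b₁, y)`. -/
noncomputable def gw (l : ℤ) (b1 y : ℝ) : ℝ :=
  if y ≤ 3 * B0 b1 then
    (if 1 ≤ l then (1 + |Real.log (Real.sqrt b1 * y)|) / |Real.log b1| else 1 / |Real.log b1|)
  else 0

/-- The weight `g̃_l(b₁, y)` for the derivatives in `b₁`. For `l ≤ 0` it is `1 / |log b₁|`,
without the logarithmic gain in the zone `B_0 / 4 ≤ y ≤ 3 B_0`, where the cut offs vary. -/
noncomputable def gtw (l : ℤ) (b1 y : ℝ) : ℝ :=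
  if y ≤ 3 * B0 b1 then
    (if 1 ≤ l then (1 + |Real.log y|) / |Real.log b1|
      else 1 / |Real.log b1| + (if B0 b1 / 4 ≤ y then 1 else 0))
  else 0

/-- The constant `F_{p₂,k,l}(b₁)`. -/
noncomputable def Fc (p₂ : ℤ) (k l : ℕ) (b1 : ℝ) : ℝ :=
  if 0 ≤ 2 * p₂ - k - 3 then 1 / (b1 ^ (l + 1) * |Real.log b1|) else 0

/-- `u` is smooth on `[0, 1]`, with Taylor expansion at the origin, to all orders,
`u(y) = ∑_{k=p₁}^p c_k y^{2k+1} + O(y^{2p+3})`. -/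
def HasOddTaylor (p₁ : ℕ) (u : ℝ → ℝ) : Prop :=
  ContDiffOn ℝ ∞ u (Icc 0 1) ∧
  ∃ c : ℕ → ℝ, ∀ p : ℕ, ∃ K : ℝ, ∀ y ∈ Icc (0 : ℝ) 1,
    |u y - ∑ k ∈ Finset.Icc p₁ p, c k * y ^ (2 * k + 1)| ≤ K * y ^ (2 * p + 3)

/-- `b₁`-admissible functions `f(b₁, y)` of degree `(p₁, p₂)`. They are smooth on
`(0, ∞) × [0, ∞)`, and the estimates are for small `b₁`. -/
def IsB1Admissible (g Q : ℝ → ℝ) (p₁ : ℕ) (p₂ : ℤ) (f : ℝ → ℝ → ℝ) : Prop :=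
  ContDiffOn ℝ ∞ (fun z : ℝ × ℝ => f z.1 z.2) (Ioi 0 ×ˢ Ici 0) ∧
  ∃ b₀ ∈ Ioo (0 : ℝ) 1,
    -- separation of variables near the origin
    (∃ (J : ℕ) (h ft : Fin J → ℝ → ℝ),
      (∀ j, ContDiffOn ℝ ∞ (h j) (Ioo 0 b₀)) ∧
      (∀ j, ∀ l : ℕ, ∃ K : ℝ, ∀ b1 ∈ Ioo 0 b₀, |iteratedDeriv l (h j) b1| ≤ K / b1 ^ l) ∧
      (∀ j, HasOddTaylor p₁ (ft j)) ∧
      ∀ b1 ∈ Ioo 0 b₀, ∀ y ∈ Icc (0 : ℝ) 1, f b1 y = ∑ j, h j b1 * ft j y) ∧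
    -- bounds at infinity
    ∃ c : ℝ, 0 < c ∧
      (∀ k : ℕ, ∃ K : ℝ, ∀ b1 ∈ Ioo 0 b₀, ∀ y, 2 ≤ y →
        |suitable g Q k (f b1) y| ≤
          K * (y ^ (2 * p₂ - k - 1) * gw (2 * p₂ - k) b1 y
            + y ^ (2 * p₂ - k - 3) * |Real.log y| ^ c
            + (if 3 * B0 b1 ≤ y then Fc p₂ k 0 b1 * y ^ (2 * p₂ - k - 3) else 0))) ∧
      (∀ k l : ℕ, 1 ≤ l → ∃ K : ℝ, ∀ b1 ∈ Ioo 0 b₀, ∀ y, 2 ≤ y →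
        |iteratedDeriv l (fun β => suitable g Q k (f β) y) b1| ≤
          K * (1 / (b1 ^ l * |Real.log b1|) *
              (y ^ (2 * p₂ - k - 1) * gtw (2 * p₂ - k) b1 y
                + y ^ (2 * p₂ - k - 3) * |Real.log y| ^ c)
            + (if 3 * B0 b1 ≤ y then Fc p₂ k l b1 * y ^ (2 * p₂ - k - 3) else 0)))

/-- The `k`-th coordinate `b_k` of `b = (b_1, …, b_L)`, with `b_k = 0` unless `1 ≤ k ≤ L`;
so `b_k` is the entry of index `k - 1`. -/
def coord {L : ℕ} (b : Fin L → ℝ) (k : ℕ) : ℝ :=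
  if h : 1 ≤ k ∧ k ≤ L then b ⟨k - 1, by omega⟩ else 0

/-- Homogeneous functions `S(b, y)` of degree `(p₁, p₂, p₃)`: finite sums of
`c_J (∏_k b_k^{j_k}) S̃_J(b₁, y)` over `J ∈ ℤ × ℕ^{L-1}` with `∑_k k j_k = p₃`, where each `S̃_J` is
`b₁`-admissible of degree `(p₁, p₂)`. They are functions on `{b₁ > 0} × {y ≥ 0}`. -/
def IsHomogeneous (g Q : ℝ → ℝ) {L : ℕ} (p₁ : ℕ) (p₂ : ℤ) (p₃ : ℕ)
    (S : (Fin L → ℝ) → ℝ → ℝ) : Prop :=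
  ∃ (𝒥 : Finset (Fin L → ℤ)) (c : (Fin L → ℤ) → ℝ) (St : (Fin L → ℤ) → ℝ → ℝ → ℝ),
    (∀ J ∈ 𝒥, (∀ k : Fin L, 1 ≤ (k : ℕ) → 0 ≤ J k) ∧
      ∑ k : Fin L, ((k : ℕ) + 1 : ℤ) * J k = p₃) ∧
    (∀ J ∈ 𝒥, IsB1Admissible g Q p₁ p₂ (St J)) ∧
    ∀ b : Fin L → ℝ, 0 < coord b 1 → ∀ y, 0 ≤ y →
      S b y = ∑ J ∈ 𝒥, c J * (∏ k : Fin L, b k ^ J k) * St J (coord b 1) y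

/-- The partial derivative of `S(b, y)` in the parameter of index `j`, that is, in `b_{j+1}`. -/
noncomputable def partialB {L : ℕ} (j : Fin L) (S : (Fin L → ℝ) → ℝ → ℝ)
    (b : Fin L → ℝ) (y : ℝ) : ℝ :=
  deriv (fun t => S (Function.update b j t) y) (b j)

/-! ### The approximate profile, the modulation term and the error -/

/-- `Q_b = Q + ∑_{i=1}^L b_i T_i + ∑_{i=2}^{L+2} S_i(b, ·)`. -/
noncomputable def profQ (Q : ℝ → ℝ) {L : ℕ} (S : ℕ → (Fin L → ℝ) → ℝ → ℝ)
    (b : Fin L → ℝ) (y : ℝ) : ℝ :=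
  Q y + (∑ i ∈ Finset.Icc 1 L, coord b i * profT Q i y + ∑ i ∈ Finset.Icc 2 (L + 2), S i b y)

/-- `∂_s Q_b - Δ Q_b + b₁ Λ Q_b + f(Q_b) / y²` for `b = b(s)`, `s ∈ I`. -/
noncomputable def flow (g Q : ℝ → ℝ) {L : ℕ} (S : ℕ → (Fin L → ℝ) → ℝ → ℝ)
    (I : Set ℝ) (b : ℝ → Fin L → ℝ) (s y : ℝ) : ℝ :=
  derivWithin (fun σ => profQ Q S (b σ) y) I s
    - lap (profQ Q S (b s)) y
    + coord (b s) 1 * scal (profQ Q S (b s)) y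
    + nonlin g (profQ Q S (b s) y) / y ^ 2

/-- `Mod = ∑_{i=1}^L [(b_i)_s + (2i-1+c_{b₁}) b₁ b_i - b_{i+1}] [T_i + ∑_{j=i+1}^{L+2} ∂S_j/∂b_i]`,
with `b_{L+1} = 0`; the index `i : Fin L` below stands for `i + 1`. -/
noncomputable def modTerm (Q χ : ℝ → ℝ) {L : ℕ} (S : ℕ → (Fin L → ℝ) → ℝ → ℝ)
    (I : Set ℝ) (b : ℝ → Fin L → ℝ) (s y : ℝ) : ℝ :=
  ∑ i : Fin L,
    (derivWithin (fun σ => b σ i) I s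
      + (2 * ((i : ℕ) + 1 : ℝ) - 1 + cb Q χ (coord (b s) 1)) * coord (b s) 1 * b s i
      - coord (b s) ((i : ℕ) + 2)) *
    (profT Q ((i : ℕ) + 1) y
      + ∑ j ∈ Finset.Icc ((i : ℕ) + 2) (L + 2), partialB i (S j) (b s) y)

/-- The error `Ψ_b`, defined by `∂_s Q_b - Δ Q_b + b₁ Λ Q_b + f(Q_b) / y² = Ψ_b + Mod`. -/
noncomputable def errorTerm (g Q χ : ℝ → ℝ) {L : ℕ} (S : ℕ → (Fin L → ℝ) → ℝ → ℝ)
    (I : Set ℝ) (b : ℝ → Fin L → ℝ) (s y : ℝ) : ℝ :=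
  flow g Q S I b s y - modTerm Q χ S I b s y

/-- `∫_{y ≤ R} w |u|²` against the measure `y dy`, in `[0, ∞]`. -/
noncomputable def sqInt (R : ℝ) (w u : ℝ → ℝ) : ℝ≥0∞ :=
  ∫⁻ y in Ioc 0 R, ENNReal.ofReal (w y * u y ^ 2 * y)

end HarmonicHeatFlow

open HarmonicHeatFlow

open scoped Real
open Real (log sqrt_pos log_nonneg norm_eq_abs log_sqrt log_nonpos log_mul log_inv log_le_log sqrt_nonneg sq_sqrt contDiffAt_log log_le_sub_one_of_pos rpow_natCast pi_pos sqrt_lt')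
open Finset (sum_congr mem_range sum_add_distrib mul_sum sum_range_succ' sum_range_succ mem_insert_of_mem sum_insert sum_nonneg sum_mul single_le_sum mem_insert_self sum_subset sum_sub_distrib prod_congr sum_comm sum_Ico_eq_sum_range)
open ENNReal (ofReal ofReal_le_ofReal)
local notation "SmoothAt" => ContDiffAt ℝ ∞
local notation "Smooth" => ContDiff ℝ ∞

namespace HarmonicHeatFlow

/-! ### Symbol classes -/

/-- Symbol bounds up to order `n`, uniform in a parameter: `|∂_y^k u| ≲ y^{-k} w` on `D`. -/
structure SymTo (n : ℕ∞) {P : Type} (D : Set (P × ℝ)) (w u : P → ℝ → ℝ) : Prop where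
  pos : ∀ z ∈ D, 0 < z.2
  nonneg : ∀ z ∈ D, 0 ≤ w z.1 z.2
  smooth : ∀ z ∈ D, SmoothAt (u z.1) z.2
  bound : ∀ k : ℕ, k ≤ n → ∃ C, 0 ≤ C ∧ ∀ z ∈ D,
    |iteratedDeriv k (u z.1) z.2| * z.2 ^ k ≤ C * w z.1 z.2

/-- Symbol bounds to all orders. -/
abbrev SymOn {P : Type} (D : Set (P × ℝ)) (w u : P → ℝ → ℝ) : Prop := SymTo ⊤ D w u

theorem exists_abs_le_Icc {f : ℝ → ℝ} (hf : Continuous f) (a b : ℝ) :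
    ∃ C, 0 ≤ C ∧ ∀ x ∈ Icc a b, |f x| ≤ C := by
  obtain ⟨C, hC⟩ := isCompact_Icc.exists_bound_of_continuousOn hf.continuousOn
  exact ⟨|C|, abs_nonneg C, fun x hx => (hC x hx).trans (le_abs_self C)⟩

theorem abs_mul_le (κ : ℝ) {p C w : ℝ} (h : |p| ≤ C * w) : |κ * p| ≤ |κ| * C * w := by
  rw [abs_mul, mul_assoc]; exact mul_le_mul_of_nonneg_left h (abs_nonneg _)

theorem eventually_differentiableAt {f : ℝ → ℝ} {x : ℝ} (h : SmoothAt f x) :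
    ∀ᶠ y in 𝓝 x, DifferentiableAt ℝ f y := by
  have h1 : ContDiffAt ℝ 1 f x := h.of_le (by exact_mod_cast le_top)
  filter_upwards [h1.eventually (by simp)] with y hy using hy.differentiableAt (by simp)

theorem contDiffAt_deriv {f : ℝ → ℝ} {x : ℝ} (h : SmoothAt f x) :
    SmoothAt (deriv f) x := h.derivWithin (by simp)

theorem contDiffAt_nat {f : ℝ → ℝ} {x : ℝ} (h : SmoothAt f x) (n : ℕ) :
    ContDiffAt ℝ n f x := h.of_le (by exact_mod_cast le_top)

theorem contDiffAt_zpow (m : ℤ) {x : ℝ} (hx : x ≠ 0) : SmoothAt (fun y : ℝ => y ^ m) x := by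
  rcases m with m | m
  · simpa using (contDiffAt_id (𝕜 := ℝ)).pow m
  · simp only [zpow_negSucc]; exact ContDiffAt.inv (by fun_prop) (pow_ne_zero _ hx)

theorem iteratedDeriv_scal {f : ℝ → ℝ} {x : ℝ} (h : SmoothAt f x) (k : ℕ) :
    iteratedDeriv k (fun y => y * deriv f y) x
      = x * iteratedDeriv (k + 1) f x + k * iteratedDeriv k f x := by
  rw [iteratedDeriv_fun_mul (f := fun y => y) contDiffAt_id (contDiffAt_nat (contDiffAt_deriv h) k)]
  simp only [iteratedDeriv_fun_id]
  rcases k with _ | k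
  · simp [iteratedDeriv_one]
  · rw [sum_range_succ', sum_range_succ']
    have : ∀ i ∈ Finset.range k, ((k + 1).choose (i + 1 + 1) : ℝ) *
        (if i + 1 + 1 = 0 then x else if i + 1 + 1 = 1 then 1 else 0) *
          iteratedDeriv (k + 1 - (i + 1 + 1)) (deriv f) x = 0 := by
      intro i _; simp
    rw [Finset.sum_eq_zero this]; simp [iteratedDeriv_succ']; ring

/-- The parameters `b = (b_1, …, b_L)`. -/
abbrev Par (L : ℕ) := Fin L → ℝ

/-- The domain `0 < b < b0`, `1 ≤ y`. -/
abbrev strip (b0 : ℝ) : Set (ℝ × ℝ) := {z | z.1 ∈ Ioo 0 b0 ∧ 1 ≤ z.2}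

section
variable {P : Type} {D D' : Set (P × ℝ)} {w w' u v : P → ℝ → ℝ} {n : ℕ∞}

theorem SymTo.restrict (h : SymTo n D w u) {m : ℕ∞} (hm : m ≤ n := by exact le_top) :
    SymTo m D w u := ⟨h.pos, h.nonneg, h.smooth, fun k hk => h.bound k (hk.trans hm)⟩

theorem SymTo.top (h : ∀ m : ℕ, SymTo m D w u) : SymOn D w u :=
  ⟨(h 0).pos, (h 0).nonneg, (h 0).smooth, fun k _ => (h k).bound k le_rfl⟩

theorem SymTo.mono_set (h : SymTo n D w u) (hD : D' ⊆ D) : SymTo n D' w u :=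
  ⟨fun z hz => h.pos z (hD hz), fun z hz => h.nonneg z (hD hz), fun z hz => h.smooth z (hD hz),
    fun k hk => let ⟨C, hC, hb⟩ := h.bound k hk; ⟨C, hC, fun z hz => hb z (hD hz)⟩⟩

theorem SymTo.weaken (h : SymTo n D w u) {K : ℝ} (hK : 0 ≤ K) (h0 : ∀ z ∈ D, 0 ≤ w' z.1 z.2)
    (hw : ∀ z ∈ D, w z.1 z.2 ≤ K * w' z.1 z.2) : SymTo n D w' u :=
  ⟨h.pos, h0, h.smooth, fun k hk => by
    obtain ⟨C, hC, hb⟩ := h.bound k hk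
    refine ⟨C * K, by positivity, fun z hz => (hb z hz).trans ?_⟩
    rw [mul_assoc]; exact mul_le_mul_of_nonneg_left (hw z hz) hC⟩

theorem SymTo.congr (h : SymTo n D w u) (he : ∀ z ∈ D, u z.1 =ᶠ[𝓝 z.2] v z.1) : SymTo n D w v :=
  ⟨h.pos, h.nonneg, fun z hz => (h.smooth z hz).congr_of_eventuallyEq (he z hz).symm, fun k hk => by
    obtain ⟨C, hC, hb⟩ := h.bound k hk
    refine ⟨C, hC, fun z hz => ?_⟩
    rw [← (he z hz).iteratedDeriv_eq]; exact hb z hz⟩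

theorem SymTo.comp_param (h : SymTo n D w u) {P' : Type} (f : P' → P) :
    SymTo n {z : P' × ℝ | (f z.1, z.2) ∈ D} (fun p => w (f p)) (fun p => u (f p)) :=
  ⟨fun z hz => h.pos _ hz, fun z hz => h.nonneg _ hz, fun z hz => h.smooth _ hz,
    fun k hk => let ⟨C, hC, hb⟩ := h.bound k hk; ⟨C, hC, fun z hz => hb _ hz⟩⟩

theorem SymTo.add (hu : SymTo n D w u) (hv : SymTo n D w v) :
    SymTo n D w (fun p y => u p y + v p y) :=
  ⟨hu.pos, hu.nonneg, fun z hz => (hu.smooth z hz).add (hv.smooth z hz), fun k hk => by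
    obtain ⟨C, hC, hb⟩ := hu.bound k hk
    obtain ⟨C', hC', hb'⟩ := hv.bound k hk
    refine ⟨C + C', by positivity, fun z hz => ?_⟩
    rw [iteratedDeriv_fun_add (contDiffAt_nat (hu.smooth z hz) k)
      (contDiffAt_nat (hv.smooth z hz) k)]
    have := pow_nonneg (hu.pos z hz).le k
    calc _ ≤ (|iteratedDeriv k (u z.1) z.2| + |iteratedDeriv k (v z.1) z.2|) * z.2 ^ k :=
          mul_le_mul_of_nonneg_right (abs_add_le _ _) this
      _ ≤ _ := by rw [add_mul, add_mul]; exact add_le_add (hb z hz) (hb' z hz)⟩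

theorem SymTo.neg (hu : SymTo n D w u) : SymTo n D w (fun p y => -u p y) :=
  ⟨hu.pos, hu.nonneg, fun z hz => (hu.smooth z hz).neg, fun k hk => by
    obtain ⟨C, hC, hb⟩ := hu.bound k hk
    refine ⟨C, hC, fun z hz => ?_⟩
    rw [iteratedDeriv_fun_neg, abs_neg]; exact hb z hz⟩

theorem SymTo.zero (hp : ∀ z ∈ D, 0 < z.2) (h0 : ∀ z ∈ D, 0 ≤ w z.1 z.2) :
    SymTo n D w (fun _ _ => 0) :=
  ⟨hp, h0, fun _ _ => contDiffAt_const, fun k _ => ⟨0, le_rfl, fun z hz => by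
    simp⟩⟩

theorem SymTo.mul (hu : SymTo n D w u) (hv : SymTo n D w' v) :
    SymTo n D (fun p y => w p y * w' p y) (fun p y => u p y * v p y) := by
  refine ⟨hu.pos, fun z hz => mul_nonneg (hu.nonneg z hz) (hv.nonneg z hz),
    fun z hz => (hu.smooth z hz).mul (hv.smooth z hz), fun k hk => ?_⟩
  choose! C hC hb using hu.bound
  choose! C' hC' hb' using hv.bound
  have hl : ∀ i ∈ Finset.range (k + 1), (i : ℕ∞) ≤ n := fun i hi =>
    (Nat.cast_le.2 (Nat.lt_succ_iff.mp (mem_range.mp hi))).trans hk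
  have hl' : ∀ i, ((k - i : ℕ) : ℕ∞) ≤ n := fun i => (Nat.cast_le.2 (Nat.sub_le _ _)).trans hk
  refine ⟨∑ i ∈ Finset.range (k + 1), (k.choose i : ℝ) * C i * C' (k - i), ?_, fun z hz => ?_⟩
  · refine sum_nonneg fun i hi => ?_
    have := hC i (hl i hi)
    have := hC' (k - i) (hl' i)
    positivity
  · rw [iteratedDeriv_fun_mul (contDiffAt_nat (hu.smooth z hz) k)
      (contDiffAt_nat (hv.smooth z hz) k), sum_mul]
    have hp := (hu.pos z hz).le
    refine (mul_le_mul_of_nonneg_right (Finset.abs_sum_le_sum_abs _ _) (pow_nonneg hp k)).trans ?_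
    rw [sum_mul]
    refine Finset.sum_le_sum fun i hi => ?_
    have hi' : i ≤ k := Nat.lt_succ_iff.mp (mem_range.mp hi)
    have h1 := hb i (hl i hi) z hz
    have h2 := hb' (k - i) (hl' i) z hz
    have h3 : z.2 ^ k = z.2 ^ i * z.2 ^ (k - i) := by rw [← pow_add]; congr 1; omega
    rw [abs_mul, abs_mul, h3, abs_of_nonneg (Nat.cast_nonneg _ : (0 : ℝ) ≤ (k.choose i : ℝ))]
    have := mul_le_mul h1 h2 (by positivity) (by
      have := hC i (hl i hi); have := hu.nonneg z hz; positivity)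
    calc _ = (k.choose i : ℝ) * ((|iteratedDeriv i (u z.1) z.2| * z.2 ^ i) *
          (|iteratedDeriv (k - i) (v z.1) z.2| * z.2 ^ (k - i))) := by ring
      _ ≤ (k.choose i : ℝ) * (C i * w z.1 z.2 * (C' (k - i) * w' z.1 z.2)) :=
          mul_le_mul_of_nonneg_left this (Nat.cast_nonneg _)
      _ = _ := by ring

theorem SymTo.coeff (h : P → ℝ) (hp : ∀ z ∈ D, 0 < z.2) :
    SymTo n D (fun p _ => |h p|) (fun p _ => h p) :=
  ⟨hp, fun _ _ => abs_nonneg _, fun _ _ => contDiffAt_const, fun k _ => ⟨1, zero_le_one,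
    fun z hz => by
      rw [iteratedDeriv_const]
      rcases k with _ | k <;> simp⟩⟩

theorem SymTo.const (c : ℝ) (hp : ∀ z ∈ D, 0 < z.2) : SymTo n D (fun _ _ => 1) (fun _ _ => c) :=
  (SymTo.coeff (fun _ => c) hp).weaken (abs_nonneg c) (fun _ _ => zero_le_one) (fun _ _ => by simp)

theorem SymTo.const_mul (hu : SymTo n D w u) (c : ℝ) : SymTo n D w (fun p y => c * u p y) :=
  ((SymTo.const c hu.pos).mul hu).weaken zero_le_one hu.nonneg (fun z _ => by simp)

theorem SymTo.coeff_mul (hu : SymTo n D w u) (h : P → ℝ) :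
    SymTo n D (fun p y => |h p| * w p y) (fun p y => h p * u p y) :=
  (SymTo.coeff h hu.pos).mul hu

theorem SymTo.sum {ι : Type*} (s : Finset ι) {f : ι → P → ℝ → ℝ}
    (hp : ∀ z ∈ D, 0 < z.2) (h0 : ∀ z ∈ D, 0 ≤ w z.1 z.2) (hf : ∀ i ∈ s, SymTo n D w (f i)) :
    SymTo n D w (fun p y => ∑ i ∈ s, f i p y) := by
  classical
  induction s using Finset.induction_on with
  | empty => simpa using SymTo.zero hp h0
  | insert a s ha ih =>
    simp only [sum_insert ha]
    exact (hf a (mem_insert_self _ _)).add (ih fun i hi => hf i (mem_insert_of_mem hi))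

theorem SymTo.pow (hu : SymTo n D w u) (m : ℕ) :
    SymTo n D (fun p y => w p y ^ m) (fun p y => u p y ^ m) := by
  induction m with
  | zero => simpa using SymTo.const 1 hu.pos
  | succ m ih => simpa only [pow_succ] using ih.mul hu

theorem SymTo.deriv_succ {n : ℕ} (hu : SymTo (n + 1 : ℕ) D w u) :
    SymTo n D (fun p y => w p y / y) (fun p => deriv (u p)) :=
  ⟨hu.pos, fun z hz => div_nonneg (hu.nonneg z hz) (hu.pos z hz).le,
    fun z hz => contDiffAt_deriv (hu.smooth z hz), fun k hk => by
    obtain ⟨C, hC, hb⟩ := hu.bound (k + 1) (by norm_cast at hk ⊢; omega)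
    refine ⟨C, hC, fun z hz => ?_⟩
    have hp := hu.pos z hz
    have := hb z hz
    rw [iteratedDeriv_succ', pow_succ] at this
    rw [mul_div_assoc', le_div_iff₀ hp]
    linarith⟩

theorem SymTo.succ_of_deriv {n : ℕ} (hs : ∀ z ∈ D, SmoothAt (u z.1) z.2)
    (h0 : ∃ C, 0 ≤ C ∧ ∀ z ∈ D, |u z.1 z.2| ≤ C * w z.1 z.2) (hw : ∀ z ∈ D, 0 ≤ w z.1 z.2)
    (hu : SymTo n D (fun p y => w p y / y) (fun p => _root_.deriv (u p))) :
    SymTo (n + 1 : ℕ) D w u :=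
  ⟨hu.pos, hw, hs, fun k hk => by
    rcases k with _ | k
    · simpa using h0
    · obtain ⟨C, hC, hb⟩ := hu.bound k (by norm_cast at hk ⊢; omega)
      refine ⟨C, hC, fun z hz => ?_⟩
      have hp := hu.pos z hz
      have := hb z hz
      rw [mul_div_assoc', le_div_iff₀ hp] at this
      rw [iteratedDeriv_succ', pow_succ]
      linarith⟩

theorem SymTo.of_bound (hp : ∀ z ∈ D, 0 < z.2) (hs : ∀ z ∈ D, SmoothAt (u z.1) z.2)
    (h0 : ∃ C, 0 ≤ C ∧ ∀ z ∈ D, |u z.1 z.2| ≤ C * w z.1 z.2) (hw : ∀ z ∈ D, 0 ≤ w z.1 z.2) :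
    SymTo 0 D w u :=
  ⟨hp, hw, hs, fun k hk => by
    obtain rfl : k = 0 := by exact_mod_cast nonpos_iff_eq_zero.1 hk
    simpa using h0⟩

theorem SymTo.bound_zero (h : SymTo n D w u) :
    ∃ C, 0 ≤ C ∧ ∀ z ∈ D, |u z.1 z.2| ≤ C * w z.1 z.2 := by
  simpa using h.bound 0 (by simp)

/-- A family of functions which is stable under `y ∂_y` consists of symbols. -/
theorem SymTo.of_scal_closed {ι : Type*} (f : ι → P → ℝ → ℝ) (σ : ι → ι)
    (hp : ∀ z ∈ D, 0 < z.2) (hw : ∀ z ∈ D, 0 ≤ w z.1 z.2)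
    (hs : ∀ i, ∀ z ∈ D, SmoothAt (f i z.1) z.2)
    (hb : ∀ i, ∃ C, 0 ≤ C ∧ ∀ z ∈ D, |f i z.1 z.2| ≤ C * w z.1 z.2)
    (hσ : ∀ i, ∀ z ∈ D, ∀ᶠ y in 𝓝 z.2, y * deriv (f i z.1) y = f (σ i) z.1 y) (i : ι) :
    SymOn D w (f i) := by
  suffices H : ∀ k i, ∃ C, 0 ≤ C ∧ ∀ z ∈ D,
      |iteratedDeriv k (f i z.1) z.2| * z.2 ^ k ≤ C * w z.1 z.2 from
    ⟨hp, hw, hs i, fun k _ => H k i⟩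
  intro k
  induction k with
  | zero => simpa using hb
  | succ k ih =>
    intro i
    obtain ⟨C, hC, h1⟩ := ih i
    obtain ⟨C', hC', h2⟩ := ih (σ i)
    refine ⟨C' + k * C, by positivity, fun z hz => ?_⟩
    have e := (show (fun y => y * deriv (f i z.1) y) =ᶠ[𝓝 z.2] f (σ i) z.1 from
      hσ i z hz).iteratedDeriv_eq k
    rw [iteratedDeriv_scal (hs i z hz)] at e
    have hz0 := hp z hz
    have e2 : iteratedDeriv (k + 1) (f i z.1) z.2 * z.2 ^ (k + 1)
        = iteratedDeriv k (f (σ i) z.1) z.2 * z.2 ^ k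
          - k * (iteratedDeriv k (f i z.1) z.2 * z.2 ^ k) := by
      rw [← e, pow_succ]; ring
    have ha : ∀ w : ℝ, ∀ m : ℕ, |w| * z.2 ^ m = |w * z.2 ^ m| := fun w m => by
      rw [abs_mul, abs_of_nonneg (pow_nonneg hz0.le m)]
    have h1 := h1 z hz
    have h2 := h2 z hz
    rw [ha] at h1 h2 ⊢
    rw [e2]
    calc _ ≤ |iteratedDeriv k (f (σ i) z.1) z.2 * z.2 ^ k|
          + |k * (iteratedDeriv k (f i z.1) z.2 * z.2 ^ k)| := abs_sub _ _
      _ ≤ C' * w z.1 z.2 + k * (C * w z.1 z.2) := by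
          rw [abs_mul (k : ℝ), abs_of_nonneg (Nat.cast_nonneg k : (0 : ℝ) ≤ k)]
          gcongr
      _ = _ := by ring

theorem SymTo.deriv (hu : SymOn D w u) :
    SymOn D (fun p y => w p y / y) (fun p => deriv (u p)) := .top fun _ => hu.restrict.deriv_succ

theorem SymTo.of_deriv (hs : ∀ z ∈ D, SmoothAt (u z.1) z.2)
    (h0 : ∃ C, 0 ≤ C ∧ ∀ z ∈ D, |u z.1 z.2| ≤ C * w z.1 z.2) (hw : ∀ z ∈ D, 0 ≤ w z.1 z.2)
    (hu : SymOn D (fun p y => w p y / y) (fun p => _root_.deriv (u p))) : SymOn D w u :=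
  .top fun _ => (succ_of_deriv hs h0 hw hu.restrict).restrict (Nat.cast_le.2 (Nat.le_succ _))

theorem SymTo.of_le (h : SymTo n D w u) (hw : ∀ z ∈ D, w z.1 z.2 ≤ w' z.1 z.2) : SymTo n D w' u :=
  h.weaken zero_le_one (fun z hz => (h.nonneg z hz).trans (hw z hz))
    (fun z hz => by simpa using hw z hz)

theorem SymTo.congr_weight (h : SymTo n D w u) (hw : ∀ z ∈ D, w z.1 z.2 = w' z.1 z.2) :
    SymTo n D w' u := h.of_le fun z hz => (hw z hz).le

theorem SymTo.inv (hu : SymOn D w u) {c : ℝ} (hc : 0 < c) (hw : ∀ z ∈ D, 0 < w z.1 z.2)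
    (hl : ∀ z ∈ D, c * w z.1 z.2 ≤ |u z.1 z.2|) :
    SymOn D (fun p y => (w p y)⁻¹) (fun p y => (u p y)⁻¹) := by
  have hne : ∀ z ∈ D, u z.1 z.2 ≠ 0 := fun z hz => by
    have := hl z hz
    have := hw z hz
    have : 0 < |u z.1 z.2| := by nlinarith
    exact abs_pos.mp this
  have hs : ∀ z ∈ D, SmoothAt (fun y => (u z.1 y)⁻¹) z.2 := fun z hz =>
    (hu.smooth z hz).inv (hne z hz)
  have h0 : ∃ C, 0 ≤ C ∧ ∀ z ∈ D, |(u z.1 z.2)⁻¹| ≤ C * (w z.1 z.2)⁻¹ :=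
    ⟨c⁻¹, by positivity, fun z hz => by
      rw [abs_inv, ← mul_inv]
      exact inv_anti₀ (mul_pos hc (hw z hz)) (hl z hz)⟩
  have hw' : ∀ z ∈ D, 0 ≤ (w z.1 z.2)⁻¹ := fun z hz => (inv_pos.mpr (hw z hz)).le
  refine .top fun n => ?_
  induction n with
  | zero => exact of_bound hu.pos hs h0 hw'
  | succ n ih =>
    refine succ_of_deriv hs h0 hw' ?_
    have := ((hu.deriv.restrict.mul (ih.mul ih)).neg).weaken (w' := fun p y => (w p y)⁻¹ / y)
      zero_le_one (fun z hz => div_nonneg (hw' z hz) (hu.pos z hz).le) (fun z hz => by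
        have h1 := (hw z hz).ne'
        have h2 := (hu.pos z hz).ne'
        apply le_of_eq; field_simp)
    refine this.congr fun z hz => ?_
    filter_upwards [eventually_differentiableAt (hu.smooth z hz),
      (hu.smooth z hz).continuousAt.eventually_ne (hne z hz)] with y hy hy'
    rw [deriv_fun_inv'' hy hy']; field_simp

theorem SymTo.zpow (hp : ∀ z ∈ D, 0 < z.2) (m : ℤ) :
    SymOn D (fun _ y => y ^ m) (fun _ y => y ^ m) := by
  have := SymTo.of_scal_closed (D := D) (w := fun _ y => y ^ m)
    (fun (c : ℝ) (_ : P) y => c * y ^ m) (fun c => c * m) hp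
    (fun z hz => zpow_nonneg (hp z hz).le m)
    (fun c z hz => contDiffAt_const.mul (contDiffAt_zpow m (hp z hz).ne'))
    (fun c => ⟨|c|, abs_nonneg c, fun z hz => by
      rw [abs_mul, abs_of_nonneg (zpow_nonneg (hp z hz).le m)]⟩)
    (fun c z hz => by
      filter_upwards [eventually_ne_nhds (hp z hz).ne'] with y hy
      rw [((hasDerivAt_zpow m y (Or.inl hy)).const_mul c).deriv, zpow_sub_one₀ hy]
      field_simp) 1
  simpa using this

theorem SymTo.log (hp : ∀ z ∈ D, 1 ≤ z.2) :
    SymOn D (fun _ y => 1 + Real.log y) (fun _ y => Real.log y) := by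
  have hp' : ∀ z ∈ D, 0 < z.2 := fun z hz => one_pos.trans_le (hp z hz)
  refine SymTo.of_deriv (fun z hz => contDiffAt_log.mpr (hp' z hz).ne')
    ⟨1, zero_le_one, fun z hz => ?_⟩ (fun z hz => ?_) ?_
  · rw [abs_of_nonneg (log_nonneg (hp z hz))]; linarith
  · linarith [log_nonneg (hp z hz)]
  · have := (SymTo.zpow hp' (-1)).of_le (w' := fun _ y => (1 + Real.log y) / y) fun z hz => by
      rw [zpow_neg_one, ← one_div]
      exact div_le_div_of_nonneg_right (by linarith [log_nonneg (hp z hz)]) (hp' z hz).le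
    refine this.congr fun z hz => ?_
    simp [Real.deriv_log']

theorem SymTo.id (hp : ∀ z ∈ D, 0 < z.2) : SymOn D (fun _ y => y) (fun _ y => y) := by
  simpa using SymTo.zpow hp 1

end


/-! ### Averaging operators -/

/-- `∫_0^1 ψ(t) w(ty) dt`. -/
noncomputable def avg (ψ w : ℝ → ℝ) (y : ℝ) : ℝ := ∫ t in (0 : ℝ)..1, ψ t * w (t * y)

theorem hasDerivAt_avg {ψ w : ℝ → ℝ} (hψ : Continuous ψ) (hw : Smooth w) (y : ℝ) :
    HasDerivAt (avg ψ w) (avg (fun t => ψ t * t) (deriv w) y) y := by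
  have hw' : Continuous (deriv w) := hw.continuous_deriv (by exact_mod_cast le_top)
  have hwd : Differentiable ℝ w := hw.differentiable (by simp)
  have hc : Continuous fun p : ℝ × ℝ => ψ p.1 * p.1 * deriv w (p.1 * p.2) := by fun_prop
  obtain ⟨C, hC⟩ := ((isCompact_Icc (a := (0 : ℝ)) (b := 1)).prod
    (isCompact_Icc (a := y - 1) (b := y + 1))).exists_bound_of_continuousOn hc.continuousOn
  refine (intervalIntegral.hasDerivAt_integral_of_dominated_loc_of_deriv_le
    (F := fun y t => ψ t * w (t * y)) (F' := fun y t => ψ t * t * deriv w (t * y))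
    (bound := fun _ => C) (s := Ioo (y - 1) (y + 1)) (Ioo_mem_nhds (by linarith) (by linarith))
    ?_ ?_ ?_ ?_ ?_ ?_).2
  · refine Eventually.of_forall fun x => Continuous.aestronglyMeasurable ?_
    have := hw.continuous
    fun_prop
  · have := hw.continuous
    exact Continuous.intervalIntegrable (by fun_prop) _ _
  · exact Continuous.aestronglyMeasurable (by fun_prop)
  · refine Eventually.of_forall fun t ht x hx => hC (t, x) ⟨?_, hx.1.le, hx.2.le⟩
    rw [uIoc_of_le zero_le_one] at ht; exact ⟨ht.1.le, ht.2⟩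
  · exact intervalIntegrable_const
  · refine Eventually.of_forall fun t _ x _ => ?_
    have h1 : HasDerivAt (fun x : ℝ => t * x) t x := by simpa using (hasDerivAt_id x).const_mul t
    have := ((hwd (t * x)).hasDerivAt.comp x h1).const_mul (ψ t)
    exact this.congr_deriv (by ring)

theorem contDiff_avg {ψ w : ℝ → ℝ} (hψ : Continuous ψ) (hw : Smooth w) : Smooth (avg ψ w) := by
  rw [contDiff_infty]
  intro n
  induction n generalizing ψ w with
  | zero =>
    have : Differentiable ℝ (avg ψ w) := fun y => (hasDerivAt_avg hψ hw y).differentiableAt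
    exact contDiff_zero.mpr this.continuous
  | succ n ih =>
    rw [Nat.cast_succ, contDiff_succ_iff_deriv]
    refine ⟨fun y => (hasDerivAt_avg hψ hw y).differentiableAt, by simp, ?_⟩
    rw [show deriv (avg ψ w) = avg (fun t => ψ t * t) (deriv w) from
      funext fun y => (hasDerivAt_avg hψ hw y).deriv]
    exact ih (by fun_prop) (contDiff_infty_iff_deriv.mp hw).2

theorem avg_neg_of_even {ψ w : ℝ → ℝ} (hw : ∀ y, w (-y) = w y) (y : ℝ) :
    avg ψ w (-y) = avg ψ w y := by
  unfold avg; simp only [mul_neg, hw]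

theorem avg_neg_of_odd {ψ w : ℝ → ℝ} (hw : ∀ y, w (-y) = -w y) (y : ℝ) :
    avg ψ w (-y) = -avg ψ w y := by
  unfold avg; simp only [mul_neg, hw, intervalIntegral.integral_neg]

theorem pow_mul_avg (w : ℝ → ℝ) (n : ℕ) (y : ℝ) :
    y ^ (n + 1) * avg (fun t => t ^ n) w y = ∫ x in (0 : ℝ)..y, x ^ n * w x := by
  have := intervalIntegral.smul_integral_comp_mul_right (a := 0) (b := 1) (fun x => x ^ n * w x) y
  rw [zero_mul, one_mul] at this
  rw [← this, avg, pow_succ', smul_eq_mul, mul_assoc, ← intervalIntegral.integral_const_mul]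
  congr 2
  funext t
  rw [mul_pow]; ring

theorem hasDerivAt_pow_mul_avg {w : ℝ → ℝ} (hw : Continuous w) (n : ℕ) (y : ℝ) :
    HasDerivAt (fun y => y ^ (n + 1) * avg (fun t => t ^ n) w y) (y ^ n * w y) y := by
  simp only [pow_mul_avg]
  have hc : Continuous fun x : ℝ => x ^ n * w x := by fun_prop
  exact intervalIntegral.integral_hasDerivAt_right (hc.intervalIntegrable _ _)
    (hc.stronglyMeasurableAtFilter _ _) hc.continuousAt

/-- Hadamard's lemma. -/
theorem sub_eq_mul_avg_deriv {w : ℝ → ℝ} (hw : Smooth w) (y : ℝ) :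
    w y - w 0 = y * avg (fun _ => 1) (deriv w) y := by
  have hw' : Continuous (deriv w) := hw.continuous_deriv (by exact_mod_cast le_top)
  have h := pow_mul_avg (deriv w) 0 y
  simp only [pow_zero, zero_add, pow_one, one_mul] at h
  rw [h, intervalIntegral.integral_deriv_eq_sub
    (fun x _ => (hw.differentiable (by simp)) x) (hw'.intervalIntegrable _ _)]

theorem deriv_even {w : ℝ → ℝ} (hw : ∀ y, w (-y) = w y) (y : ℝ) : deriv w (-y) = -deriv w y := by
  have h := deriv_comp_neg w y
  rw [show (fun x => w (-x)) = w from funext hw] at h; linarith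

theorem deriv_odd {w : ℝ → ℝ} (hw : ∀ y, w (-y) = -w y) (y : ℝ) : deriv w (-y) = deriv w y := by
  have h := deriv_comp_neg w y
  rw [show (fun x => w (-x)) = fun x => -w x from funext hw, deriv.fun_neg] at h; linarith

/-! ### The target -/

theorem exists_bound_of_periodic {f : ℝ → ℝ} (hf : Continuous f) {T : ℝ} (hT : T ≠ 0)
    (hp : ∀ u, f (u + T) = f u) : ∃ C, 0 ≤ C ∧ ∀ u, |f u| ≤ C := by
  obtain ⟨C, hC⟩ := (Function.Periodic.isBounded_of_continuous (f := f) hp hT hf).exists_norm_le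
  exact ⟨|C|, abs_nonneg C, fun u => (hC (f u) ⟨u, rfl⟩).trans (le_abs_self C)⟩

theorem abs_sub_le_of_deriv_le {f : ℝ → ℝ} (hf : Differentiable ℝ f) {C : ℝ}
    (hC : ∀ u, |deriv f u| ≤ C) (u v : ℝ) : |f u - f v| ≤ C * |u - v| :=
  convex_univ.norm_image_sub_le_of_norm_deriv_le (fun x _ => hf x) (fun x _ => hC x)
    (mem_univ v) (mem_univ u)

/-- If `|y h'| ≤ n |h|` then a zero of `h` propagates. -/
theorem eq_zero_of_scal_le {h h' : ℝ → ℝ} {n : ℕ} (hd : ∀ y, 0 < y → HasDerivAt h (h' y) y)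
    (hb : ∀ y, 0 < y → |y * h' y| ≤ n * |h y|) {y₀ : ℝ} (hy₀ : 0 < y₀) (h0 : h y₀ = 0) :
    ∀ y, 0 < y → h y = 0 := by
  have key : ∀ ε : ℝ, |ε| = 1 → ∀ t, 0 ≤ t → h (y₀ * Real.exp (ε * t)) = 0 := fun ε hε t ht => by
    have hp : ∀ x, 0 < y₀ * Real.exp (ε * x) := fun x => mul_pos hy₀ (Real.exp_pos _)
    have hf : ∀ x, HasDerivAt (fun x => h (y₀ * Real.exp (ε * x)))
        (ε * (y₀ * Real.exp (ε * x) * h' (y₀ * Real.exp (ε * x)))) x := fun x =>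
      ((hd _ (hp x)).comp x (((hasDerivAt_id x).const_mul ε).exp.const_mul y₀)).congr_deriv
        (by simp; ring)
    refine eq_zero_of_abs_deriv_le_mul_abs_self_of_eq_zero_right (K := n)
      (fun x _ => (hf x).continuousAt.continuousWithinAt) (fun x _ => (hf x).hasDerivWithinAt)
      (by simpa using h0) (fun x _ => ?_) t ⟨ht, le_rfl⟩
    rw [norm_mul, norm_eq_abs, hε, one_mul]; exact hb _ (hp x)
  intro y hy
  have e : y₀ * Real.exp (log (y / y₀)) = y := by rw [Real.exp_log (div_pos hy hy₀)]; field_simp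
  rcases le_total 0 (log (y / y₀)) with hl | hl
  · simpa [e] using key 1 (by simp) _ hl
  · simpa [e] using key (-1) (by simp) _ (neg_nonneg.mpr hl)

section target
variable {g Q : ℝ → ℝ}

theorem IsTargetProfile.contDiff_deriv (hg : IsTargetProfile g) : Smooth (deriv g) :=
  (contDiff_infty_iff_deriv.mp hg.smooth).2

theorem IsTargetProfile.lipschitz (hg : IsTargetProfile g) :
    ∃ n : ℕ, ∀ u v, |g u - g v| ≤ n * |u - v| := by
  obtain ⟨C, _, hC⟩ := exists_bound_of_periodic (f := deriv g) hg.contDiff_deriv.continuous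
    (T := 2 * π) (by positivity) (fun u => by
      rw [← deriv_comp_add_const, show (fun x => g (x + 2 * π)) = g from funext hg.periodic])
  obtain ⟨n, hn⟩ := exists_nat_ge C
  exact ⟨n, abs_sub_le_of_deriv_le (hg.smooth.differentiable (by simp)) fun u => (hC u).trans hn⟩

theorem IsHarmonicMap.mem_Ioo (hg : IsTargetProfile g) (hQ : IsHarmonicMap g Q) {y : ℝ}
    (hy : 0 < y) : Q y ∈ Ioo 0 π := by
  obtain ⟨n, hn⟩ := hg.lipschitz
  have hc : ContinuousOn Q (Ioi 0) := fun y hy => (hQ.ode y hy).continuousAt.continuousWithinAt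
  have h0 : ∀ y, 0 < y → Q y ≠ 0 := fun y₀ hy₀ h0 => by
    have hz := eq_zero_of_scal_le (h := Q) (n := n) hQ.ode (fun y hy => by
      rw [mul_div_cancel₀ _ hy.ne']; simpa [hg.zero] using hn (Q y) 0) hy₀ h0
    have : Tendsto Q atTop (𝓝 0) := tendsto_const_nhds.congr' (by
      filter_upwards [eventually_gt_atTop 0] with y hy using (hz y hy).symm)
    exact Real.pi_ne_zero (tendsto_nhds_unique hQ.tendsto_pi this)
  have hpi : ∀ y, 0 < y → Q y - π ≠ 0 := fun y₀ hy₀ h0 => by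
    have hz := eq_zero_of_scal_le (h := fun y => Q y - π) (n := n)
      (fun y hy => (hQ.ode y hy).sub_const _) (fun y hy => by
      rw [mul_div_cancel₀ _ hy.ne']; simpa [hg.pi] using hn (Q y) π) hy₀ h0
    have h1 : Tendsto Q (𝓝[>] 0) (𝓝 0) := by
      have := hQ.continuous_zero.mono Ioi_subset_Ici_self
      rwa [ContinuousWithinAt, hQ.zero] at this
    have h2 : Tendsto Q (𝓝[>] 0) (𝓝 π) := tendsto_const_nhds.congr' (by
      filter_upwards [self_mem_nhdsWithin] with y hy using (sub_eq_zero.mp (hz y hy)).symm)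
    exact Real.pi_ne_zero (tendsto_nhds_unique h2 h1)
  constructor
  · obtain ⟨y₁, hy₁, hy₁'⟩ := ((hQ.tendsto_pi.eventually (lt_mem_nhds pi_pos)).and
      (eventually_gt_atTop 0)).exists
    by_contra hneg
    push Not at hneg
    obtain ⟨x, hx, hx0⟩ := isPreconnected_Ioi.intermediate_value (s := Ioi (0 : ℝ)) hy hy₁' hc
      (show (0 : ℝ) ∈ Icc (Q y) (Q y₁) from ⟨hneg, hy₁.le⟩)
    exact h0 x hx hx0
  · have h1 : Tendsto Q (𝓝[>] 0) (𝓝 0) := by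
      have := hQ.continuous_zero.mono Ioi_subset_Ici_self
      rwa [ContinuousWithinAt, hQ.zero] at this
    obtain ⟨y₁, hy₁, hy₁'⟩ := ((h1.eventually (gt_mem_nhds pi_pos)).and
      (self_mem_nhdsWithin)).exists
    by_contra hneg
    push Not at hneg
    obtain ⟨x, hx, hx0⟩ := isPreconnected_Ioi.intermediate_value (s := Ioi (0 : ℝ)) hy₁' hy hc
      (show π ∈ Icc (Q y₁) (Q y) from ⟨hy₁.le, hneg⟩)
    exact hpi x hx (sub_eq_zero.mpr hx0)

theorem IsTargetProfile.exists_quotient (hg : IsTargetProfile g) :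
    ∃ g₁ k : ℝ → ℝ, Smooth g₁ ∧ Smooth k ∧ (∀ u, g u = u * g₁ u) ∧
      (∀ u, g₁ u = 1 + u * k u) ∧ (∀ u, g₁ (-u) = g₁ u) ∧ (∀ u, k (-u) = -k u) ∧
      ∀ u ∈ Ioo (-π) π, 0 < g₁ u := by
  have h1 : Smooth (avg (fun _ => 1) (deriv g)) := contDiff_avg continuous_const hg.contDiff_deriv
  have he : ∀ u, avg (fun _ => 1) (deriv g) (-u) = avg (fun _ => 1) (deriv g) u :=
    avg_neg_of_even (deriv_odd hg.odd)
  have hm : ∀ u, g u = u * avg (fun _ => 1) (deriv g) u := fun u => by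
    simpa [hg.zero] using sub_eq_mul_avg_deriv hg.smooth u
  have h0 : avg (fun _ => 1) (deriv g) 0 = 1 := by simp [avg, hg.deriv_zero]
  refine ⟨avg (fun _ => 1) (deriv g), avg (fun _ => 1) (deriv (avg (fun _ => 1) (deriv g))),
    h1, contDiff_avg continuous_const (contDiff_infty_iff_deriv.mp h1).2, hm, fun u => ?_, he,
    avg_neg_of_odd (deriv_even he), fun u hu => ?_⟩
  · have := sub_eq_mul_avg_deriv h1 u
    rw [h0] at this; linarith
  · have hpos : ∀ u ∈ Ioo 0 π, 0 < avg (fun _ => 1) (deriv g) u := fun u hu => by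
      have := hg.pos u hu
      rw [hm] at this; exact (pos_iff_pos_of_mul_pos this).mp hu.1
    rcases lt_trichotomy u 0 with h | h | h
    · rw [← he]; exact hpos _ ⟨by linarith, by linarith [hu.1]⟩
    · rw [h, h0]; exact one_pos
    · exact hpos u ⟨h, hu.2⟩

/-- The linearizing coordinate of `y Q' = g(Q)`. -/
theorem IsTargetProfile.exists_linearization (hg : IsTargetProfile g) :
    ∃ e k g₁ : ℝ → ℝ, Smooth g₁ ∧ (∀ u, g u = u * g₁ u) ∧ (∀ u, g₁ (-u) = g₁ u) ∧
      (∀ u ∈ Ioo (-π) π, 0 < g₁ u) ∧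
      ContDiffOn ℝ ∞ e (Ioo (-π) π) ∧ (∀ u, 0 < e u) ∧ (∀ u, e (-u) = e u) ∧
      (∀ u ∈ Ioo (-π) π, HasDerivAt e (-(k u / g₁ u) * e u) u) ∧
      (∀ u, g₁ u = 1 + u * k u) := by
  obtain ⟨g₁, k, h1, hk, hm, hk1, he, ho, hpos⟩ := hg.exists_quotient
  set κ : ℝ → ℝ := fun u => -(k u / g₁ u)
  have hκ : ContDiffOn ℝ ∞ κ (Ioo (-π) π) :=
    (hk.contDiffOn.div h1.contDiffOn fun u hu => (hpos u hu).ne').neg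
  have hI : ∀ u ∈ Ioo (-π) π, HasDerivAt (fun u => ∫ x in (0 : ℝ)..u, κ x) (κ u) u := by
    intro u hu
    have hsub : uIcc 0 u ⊆ Ioo (-π) π :=
      (ordConnected_Ioo).uIcc_subset ⟨by linarith [pi_pos], pi_pos⟩ hu
    exact intervalIntegral.integral_hasDerivAt_right
      ((hκ.continuousOn.mono hsub).intervalIntegrable)
      (hκ.continuousOn.stronglyMeasurableAtFilter isOpen_Ioo u hu)
      (hκ.continuousOn.continuousAt (isOpen_Ioo.mem_nhds hu))
  have hIs : ContDiffOn ℝ ∞ (fun u => ∫ x in (0 : ℝ)..u, κ x) (Ioo (-π) π) := by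
    rw [contDiffOn_infty_iff_deriv_of_isOpen isOpen_Ioo]
    exact ⟨fun u hu => (hI u hu).differentiableAt.differentiableWithinAt,
      hκ.congr fun u hu => (hI u hu).deriv⟩
  refine ⟨fun u => Real.exp (∫ x in (0 : ℝ)..u, κ x), k, g₁, h1, hm, he, hpos, hIs.exp,
    fun u => Real.exp_pos _, fun u => ?_, fun u hu => ?_, hk1⟩
  · simp only
    congr 1
    have := intervalIntegral.integral_comp_neg (a := 0) (b := u) κ
    have hodd : ∀ x, κ (-x) = -κ x := fun x => by simp only [κ, ho, he]; ring
    simp only [hodd, intervalIntegral.integral_neg, neg_zero] at this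
    rw [intervalIntegral.integral_symm, ← this, neg_neg]
  · exact (hI u hu).exp.congr_deriv (mul_comm _ _)

/-- The odd extension of the harmonic map is smooth. -/
theorem IsHarmonicMap.exists_odd_extension (hg : IsTargetProfile g) (hQ : IsHarmonicMap g Q) :
    ∃ q : ℝ → ℝ, Smooth q ∧ (∀ y, q (-y) = -q y) ∧ (∀ y, 0 ≤ y → q y = Q y) ∧
      ∀ y, 0 < deriv q y := by
  obtain ⟨e, k, g₁, h1, hm, hev, hpos, hes, hepos, heev, hed, hk⟩ := hg.exists_linearization
  have hmem : ∀ y, 0 < y → Q y ∈ Ioo (-π) π := fun y hy =>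
    ⟨by linarith [(hQ.mem_Ioo hg hy).1, pi_pos], (hQ.mem_Ioo hg hy).2⟩
  obtain ⟨α, hα⟩ : ∃ α, ∀ y ∈ Ioi (0 : ℝ), Q y * e (Q y) / y = α := by
    have hd : ∀ y ∈ Ioi (0 : ℝ), HasDerivAt (fun y => Q y * e (Q y) / y) 0 y := by
      intro y hy
      have hy0 : y ≠ 0 := ne_of_gt hy
      have h := hQ.ode y hy
      have hg1 := hpos _ (hmem y hy)
      have := (h.mul ((hed _ (hmem y hy)).comp y h)).div (hasDerivAt_id y) hy0
      refine this.congr_deriv ?_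
      have e1 := hk (Q y)
      have e2 := hm (Q y)
      have : k (Q y) * Q y = g₁ (Q y) - 1 := by linarith
      simp only [Function.comp, id, Pi.mul_apply, e2]; field_simp
      linear_combination (- Q y * e (Q y)) * this
    exact isOpen_Ioi.exists_is_const_of_deriv_eq_zero isPreconnected_Ioi
      (fun y hy => (hd y hy).differentiableAt.differentiableWithinAt) (fun y hy => (hd y hy).deriv)
  have hα0 : 0 < α := by
    rw [← hα 1 (mem_Ioi.mpr one_pos), div_one]; exact mul_pos (hQ.mem_Ioo hg one_pos).1 (hepos _)
  set q : ℝ → ℝ := fun y => if 0 ≤ y then Q y else -Q (-y) with hq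
  have hq0 : ∀ y, 0 ≤ y → q y = Q y := fun y hy => if_pos hy
  have hodd : ∀ y, q (-y) = -q y := by
    intro y
    rcases lt_trichotomy y 0 with h | h | h
    · simp [hq, h.le, not_le.mpr h]
    · simp [hq, h, hQ.zero]
    · simp [hq, h.le, not_le.mpr h]
  have hqm : ∀ y, q y ∈ Ioo (-π) π := by
    intro y
    rcases lt_trichotomy y 0 with h | h | h
    · have := hmem (-y) (by linarith)
      rw [← neg_neg y, hodd, hq0 (-y) (by linarith)]
      exact ⟨by linarith [this.2], by linarith [this.1]⟩
    · rw [h, hq0 0 le_rfl, hQ.zero]; exact ⟨by linarith [pi_pos], pi_pos⟩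
    · rw [hq0 y h.le]; exact hmem y h
  set Φ : ℝ → ℝ := fun u => α * g₁ u / e u
  have hΦs : ContDiffOn ℝ ∞ Φ (Ioo (-π) π) :=
    (contDiffOn_const.mul h1.contDiffOn).div hes fun u _ => (hepos u).ne'
  have hΦe : ∀ u, Φ (-u) = Φ u := fun u => by simp only [Φ, hev, heev]
  have hdpos : ∀ y, 0 < y → HasDerivAt q (Φ (q y)) y := by
    intro y hy
    have : q =ᶠ[𝓝 y] Q := by filter_upwards [lt_mem_nhds hy] with x hx using hq0 x hx.le
    refine ((hQ.ode y hy).congr_of_eventuallyEq this).congr_deriv ?_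
    rw [hq0 y hy.le, hm]
    have h2 := hα y hy
    have h3 := (hepos (Q y)).ne'
    simp only [Φ]
    rw [← h2]; field_simp
  have hdneg : ∀ y, y < 0 → HasDerivAt q (Φ (q y)) y := by
    intro y hy
    have h1 := hdpos (-y) (by linarith)
    have h2 := (h1.scomp y (hasDerivAt_neg y)).neg
    refine (h2.congr_of_eventuallyEq (Eventually.of_forall fun x => ?_)).congr_deriv ?_
    · simp [hodd]
    · simp [hodd, hΦe]
  have hcont : ContinuousAt q 0 := by
    have hr : ContinuousWithinAt q (Ici 0) 0 :=
      hQ.continuous_zero.congr (fun y hy => hq0 y hy) (hq0 0 le_rfl)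
    have hl : ContinuousWithinAt q (Iic 0) 0 := by
      have h1 : ContinuousWithinAt (fun y => -q (-y)) (Iic 0) 0 := by
        refine (ContinuousWithinAt.comp (g := q) (f := fun y : ℝ => -y) (t := Ici 0) ?_
          continuous_neg.continuousWithinAt fun y hy => ?_).neg
        · simpa using hr
        · simpa using hy
      refine h1.congr (fun y _ => by rw [hodd, neg_neg]) (by rw [hodd, neg_neg])
    rw [← continuousWithinAt_univ, ← Iic_union_Ici (a := (0 : ℝ))]; exact hl.union hr
  have hd : ∀ y, HasDerivAt q (Φ (q y)) y := by
    have hne : ∀ y ≠ 0, HasDerivAt q (Φ (q y)) y := fun y hy =>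
      (lt_or_gt_of_ne hy).elim (hdneg y) (hdpos y)
    intro y
    rcases eq_or_ne y 0 with rfl | hy
    · refine hasDerivAt_of_hasDerivAt_of_ne (f := q) (g := fun y => Φ (q y)) hne hcont ?_
      exact ContinuousAt.comp (g := Φ)
        (hΦs.continuousOn.continuousAt (isOpen_Ioo.mem_nhds (hqm 0))) hcont
    · exact hne y hy
  have hder : deriv q = fun y => Φ (q y) := funext fun y => (hd y).deriv
  refine ⟨q, ?_, hodd, hq0, fun y => ?_⟩
  · rw [contDiff_infty]
    intro n
    induction n with
    | zero =>
      have : Differentiable ℝ q := fun y => (hd y).differentiableAt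
      exact contDiff_zero.mpr this.continuous
    | succ n ih =>
      rw [Nat.cast_succ, contDiff_succ_iff_deriv]
      refine ⟨fun y => (hd y).differentiableAt, by simp, ?_⟩
      rw [hder]; exact (hΦs.of_le (by exact_mod_cast le_top)).comp_contDiff ih hqm
  · rw [(hd y).deriv]; exact div_pos (mul_pos hα0 (hpos _ (hqm y))) (hepos _)

end target


/-- `q` is the smooth odd extension to `ℝ` of the harmonic map `Q`. -/
structure IsExt (g Q q : ℝ → ℝ) : Prop where
  target : IsTargetProfile g
  map : IsHarmonicMap g Q
  smooth : Smooth q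
  odd : ∀ y, q (-y) = -q y
  eq : ∀ y, 0 ≤ y → q y = Q y
  deriv_pos : ∀ y, 0 < deriv q y

theorem hadamard {F : ℝ → ℝ} (hF : Smooth F) {c : ℝ} (hc : F c = 0) :
    ∃ G : ℝ → ℝ, Smooth G ∧ ∀ u, F u = (c - u) * G u := by
  have h1 : Smooth fun u => F (c - u) := by fun_prop
  have h2 := contDiff_avg (ψ := fun _ => 1) continuous_const (contDiff_infty_iff_deriv.mp h1).2
  refine ⟨fun u => avg (fun _ => 1) (deriv fun u => F (c - u)) (c - u), by fun_prop, fun u => ?_⟩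
  have := sub_eq_mul_avg_deriv h1 (c - u)
  simpa [hc] using this

theorem tendsto_inv_sq (C : ℝ) : Tendsto (fun y : ℝ => C * y ^ (-2 : ℤ)) atTop (𝓝 0) := by
  simpa using (tendsto_zpow_atTop_zero (𝕜 := ℝ) (n := -2) (by norm_num)).const_mul C

/-- A function whose derivative is `O(y^{-3})` converges, up to `O(y^{-2})`. -/
theorem exists_limit_of_deriv_le {w f : ℝ → ℝ} {C : ℝ} (hC : 0 ≤ C)
    (hd : ∀ y, 0 < y → HasDerivAt w (f y) y) (hb : ∀ y, 1 ≤ y → |f y| ≤ C * y ^ (-3 : ℤ)) :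
    ∃ β, ∀ y, 1 ≤ y → |w y - β| ≤ C * y ^ (-2 : ℤ) := by
  have hz : ∀ y : ℝ, 0 < y → HasDerivAt (fun y : ℝ => C * y ^ (-2 : ℤ))
      (-2 * C * y ^ (-3 : ℤ)) y := fun y hy => by
    refine ((hasDerivAt_zpow (-2) y (Or.inl hy.ne')).const_mul C).congr_deriv ?_
    norm_num; ring
  have hI : ∀ y ∈ interior (Ici (1 : ℝ)), 1 ≤ y ∧ 0 < y := fun y hy => by
    have : (1 : ℝ) ≤ y := interior_subset hy
    exact ⟨this, by linarith⟩
  have hp : ∀ y : ℝ, 1 ≤ y → 0 ≤ C * y ^ (-3 : ℤ) := fun y hy =>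
    mul_nonneg hC (zpow_nonneg (by linarith) _)
  have hanti : AntitoneOn (fun y => w y + C * y ^ (-2 : ℤ)) (Ici 1) := by
    have hd2 : ∀ y : ℝ, 0 < y → _ := fun y hy => (hd y hy).fun_add (hz y hy)
    refine antitoneOn_of_deriv_nonpos (convex_Ici 1)
      (fun y hy => (hd2 y (by linarith [mem_Ici.mp hy])).continuousAt.continuousWithinAt)
      (fun y hy => (hd2 y (hI y hy).2).differentiableAt.differentiableWithinAt) fun y hy => ?_
    rw [(hd2 y (hI y hy).2).deriv]; linarith [le_of_abs_le (hb y (hI y hy).1), hp y (hI y hy).1]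
  have hmono : MonotoneOn (fun y => w y - C * y ^ (-2 : ℤ)) (Ici 1) := by
    have hd2 : ∀ y : ℝ, 0 < y → _ := fun y hy => (hd y hy).fun_sub (hz y hy)
    refine monotoneOn_of_deriv_nonneg (convex_Ici 1)
      (fun y hy => (hd2 y (by linarith [mem_Ici.mp hy])).continuousAt.continuousWithinAt)
      (fun y hy => (hd2 y (hI y hy).2).differentiableAt.differentiableWithinAt) fun y hy => ?_
    rw [(hd2 y (hI y hy).2).deriv]; linarith [neg_le_of_abs_le (hb y (hI y hy).1), hp y (hI y hy).1]
  have hq : ∀ y : ℝ, 1 ≤ y → 0 ≤ C * y ^ (-2 : ℤ) := fun y hy =>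
    mul_nonneg hC (zpow_nonneg (by linarith) _)
  have key : ∀ x y : ℝ, 1 ≤ x → 1 ≤ y → w x - C * x ^ (-2 : ℤ) ≤ w y + C * y ^ (-2 : ℤ) := by
    intro x y hx hy
    have h1 := hmono hx (mem_Ici.mpr (hx.trans (le_max_left x y))) (le_max_left x y)
    have h2 := hanti hy (mem_Ici.mpr (hy.trans (le_max_right x y))) (le_max_right x y)
    have h3 := hq _ (hx.trans (le_max_left x y))
    simp only at h1 h2; linarith
  set S := (fun y => w y - C * y ^ (-2 : ℤ)) '' Ici 1
  have hS : BddAbove S := ⟨w 1 + C * 1 ^ (-2 : ℤ), by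
    rintro _ ⟨x, hx, rfl⟩; exact key x 1 hx le_rfl⟩
  refine ⟨sSup S, fun y hy => abs_le.mpr ⟨?_, ?_⟩⟩
  · have : sSup S ≤ w y + C * y ^ (-2 : ℤ) :=
      csSup_le ⟨_, 1, mem_Ici.mpr le_rfl, rfl⟩ (by rintro _ ⟨x, hx, rfl⟩; exact key x y hx hy)
    linarith
  · have : w y - C * y ^ (-2 : ℤ) ≤ sSup S := le_csSup hS ⟨y, hy, rfl⟩
    linarith

namespace IsExt
variable {g Q q : ℝ → ℝ} (h : IsExt g Q q)
include h

theorem contDiff_deriv : Smooth (deriv q) := (contDiff_infty_iff_deriv.mp h.smooth).2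

theorem eventuallyEq {y : ℝ} (hy : 0 < y) : Q =ᶠ[𝓝 y] q := by
  filter_upwards [lt_mem_nhds hy] with x hx using (h.eq x (le_of_lt hx)).symm

theorem hasDerivAt {y : ℝ} (hy : 0 < y) : HasDerivAt q (g (q y) / y) y := by
  rw [h.eq y hy.le]; exact (h.map.ode y hy).congr_of_eventuallyEq (h.eventuallyEq hy).symm

theorem mul_deriv {y : ℝ} (hy : 0 < y) : y * deriv q y = g (q y) := by
  rw [(h.hasDerivAt hy).deriv, mul_div_cancel₀ _ hy.ne']

theorem scal_eq {y : ℝ} (hy : 0 ≤ y) : scal Q y = y * deriv q y := by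
  rcases hy.eq_or_lt with rfl | hy
  · simp [scal]
  · rw [scal, (h.eventuallyEq hy).deriv_eq]

theorem mem {y : ℝ} (hy : 0 < y) : q y ∈ Ioo 0 π := by
  rw [h.eq y hy.le]; exact h.map.mem_Ioo h.target hy

theorem bound_comp {F : ℝ → ℝ} (hF : Continuous F) : ∃ C, 0 ≤ C ∧ ∀ y, 0 < y → |F (q y)| ≤ C := by
  obtain ⟨C, hC0, hC⟩ := exists_abs_le_Icc hF 0 π
  exact ⟨C, hC0, fun y hy => hC _ (Ioo_subset_Icc_self (h.mem hy))⟩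

section
variable {P : Type} {D : Set (P × ℝ)}

theorem symOn_comp (hD : ∀ z ∈ D, 0 < z.2) {F : ℝ → ℝ} (hF : Smooth F) :
    SymOn D (fun _ _ => 1) (fun _ y => F (q y)) := by
  have hs := h.smooth
  have hg := h.target.smooth
  refine SymTo.of_scal_closed (ι := {F : ℝ → ℝ // Smooth F})
    (fun F _ y => F.1 (q y)) (fun F => ⟨fun u => deriv F.1 u * g u,
      (contDiff_infty_iff_deriv.mp F.2).2.mul hg⟩) hD (fun _ _ => zero_le_one) ?_ ?_ ?_ ⟨F, hF⟩
  · exact fun F z _ => (F.2.comp hs).contDiffAt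
  · intro F
    obtain ⟨C, hC, hb⟩ := h.bound_comp F.2.continuous
    exact ⟨C, hC, fun z hz => by simpa using hb z.2 (hD z hz)⟩
  · intro F z hz
    filter_upwards [lt_mem_nhds (hD z hz)] with y hy
    have := ((F.2.differentiable (by simp) (q y)).hasDerivAt.comp y (h.hasDerivAt hy)).deriv
    rw [show (fun y => F.1 (q y)) = F.1 ∘ q from rfl, this]
    have hy' : y ≠ 0 := ne_of_gt hy
    field_simp

theorem exists_cubic : ∃ k : ℝ → ℝ, Smooth k ∧ ∀ u, g u = (π - u) + (π - u) ^ 3 * k u := by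
  have hg' : IsTargetProfile fun v => g (π - v) := by
    have hs := h.target.smooth
    have ho : ∀ v, g (π - -v) = -g (π - v) := fun v => by
      rw [← h.target.odd, ← h.target.periodic (-(π - v))]; congr 1; ring
    refine ⟨by fun_prop, ho, fun u => ?_, by simpa using h.target.pi, by simpa using h.target.zero,
      fun u hu => h.target.pos _ ⟨by linarith [hu.2], by linarith [hu.1]⟩, ?_, ?_⟩
    · rw [← h.target.periodic]; congr 1; ring
    · rw [deriv_comp_const_sub]; simp [h.target.deriv_pi]
    · rw [deriv_comp_const_sub]; simp [h.target.deriv_zero]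
  obtain ⟨g₁, k, h1, hk, hm, hk1, -, hko, -⟩ := hg'.exists_quotient
  have hk0 : k 0 = 0 := by have := hko 0; simp at this; linarith
  obtain ⟨G, hG, hGk⟩ := hadamard hk hk0
  refine ⟨fun u => -G (π - u), by fun_prop, fun u => ?_⟩
  have := hm (π - u)
  simp only [sub_sub_cancel] at this
  rw [this, hk1, hGk]; ring

theorem tendsto_scaling : Tendsto (fun y => y * (π - q y)) atTop (𝓝 2) := h.map.scaling.congr' (by
    filter_upwards [eventually_ge_atTop 0] with y hy
    rw [h.eq y hy])

theorem bound_pi_sub : ∃ C, 0 ≤ C ∧ ∀ y, 1 ≤ y → |π - q y| ≤ C * y⁻¹ := by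
  have hs := h.smooth.continuous
  obtain ⟨R, hR⟩ := ((h.tendsto_scaling.abs.eventually_le_const
    (show |(2 : ℝ)| < 3 by norm_num)).and (eventually_ge_atTop 1)).exists_forall_of_atTop
  obtain ⟨C, hC⟩ := (isCompact_Icc (a := 1) (b := R)).exists_bound_of_continuousOn
    (f := fun y => y * (π - q y)) (by fun_prop)
  refine ⟨max 3 |C|, by positivity, fun y hy => ?_⟩
  have hy0 : 0 < y := by linarith
  rw [← div_eq_mul_inv, le_div_iff₀ hy0, ← abs_of_pos hy0, ← abs_mul, mul_comm, abs_of_pos hy0]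
  rcases le_total y R with hyR | hyR
  · exact (hC y ⟨hy, hyR⟩).trans ((le_abs_self C).trans (le_max_right _ _))
  · exact (hR y hyR).1.trans (le_max_left _ _)

theorem symOn_vanishing (hD : ∀ z ∈ D, 1 ≤ z.2) (m : ℕ) {G : ℝ → ℝ} (hG : Smooth G) :
    SymOn D (fun _ y => y ^ (-m : ℤ)) (fun _ y => (π - q y) ^ m * G (q y)) := by
  have hs := h.smooth
  have hg := h.target.smooth
  obtain ⟨k, hk, hgk⟩ := h.exists_cubic
  have hD' : ∀ z ∈ D, 0 < z.2 := fun z hz => by linarith [hD z hz]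
  set g₁ : ℝ → ℝ := fun u => 1 + (π - u) ^ 2 * k u
  have hg₁ : Smooth g₁ := by fun_prop
  have hgg : ∀ u, g u = (π - u) * g₁ u := fun u => by rw [hgk]; ring
  refine SymTo.of_scal_closed (ι := {F : ℝ → ℝ // Smooth F})
    (fun F _ y => (π - q y) ^ m * F.1 (q y)) (fun F => ⟨fun u => deriv F.1 u * g u
      - m * g₁ u * F.1 u, ((contDiff_infty_iff_deriv.mp F.2).2.mul hg).sub
        ((contDiff_const.mul hg₁).mul F.2)⟩) hD'
        (fun z hz => zpow_nonneg (hD' z hz).le _) ?_ ?_ ?_ ⟨G, hG⟩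
  · exact fun F z _ => by have := F.2; fun_prop
  · intro F
    obtain ⟨C, hC, hb⟩ := h.bound_comp F.2.continuous
    obtain ⟨C', hC', hb'⟩ := h.bound_pi_sub
    refine ⟨C' ^ m * C, by positivity, fun z hz => ?_⟩
    rw [abs_mul, abs_pow, zpow_neg, zpow_natCast, ← inv_pow]
    calc _ ≤ (C' * z.2⁻¹) ^ m * C := mul_le_mul
          (pow_le_pow_left₀ (abs_nonneg _) (hb' _ (hD z hz)) m) (hb _ (hD' z hz)) (abs_nonneg _)
          (by have := hD' z hz; positivity)
      _ = _ := by rw [mul_pow]; ring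
  · intro F z hz
    filter_upwards [lt_mem_nhds (hD' z hz)] with y hy
    have hq := h.hasDerivAt hy
    have := ((hq.const_sub π).fun_pow m).fun_mul
      ((F.2.differentiable (by simp) (q y)).hasDerivAt.comp y hq)
    simp only [Function.comp_def] at this
    rw [this.deriv]
    have hy' : y ≠ 0 := ne_of_gt hy
    rcases m with _ | m
    · simp; field_simp
    · simp only [hgg (q y)]; simp; field_simp; ring

theorem symOn_scaling (hD : ∀ z ∈ D, 1 ≤ z.2) :
    SymOn D (fun _ y => y ^ (-2 : ℤ)) (fun _ y => y * (π - q y) - 2) := by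
  have hD' : ∀ z ∈ D, 0 < z.2 := fun z hz => by linarith [hD z hz]
  have hs := h.smooth
  obtain ⟨k, hk, hgk⟩ := h.exists_cubic
  set w : ℝ → ℝ := fun y => y * (π - q y) with hw
  have hd : ∀ y, 0 < y → HasDerivAt w (-((π - q y) ^ 3 * k (q y))) y := fun y hy => by
    have := (hasDerivAt_id y).fun_mul ((h.hasDerivAt hy).const_sub π)
    refine this.congr_deriv ?_
    have hy' : y ≠ 0 := ne_of_gt hy
    simp only [id, hgk (q y)]; field_simp; ring
  obtain ⟨C, hC, hb⟩ := (h.symOn_vanishing (P := Unit) (D := {z | 1 ≤ z.2}) (fun z hz => hz) 3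
    hk).bound_zero
  have hb : ∀ y, 1 ≤ y → |(π - q y) ^ 3 * k (q y)| ≤ C * y ^ (-3 : ℤ) := fun y hy => hb ((), y) hy
  obtain ⟨β, hβ⟩ := exists_limit_of_deriv_le hC hd (fun y hy => by rw [abs_neg]; exact hb y hy)
  have hβ2 : β = 2 := by
    refine tendsto_nhds_unique ?_ h.tendsto_scaling
    rw [tendsto_iff_norm_sub_tendsto_zero]
    refine squeeze_zero' (Eventually.of_forall fun _ => norm_nonneg _) ?_ (tendsto_inv_sq C)
    filter_upwards [eventually_ge_atTop 1] with y hy using hβ y hy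
  refine SymTo.of_deriv (fun z _ => by fun_prop) ⟨C, hC, fun z hz => ?_⟩
    (fun z hz => zpow_nonneg (hD' z hz).le _) ?_
  · rw [← hβ2]; exact hβ z.2 (hD z hz)
  · refine ((h.symOn_vanishing hD 3 hk).neg.congr_weight fun z hz => ?_).congr fun z hz => ?_
    · rw [show (-2 : ℤ) = -3 + 1 by norm_num, zpow_add_one₀ (hD' z hz).ne',
        mul_div_cancel_right₀ _ (hD' z hz).ne']; norm_num
    · filter_upwards [lt_mem_nhds (hD' z hz)] with y hy
      rw [((hd y hy).sub_const 2).deriv]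

theorem symOn_scal_q (hD : ∀ z ∈ D, 1 ≤ z.2) :
    SymOn D (fun _ y => y ^ (-3 : ℤ)) (fun _ y => g (q y) - 2 * y⁻¹) := by
  have hD' : ∀ z ∈ D, 0 < z.2 := fun z hz => by linarith [hD z hz]
  obtain ⟨k, hk, hgk⟩ := h.exists_cubic
  have h1 := (h.symOn_vanishing hD 3 hk)
  have h2 := ((SymTo.zpow hD' (-1)).mul (h.symOn_scaling hD)).congr_weight
    (w' := fun _ y => y ^ (-3 : ℤ)) fun z hz => by rw [← zpow_add₀ (hD' z hz).ne']; norm_num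
  refine (h1.add h2).congr fun z hz => ?_
  filter_upwards [lt_mem_nhds (hD' z hz)] with y hy
  have : y ≠ 0 := ne_of_gt hy
  rw [hgk (q y), zpow_neg_one]; field_simp; ring

theorem symOn_g (hD : ∀ z ∈ D, 1 ≤ z.2) :
    SymOn D (fun _ y => y ^ (-1 : ℤ)) (fun _ y => g (q y)) := by
  obtain ⟨G, hG, hgG⟩ := hadamard h.target.smooth h.target.pi
  simpa [hgG] using h.symOn_vanishing hD 1 hG

theorem symOn_deriv_g (hD : ∀ z ∈ D, 1 ≤ z.2) :
    SymOn D (fun _ y => y ^ (-2 : ℤ)) (fun _ y => deriv g (q y) + 1) := by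
  obtain ⟨k, hk, hgk⟩ := h.exists_cubic
  have hk' := (contDiff_infty_iff_deriv.mp hk).2
  have e : ∀ u, deriv g u = -1 + (π - u) ^ 2 * (-3 * k u + (π - u) * deriv k u) := by
    intro u
    rw [show g = fun u => (π - u) + (π - u) ^ 3 * k u from funext hgk]
    have h1 : HasDerivAt (fun u : ℝ => π - u) (-1) u := by simpa using (hasDerivAt_id u).const_sub π
    have := (h1.fun_add ((h1.fun_pow 3).fun_mul (hk.differentiable (by simp) u).hasDerivAt)).deriv
    rw [this]; simp; ring
  have := h.symOn_vanishing hD 2 (G := fun u => -3 * k u + (π - u) * deriv k u) (by fun_prop)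
  simpa [e] using this

theorem lower_bound_g : ∃ c, 0 < c ∧ ∀ y, 1 ≤ y → c * y⁻¹ ≤ g (q y) := by
  have hs := h.smooth.continuous
  have hgs := h.target.smooth.continuous
  have hlim : Tendsto (fun y => y * g (q y)) atTop (𝓝 2) := by
    obtain ⟨C, hC, hb⟩ := (h.symOn_scal_q (P := Unit) (D := {z | 1 ≤ z.2})
      (fun z hz => hz)).bound_zero
    have h0 : Tendsto (fun y : ℝ => C * y ^ (-2 : ℤ)) atTop (𝓝 0) := by
      simpa using (tendsto_zpow_atTop_zero (𝕜 := ℝ) (n := -2) (by norm_num)).const_mul C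
    rw [tendsto_iff_norm_sub_tendsto_zero]
    refine squeeze_zero' (Eventually.of_forall fun _ => norm_nonneg _) ?_ h0
    filter_upwards [eventually_ge_atTop 1] with y hy
    have hy0 : 0 < y := by linarith
    have := hb ((), y) hy
    have e : y * g (q y) - 2 = y * (g (q y) - 2 * y⁻¹) := by field_simp
    rw [e, norm_eq_abs, abs_mul, abs_of_pos hy0]
    calc _ ≤ y * (C * y ^ (-3 : ℤ)) := mul_le_mul_of_nonneg_left this hy0.le
      _ = C * y ^ (-2 : ℤ) := by
        rw [show (-2 : ℤ) = -3 + 1 by norm_num, zpow_add_one₀ hy0.ne']; ring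
  obtain ⟨R, hR⟩ := ((hlim.eventually_const_le (show (1 : ℝ) < 2 by norm_num)).and
    (eventually_ge_atTop 1)).exists_forall_of_atTop
  have hpos : ∀ y, 0 < y → 0 < y * g (q y) := fun y hy => by
    rw [← h.mul_deriv hy]
    have := h.deriv_pos y
    positivity
  have h1R : (1 : ℝ) ≤ max 1 R := le_max_left _ _
  obtain ⟨x, hx, hmin⟩ := (isCompact_Icc (a := (1 : ℝ)) (b := max 1 R)).exists_isMinOn
    ⟨1, le_rfl, h1R⟩ (f := fun y => y * g (q y)) (by fun_prop)
  have hx0 : 0 < x := by linarith [hx.1]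
  refine ⟨min 1 (x * g (q x)), lt_min one_pos (hpos x hx0), fun y hy => ?_⟩
  have hy0 : 0 < y := by linarith
  rw [← div_eq_mul_inv, div_le_iff₀ hy0, mul_comm (g (q y))]
  rcases le_total y (max 1 R) with hyR | hyR
  · exact (min_le_right _ _).trans (hmin ⟨hy, hyR⟩)
  · exact (min_le_left _ _).trans (hR y ((le_max_right _ _).trans hyR)).1

end

/-! ### The suitable derivatives -/

section
variable {P : Type} {D : Set (P × ℝ)}

theorem symOn_opA {w u : P → ℝ → ℝ} (hu : SymOn D w u) :
    SymOn D (fun p y => w p y / y) (fun p => opA g Q (u p)) := by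
  have hZ := h.symOn_comp hu.pos h.target.contDiff_deriv
  have h1 := ((hZ.mul (SymTo.zpow hu.pos (-1))).mul hu).congr_weight
    (w' := fun p y => w p y / y) fun z hz => by simp [div_eq_inv_mul]
  refine (hu.deriv.neg.add h1).congr fun z hz => ?_
  filter_upwards [lt_mem_nhds (hu.pos z hz)] with y hy
  rw [opA, ← h.eq y (le_of_lt hy), zpow_neg_one]; ring

theorem symOn_opAstar {w u : P → ℝ → ℝ} (hu : SymOn D w u) :
    SymOn D (fun p y => w p y / y) (fun p => opAstar g Q (u p)) := by
  have hZ := h.symOn_comp hu.pos (F := fun u => 1 + deriv g u)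
    (contDiff_const.add h.target.contDiff_deriv)
  have h1 := ((hZ.mul (SymTo.zpow hu.pos (-1))).mul hu).congr_weight
    (w' := fun p y => w p y / y) fun z hz => by simp [div_eq_inv_mul]
  refine (hu.deriv.add h1).congr fun z hz => ?_
  filter_upwards [lt_mem_nhds (hu.pos z hz)] with y hy
  rw [opAstar, ← h.eq y (le_of_lt hy), zpow_neg_one]; ring

theorem symOn_suitable {w u : P → ℝ → ℝ} (hu : SymOn D w u) (k : ℕ) :
    SymOn D (fun p y => w p y / y ^ k) (fun p => suitable g Q k (u p)) := by
  induction k with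
  | zero => simpa [suitable] using hu
  | succ k ih =>
    simp only [suitable, pow_succ, ← div_div]
    split_ifs
    · exact h.symOn_opA ih
    · exact h.symOn_opAstar ih

end

theorem opH_eq {u : ℝ → ℝ} {y : ℝ} (hy : 0 < y) (hu : SmoothAt u y) :
    opH g Q u y = opAstar g Q (opA g Q u) y := by
  have hg1 := h.target.smooth
  have hg2 := h.target.contDiff_deriv
  have hq := h.hasDerivAt hy
  have hd := (hu.differentiableAt (by simp)).hasDerivAt
  have hdd := ((contDiffAt_deriv hu).differentiableAt (by simp)).hasDerivAt
  have hZ : HasDerivAt (fun x => deriv g (q x)) (deriv (deriv g) (q y) * (g (q y) / y)) y :=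
    (hg2.differentiable (by simp) (q y)).hasDerivAt.comp y hq
  have hA : HasDerivAt (opA g Q u) (-deriv (deriv u) y
      + ((deriv (deriv g) (q y) * (g (q y) / y) * y - deriv g (q y) * 1) / y ^ 2 * u y
        + deriv g (q y) / y * deriv u y)) y := by
    have := hdd.fun_neg.fun_add ((hZ.fun_div (hasDerivAt_id y) hy.ne').fun_mul hd)
    refine this.congr_of_eventuallyEq ?_
    filter_upwards [lt_mem_nhds hy] with x hx
    rw [opA, ← h.eq x (le_of_lt hx), id]
  have hf : deriv (nonlin g) (q y) = deriv g (q y) * deriv g (q y) + g (q y) * deriv (deriv g) (q y) := by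
    exact ((hg1.differentiable (by simp) (q y)).hasDerivAt.fun_mul
      (hg2.differentiable (by simp) (q y)).hasDerivAt).deriv
  rw [opAstar, hA.deriv, opA, opH, lap, ← h.eq y hy.le, hf]; field_simp; ring

theorem contDiffAt_opA {u : ℝ → ℝ} {y : ℝ} (hy : 0 < y) (hu : SmoothAt u y) :
    SmoothAt (opA g Q u) y := by
  have hg2 := h.target.contDiff_deriv
  have hq := h.smooth
  have hdu := contDiffAt_deriv hu
  have : SmoothAt (fun y => -deriv u y + deriv g (q y) / y * u y) y :=
    hdu.neg.add (((hg2.comp hq).contDiffAt.div contDiffAt_id hy.ne').mul hu)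
  refine this.congr_of_eventuallyEq ?_
  filter_upwards [lt_mem_nhds hy] with x hx
  rw [opA, ← h.eq x (le_of_lt hx)]

theorem contDiffAt_opAstar {u : ℝ → ℝ} {y : ℝ} (hy : 0 < y) (hu : SmoothAt u y) :
    SmoothAt (opAstar g Q u) y := by
  have hg2 := h.target.contDiff_deriv
  have hq := h.smooth
  have hdu := contDiffAt_deriv hu
  have : SmoothAt (fun y => deriv u y + (1 + deriv g (q y)) / y * u y) y :=
    hdu.add ((((contDiff_const.add (hg2.comp hq)).contDiffAt).div contDiffAt_id hy.ne').mul hu)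
  refine this.congr_of_eventuallyEq ?_
  filter_upwards [lt_mem_nhds hy] with x hx
  rw [opAstar, ← h.eq x (le_of_lt hx)]

theorem contDiffAt_suitable {u : ℝ → ℝ} {y : ℝ} (hy : 0 < y) (hu : SmoothAt u y) (k : ℕ) :
    SmoothAt (suitable g Q k u) y := by
  induction k with
  | zero => exact hu
  | succ k ih =>
    rw [suitable]
    split_ifs
    · exact h.contDiffAt_opA hy ih
    · exact h.contDiffAt_opAstar hy ih

theorem opH_iterate {u : ℝ → ℝ} {s : Set ℝ} (hs : ∀ y ∈ s, 0 < y) (hu : ∀ y ∈ s, SmoothAt u y)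
    (hso : IsOpen s) (k : ℕ) : ∀ y ∈ s, (opH g Q)^[k] u y = suitable g Q (2 * k) u y := by
  induction k with
  | zero => intro y _; rfl
  | succ k ih =>
    intro y hy
    have he : (opH g Q)^[k] u =ᶠ[𝓝 y] suitable g Q (2 * k) u := by
      filter_upwards [hso.mem_nhds hy] with x hx using ih x hx
    have hc := h.contDiffAt_suitable (hs y hy) (hu y hy) (2 * k)
    rw [Function.iterate_succ_apply', show 2 * (k + 1) = 2 * k + 1 + 1 by ring, suitable,
      if_neg (by simp), suitable, if_pos (by simp), ← h.opH_eq (hs y hy) hc]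
    simp only [opH, lap, he.deriv_eq, he.deriv.deriv_eq, he.eq_of_nhds]

end IsExt


/-! ### Symbols and expansions at infinity -/

/-- `u` is a symbol of order `n` at infinity, up to powers of `log y`. -/
def SymInf (n : ℤ) (u : ℝ → ℝ) : Prop :=
  ∃ c : ℕ, SymOn (P := Unit) {z | 1 ≤ z.2} (fun _ y => y ^ n * (1 + log y) ^ c) (fun _ => u)

/-- `u = y^n (α log y + β)` up to a symbol of order `n - 2`. -/
def Expn (n : ℤ) (u : ℝ → ℝ) (α β : ℝ) : Prop :=
  SymInf (n - 2) fun y => u y - y ^ n * (α * log y + β)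

theorem mem_one_le {z : Unit × ℝ} (hz : z ∈ {z : Unit × ℝ | 1 ≤ z.2}) : 0 < z.2 :=
  lt_of_lt_of_le one_pos hz

theorem one_le_one_add_log {y : ℝ} (hy : 1 ≤ y) : 1 ≤ 1 + log y := by linarith [log_nonneg hy]

theorem SymTo.symInf {n : ℤ} {u : ℝ → ℝ}
    (h : SymOn (P := Unit) {z | 1 ≤ z.2} (fun _ y => y ^ n) (fun _ => u)) : SymInf n u :=
  ⟨0, by simpa using h⟩

theorem weight_nonneg (n : ℤ) (c : ℕ) {y : ℝ} (hy : 1 ≤ y) : 0 ≤ y ^ n * (1 + log y) ^ c :=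
  mul_nonneg (zpow_nonneg (by linarith) _)
    (pow_nonneg (zero_le_one.trans (one_le_one_add_log hy)) _)

theorem SymInf.mono {n m : ℤ} {u : ℝ → ℝ} (h : SymInf n u) (hnm : n ≤ m) : SymInf m u := by
  obtain ⟨c, hc⟩ := h
  refine ⟨c, hc.of_le fun z hz => ?_⟩
  exact mul_le_mul_of_nonneg_right (zpow_le_zpow_right₀ hz hnm)
    (pow_nonneg (zero_le_one.trans (one_le_one_add_log hz)) _)

theorem SymInf.congr {n : ℤ} {u v : ℝ → ℝ} (h : SymInf n u) (he : ∀ y, 0 < y → u y = v y) :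
    SymInf n v := by
  obtain ⟨c, hc⟩ := h
  refine ⟨c, hc.congr fun z hz => ?_⟩
  filter_upwards [lt_mem_nhds (mem_one_le hz)] with y hy using he y hy

theorem SymInf.exists_of_le {n : ℤ} {u : ℝ → ℝ} (h : SymInf n u) : ∃ c₀ : ℕ, ∀ c, c₀ ≤ c →
    SymOn (P := Unit) {z | 1 ≤ z.2} (fun _ y => y ^ n * (1 + Real.log y) ^ c) (fun _ => u) := by
  obtain ⟨c₀, h⟩ := h
  refine ⟨c₀, fun c hc => h.of_le fun z hz => ?_⟩
  exact mul_le_mul_of_nonneg_left (pow_le_pow_right₀ (one_le_one_add_log hz) hc)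
    (zpow_nonneg (mem_one_le hz).le _)

theorem SymInf.add {n : ℤ} {u v : ℝ → ℝ} (hu : SymInf n u) (hv : SymInf n v) :
    SymInf n fun y => u y + v y := by
  obtain ⟨c, hu⟩ := hu.exists_of_le
  obtain ⟨c', hv⟩ := hv.exists_of_le
  exact ⟨max c c', (hu _ (le_max_left _ _)).add (hv _ (le_max_right _ _))⟩

theorem SymInf.const_mul {n : ℤ} {u : ℝ → ℝ} (hu : SymInf n u) (a : ℝ) :
    SymInf n fun y => a * u y := let ⟨c, h⟩ := hu; ⟨c, h.const_mul a⟩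

theorem SymInf.neg {n : ℤ} {u : ℝ → ℝ} (hu : SymInf n u) : SymInf n fun y => -u y :=
  let ⟨c, h⟩ := hu; ⟨c, h.neg⟩

theorem SymInf.mul {n m : ℤ} {u v : ℝ → ℝ} (hu : SymInf n u) (hv : SymInf m v) :
    SymInf (n + m) fun y => u y * v y := by
  obtain ⟨c, hu⟩ := hu
  obtain ⟨c', hv⟩ := hv
  refine ⟨c + c', (hu.mul hv).congr_weight fun z hz => ?_⟩
  rw [zpow_add₀ (mem_one_le hz).ne', pow_add]; ring

theorem SymInf.zpow (n : ℤ) : SymInf n fun y => y ^ n :=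
  SymTo.symInf (SymTo.zpow (fun _ hz => mem_one_le hz) n)

theorem SymInf.log : SymInf 0 Real.log :=
  ⟨1, by simpa using SymTo.log (P := Unit) (D := {z | 1 ≤ z.2}) (fun _ hz => hz)⟩

theorem SymInf.const (c : ℝ) : SymInf 0 fun _ => c :=
  SymTo.symInf (by simpa using SymTo.const c (fun _ hz => mem_one_le hz))

theorem SymInf.zero (n : ℤ) : SymInf n fun _ => 0 := by simpa using (SymInf.zpow n).const_mul 0

theorem SymInf.leading (n : ℤ) (α β : ℝ) : SymInf n fun y => y ^ n * (α * Real.log y + β) := by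
  simpa using (SymInf.zpow n).mul ((SymInf.log.const_mul α).add (SymInf.const β))

theorem SymInf.deriv {n : ℤ} {u : ℝ → ℝ} (hu : SymInf n u) : SymInf (n - 1) (deriv u) := by
  obtain ⟨c, h⟩ := hu
  refine ⟨c, h.deriv.congr_weight fun z hz => ?_⟩
  rw [zpow_sub_one₀ (mem_one_le hz).ne']; field_simp

theorem SymInf.smooth {n : ℤ} {u : ℝ → ℝ} (hu : SymInf n u) {y : ℝ} (hy : 1 ≤ y) :
    SmoothAt u y := let ⟨_, h⟩ := hu; h.smooth ((), y) hy

/-- A primitive of a symbol of order `n ≥ -1` is a symbol of order `n + 1`. -/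
theorem SymInf.primitive {n : ℤ} (hn : -1 ≤ n) {F f : ℝ → ℝ} (hf : SymInf n f)
    (hF : ∀ y, 1 ≤ y → SmoothAt F y) (hd : ∀ y, 0 < y → HasDerivAt F (f y) y) :
    SymInf (n + 1) F := by
  obtain ⟨c, h⟩ := hf
  obtain ⟨C, hC, hb⟩ := h.bound_zero
  refine ⟨c + 1, SymTo.of_deriv (fun z hz => hF _ hz) ?_ (fun z hz => weight_nonneg _ _ hz) ?_⟩
  · set K := C + |F 1|
    have hK : 0 ≤ K := by positivity
    refine ⟨K, hK, fun z hz => ?_⟩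
    have hB : ∀ y : ℝ, 0 < y → HasDerivAt (fun y => K * (y ^ (n + 1) * (1 + Real.log y) ^ (c + 1)))
        (K * (((n + 1 : ℤ) * y ^ n) * (1 + Real.log y) ^ (c + 1)
          + y ^ (n + 1) * ((c + 1 : ℕ) * (1 + Real.log y) ^ c * y⁻¹))) y := fun y hy => by
      have h1 := hasDerivAt_zpow (n + 1) y (Or.inl hy.ne')
      rw [add_sub_cancel_right] at h1
      exact (h1.fun_mul (((Real.hasDerivAt_log hy.ne').const_add 1).fun_pow (c + 1))).const_mul K
    refine image_norm_le_of_norm_deriv_right_le_deriv_boundary' (f := F) (f' := f)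
      (a := 1) (b := z.2) (fun y hy => (hF y hy.1).continuousAt.continuousWithinAt)
      (fun y hy => (hd y (by linarith [hy.1])).hasDerivWithinAt) ?_
      (fun y hy => (hB y (by linarith [hy.1])).continuousAt.continuousWithinAt)
      (fun y hy => (hB y (by linarith [hy.1])).hasDerivWithinAt) (fun y hy => ?_)
      (right_mem_Icc.mpr hz)
    · simp [K]; linarith
    · have hy0 : 0 < y := by linarith [hy.1]
      have h1 := hb ((), y) hy.1
      have h2 := one_le_one_add_log hy.1
      have h3 : 0 ≤ y ^ n * (1 + Real.log y) ^ c := weight_nonneg _ _ hy.1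
      have h4 : (0 : ℝ) ≤ ((n + 1 : ℤ) : ℝ) := by exact_mod_cast (by omega : 0 ≤ n + 1)
      have h5 : 0 ≤ y ^ n * (1 + Real.log y) ^ (c + 1) := weight_nonneg _ _ hy.1
      rw [norm_eq_abs]
      have e : y ^ (n + 1) * ((c + 1 : ℕ) * (1 + Real.log y) ^ c * y⁻¹)
          = (c + 1) * (y ^ n * (1 + Real.log y) ^ c) := by
        rw [zpow_add_one₀ hy0.ne']; push_cast; field_simp
      rw [e]
      have h6 : 0 ≤ (c : ℝ) * (y ^ n * (1 + Real.log y) ^ c) := by positivity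
      have h7 : 0 ≤ ((n + 1 : ℤ) * y ^ n) * (1 + Real.log y) ^ (c + 1) := by
        rw [mul_assoc]; exact mul_nonneg h4 h5
      calc |f y| ≤ C * (y ^ n * (1 + Real.log y) ^ c) := h1
        _ ≤ K * (y ^ n * (1 + Real.log y) ^ c) := mul_le_mul_of_nonneg_right (by simp [K]) h3
        _ ≤ _ := mul_le_mul_of_nonneg_left (by linarith) hK
  · refine (h.of_le fun z hz => ?_).congr fun z hz => ?_
    · have hz0 := mem_one_le hz
      rw [zpow_add_one₀ hz0.ne', mul_right_comm, mul_div_cancel_right₀ _ hz0.ne']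
      exact mul_le_mul_of_nonneg_left (pow_le_pow_right₀ (one_le_one_add_log hz) (Nat.le_succ c))
        (zpow_nonneg hz0.le _)
    · filter_upwards [lt_mem_nhds (mem_one_le hz)] with y hy
      exact (hd y hy).deriv.symm

theorem Expn.symInf {n : ℤ} {u : ℝ → ℝ} {α β : ℝ} (h : Expn n u α β) : SymInf n u := by
  have := (SymInf.mono h (m := n) (by omega)).add (SymInf.leading n α β)
  simpa using this

theorem SymInf.expn {n : ℤ} {u : ℝ → ℝ} (h : SymInf (n - 2) u) : Expn n u 0 0 := by
  simpa [Expn] using h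

theorem Expn.congr {n : ℤ} {u v : ℝ → ℝ} {α β : ℝ} (h : Expn n u α β)
    (he : ∀ y, 0 < y → u y = v y) : Expn n v α β :=
  SymInf.congr h fun y hy => by rw [he y hy]

theorem Expn.const_mul {n : ℤ} {u : ℝ → ℝ} {α β : ℝ} (h : Expn n u α β) (c : ℝ) :
    Expn n (fun y => c * u y) (c * α) (c * β) :=
  (SymInf.const_mul h c).congr fun y _ => by ring

theorem Expn.mul {n m : ℤ} {u v : ℝ → ℝ} {α β κ : ℝ} (h : Expn n u α β) (h' : Expn m v 0 κ) :
    Expn (m + n) (fun y => v y * u y) (κ * α) (κ * β) := by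
  have h1 := (SymInf.mul h' h.symInf).mono (m := m + n - 2) (by omega)
  have h2 := (SymInf.mul ((SymInf.zpow m).const_mul κ) h).mono (m := m + n - 2) (by omega)
  refine (h1.add h2).congr fun y hy => ?_
  rw [zpow_add₀ hy.ne']; ring

theorem Expn.zpow (n : ℤ) (c : ℝ) : Expn n (fun y => c * y ^ n) 0 c := by
  have := SymInf.zero (n - 2)
  exact this.congr fun y _ => by ring

theorem Expn.deriv {n : ℤ} {u : ℝ → ℝ} {α β : ℝ} (h : Expn n u α β) :
    Expn (n - 1) (deriv u) (n * α) (n * β + α) := by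
  obtain ⟨c, hc⟩ := SymInf.deriv h
  refine ⟨c, ?_⟩
  rw [show n - 1 - 2 = n - 2 - 1 by ring]
  refine hc.congr fun z hz => ?_
  have hz0 := mem_one_le hz
  filter_upwards [eventually_differentiableAt (h.symInf.smooth hz), lt_mem_nhds hz0] with y hy hy0
  have hy0 : 0 < y := hy0
  have hl : HasDerivAt (fun y : ℝ => y ^ n * (α * log y + β)) _ y :=
    (hasDerivAt_zpow n y (Or.inl hy0.ne')).fun_mul
      (((Real.hasDerivAt_log hy0.ne').const_mul α).add_const β)
  rw [(hy.hasDerivAt.fun_sub hl).deriv, zpow_sub_one₀ hy0.ne']; ring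

theorem Expn.primitive {n : ℤ} (hn : 1 ≤ n) {F f : ℝ → ℝ} {α β : ℝ} (hf : Expn n f α β)
    (hF : ∀ y, 1 ≤ y → SmoothAt F y) (hd : ∀ y, 0 < y → HasDerivAt F (f y) y) :
    Expn (n + 1) F (((n : ℝ) + 1)⁻¹ * α) (((n : ℝ) + 1)⁻¹ * β - ((n : ℝ) + 1)⁻¹ ^ 2 * α) := by
  have hn0 : (n : ℝ) + 1 ≠ 0 := by exact_mod_cast (by omega : n + 1 ≠ 0)
  set A := ((n : ℝ) + 1)⁻¹ * α
  set B := ((n : ℝ) + 1)⁻¹ * β - ((n : ℝ) + 1)⁻¹ ^ 2 * α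
  have := SymInf.primitive (n := n - 2) (by omega) (F := fun y => F y - y ^ (n + 1) *
    (A * log y + B)) hf (fun y hy => ?_) (fun y hy => ?_)
  · rw [Expn, show n + 1 - 2 = n - 2 + 1 by ring]; exact this
  · have hy0 : y ≠ 0 := by linarith
    exact (hF y hy).sub ((contDiffAt_zpow _ hy0).mul
      ((contDiffAt_const.mul (contDiffAt_log.mpr hy0)).add contDiffAt_const))
  · have hl : HasDerivAt (fun y : ℝ => y ^ (n + 1) * (A * log y + B)) _ y :=
      (hasDerivAt_zpow (n + 1) y (Or.inl hy.ne')).fun_mul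
        (((Real.hasDerivAt_log hy.ne').const_mul A).add_const B)
    refine ((hd y hy).fun_sub hl).congr_deriv ?_
    rw [add_sub_cancel_right, zpow_add_one₀ hy.ne']; simp only [A, B]; push_cast; field_simp; ring

/-! ### Inversion of `H` -/

section
variable {g Q q : ℝ → ℝ}

/-- The profile of `H⁻¹(y v)`, divided by `y`. -/
noncomputable def invProf (q v : ℝ → ℝ) (y : ℝ) : ℝ := -(y ^ 2 * (deriv q y * avg (fun t => t ^ 1)
    (fun x => (deriv q x)⁻¹ ^ 2 * avg (fun t => t ^ 3) (fun z => deriv q z * v z) x) y))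

theorem avg_pow_mul (ψ w : ℝ → ℝ) (m : ℕ) (y : ℝ) :
    avg ψ (fun x => x ^ m * w x) y = y ^ m * avg (fun t => ψ t * t ^ m) w y := by
  unfold avg
  rw [← intervalIntegral.integral_const_mul]
  congr 1; funext t; simp only [mul_pow]; ring

namespace IsExt
variable (h : IsExt g Q q)
include h

theorem deriv_ne (y : ℝ) : deriv q y ≠ 0 := (h.deriv_pos y).ne'

theorem contDiff_inner {v : ℝ → ℝ} (hv : Smooth v) {ψ : ℝ → ℝ} (hψ : Continuous ψ) :
    Smooth (fun x => (deriv q x)⁻¹ ^ 2 * avg ψ (fun z => deriv q z * v z) x) :=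
  ((h.contDiff_deriv.inv h.deriv_ne).pow 2).mul (contDiff_avg hψ (h.contDiff_deriv.mul hv))

theorem invProf_even_smooth {v : ℝ → ℝ} (hv : Smooth v) (he : ∀ y, v (-y) = v y) (p : ℕ) :
    ∃ v' : ℝ → ℝ, Smooth v' ∧ (∀ y, v' (-y) = v' y) ∧
      ∀ y, invProf q (fun y => y ^ (2 * p) * v y) y = y ^ (2 * p + 2) * v' y := by
  have ha := deriv_odd h.odd
  have hin := h.contDiff_inner hv (ψ := fun t => t ^ 3 * t ^ (2 * p)) (by fun_prop)
  refine ⟨fun y => -(deriv q y * avg (fun t => t ^ 1 * t ^ (2 * p))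
    (fun x => (deriv q x)⁻¹ ^ 2 * avg (fun t => t ^ 3 * t ^ (2 * p)) (fun z => deriv q z * v z) x)
      y), (h.contDiff_deriv.mul (contDiff_avg (by fun_prop) hin)).neg, fun y => ?_, fun y => ?_⟩
  · beta_reduce
    rw [ha, avg_neg_of_even]
    intro x
    rw [ha, avg_neg_of_even]
    intro z
    rw [ha, he]
  · unfold invProf
    have e1 : (fun z => deriv q z * (z ^ (2 * p) * v z)) = fun z => z ^ (2 * p) * (deriv q z * v z) :=
      funext fun z => by ring
    rw [e1]; simp only [avg_pow_mul]
    have e2 : (fun x => (deriv q x)⁻¹ ^ 2 * (x ^ (2 * p) *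
          avg (fun t => t ^ 3 * t ^ (2 * p)) (fun z => deriv q z * v z) x))
        = fun x => x ^ (2 * p) * ((deriv q x)⁻¹ ^ 2 *
          avg (fun t => t ^ 3 * t ^ (2 * p)) (fun z => deriv q z * v z) x) :=
      funext fun z => by ring
    rw [e2, avg_pow_mul]; ring

theorem opH_invProf {v : ℝ → ℝ} (hv : Smooth v) {y : ℝ} (hy : 0 < y) :
    opH g Q (fun y => y * invProf q v y) y = y * v y := by
  have hin := h.contDiff_inner hv (ψ := fun t => t ^ 3) (by fun_prop)
  have hav : Continuous fun z => deriv q z * v z := (h.contDiff_deriv.mul hv).continuous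
  set X : ℝ → ℝ := fun y => y ^ (3 + 1) * avg (fun t => t ^ 3) (fun z => deriv q z * v z) y with hX
  set W : ℝ → ℝ := fun y => y ^ (1 + 1) * avg (fun t => t ^ 1)
    (fun x => (deriv q x)⁻¹ ^ 2 * avg (fun t => t ^ 3) (fun z => deriv q z * v z) x) y with hW
  have hXd : ∀ y, HasDerivAt X (y ^ 3 * (deriv q y * v y)) y := hasDerivAt_pow_mul_avg hav 3
  have hWd : ∀ y, 0 < y → HasDerivAt W (X y / (y ^ 3 * deriv q y ^ 2)) y := fun y hy => by
    refine (hasDerivAt_pow_mul_avg hin.continuous 1 y).congr_deriv ?_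
    have := h.deriv_ne y
    simp only [hX]; field_simp; ring
  have hg2 := h.target.contDiff_deriv
  have hGd : ∀ y, 0 < y → HasDerivAt (fun x => g (q x)) (deriv g (q y) * (g (q y) / y)) y :=
    fun y hy => (h.target.smooth.differentiable (by simp) (q y)).hasDerivAt.comp y (h.hasDerivAt hy)
  have hGp : ∀ y, 0 < y → g (q y) ≠ 0 := fun y hy => by
    rw [← h.mul_deriv hy]; exact mul_ne_zero hy.ne' (h.deriv_ne y)
  have hu : ∀ y, 0 < y → y * invProf q v y = -(g (q y) * W y) := fun y hy => by
    rw [← h.mul_deriv hy]; simp only [invProf, hW]; ring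
  have hud : ∀ y, 0 < y → opA g Q (fun y => y * invProf q v y) y = X y / (y * g (q y)) := by
    intro y hy
    have e : (fun y => y * invProf q v y) =ᶠ[𝓝 y] fun y => -(g (q y) * W y) := by
      filter_upwards [lt_mem_nhds hy] with x hx using hu x hx
    rw [opA, e.deriv_eq, ((hGd y hy).fun_mul (hWd y hy)).fun_neg.deriv, hu y hy, ← h.eq y hy.le]
    have h1 := hGp y hy
    have h2 := h.deriv_ne y
    have h3 := h.mul_deriv hy
    rw [← h3]; field_simp; ring
  have hs : SmoothAt (fun y => y * invProf q v y) y := by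
    have := contDiff_avg (ψ := fun t => t ^ 1) (by fun_prop) hin
    have h1 := h.contDiff_deriv
    unfold invProf; fun_prop
  rw [h.opH_eq hy hs, opAstar]
  have e : opA g Q (fun y => y * invProf q v y) =ᶠ[𝓝 y] fun y => X y / (y * g (q y)) := by
    filter_upwards [lt_mem_nhds hy] with x hx using hud x hx
  have h1 := hGp y hy
  have h4 := hy.ne'
  have hid : HasDerivAt (fun y : ℝ => y) 1 y := hasDerivAt_id y
  have h2 := (hXd y).fun_div (hid.fun_mul (hGd y hy)) (mul_ne_zero h4 h1)
  rw [e.deriv_eq, e.eq_of_nhds, h2.deriv, ← h.eq y hy.le]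
  have h3 := h.mul_deriv hy
  have h5 : deriv q y = g (q y) / y := by rw [← h3]; field_simp
  rw [h5]; field_simp; ring

theorem invH_eq {v u : ℝ → ℝ} (hv : Smooth v) (hu : ∀ y, 0 ≤ y → u y = y * v y) {y : ℝ}
    (hy : 0 ≤ y) : invH Q u y = y * invProf q v y := by
  rcases hy.eq_or_lt with rfl | hy
  · simp [invH, h.scal_eq le_rfl, Gam]
  have hin := h.contDiff_inner hv (ψ := fun t => t ^ 3) (by fun_prop)
  have hav : Continuous fun z => deriv q z * v z := (h.contDiff_deriv.mul hv).continuous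
  have haq := h.contDiff_deriv.continuous
  have hvc := hv.continuous
  set X : ℝ → ℝ := fun y => y ^ (3 + 1) * avg (fun t => t ^ 3) (fun z => deriv q z * v z) y with hX
  set W : ℝ → ℝ := fun y => y ^ (1 + 1) * avg (fun t => t ^ 1)
    (fun x => (deriv q x)⁻¹ ^ 2 * avg (fun t => t ^ 3) (fun z => deriv q z * v z) x) y with hW
  have hXd : ∀ y, HasDerivAt X (y ^ 3 * (deriv q y * v y)) y := hasDerivAt_pow_mul_avg hav 3
  have hWd : ∀ y, 0 < y → HasDerivAt W (X y / (y ^ 3 * deriv q y ^ 2)) y := fun y hy => by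
    refine (hasDerivAt_pow_mul_avg hin.continuous 1 y).congr_deriv ?_
    have := h.deriv_ne y
    simp only [hX]; field_simp; ring
  set ρ : ℝ → ℝ := fun x => 1 / (x * (x * deriv q x) ^ 2) with hρ
  have hρc : ContinuousOn ρ (Ioi 0) := by
    refine continuousOn_const.div (by fun_prop) fun x hx => ?_
    have hx0 : x ≠ 0 := ne_of_gt hx
    have := h.deriv_ne x
    positivity
  set J : ℝ → ℝ := fun y => ∫ x in (1 : ℝ)..y, ρ x with hJ
  have hsub : ∀ y : ℝ, 0 < y → uIcc 1 y ⊆ Ioi 0 := fun y hy =>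
    ordConnected_Ioi.uIcc_subset (mem_Ioi.mpr one_pos) (mem_Ioi.mpr hy)
  have hJd : ∀ y, 0 < y → HasDerivAt J (ρ y) y := fun y hy =>
    intervalIntegral.integral_hasDerivAt_right ((hρc.mono (hsub y hy)).intervalIntegrable)
      (hρc.stronglyMeasurableAtFilter isOpen_Ioi y hy)
      (hρc.continuousAt (isOpen_Ioi.mem_nhds hy))
  have hGam : ∀ y, 0 < y → Gam Q y = y * deriv q y * J y := fun y hy => by
    rw [Gam, h.scal_eq hy.le]
    congr 1
    refine intervalIntegral.integral_congr fun x hx => ?_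
    simp only [hρ, h.scal_eq (le_of_lt (hsub y hy hx))]
  have hA : (∫ x in (0 : ℝ)..y, u x * scal Q x * x) = X y := by
    rw [hX]; simp only; rw [pow_mul_avg]
    refine intervalIntegral.integral_congr fun x hx => ?_
    rw [uIcc_of_le hy.le] at hx; simp only [h.scal_eq hx.1, hu x hx.1]; ring
  set β : ℝ → ℝ := fun x => x ^ 3 * (deriv q x * v x) * J x with hβ
  have hB : (∫ x in (0 : ℝ)..y, u x * Gam Q x * x) = ∫ x in (0 : ℝ)..y, β x := by
    refine intervalIntegral.integral_congr fun x hx => ?_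
    rw [uIcc_of_le hy.le] at hx
    rcases hx.1.eq_or_lt with h0 | h0
    · simp [hβ, ← h0]
    · simp only [hβ, hGam x h0, hu x hx.1]; ring
  -- bounds near the origin
  obtain ⟨C₁, hC₁0, hC₁⟩ := exists_abs_le_Icc (f := fun x => (deriv q x)⁻¹ ^ 2)
    ((h.contDiff_deriv.inv h.deriv_ne).pow 2).continuous 0 1
  obtain ⟨C₂, -, hC₂⟩ := exists_abs_le_Icc hav 0 1
  obtain ⟨C₃, -, hC₃⟩ := exists_abs_le_Icc (f := avg (fun t => t ^ 3) fun z => deriv q z * v z)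
    (contDiff_avg (by fun_prop) (h.contDiff_deriv.mul hv)).continuous 0 1
  have hJb : ∀ x ∈ Ioc (0 : ℝ) 1, x ^ 3 * |J x| ≤ C₁ := by
    intro x hx
    have hb : ‖∫ t in x..1, ρ t‖ ≤ C₁ * (x⁻¹) ^ 3 * |1 - x| := by
      refine intervalIntegral.norm_integral_le_of_norm_le_const fun t ht => ?_
      rw [uIoc_of_le hx.2] at ht
      have ht0 : 0 < t := hx.1.trans ht.1
      have h1 := hC₁ t ⟨ht0.le, ht.2⟩
      have e : ρ t = (deriv q t)⁻¹ ^ 2 * (t⁻¹) ^ 3 := by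
        have := h.deriv_ne t
        simp only [hρ]; field_simp
      rw [e, norm_mul]
      have h2 : ‖t⁻¹ ^ 3‖ ≤ x⁻¹ ^ 3 := by
        rw [Real.norm_of_nonneg (by positivity)]
        exact pow_le_pow_left₀ (by positivity) (inv_anti₀ hx.1 ht.1.le) 3
      exact mul_le_mul h1 h2 (norm_nonneg _) hC₁0
    rw [norm_eq_abs, intervalIntegral.integral_symm, abs_neg] at hb
    have hx3 : 0 < x ^ 3 := pow_pos hx.1 3
    calc x ^ 3 * |J x| ≤ x ^ 3 * (C₁ * (x⁻¹) ^ 3 * |1 - x|) := mul_le_mul_of_nonneg_left hb hx3.le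
      _ = C₁ * (1 - x) := by
          have := hx.1.ne'; rw [abs_of_nonneg (by linarith [hx.2])]; field_simp
      _ ≤ C₁ := mul_le_of_le_one_right hC₁0 (by linarith [hx.1])
  have hβb : ∀ x ∈ Ioc (0 : ℝ) 1, |β x| ≤ C₁ * C₂ := by
    intro x hx
    have h1 := hJb x hx
    have h2 := hC₂ x ⟨hx.1.le, hx.2⟩
    calc |β x| = (x ^ 3 * |J x|) * |deriv q x * v x| := by
          rw [hβ]; simp only [abs_mul, abs_pow, abs_of_pos hx.1]; ring
      _ ≤ _ := mul_le_mul h1 h2 (abs_nonneg _) hC₁0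
  have hJc : ContinuousOn J (Ioi 0) := fun x hx => (hJd x hx).continuousAt.continuousWithinAt
  have hβc : ContinuousOn β (Ioi 0) := by refine ContinuousOn.mul (by fun_prop) hJc
  have hβi : ∀ y, 0 < y → IntervalIntegrable β volume 0 y := by
    have h01 : IntervalIntegrable β volume 0 1 := by
      rw [intervalIntegrable_iff_integrableOn_Ioc_of_le zero_le_one]
      exact Integrable.of_bound
        ((hβc.mono fun x hx => hx.1).aestronglyMeasurable measurableSet_Ioc) (C₁ * C₂)
        ((ae_restrict_iff' measurableSet_Ioc).mpr (Eventually.of_forall hβb))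
    intro y hy; exact h01.trans ((hβc.mono (hsub y hy)).intervalIntegrable)
  have hBd : ∀ y, 0 < y → HasDerivAt (fun y => ∫ x in (0 : ℝ)..y, β x) (β y) y := fun y hy =>
    intervalIntegral.integral_hasDerivAt_right (hβi y hy)
      (hβc.stronglyMeasurableAtFilter isOpen_Ioi y hy)
      (hβc.continuousAt (isOpen_Ioi.mem_nhds hy))
  set E : ℝ → ℝ := fun y => -(J y * X y) + (∫ x in (0 : ℝ)..y, β x) + W y with hE
  have hEd : ∀ y ∈ Ioi (0 : ℝ), HasDerivAt E 0 y := fun y hy => by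
    have := (((hJd y hy).fun_mul (hXd y)).fun_neg.fun_add (hBd y hy)).fun_add (hWd y hy)
    refine this.congr_deriv ?_
    have h1 : y ≠ 0 := ne_of_gt hy
    have h2 := h.deriv_ne y
    simp only [hρ, hβ]; field_simp; ring
  obtain ⟨c, hc⟩ := isOpen_Ioi.exists_is_const_of_deriv_eq_zero isPreconnected_Ioi
    (fun y hy => (hEd y hy).differentiableAt.differentiableWithinAt) (fun y hy => (hEd y hy).deriv)
  have hc0 : c = 0 := by
    have hlim : Tendsto E (𝓝[>] 0) (𝓝 0) := by
      have hWc : Tendsto W (𝓝[>] 0) (𝓝 0) := by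
        have : Continuous W := by
          have := (contDiff_avg (ψ := fun t => t ^ 1) (by fun_prop) hin).continuous
          fun_prop
        simpa [hW] using (this.tendsto 0).mono_left (nhdsWithin_le_nhds (s := Ioi 0))
      have hJX : Tendsto (fun y => -(J y * X y) + ∫ x in (0 : ℝ)..y, β x) (𝓝[>] 0) (𝓝 0) := by
        have hb : Tendsto (fun y : ℝ => (C₁ * C₃ + C₁ * C₂) * y) (𝓝[>] 0) (𝓝 0) := by
          have : Continuous fun y : ℝ => (C₁ * C₃ + C₁ * C₂) * y := by fun_prop
          simpa using (this.tendsto 0).mono_left (nhdsWithin_le_nhds (s := Ioi 0))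
        refine squeeze_zero_norm' ?_ hb
        filter_upwards [Ioc_mem_nhdsGT (zero_lt_one' ℝ)] with x hx
        refine (norm_add_le _ _).trans ?_
        rw [add_mul]
        refine add_le_add ?_ ?_
        · rw [norm_neg, norm_eq_abs]
          have h1 := hJb x hx
          have h2 := hC₃ x ⟨hx.1.le, hx.2⟩
          calc |J x * X x| = (x ^ 3 * |J x|) *
                |avg (fun t => t ^ 3) (fun z => deriv q z * v z) x| * x := by
                rw [hX]; simp only [abs_mul, abs_pow, abs_of_pos hx.1]; ring
            _ ≤ C₁ * C₃ * x :=
                mul_le_mul_of_nonneg_right (mul_le_mul h1 h2 (abs_nonneg _) hC₁0) hx.1.le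
        · have := intervalIntegral.norm_integral_le_of_norm_le_const (a := 0) (b := x) (f := β)
            (C := C₁ * C₂) fun t ht => by
              rw [uIoc_of_le hx.1.le] at ht; exact hβb t ⟨ht.1, ht.2.trans hx.2⟩
          simpa [abs_of_pos hx.1] using this
      simpa using hJX.add hWc
    have : Tendsto E (𝓝[>] 0) (𝓝 c) := tendsto_const_nhds.congr' (by
      filter_upwards [self_mem_nhdsWithin] with y hy using (hc y hy).symm)
    exact tendsto_nhds_unique this hlim
  have hE0 := hc y hy
  rw [hc0] at hE0; simp only [hE] at hE0
  rw [invH, hA, hB, hGam y hy, h.scal_eq hy.le]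
  have e1 : y * invProf q v y = -(y * deriv q y * W y) := by simp only [invProf, hW]; ring
  rw [e1]
  linear_combination y * deriv q y * hE0

end IsExt

end


/-- `u = y^s v` with `v` smooth and even. -/
def ZeroOrd (s : ℕ) (u : ℝ → ℝ) : Prop :=
  ∃ v : ℝ → ℝ, Smooth v ∧ (∀ y, v (-y) = v y) ∧ ∀ y, u y = y ^ s * v y

theorem ZeroOrd.contDiff {s : ℕ} {u : ℝ → ℝ} (h : ZeroOrd s u) : Smooth u := by
  obtain ⟨v, hv, -, hu⟩ := h
  rw [funext hu]; fun_prop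

theorem ZeroOrd.const_mul {s : ℕ} {u : ℝ → ℝ} (hu : ZeroOrd s u) (c : ℝ) :
    ZeroOrd s fun y => c * u y := by
  obtain ⟨a, ha, ha', h⟩ := hu
  exact ⟨fun y => c * a y, contDiff_const.mul ha, fun y => by beta_reduce; rw [ha'], fun y => by beta_reduce; rw [h]; ring⟩

theorem ZeroOrd.mul {s t : ℕ} {u v : ℝ → ℝ} (hu : ZeroOrd s u) (hv : ZeroOrd t v) :
    ZeroOrd (s + t) fun y => u y * v y := by
  obtain ⟨a, ha, ha', h⟩ := hu
  obtain ⟨b, hb, hb', h'⟩ := hv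
  exact ⟨fun y => a y * b y, ha.mul hb, fun y => by beta_reduce; rw [ha', hb'],
    fun y => by beta_reduce; rw [h, h', pow_add]; ring⟩

theorem ZeroOrd.of_le {s t : ℕ} {u : ℝ → ℝ} (hu : ZeroOrd (s + 2 * t) u) : ZeroOrd s u := by
  obtain ⟨a, ha, ha', h⟩ := hu
  exact ⟨fun y => y ^ (2 * t) * a y, by fun_prop,
    fun y => by beta_reduce; rw [ha', Even.neg_pow (by simp)], fun y => by beta_reduce; rw [h, pow_add]; ring⟩

theorem ZeroOrd.scal {s : ℕ} {u : ℝ → ℝ} (hu : ZeroOrd s u) : ZeroOrd s fun y => y * deriv u y := by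
  obtain ⟨a, ha, ha', h⟩ := hu
  have ha1 := (contDiff_infty_iff_deriv.mp ha).2
  refine ⟨fun y => s * a y + y * deriv a y, by fun_prop,
    fun y => by beta_reduce; rw [ha', deriv_even ha']; ring, fun y => ?_⟩
  have hd : HasDerivAt u (s * y ^ (s - 1) * a y + y ^ s * deriv a y) y := by
    rw [funext h]; exact (hasDerivAt_pow s y).fun_mul (ha.differentiable (by simp) y).hasDerivAt
  beta_reduce
  rw [hd.deriv]
  rcases s with _ | s
  · simp
  · simp only [add_tsub_cancel_right, pow_succ]; push_cast; ring

section
variable {g Q q : ℝ → ℝ}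

/-- `∫_0^y (ΛQ)² x dx`. -/
noncomputable def mass (q : ℝ → ℝ) (y : ℝ) : ℝ :=
  y ^ (3 + 1) * avg (fun t => t ^ 3) (fun z => deriv q z * deriv q z) y

namespace IsExt
variable (h : IsExt g Q q)
include h

theorem expn_g : Expn (-1) (fun y => g (q y)) 0 2 := by
  have := (h.symOn_scal_q (P := Unit) (D := {z | 1 ≤ z.2}) (fun _ hz => hz)).symInf
  exact this.congr fun y _ => by simp; ring

theorem g_pos {y : ℝ} (hy : 0 < y) : 0 < g (q y) := by
  rw [← h.mul_deriv hy]; exact mul_pos hy (h.deriv_pos y)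

theorem expn_inv_g_sq : Expn 2 (fun y => (g (q y))⁻¹ ^ 2) 0 (1 / 4) := by
  obtain ⟨c, hc, hl⟩ := h.lower_bound_g
  have h1 : SymInf 1 fun y => (g (q y))⁻¹ := by
    refine SymTo.symInf (((h.symOn_g (P := Unit) (D := {z | 1 ≤ z.2}) (fun _ hz => hz)).inv hc
      (fun z hz => zpow_pos (mem_one_le hz) _) fun z hz => ?_).congr_weight fun z hz => by simp)
    rw [zpow_neg_one]; exact (hl _ hz).trans (le_abs_self _)
  have h2 : SymInf 0 fun y => 2 + y * g (q y) := by
    simpa using (SymInf.const 2).add ((SymInf.zpow 1).mul h.expn_g.symInf)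
  have h3 : SymInf (-2) fun y => 2 - y * g (q y) := by
    have := ((SymInf.zpow 1).mul h.expn_g).neg
    exact (this.mono (by norm_num)).congr fun y hy => by
      have : y ≠ 0 := ne_of_gt hy
      simp; field_simp; ring
  refine ((((h1.mul h1).mul (h2.mul h3)).const_mul (1 / 4)).mono (by norm_num)).congr fun y hy => ?_
  have h4 := (h.g_pos hy).ne'
  field_simp
  norm_num; ring

/-- From the primitive of `φ ΛQ y` to `H⁻¹ φ`, `φ = y v`. -/
theorem invProf_expn_of_primitive (n : ℤ) (hn : -1 ≤ n) : ∃ κ κ' : ℝ, ∀ v : ℝ → ℝ,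
    Smooth v → ∀ α β : ℝ,
    Expn (n + 1) (fun y => y ^ (3 + 1) * avg (fun t => t ^ 3) (fun z => deriv q z * v z) y) α β →
    Expn (n + 2) (fun y => y * invProf q v y) (κ * α) (κ * β + κ' * α) := by
  set r : ℝ := ((n + 2 : ℤ) : ℝ) + 1
  refine ⟨-2 * r⁻¹ * (1 / 4), 2 * r⁻¹ ^ 2 * (1 / 4), fun v hv α β hX => ?_⟩
  have hin := h.contDiff_inner hv (ψ := fun t => t ^ 3) (by fun_prop)
  have hW := contDiff_avg (ψ := fun t => t ^ 1) (by fun_prop) hin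
  have h1 : Expn 1 (fun y => y⁻¹ * (g (q y))⁻¹ ^ 2) 0 (1 / 4) := by
    have := Expn.mul h.expn_inv_g_sq (Expn.zpow (-1) 1)
    simpa using this
  have h2 := Expn.mul hX h1
  rw [show 1 + (n + 1) = n + 2 by ring] at h2
  have h3 := Expn.primitive (n := n + 2) (by omega) (F := fun y => y ^ (1 + 1) *
    avg (fun t => t ^ 1) (fun x => (deriv q x)⁻¹ ^ 2 *
      avg (fun t => t ^ 3) (fun z => deriv q z * v z) x) y) h2
    (fun y _ => by fun_prop) (fun y hy => by
      refine (hasDerivAt_pow_mul_avg hin.continuous 1 y).congr_deriv ?_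
      have := h.deriv_ne y
      rw [← h.mul_deriv hy]; field_simp
      ring)
  have h4 := (Expn.mul h3 h.expn_g).const_mul (-1)
  rw [show -1 + (n + 2 + 1) = n + 2 by ring] at h4
  have h5 : Expn (n + 2) (fun y => y * invProf q v y) _ _ := h4.congr fun y hy => by
    rw [← h.mul_deriv hy]; simp only [invProf]; ring
  convert h5 using 1 <;> ring

theorem invProf_expn (n : ℤ) (hn : 1 ≤ n) : ∃ κ κ' : ℝ, ∀ v : ℝ → ℝ, Smooth v → ∀ α β : ℝ,
    Expn n (fun y => y * v y) α β →
    Expn (n + 2) (fun y => y * invProf q v y) (κ * α) (κ * β + κ' * α) := by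
  obtain ⟨κ, κ', H⟩ := h.invProf_expn_of_primitive n (by omega)
  set r : ℝ := (n : ℝ) + 1
  refine ⟨κ * (r⁻¹ * 2), κ' * (r⁻¹ * 2) - κ * (r⁻¹ ^ 2 * 2), fun v hv α β hφ => ?_⟩
  have hav := h.contDiff_deriv.mul hv
  have h1 : Expn 0 (fun y => y * g (q y)) 0 2 := by simpa using Expn.mul h.expn_g (Expn.zpow 1 1)
  have h2 := Expn.mul hφ h1
  rw [zero_add] at h2
  have h3 := Expn.primitive hn (F := fun y => y ^ (3 + 1) *
    avg (fun t => t ^ 3) (fun z => deriv q z * v z) y) h2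
    (fun y _ => by
      have := contDiff_avg (ψ := fun t => t ^ 3) (by fun_prop) hav
      fun_prop)
    (fun y hy => by
      refine (hasDerivAt_pow_mul_avg hav.continuous 3 y).congr_deriv ?_
      rw [← h.mul_deriv hy]; ring)
  have h4 := H v hv _ _ h3
  convert h4 using 1 <;> ring

theorem contDiff_mass : Smooth (mass q) := by
  have := contDiff_avg (ψ := fun t => t ^ 3) (by fun_prop) (h.contDiff_deriv.mul h.contDiff_deriv)
  unfold mass; fun_prop

theorem hasDerivAt_mass {y : ℝ} (hy : 0 < y) : HasDerivAt (mass q) (y * g (q y) ^ 2) y := by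
  refine (hasDerivAt_pow_mul_avg (h.contDiff_deriv.mul h.contDiff_deriv).continuous 3
    y).congr_deriv ?_
  rw [← h.mul_deriv hy]; ring

theorem symOn_mass : ∃ β : ℝ, SymOn (P := Unit) {z | 1 ≤ z.2} (fun _ y => y ^ (-2 : ℤ))
    (fun _ y => mass q y - 4 * log y - β) := by
  set X := mass q
  have hXs : Smooth X := h.contDiff_mass
  have hXd : ∀ y, 0 < y → HasDerivAt X (y * g (q y) ^ 2) y := fun y hy => h.hasDerivAt_mass hy
  have hd : ∀ y, 0 < y → HasDerivAt (fun y => X y - 4 * log y)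
      (y * g (q y) ^ 2 - 4 * y⁻¹) y := fun y hy =>
    (hXd y hy).fun_sub ((Real.hasDerivAt_log hy.ne').const_mul 4)
  have hf : SymOn (P := Unit) {z | 1 ≤ z.2} (fun _ y => y ^ (-3 : ℤ))
      (fun _ y => y * g (q y) ^ 2 - 4 * y⁻¹) := by
    have hD : ∀ z ∈ {z : Unit × ℝ | 1 ≤ z.2}, 0 < z.2 := fun z hz => mem_one_le hz
    have h1 := h.symOn_scal_q (P := Unit) (D := {z | 1 ≤ z.2}) (fun _ hz => hz)
    have h2 := h.symOn_g (P := Unit) (D := {z | 1 ≤ z.2}) (fun _ hz => hz)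
    have h3 := (SymTo.id hD).mul (h1.mul (h2.add ((SymTo.zpow hD (-1)).const_mul 2)))
    refine (h3.congr_weight fun z hz => ?_).congr fun z hz => ?_
    · have := (mem_one_le hz).ne'
      rw [show (-3 : ℤ) = -1 + (-3 + 1) by norm_num, zpow_add₀ this, zpow_add₀ this]
      simp; field_simp
    · filter_upwards [lt_mem_nhds (mem_one_le hz)] with y hy
      have : y ≠ 0 := ne_of_gt hy
      simp only [zpow_neg_one]; field_simp; ring
  obtain ⟨C, hC, hb⟩ := hf.bound_zero
  obtain ⟨β, hβ⟩ := exists_limit_of_deriv_le hC hd fun y hy => hb ((), y) hy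
  have hs : ∀ y : ℝ, 1 ≤ y → SmoothAt (fun y => X y - 4 * log y - β) y := fun y hy =>
    (hXs.contDiffAt.sub (contDiffAt_const.mul
      (contDiffAt_log.mpr (by linarith)))).sub contDiffAt_const
  refine ⟨β, SymTo.of_deriv (fun z hz => hs _ hz) ⟨C, hC, fun z hz => hβ _ hz⟩
    (fun z hz => zpow_nonneg (mem_one_le hz).le _) ?_⟩
  refine (hf.congr_weight fun z hz => ?_).congr fun z hz => ?_
  · rw [show (-2 : ℤ) = -3 + 1 by norm_num, zpow_add_one₀ (mem_one_le hz).ne',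
      mul_div_cancel_right₀ _ (mem_one_le hz).ne']
  · filter_upwards [lt_mem_nhds (mem_one_le hz)] with y hy
    exact ((hd y hy).sub_const β).deriv.symm

theorem invProf_expn_base : ∃ α β : ℝ, Expn 1 (fun y => y * invProf q (deriv q) y) α β := by
  obtain ⟨κ, κ', H⟩ := h.invProf_expn_of_primitive (-1) le_rfl
  obtain ⟨β, hβ⟩ := h.symOn_mass
  exact ⟨_, _, H (deriv q) h.contDiff_deriv 4 β (hβ.symInf.congr fun y _ => by simp [mass]; ring)⟩


end IsExt

/-- `u` is a profile of degree `d`: it vanishes to order `2d + 1` at the origin, and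
`u ~ y^{2d-1} (α log y + β)` at infinity. -/
def Prof (d : ℕ) (u : ℝ → ℝ) (α β : ℝ) : Prop := ZeroOrd (2 * d + 1) u ∧ Expn (2 * d - 1) u α β

theorem IsExt.exists_inverse (h : IsExt g Q q) (d : ℕ) (hd : 1 ≤ d) : ∃ κ κ' : ℝ,
    ∀ φ : ℝ → ℝ, ∀ α β : ℝ, Prof d φ α β → ∃ ψ : ℝ → ℝ, Prof (d + 1) ψ (κ * α) (κ * β + κ' * α) ∧
      ∀ y, 0 < y → opH g Q ψ y = φ y := by
  obtain ⟨κ, κ', H⟩ := h.invProf_expn (2 * d - 1) (by omega)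
  refine ⟨κ, κ', fun φ α β hφ => ?_⟩
  obtain ⟨⟨v, hv, hve, hφv⟩, hE⟩ := hφ
  obtain ⟨v', hv', hve', hvv'⟩ := h.invProf_even_smooth hv hve d
  have hs : Smooth fun y => y ^ (2 * d) * v y := by fun_prop
  have e : ∀ y, y * (y ^ (2 * d) * v y) = φ y := fun y => by rw [hφv]; ring
  refine ⟨fun y => y * invProf q (fun y => y ^ (2 * d) * v y) y, ⟨⟨v', hv', hve', fun y => ?_⟩, ?_⟩,
    fun y hy => ?_⟩
  · beta_reduce; rw [hvv']; ring
  · have := H _ hs α β (by simpa only [e] using hE)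
    push_cast
    convert this using 1
    ring
  · rw [h.opH_invProf hs hy, e]

/-- `(-1)^i T_i / y`. -/
noncomputable def profV (q : ℝ → ℝ) : ℕ → ℝ → ℝ
  | 0 => deriv q
  | i + 1 => invProf q (profV q i)

theorem opH_const_mul (u : ℝ → ℝ) (c : ℝ) {y : ℝ} (hu : SmoothAt u y) :
    opH g Q (fun y => c * u y) y = c * opH g Q u y := by
  have e : deriv (fun y => c * u y) =ᶠ[𝓝 y] fun y => c * deriv u y := by
    filter_upwards [eventually_differentiableAt hu] with x hx using deriv_const_mul c hx
  unfold opH lap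
  rw [e.deriv_eq, e.eq_of_nhds, deriv_const_mul c ((contDiffAt_deriv hu).differentiableAt (by simp))]
  ring

theorem opH_add {u v : ℝ → ℝ} {y : ℝ} (hu : SmoothAt u y) (hv : SmoothAt v y) :
    opH g Q (fun y => u y + v y) y = opH g Q u y + opH g Q v y := by
  have e : deriv (fun y => u y + v y) =ᶠ[𝓝 y] fun y => deriv u y + deriv v y := by
    filter_upwards [eventually_differentiableAt hu, eventually_differentiableAt hv] with x hx hx'
      using deriv_fun_add hx hx'
  unfold opH lap
  rw [e.deriv_eq, e.eq_of_nhds, deriv_fun_add ((contDiffAt_deriv hu).differentiableAt (by simp))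
    ((contDiffAt_deriv hv).differentiableAt (by simp))]
  ring

theorem opH_zero (y : ℝ) : opH g Q (fun _ => 0) y = 0 := by simp [opH, lap]

theorem opH_sum {ι : Type*} (s : Finset ι) {u : ι → ℝ → ℝ} {y : ℝ}
    (hu : ∀ i ∈ s, SmoothAt (u i) y) :
    opH g Q (fun y => ∑ i ∈ s, u i y) y = ∑ i ∈ s, opH g Q (u i) y := by
  classical
  induction s using Finset.induction_on with
  | empty => simp [opH_zero]
  | insert a s ha ih =>
    simp only [sum_insert ha]
    rw [opH_add (hu a (mem_insert_self _ _))
      (ContDiffAt.sum fun i hi => hu i (mem_insert_of_mem hi)),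
      ih fun i hi => hu i (mem_insert_of_mem hi)]

theorem opH_congr {u v : ℝ → ℝ} {y : ℝ} (h : u =ᶠ[𝓝 y] v) : opH g Q u y = opH g Q v y := by
  unfold opH lap
  rw [h.deriv.deriv_eq, h.deriv_eq, h.eq_of_nhds]

namespace IsExt
variable (h : IsExt g Q q)
include h

theorem profV_zeroOrd (i : ℕ) : ∃ v : ℝ → ℝ, Smooth v ∧ (∀ y, v (-y) = v y) ∧
    ∀ y, profV q i y = y ^ (2 * i) * v y := by
  induction i with
  | zero => exact ⟨deriv q, h.contDiff_deriv, deriv_odd h.odd, fun y => by simp [profV]⟩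
  | succ i ih =>
    obtain ⟨v, hv, he, hvv⟩ := ih
    obtain ⟨v', hv', hve', hvv'⟩ := h.invProf_even_smooth hv he i
    refine ⟨v', hv', hve', fun y => ?_⟩
    rw [profV, show profV q i = fun y => y ^ (2 * i) * v y from funext hvv, hvv']; ring

theorem contDiff_profV (i : ℕ) : Smooth (profV q i) := by
  obtain ⟨v, hv, -, hvv⟩ := h.profV_zeroOrd i
  rw [funext hvv]; fun_prop

theorem iterate_invH (i : ℕ) : ∀ y, 0 ≤ y → ((invH Q)^[i] (scal Q)) y = y * profV q i y := by
  induction i with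
  | zero => exact fun y hy => h.scal_eq hy
  | succ i ih =>
    intro y hy
    rw [Function.iterate_succ_apply', h.invH_eq (h.contDiff_profV i) ih hy]; rfl

theorem profT_eq (i : ℕ) {y : ℝ} (hy : 0 ≤ y) : profT Q i y = (-1) ^ i * (y * profV q i y) := by
  rw [profT, h.iterate_invH i y hy]

theorem profV_prof (i : ℕ) (hi : 1 ≤ i) : ∃ α β, Prof i (fun y => (-1) ^ i * (y * profV q i y)) α β := by
  have hE : ∃ α β, Expn (2 * i - 1) (fun y => y * profV q i y) α β := by
    induction i, hi using Nat.le_induction with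
    | base => simpa [profV] using h.invProf_expn_base
    | succ i hi ih =>
      obtain ⟨α, β, hE⟩ := ih
      obtain ⟨κ, κ', H⟩ := h.invProf_expn (2 * i - 1) (by omega)
      have := H _ (h.contDiff_profV i) α β hE
      refine ⟨κ * α, κ * β + κ' * α, ?_⟩
      rw [show 2 * ((i + 1 : ℕ) : ℤ) - 1 = 2 * i - 1 + 2 by push_cast; ring]; exact this
  obtain ⟨α, β, hE⟩ := hE
  refine ⟨_, _, ?_, hE.const_mul ((-1) ^ i)⟩
  obtain ⟨v, hv, he, hvv⟩ := h.profV_zeroOrd i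
  refine ZeroOrd.const_mul ⟨v, hv, he, fun y => by beta_reduce; rw [hvv]; ring⟩ _

theorem opH_profT (i : ℕ) {y : ℝ} (hy : 0 < y) :
    opH g Q (fun y => (-1) ^ (i + 1) * (y * profV q (i + 1) y)) y
      = -((-1) ^ i * (y * profV q i y)) := by
  have hs := h.contDiff_profV (i + 1)
  rw [opH_const_mul _ _ (by fun_prop), profV, h.opH_invProf (h.contDiff_profV i) hy, pow_succ]; ring

end IsExt

end


/-! ### Coefficients depending on `b₁` -/

/-- Smooth functions on `(0, ∞)` which are symbols of size `w` on `(0, b0)`. -/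
def CoefS (b0 : ℝ) (w h : ℝ → ℝ) : Prop := (∀ b, 0 < b → SmoothAt h b) ∧
  SymOn (P := Unit) {z | z.2 ∈ Ioo 0 b0} (fun _ => w) (fun _ => h)

/-- The size `|log b|^{-n}`. -/
noncomputable def logw (n : ℕ) (b : ℝ) : ℝ := |log b|⁻¹ ^ n

section
variable {b0 : ℝ} {w w' h k : ℝ → ℝ}

theorem one_le_abs_log (hb0 : b0 ≤ 1 / 16) {b : ℝ} (hb : b ∈ Ioo 0 b0) : 1 ≤ |log b| := by
  have h1 : b < Real.exp (-1) := by
    have : (1 : ℝ) / 16 ≤ Real.exp (-1) := by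
      rw [Real.exp_neg, one_div]
      exact inv_anti₀ (Real.exp_pos 1) (by linarith [Real.exp_one_lt_d9])
    linarith [hb.2]
  have := (Real.log_lt_iff_lt_exp hb.1).mpr h1
  rw [abs_of_neg (by linarith)]; linarith

theorem logw_nonneg (n : ℕ) (b : ℝ) : 0 ≤ logw n b := by unfold logw; positivity

theorem logw_le (hb0 : b0 ≤ 1 / 16) {b : ℝ} (hb : b ∈ Ioo 0 b0) {m n : ℕ} (hmn : m ≤ n) :
    logw n b ≤ logw m b :=
  pow_le_pow_of_le_one (by positivity) (inv_le_one_of_one_le₀ (one_le_abs_log hb0 hb)) hmn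

theorem logw_zero (b : ℝ) : logw 0 b = 1 := pow_zero _

theorem logw_mul (m n : ℕ) (b : ℝ) : logw m b * logw n b = logw (m + n) b := (pow_add _ _ _).symm

theorem CoefS.congr (hh : CoefS b0 w h) (he : ∀ b, 0 < b → h b = k b) : CoefS b0 w k :=
  have he' : ∀ b, 0 < b → h =ᶠ[𝓝 b] k := fun b hb => by
    filter_upwards [lt_mem_nhds hb] with x hx using he x hx
  ⟨fun b hb => (hh.1 b hb).congr_of_eventuallyEq (he' b hb).symm,
    hh.2.congr fun z hz => he' z.2 hz.1⟩

theorem CoefS.of_le (hh : CoefS b0 w h) (hw : ∀ b ∈ Ioo 0 b0, w b ≤ w' b) : CoefS b0 w' h :=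
  ⟨hh.1, hh.2.of_le fun z hz => hw z.2 hz⟩

theorem CoefS.log_of_le (hb0 : b0 ≤ 1 / 16) {m n : ℕ} (hh : CoefS b0 (logw n) h) (hmn : m ≤ n) :
    CoefS b0 (logw m) h := hh.of_le fun _ hb => logw_le hb0 hb hmn

theorem CoefS.add (hh : CoefS b0 w h) (hk : CoefS b0 w k) : CoefS b0 w fun b => h b + k b :=
  ⟨fun b hb => (hh.1 b hb).add (hk.1 b hb), hh.2.add hk.2⟩

theorem CoefS.mul (hh : CoefS b0 w h) (hk : CoefS b0 w' k) :
    CoefS b0 (fun b => w b * w' b) fun b => h b * k b :=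
  ⟨fun b hb => (hh.1 b hb).mul (hk.1 b hb), hh.2.mul hk.2⟩

theorem CoefS.log_mul {m n : ℕ} (hh : CoefS b0 (logw m) h) (hk : CoefS b0 (logw n) k) :
    CoefS b0 (logw (m + n)) fun b => h b * k b := by
  have := hh.mul hk
  simpa only [logw_mul] using this

theorem CoefS.const_mul (hh : CoefS b0 w h) (c : ℝ) : CoefS b0 w fun b => c * h b :=
  ⟨fun b hb => contDiffAt_const.mul (hh.1 b hb), hh.2.const_mul c⟩

theorem CoefS.const (c : ℝ) : CoefS b0 (logw 0) fun _ => c := ⟨fun _ _ => contDiffAt_const,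
    (SymTo.const c fun z hz => hz.1).congr_weight fun z _ => (logw_zero _).symm⟩

theorem CoefS.zero (n : ℕ) : CoefS b0 (logw n) fun _ => 0 :=
  ⟨fun _ _ => contDiffAt_const, SymTo.zero (fun _ hz => hz.1) fun _ _ => logw_nonneg _ _⟩

theorem CoefS.scal (hh : CoefS b0 w h) : CoefS b0 w (scal h) :=
  ⟨fun b hb => contDiffAt_id.mul (contDiffAt_deriv (hh.1 b hb)),
    ((SymTo.id hh.2.pos).mul hh.2.deriv).congr_weight fun z hz => by
      have := (hz.1 : 0 < z.2).ne'
      field_simp⟩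

theorem scal_mul_eq {b : ℝ} (hh : SmoothAt h b) (hk : SmoothAt k b) :
    scal (fun b => h b * k b) b = scal h b * k b + h b * scal k b := by
  simp only [HarmonicHeatFlow.scal]
  rw [deriv_fun_mul (hh.differentiableAt (by simp)) (hk.differentiableAt (by simp))]; ring

theorem scal_add_eq {b : ℝ} (hh : SmoothAt h b) (hk : SmoothAt k b) :
    scal (fun b => h b + k b) b = scal h b + scal k b := by
  simp only [HarmonicHeatFlow.scal]
  rw [deriv_fun_add (hh.differentiableAt (by simp)) (hk.differentiableAt (by simp))]; ring

theorem scal_const_mul_eq {b : ℝ} (c : ℝ) (hh : SmoothAt h b) :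
    scal (fun b => c * h b) b = c * scal h b := by
  simp only [HarmonicHeatFlow.scal]
  rw [deriv_const_mul c (hh.differentiableAt (by simp))]; ring

/-- Bounded coefficients, whose derivatives gain `|log b|^{-2}`. -/
def Coef (b0 : ℝ) (h : ℝ → ℝ) : Prop := CoefS b0 (logw 0) h ∧ CoefS b0 (logw 2) (scal h)

theorem Coef.const (c : ℝ) : Coef b0 fun _ => c :=
  ⟨CoefS.const c, (CoefS.zero 2).congr fun b _ => by simp [HarmonicHeatFlow.scal]⟩

theorem Coef.add (hh : Coef b0 h) (hk : Coef b0 k) : Coef b0 fun b => h b + k b :=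
  ⟨hh.1.add hk.1, (hh.2.add hk.2).congr fun b hb => (scal_add_eq (hh.1.1 b hb) (hk.1.1 b hb)).symm⟩

theorem Coef.mul (hh : Coef b0 h) (hk : Coef b0 k) : Coef b0 fun b => h b * k b :=
  ⟨hh.1.log_mul hk.1, ((hh.2.log_mul hk.1).add (hh.1.log_mul hk.2)).congr fun b hb =>
    (scal_mul_eq (hh.1.1 b hb) (hk.1.1 b hb)).symm⟩

theorem Coef.const_mul (hh : Coef b0 h) (c : ℝ) : Coef b0 fun b => c * h b := (Coef.const c).mul hh

theorem Coef.scal (hb0 : b0 ≤ 1 / 16) (hh : Coef b0 h) : Coef b0 (scal h) :=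
  ⟨hh.2.log_of_le hb0 (by omega), hh.2.scal⟩

/-- Leading coefficients: `p log y + q = O((1 + |log (√b y)|) / |log b|)`. -/
structure Good (b0 : ℝ) (p q : ℝ → ℝ) : Prop where
  p_small : CoefS b0 (logw 1) p
  p_scal : CoefS b0 (logw 2) (scal p)
  q_coef : Coef b0 q
  balance : ∃ C, 0 ≤ C ∧ ∀ b ∈ Ioo 0 b0, |q b + p b * (|log b| / 2)| ≤ C * logw 1 b

theorem Good.zero : Good b0 (fun _ => 0) (fun _ => 0) :=
  ⟨CoefS.zero 1, (CoefS.zero 2).congr fun b _ => by simp [HarmonicHeatFlow.scal], Coef.const 0,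
    ⟨0, le_rfl, fun b _ => by simp⟩⟩

theorem Good.congr {p q p' q' : ℝ → ℝ} (hg : Good b0 p q) (hp : ∀ b, 0 < b → p b = p' b)
    (hq : ∀ b, 0 < b → q b = q' b) : Good b0 p' q' := by
  have hs : ∀ {u v : ℝ → ℝ}, (∀ b, 0 < b → u b = v b) → ∀ b, 0 < b →
      HarmonicHeatFlow.scal u b = HarmonicHeatFlow.scal v b := fun {u v} huv b hb => by
    have : u =ᶠ[𝓝 b] v := by filter_upwards [lt_mem_nhds hb] with x hx using huv x hx
    simp only [HarmonicHeatFlow.scal, this.deriv_eq]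
  obtain ⟨C, hC, hb⟩ := hg.balance
  exact ⟨hg.p_small.congr hp, hg.p_scal.congr (hs hp),
    ⟨hg.q_coef.1.congr hq, hg.q_coef.2.congr (hs hq)⟩,
    ⟨C, hC, fun b hb' => by rw [← hq b hb'.1, ← hp b hb'.1]; exact hb b hb'⟩⟩

theorem Good.add {p q p' q' : ℝ → ℝ} (hg : Good b0 p q) (hg' : Good b0 p' q') :
    Good b0 (fun b => p b + p' b) (fun b => q b + q' b) := by
  obtain ⟨C, hC, hb⟩ := hg.balance
  obtain ⟨C', hC', hb'⟩ := hg'.balance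
  refine ⟨hg.p_small.add hg'.p_small, (hg.p_scal.add hg'.p_scal).congr fun b hb =>
    (scal_add_eq (hg.p_small.1 b hb) (hg'.p_small.1 b hb)).symm, hg.q_coef.add hg'.q_coef,
    ⟨C + C', by positivity, fun b hbb => ?_⟩⟩
  have e : q b + q' b + (p b + p' b) * (|log b| / 2)
    = (q b + p b * (|log b| / 2)) + (q' b + p' b * (|log b| / 2)) := by ring
  rw [e, add_mul]; exact (abs_add_le _ _).trans (add_le_add (hb b hbb) (hb' b hbb))

theorem Good.mul (hb0 : b0 ≤ 1 / 16) {p q : ℝ → ℝ} (hh : Coef b0 h) (hg : Good b0 p q) :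
    Good b0 (fun b => h b * p b) (fun b => h b * q b) := by
  obtain ⟨C, hC, hb⟩ := hg.balance
  obtain ⟨C', hC', hb'⟩ := hh.1.2.bound_zero
  have h1 := hh.1.log_mul hg.p_small
  have h2 := (hh.1.log_mul hg.p_scal)
  have h3 := (hh.2.log_mul hg.p_small).log_of_le hb0 (m := 2) (by omega)
  refine ⟨by simpa using h1, by
    have := h3.add (by simpa using h2)
    exact this.congr fun b hb => (scal_mul_eq (hh.1.1 b hb) (hg.p_small.1 b hb)).symm,
    hh.mul hg.q_coef, ⟨C' * C, by positivity, fun b hbb => ?_⟩⟩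
  have e : h b * q b + h b * p b * (|log b| / 2) = h b * (q b + p b * (|log b| / 2)) := by ring
  rw [e, abs_mul, mul_assoc]
  have := hb' ((), b) hbb
  simp only [logw_zero, mul_one] at this; exact mul_le_mul this (hb b hbb) (abs_nonneg _) hC'

theorem Good.scal (hb0 : b0 ≤ 1 / 16) {p q : ℝ → ℝ} (hg : Good b0 p q) :
    Good b0 (scal p) (scal q) := by
  obtain ⟨C, hC, hb⟩ := hg.p_scal.2.bound_zero
  obtain ⟨C', hC', hb'⟩ := hg.q_coef.2.2.bound_zero
  refine ⟨hg.p_scal.log_of_le hb0 (by omega), hg.p_scal.scal, hg.q_coef.scal hb0,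
    ⟨C' + C / 2, by positivity, fun b hbb => ?_⟩⟩
  have hL := one_le_abs_log hb0 hbb
  have h1 := hb ((), b) hbb
  have h2 := hb' ((), b) hbb
  have h3 := logw_le hb0 hbb (show 1 ≤ 2 by omega)
  have hne : |log b| ≠ 0 := by positivity
  have h4 : logw 2 b * |log b| = logw 1 b := by unfold logw; field_simp
  calc |HarmonicHeatFlow.scal q b + HarmonicHeatFlow.scal p b * (|log b| / 2)|
      ≤ |HarmonicHeatFlow.scal q b| + |HarmonicHeatFlow.scal p b * (|log b| / 2)| := abs_add_le _ _
    _ ≤ C' * logw 1 b + C * logw 2 b * (|log b| / 2) := by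
        rw [abs_mul, abs_of_nonneg (by positivity : 0 ≤ |log b| / 2)]
        exact add_le_add (h2.trans (mul_le_mul_of_nonneg_left h3 hC'))
          (mul_le_mul_of_nonneg_right h1 (by positivity))
    _ = _ := by rw [add_mul, ← h4]; ring

theorem Good.of_small (hb0 : b0 ≤ 1 / 16) {p : ℝ → ℝ} (h1 : CoefS b0 (logw 1) p)
    (h2 : CoefS b0 (logw 2) (HarmonicHeatFlow.scal p)) : Good b0 (fun _ => 0) p := by
  obtain ⟨C, hC, hb⟩ := h1.2.bound_zero
  exact ⟨Good.zero.p_small, Good.zero.p_scal, ⟨h1.log_of_le hb0 (by omega), h2⟩,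
    ⟨C, hC, fun b hbb => by simpa using hb ((), b) hbb⟩⟩

theorem Good.lin (hb0 : b0 ≤ 1 / 16) {p q : ℝ → ℝ} (hg : Good b0 p q) (κ κ' : ℝ) :
    Good b0 (fun b => κ * p b) (fun b => κ * q b + κ' * p b) := by
  have h1 := Good.of_small hb0 (hg.p_small.const_mul κ') ((hg.p_scal.const_mul κ').congr
    fun b hb => (scal_const_mul_eq κ' (hg.p_small.1 b hb)).symm)
  have h2 := (Good.mul hb0 (Coef.const κ) hg).add h1
  exact h2.congr (fun b _ => by simp) (fun b _ => rfl)

end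

/-! ### The constant `c_{b₁}` -/

section
variable {g Q q χ : ℝ → ℝ}

theorem scal_avg {ψ m : ℝ → ℝ} (hψ : Continuous ψ) (hm : Smooth m) (y : ℝ) :
    y * deriv (avg ψ m) y = avg ψ (fun x => x * deriv m x) y := by
  rw [(hasDerivAt_avg hψ hm y).deriv, avg, avg, ← intervalIntegral.integral_const_mul]
  congr 1; funext t; ring

/-- The cut off average of the mass. -/
noncomputable def cutMass (q χ : ℝ → ℝ) (b : ℝ) : ℝ :=
  avg (fun t => -2 * deriv χ (2 * t)) (mass q) (2 * √b)⁻¹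

theorem hasDerivAt_inv_sqrt {b : ℝ} (hb : 0 < b) :
    HasDerivAt (fun b => (2 * √b)⁻¹) (-(1 / 2) * (2 * √b)⁻¹ / b) b := by
  have h1 := ((Real.hasDerivAt_sqrt hb.ne').const_mul 2).fun_inv (by positivity)
  refine h1.congr_deriv ?_
  have hs : 0 < √b := sqrt_pos.mpr hb
  have h2 : b = √b * √b := (Real.mul_self_sqrt hb.le).symm
  rw [div_eq_div_iff (by positivity) hb.ne']
  nth_rewrite 2 [h2]
  field_simp

theorem contDiffAt_avg_inv_sqrt {ψ m : ℝ → ℝ} (hψ : Continuous ψ) (hm : Smooth m) {b : ℝ}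
    (hb : 0 < b) : SmoothAt (fun b => avg ψ m (2 * √b)⁻¹) b := by
  have hs : 0 < √b := sqrt_pos.mpr hb
  have h1 : SmoothAt (fun b => (2 * √b)⁻¹) b :=
    (contDiffAt_const.mul (Real.contDiffAt_sqrt hb.ne')).inv (by positivity)
  exact (contDiff_avg hψ hm).contDiffAt.comp b h1

theorem scal_avg_inv_sqrt {ψ m : ℝ → ℝ} (hψ : Continuous ψ) (hm : Smooth m) {b : ℝ}
    (hb : 0 < b) : b * deriv (fun b => avg ψ m (2 * √b)⁻¹) b
      = avg ψ (fun x => -(1 / 2) * (x * deriv m x)) (2 * √b)⁻¹ := by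
  have h1 := ((contDiff_avg hψ hm).differentiable (by simp) (2 * √b)⁻¹).hasDerivAt.comp b
    (hasDerivAt_inv_sqrt hb)
  rw [show (fun b => avg ψ m (2 * √b)⁻¹) = avg ψ m ∘ fun b => (2 * √b)⁻¹ from rfl, h1.deriv]
  have h2 := scal_avg hψ hm (2 * √b)⁻¹
  have h3 : avg ψ (fun x => -(1 / 2) * (x * deriv m x)) (2 * √b)⁻¹
      = -(1 / 2) * avg ψ (fun x => x * deriv m x) (2 * √b)⁻¹ := by
    rw [avg, avg, ← intervalIntegral.integral_const_mul]
    congr 1; funext t; ring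
  rw [h3, ← h2]; field_simp

namespace IsCutoff
variable (hχ : IsCutoff χ)
include hχ

theorem contDiff_deriv : Smooth (deriv χ) := (contDiff_infty_iff_deriv.mp hχ.smooth).2

theorem deriv_eq_zero_of_lt {y : ℝ} (hy : y < 1) : deriv χ y = 0 := by
  have : χ =ᶠ[𝓝 y] fun _ => 1 := by
    filter_upwards [gt_mem_nhds hy] with x hx using hχ.eq_one x (le_of_lt hx)
  rw [this.deriv_eq]; simp

theorem deriv_nonpos (y : ℝ) : deriv χ y ≤ 0 := hχ.antitone.deriv_nonpos

theorem continuous_weight : Continuous fun t => -2 * deriv χ (2 * t) := by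
  have := hχ.contDiff_deriv.continuous
  fun_prop

theorem weight_nonneg (t : ℝ) : 0 ≤ -2 * deriv χ (2 * t) := by
  have := hχ.deriv_nonpos (2 * t); linarith

theorem weight_eq_zero {t : ℝ} (ht : t < 1 / 2) : -2 * deriv χ (2 * t) = 0 := by
  rw [hχ.deriv_eq_zero_of_lt (by linarith)]; simp

theorem integral_weight : (∫ t in (0 : ℝ)..1, -2 * deriv χ (2 * t)) = 1 := by
  have h1 : ∀ t ∈ uIcc (0 : ℝ) 1, HasDerivAt (fun t => -χ (2 * t)) (-2 * deriv χ (2 * t)) t := by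
    intro t _
    have h2 : HasDerivAt (fun t : ℝ => 2 * t) 2 t := by simpa using (hasDerivAt_id t).const_mul 2
    refine ((hχ.smooth.differentiable (by simp) (2 * t)).hasDerivAt.comp t h2).neg.congr_deriv ?_
    ring
  rw [intervalIntegral.integral_eq_sub_of_hasDerivAt h1
    (hχ.continuous_weight.intervalIntegrable _ _)]
  simp [hχ.eq_one 0 (by norm_num), hχ.eq_zero 2 le_rfl]

end IsCutoff

theorem abs_avg_le {ψ m : ℝ → ℝ} {C y : ℝ} (hψ : Continuous ψ) (hψ0 : ∀ t, 0 ≤ ψ t)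
    (hψ1 : ∀ t, t < 1 / 2 → ψ t = 0) (hint : (∫ t in (0 : ℝ)..1, ψ t) = 1)
    (hC : ∀ t ∈ Icc (1 / 2 : ℝ) 1, |m (t * y)| ≤ C) : |avg ψ m y| ≤ C := by
  have hb : ‖∫ t in (0 : ℝ)..1, ψ t * m (t * y)‖ ≤ ∫ t in (0 : ℝ)..1, C * ψ t := by
    refine intervalIntegral.norm_integral_le_of_norm_le zero_le_one (Eventually.of_forall
      fun t ht => ?_) ((continuous_const.mul hψ).intervalIntegrable _ _)
    rw [norm_eq_abs, abs_mul, abs_of_nonneg (hψ0 t), mul_comm]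
    rcases lt_or_ge t (1 / 2) with h | h
    · simp [hψ1 t h]
    · exact mul_le_mul_of_nonneg_right (hC t ⟨h, ht.2⟩) (hψ0 t)
  rwa [intervalIntegral.integral_const_mul, hint, mul_one, norm_eq_abs] at hb

theorem one_le_half_inv_sqrt {b t : ℝ} (hb : b ∈ Ioc (0 : ℝ) (1 / 16)) (ht : 1 / 2 ≤ t) :
    1 ≤ t * (2 * √b)⁻¹ := by
  have hs : 0 < √b := sqrt_pos.mpr hb.1
  have h4 : √b ≤ 1 / 4 := Real.sqrt_le_iff.mpr ⟨by norm_num, by linarith [hb.2]⟩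
  rw [← div_eq_mul_inv, le_div_iff₀ (by positivity)]; nlinarith

namespace IsExt
variable (h : IsExt g Q q) (hχ : IsCutoff χ)
include h hχ

theorem mass_pos {y : ℝ} (hy : 0 < y) : 0 < mass q y := by
  refine mul_pos (by positivity) ?_
  have hc := h.contDiff_deriv.continuous
  refine intervalIntegral.intervalIntegral_pos_of_pos_on
    (Continuous.intervalIntegrable (by fun_prop) _ _) (fun t ht => ?_) one_pos
  have := h.deriv_pos (t * y)
  have := ht.1
  positivity

theorem cutMass_pos {b : ℝ} (hb : 0 < b) : 0 < cutMass q χ b := by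
  set y := (2 * √b)⁻¹
  have hy : 0 < y := by have := sqrt_pos.mpr hb; positivity
  have hm := h.contDiff_mass.continuous
  have hψ := hχ.continuous_weight
  obtain ⟨x, hx, hmin⟩ := (isCompact_Icc (a := (1 / 2 : ℝ)) (b := 1)).exists_isMinOn
    ⟨1, by norm_num, le_rfl⟩ (f := fun t => mass q (t * y)) (by fun_prop)
  have hx0 : 0 < mass q (x * y) := h.mass_pos hχ (mul_pos (by linarith [hx.1]) hy)
  have : mass q (x * y) * 1 ≤ cutMass q χ b := by
    rw [← hχ.integral_weight, ← intervalIntegral.integral_const_mul]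
    refine intervalIntegral.integral_mono_on zero_le_one
      (Continuous.intervalIntegrable (by fun_prop) _ _)
      (Continuous.intervalIntegrable (by fun_prop) _ _) fun t ht => ?_
    rw [mul_comm]
    rcases lt_or_ge t (1 / 2) with h' | h'
    · simp [hχ.weight_eq_zero h']
    · exact mul_le_mul_of_nonneg_left (hmin ⟨h', ht.2⟩) (hχ.weight_nonneg t)
  linarith

theorem cb_eq {b : ℝ} (hb : 0 < b) : cb Q χ b = 4 * (cutMass q χ b)⁻¹ := by
  have hs : 0 < √b := sqrt_pos.mpr hb
  set R := B0 b / 4 with hR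
  have hR0 : 0 < R := by simp only [hR, B0]; positivity
  have hR2 : (2 * √b)⁻¹ = 2 * R := by simp only [hR, B0]; field_simp; norm_num
  have hχs := hχ.smooth
  have hχc := hχ.smooth.continuous
  have hχd := hχ.contDiff_deriv.continuous
  have hmc := h.contDiff_mass.continuous
  have hac := h.contDiff_deriv.continuous
  rw [cb, div_eq_mul_inv]
  congr 2
  have e1 : ∫ y in Ioi (0 : ℝ), χ (y / R) * scal Q y ^ 2 * y
      = ∫ y in (0 : ℝ)..2 * R, χ (y / R) * (y * deriv q y) ^ 2 * y := by
    rw [intervalIntegral.integral_of_le (by positivity)]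
    rw [setIntegral_eq_of_subset_of_forall_diff_eq_zero (s := Ioc 0 (2 * R)) (t := Ioi 0)
      measurableSet_Ioi (fun x hx => hx.1)]
    · refine setIntegral_congr_fun measurableSet_Ioc fun y hy => ?_
      simp only [h.scal_eq hy.1.le]
    · intro y hy
      have h1 : 2 * R < y := by by_contra hc; exact hy.2 ⟨hy.1, not_lt.mp hc⟩
      rw [hχ.eq_zero _ ((le_div_iff₀ hR0).mpr h1.le)]; simp
  have hd1 : ∀ y ∈ uIcc 0 (2 * R), HasDerivAt (fun y => χ (y / R)) (deriv χ (y / R) / R) y := by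
    intro y _
    have h1 : HasDerivAt (fun y : ℝ => y / R) (1 / R) y := (hasDerivAt_id y).div_const R
    refine ((hχs.differentiable (by simp) (y / R)).hasDerivAt.comp y h1).congr_deriv ?_
    ring
  have hd2 : ∀ y ∈ uIcc 0 (2 * R), HasDerivAt (mass q) (y * (y * deriv q y) ^ 2) y := by
    intro y _
    refine (hasDerivAt_pow_mul_avg (h.contDiff_deriv.mul h.contDiff_deriv).continuous 3
      y).congr_deriv ?_
    ring
  have e2 := intervalIntegral.integral_mul_deriv_eq_deriv_mul hd1 hd2
    (Continuous.intervalIntegrable (by fun_prop) _ _)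
    (Continuous.intervalIntegrable (by fun_prop) _ _)
  have e3 : χ (2 * R / R) = 0 := by rw [mul_div_cancel_right₀ _ hR0.ne']; exact hχ.eq_zero 2 le_rfl
  have e4 : mass q 0 = 0 := by simp [mass]
  rw [e3, e4] at e2
  have e5 := intervalIntegral.smul_integral_comp_mul_right (a := 0) (b := 1)
    (fun y => deriv χ (y / R) / R * mass q y) (2 * R)
  rw [zero_mul, one_mul] at e5
  rw [e1, cutMass, hR2, avg]
  have e6 : (∫ y in (0 : ℝ)..2 * R, χ (y / R) * (y * deriv q y) ^ 2 * y)
      = ∫ y in (0 : ℝ)..2 * R, χ (y / R) * (y * (y * deriv q y) ^ 2) := by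
    congr 1; funext y; ring
  rw [e6, e2, ← e5, smul_eq_mul, ← intervalIntegral.integral_const_mul]
  rw [zero_mul, mul_zero, sub_zero, zero_sub, ← intervalIntegral.integral_neg]
  congr 1; funext t
  rw [show t * (2 * R) / R = 2 * t by field_simp]; field_simp

theorem exists_cutMass_bound : ∃ C, 0 ≤ C ∧ ∀ b ∈ Ioc (0 : ℝ) (1 / 16),
    abs (cutMass q χ b - 2 * abs (log b)) ≤ C := by
  obtain ⟨β, hβ⟩ := h.symOn_mass
  obtain ⟨C, hC, hb⟩ := hβ.bound_zero
  refine ⟨C + |β| + 8 * log 2, by have := Real.log_pos one_lt_two; positivity, fun b hbb => ?_⟩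
  have hs : 0 < √b := sqrt_pos.mpr hbb.1
  set y := (2 * √b)⁻¹ with hy
  have hy0 : 0 < y := by positivity
  have hψ := hχ.continuous_weight
  have hmc := h.contDiff_mass.continuous
  have hl : 2 * |log b| = 4 * log y + 4 * log 2 := by
    rw [abs_of_neg (Real.log_neg hbb.1 (by linarith [hbb.2])), hy, log_inv,
      log_mul two_ne_zero hs.ne', log_sqrt hbb.1.le]
    ring
  have e : cutMass q χ b - 2 * |log b|
      = avg (fun t => -2 * deriv χ (2 * t)) (fun x => mass q x - 2 * |log b|) y := by
    rw [cutMass, avg, avg]; simp only [mul_sub]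
    rw [intervalIntegral.integral_sub (Continuous.intervalIntegrable (by fun_prop) _ _)
      (Continuous.intervalIntegrable (by fun_prop) _ _), intervalIntegral.integral_mul_const,
      hχ.integral_weight, one_mul]
  rw [e]
  refine abs_avg_le hψ hχ.weight_nonneg (fun t ht => hχ.weight_eq_zero ht) hχ.integral_weight
    fun t ht => ?_
  have h1 : 1 ≤ t * y := one_le_half_inv_sqrt hbb ht.1
  have ht0 : 0 < t := by linarith [ht.1]
  have h2 := hb ((), t * y) h1
  have h3 : (t * y) ^ (-2 : ℤ) ≤ 1 := zpow_le_one_of_nonpos₀ h1 (by norm_num)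
  have h4 : |log t| ≤ log 2 := by
    rw [abs_of_nonpos (log_nonpos ht0.le ht.2), ← log_inv]
    exact log_le_log (by positivity) (by rw [inv_le_comm₀ ht0 two_pos]; linarith [ht.1])
  simp only at h2
  rw [log_mul ht0.ne' hy0.ne'] at h2
  have h5 : |mass q (t * y) - 4 * (log t + log y) - β| ≤ C :=
    h2.trans (mul_le_of_le_one_right hC h3)
  rw [hl]
  have h6 := Real.log_pos one_lt_two
  rw [abs_le] at h4 h5 ⊢
  have h7 := abs_le.mp (le_refl |β|)
  constructor <;> linarith

end IsExt

/-- The facts on `c = c_{b₁}` which the construction uses. -/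
structure IsSpeed (b0 : ℝ) (c : ℝ → ℝ) : Prop where
  small : CoefS b0 (logw 1) c
  scal : CoefS b0 (logw 2) (scal c)
  balance : ∃ C, 0 ≤ C ∧ ∀ b ∈ Ioo 0 b0, |1 - c b * (|log b| / 2)| ≤ C * logw 1 b

theorem IsExt.exists_isSpeed (h : IsExt g Q q) (hχ : IsCutoff χ) :
    ∃ b0, 0 < b0 ∧ b0 ≤ 1 / 16 ∧ IsSpeed b0 (cb Q χ) := by
  obtain ⟨C, hC, hb⟩ := h.exists_cutMass_bound hχ
  set b0 := min (1 / 16) (Real.exp (-C)) with hb0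
  have hb00 : 0 < b0 := lt_min (by norm_num) (Real.exp_pos _)
  have hb16 : b0 ≤ 1 / 16 := min_le_left _ _
  refine ⟨b0, hb00, hb16, ?_⟩
  have hψ := hχ.continuous_weight
  set ψ : ℝ → ℝ := fun t => -2 * deriv χ (2 * t)
  have hm := h.contDiff_mass
  have hmem : ∀ b ∈ Ioo 0 b0, b ∈ Ioc (0 : ℝ) (1 / 16) := fun b hbb => ⟨hbb.1, hbb.2.le.trans hb16⟩
  have hlC : ∀ b ∈ Ioo 0 b0, C ≤ |log b| := fun b hbb => by
    have : log b < -C := (Real.log_lt_iff_lt_exp hbb.1).mpr (hbb.2.trans_le (min_le_right _ _))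
    exact (by linarith : C ≤ -log b).trans (neg_le_abs _)
  have hlow : ∀ b ∈ Ioo 0 b0, |log b| ≤ cutMass q χ b := fun b hbb => by
    have := (abs_le.mp (hb b (hmem b hbb))).1
    linarith [hlC b hbb]
  have hup : ∀ b ∈ Ioo 0 b0, cutMass q χ b ≤ 3 * |log b| := fun b hbb => by
    have := (abs_le.mp (hb b (hmem b hbb))).2
    linarith [hlC b hbb]
  have hIs : ∀ b, 0 < b → SmoothAt (cutMass q χ) b := fun b hb => contDiffAt_avg_inv_sqrt hψ hm hb
  -- bounded averages
  have hfam : ∀ m : ℝ → ℝ, Smooth m → SymOn (P := Unit) {z | 1 ≤ z.2} (fun _ _ => 1) (fun _ => m) →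
      CoefS b0 (logw 0) fun b => avg ψ m (2 * √b)⁻¹ := by
    intro m hm1 hm2
    refine ⟨fun b hb => contDiffAt_avg_inv_sqrt hψ hm1 hb, ?_⟩
    refine SymTo.of_scal_closed (ι := {m : ℝ → ℝ // Smooth m ∧
      SymOn (P := Unit) {z | 1 ≤ z.2} (fun _ _ => 1) (fun _ => m)})
      (fun m _ b => avg ψ m.1 (2 * √b)⁻¹)
      (fun m => ⟨fun x => -(1 / 2) * (x * deriv m.1 x), ?_, ?_⟩) (w := fun _ => logw 0)
      (D := {z | z.2 ∈ Ioo 0 b0}) (fun z hz => (hz : z.2 ∈ Ioo 0 b0).1)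
      (fun z _ => logw_nonneg _ _)
      (fun m z hz => contDiffAt_avg_inv_sqrt hψ m.2.1 (hz : z.2 ∈ Ioo 0 b0).1) ?_ ?_
      ⟨m, hm1, hm2⟩
    · have := (contDiff_infty_iff_deriv.mp m.2.1).2
      fun_prop
    · have := m.2.2
      refine (((SymTo.id this.pos).mul this.deriv).const_mul _).congr_weight fun z hz => ?_
      have : z.2 ≠ 0 := (mem_one_le hz).ne'
      field_simp
    · intro m
      obtain ⟨C, hC, hb⟩ := m.2.2.bound_zero
      refine ⟨C, hC, fun z hz => ?_⟩
      rw [logw_zero, mul_one]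
      refine abs_avg_le hψ hχ.weight_nonneg (fun t ht => hχ.weight_eq_zero ht) hχ.integral_weight
        fun t ht => ?_
      simpa using hb ((), t * (2 * √z.2)⁻¹) (one_le_half_inv_sqrt (hmem _ hz) ht.1)
    · intro m z hz
      filter_upwards [lt_mem_nhds (hz : z.2 ∈ Ioo 0 b0).1] with b hb using scal_avg_inv_sqrt hψ m.2.1 hb
  have hscal : CoefS b0 (logw 0) (HarmonicHeatFlow.scal (cutMass q χ)) := by
    have hmd := (contDiff_infty_iff_deriv.mp hm).2
    have h1 := hfam (fun x => -(1 / 2) * (x * deriv (mass q) x)) (by fun_prop) (by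
      have hD : ∀ z ∈ {z : Unit × ℝ | 1 ≤ z.2}, 0 < z.2 := fun z hz => mem_one_le hz
      have := ((((SymTo.zpow hD 1).mul (h.symOn_g (P := Unit) (D := {z | 1 ≤ z.2})
        (fun _ hz => hz))).pow 2).const_mul (-(1 / 2))).congr_weight (w' := fun _ _ => 1)
        fun z hz => by
          have := (mem_one_le hz).ne'
          rw [zpow_one, zpow_neg_one, mul_inv_cancel₀ this, one_pow]
      refine this.congr fun z hz => ?_
      filter_upwards [lt_mem_nhds (mem_one_le hz)] with y hy
      rw [(h.hasDerivAt_mass hy).deriv]; simp; ring)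
    exact h1.congr fun b hb => (scal_avg_inv_sqrt hψ hm hb).symm
  have hI : SymOn (P := Unit) {z | z.2 ∈ Ioo 0 b0} (fun _ b => |log b|) (fun _ => cutMass q χ) := by
    refine SymTo.of_deriv (fun z hz => hIs _ hz.1) ⟨3, by norm_num, fun z hz => ?_⟩
      (fun _ _ => abs_nonneg _) ?_
    · rw [abs_of_pos (h.cutMass_pos hχ hz.1)]; exact hup _ hz
    · have h1 := ((SymTo.zpow (P := Unit) (D := {z | z.2 ∈ Ioo 0 b0}) (fun z hz => hz.1) (-1)).mul
        hscal.2).of_le (w' := fun _ b => |log b| / b) fun z hz => by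
          have := one_le_abs_log hb16 hz
          have h0 : 0 < z.2 := hz.1
          rw [logw_zero, zpow_neg_one, mul_one, ← one_div]
          gcongr
      refine h1.congr fun z hz => ?_
      filter_upwards [lt_mem_nhds hz.1] with b hb
      have : b ≠ 0 := ne_of_gt hb
      simp only [HarmonicHeatFlow.scal, zpow_neg_one]; field_simp
  have hinv : CoefS b0 (logw 1) fun b => (cutMass q χ b)⁻¹ :=
    ⟨fun b hb => (hIs b hb).inv (h.cutMass_pos hχ hb).ne', (hI.inv one_pos
      (fun z hz => one_pos.trans_le (one_le_abs_log hb16 hz)) fun z hz => by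
        rw [one_mul]; exact (hlow _ hz).trans (le_abs_self _)).congr_weight fun z _ => by
          simp [logw]⟩
  have hcb : ∀ b, 0 < b → 4 * (cutMass q χ b)⁻¹ = cb Q χ b := fun b hb => (h.cb_eq hχ hb).symm
  have hc1 := (hinv.const_mul 4).congr hcb
  refine ⟨hc1, ?_, ⟨C, hC, fun b hbb => ?_⟩⟩
  · have h1 := (((hinv.log_mul hinv).log_mul hscal).const_mul (-4))
    refine h1.congr fun b hb => ?_
    have : cb Q χ =ᶠ[𝓝 b] fun b => 4 * (cutMass q χ b)⁻¹ := by
      filter_upwards [lt_mem_nhds hb] with x hx using h.cb_eq hχ hx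
    have hne := (h.cutMass_pos hχ hb).ne'
    simp only [HarmonicHeatFlow.scal]
    rw [this.deriv_eq, deriv_const_mul _ ((hinv.1 b hb).differentiableAt (by simp)),
      deriv_fun_inv'' ((hIs b hb).differentiableAt (by simp)) hne]
    field_simp
  · have hne := h.cutMass_pos hχ hbb.1
    have hl := one_le_abs_log hb16 hbb
    rw [h.cb_eq hχ hbb.1]
    have e : 1 - 4 * (cutMass q χ b)⁻¹ * (|log b| / 2)
        = (cutMass q χ b - 2 * |log b|) / cutMass q χ b := by field_simp; ring
    rw [e, abs_div, abs_of_pos hne, logw, pow_one, ← div_eq_mul_inv]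
    exact div_le_div₀ hC (hb b (hmem b hbb)) (by linarith) (hlow b hbb)

end


/-! ### Separated functions of `(b₁, y)` -/

/-- Finite sums `F = ∑ h(b) φ(y)` with `h` in the class `𝒞` and `φ` in the class `𝒬` with leading
coefficients `α, β`, together with the sums `p = ∑ h α`, `q = ∑ h β`. -/
inductive Sep (𝒞 : (ℝ → ℝ) → Prop) (𝒬 : (ℝ → ℝ) → ℝ → ℝ → Prop) :
    (ℝ → ℝ → ℝ) → (ℝ → ℝ) → (ℝ → ℝ) → Prop
  | zero : Sep 𝒞 𝒬 (fun _ _ => 0) (fun _ => 0) (fun _ => 0)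
  | term {h φ : ℝ → ℝ} {α β : ℝ} : 𝒞 h → 𝒬 φ α β →
      Sep 𝒞 𝒬 (fun b y => h b * φ y) (fun b => h b * α) (fun b => h b * β)
  | add {F G : ℝ → ℝ → ℝ} {p q p' q' : ℝ → ℝ} : Sep 𝒞 𝒬 F p q → Sep 𝒞 𝒬 G p' q' →
      Sep 𝒞 𝒬 (fun b y => F b y + G b y) (fun b => p b + p' b) (fun b => q b + q' b)
  | congr {F G : ℝ → ℝ → ℝ} {p q p' q' : ℝ → ℝ} : Sep 𝒞 𝒬 F p q →
      (∀ b, 0 < b → ∀ y, 0 ≤ y → F b y = G b y) → (∀ b, 0 < b → p b = p' b) →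
      (∀ b, 0 < b → q b = q' b) → Sep 𝒞 𝒬 G p' q'

theorem eventuallyEq_of_pos {u v : ℝ → ℝ} (h : ∀ b, 0 < b → u b = v b) {b : ℝ} (hb : 0 < b) :
    u =ᶠ[𝓝 b] v := by filter_upwards [lt_mem_nhds hb] with x hx using h x hx

theorem eventuallyEq_of_nonneg {u v : ℝ → ℝ} (h : ∀ y, 0 ≤ y → u y = v y) {y : ℝ} (hy : 0 < y) :
    u =ᶠ[𝓝 y] v := by filter_upwards [lt_mem_nhds hy] with x hx using h x (le_of_lt hx)

theorem scal_congr {u v : ℝ → ℝ} {b : ℝ} (h : u =ᶠ[𝓝 b] v) : scal u b = scal v b := by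
  simp only [scal, h.deriv_eq]

namespace Sep
variable {𝒞 𝒞' : (ℝ → ℝ) → Prop} {𝒬 𝒬' : (ℝ → ℝ) → ℝ → ℝ → Prop} {F G : ℝ → ℝ → ℝ} {p q : ℝ → ℝ}

theorem mono (hF : Sep 𝒞 𝒬 F p q) (h1 : ∀ h, 𝒞 h → 𝒞' h) (h2 : ∀ φ α β, 𝒬 φ α β → 𝒬' φ α β) :
    Sep 𝒞' 𝒬' F p q := by
  induction hF with
  | zero => exact zero
  | term hh hφ => exact term (h1 _ hh) (h2 _ _ _ hφ)
  | add _ _ ih ih' => exact ih.add ih'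
  | congr _ h h' h'' ih => exact ih.congr h h' h''

theorem coef_mul (hF : Sep 𝒞 𝒬 F p q) (k : ℝ → ℝ) (hk : ∀ h, 𝒞 h → 𝒞' fun b => k b * h b) :
    Sep 𝒞' 𝒬 (fun b y => k b * F b y) (fun b => k b * p b) (fun b => k b * q b) := by
  induction hF with
  | zero => simpa using zero (𝒞 := 𝒞') (𝒬 := 𝒬)
  | term hh hφ => simpa only [mul_assoc] using term (hk _ hh) hφ
  | add _ _ ih ih' => simpa only [mul_add] using ih.add ih'
  | congr _ h h' h'' ih =>
    exact ih.congr (fun b hb y hy => by rw [h b hb y hy]) (fun b hb => by rw [h' b hb])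
      fun b hb => by rw [h'' b hb]

theorem smooth_left (hF : Sep 𝒞 𝒬 F p q) (h1 : ∀ h, 𝒞 h → ∀ b, 0 < b → SmoothAt h b)
    {b : ℝ} (hb : 0 < b) : (∀ y, 0 ≤ y → SmoothAt (fun b => F b y) b) ∧
      SmoothAt p b ∧ SmoothAt q b := by
  induction hF with
  | zero => exact ⟨fun _ _ => contDiffAt_const, contDiffAt_const, contDiffAt_const⟩
  | term hh hφ =>
    exact ⟨fun y _ => (h1 _ hh b hb).mul contDiffAt_const, (h1 _ hh b hb).mul contDiffAt_const,
      (h1 _ hh b hb).mul contDiffAt_const⟩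
  | add _ _ ih ih' =>
    exact ⟨fun y hy => (ih.1 y hy).add (ih'.1 y hy), ih.2.1.add ih'.2.1, ih.2.2.add ih'.2.2⟩
  | congr _ h h' h'' ih =>
    exact ⟨fun y hy => (ih.1 y hy).congr_of_eventuallyEq
        (eventuallyEq_of_pos (fun b hb => (h b hb y hy).symm) hb),
      ih.2.1.congr_of_eventuallyEq (eventuallyEq_of_pos (fun b hb => (h' b hb).symm) hb),
      ih.2.2.congr_of_eventuallyEq (eventuallyEq_of_pos (fun b hb => (h'' b hb).symm) hb)⟩

theorem smooth_right (hF : Sep 𝒞 𝒬 F p q) (h1 : ∀ φ α β, 𝒬 φ α β → ∀ y, 0 < y → SmoothAt φ y)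
    {b : ℝ} (hb : 0 < b) {y : ℝ} (hy : 0 < y) : SmoothAt (F b) y := by
  induction hF with
  | zero => exact contDiffAt_const
  | term hh hφ => exact contDiffAt_const.mul (h1 _ _ _ hφ y hy)
  | add _ _ ih ih' => exact ih.add ih'
  | congr _ h h' h'' ih =>
    exact ih.congr_of_eventuallyEq (eventuallyEq_of_nonneg (fun y hy => (h b hb y hy).symm) hy)

theorem smooth_joint (hF : Sep 𝒞 𝒬 F p q) (h1 : ∀ h, 𝒞 h → ∀ b, 0 < b → SmoothAt h b)
    (h2 : ∀ φ α β, 𝒬 φ α β → Smooth φ) :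
    ContDiffOn ℝ ∞ (fun z : ℝ × ℝ => F z.1 z.2) (Ioi 0 ×ˢ Ici 0) := by
  induction hF with
  | zero => exact contDiffOn_const
  | term hh hφ =>
    refine ContDiffOn.mul (fun z hz => ?_) ((h2 _ _ _ hφ).comp contDiff_snd).contDiffOn
    exact ((h1 _ hh z.1 hz.1).comp z contDiffAt_fst).contDiffWithinAt
  | add _ _ ih ih' => exact ih.add ih'
  | congr _ h h' h'' ih => exact ih.congr fun z hz => (h z.1 hz.1 z.2 hz.2).symm

theorem scal_left (hF : Sep 𝒞 𝒬 F p q) (h1 : ∀ h, 𝒞 h → ∀ b, 0 < b → SmoothAt h b)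
    (h2 : ∀ h, 𝒞 h → 𝒞' (scal h)) :
    Sep 𝒞' 𝒬 (fun b y => scal (fun b => F b y) b) (scal p) (scal q) := by
  induction hF with
  | zero =>
    refine zero.congr (fun b _ y _ => ?_) (fun b _ => ?_) (fun b _ => ?_) <;>
    simp [HarmonicHeatFlow.scal]
  | term hh hφ =>
    have e : ∀ (c : ℝ) h, 𝒞 h → ∀ b, 0 < b → HarmonicHeatFlow.scal h b * c
        = HarmonicHeatFlow.scal (fun b => h b * c) b := fun c h hh b hb => by
      simp only [HarmonicHeatFlow.scal]
      rw [deriv_mul_const ((h1 _ hh b hb).differentiableAt (by simp))]; ring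
    exact (term (h2 _ hh) hφ).congr (fun b hb y _ => e _ _ hh b hb) (fun b hb => e _ _ hh b hb)
      (fun b hb => e _ _ hh b hb)
  | add hF hG ih ih' =>
    refine (ih.add ih').congr (fun b hb y hy => ?_) (fun b hb => ?_) (fun b hb => ?_)
    · exact (scal_add_eq ((hF.smooth_left h1 hb).1 y hy) ((hG.smooth_left h1 hb).1 y hy)).symm
    · exact (scal_add_eq (hF.smooth_left h1 hb).2.1 (hG.smooth_left h1 hb).2.1).symm
    · exact (scal_add_eq (hF.smooth_left h1 hb).2.2 (hG.smooth_left h1 hb).2.2).symm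
  | congr _ h h' h'' ih =>
    exact ih.congr (fun b hb y hy => scal_congr (eventuallyEq_of_pos (fun b hb => h b hb y hy) hb))
      (fun b hb => scal_congr (eventuallyEq_of_pos h' hb))
      (fun b hb => scal_congr (eventuallyEq_of_pos h'' hb))

/-- Images under a linear relation `R` which acts on the leading coefficients by a triangular
matrix. -/
theorem map (hF : Sep 𝒞 𝒬 F p q) {κ κ' : ℝ} {R : (ℝ → ℝ) → (ℝ → ℝ) → Prop}
    (h1 : ∀ φ α β, 𝒬 φ α β → ∀ y, 0 < y → SmoothAt φ y)
    (hR : ∀ φ α β, 𝒬 φ α β → ∃ ψ, 𝒬' ψ (κ * α) (κ * β + κ' * α) ∧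
      (∀ y, 0 < y → SmoothAt ψ y) ∧ R φ ψ) (h0 : R (fun _ => 0) fun _ => 0)
    (hc : ∀ (c : ℝ) φ ψ, (∀ y, 0 < y → SmoothAt φ y) → (∀ y, 0 < y → SmoothAt ψ y) →
      R φ ψ → R (fun y => c * φ y) fun y => c * ψ y)
    (ha : ∀ φ ψ φ' ψ', (∀ y, 0 < y → SmoothAt φ y) → (∀ y, 0 < y → SmoothAt ψ y) →
      (∀ y, 0 < y → SmoothAt φ' y) → (∀ y, 0 < y → SmoothAt ψ' y) →
      R φ ψ → R φ' ψ' → R (fun y => φ y + φ' y) fun y => ψ y + ψ' y)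
    (hcongr : ∀ φ φ' ψ, (∀ y, 0 ≤ y → φ y = φ' y) → R φ ψ → R φ' ψ) :
    ∃ F', Sep 𝒞 𝒬' F' (fun b => κ * p b) (fun b => κ * q b + κ' * p b) ∧
      ∀ b, 0 < b → (∀ y, 0 < y → SmoothAt (F' b) y) ∧ R (F b) (F' b) := by
  induction hF with
  | zero => exact ⟨_, zero.congr (fun _ _ _ _ => rfl) (fun _ _ => by simp) fun _ _ => by simp,
      fun _ _ => ⟨fun _ _ => contDiffAt_const, h0⟩⟩
  | term hh hφ =>
    obtain ⟨ψ, hψ, hs, hr⟩ := hR _ _ _ hφ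
    exact ⟨_, (term hh hψ).congr (fun _ _ _ _ => rfl) (fun _ _ => by ring) fun _ _ => by ring,
      fun b hb => ⟨fun y hy => contDiffAt_const.mul (hs y hy), hc _ _ _ (h1 _ _ _ hφ) hs hr⟩⟩
  | add hF hG ih ih' =>
    obtain ⟨F', hF', hr⟩ := ih
    obtain ⟨G', hG', hr'⟩ := ih'
    exact ⟨_, (hF'.add hG').congr (fun _ _ _ _ => rfl) (fun _ _ => by ring) fun _ _ => by ring,
      fun b hb => ⟨fun y hy => ((hr b hb).1 y hy).add ((hr' b hb).1 y hy),
        ha _ _ _ _ (fun y hy => hF.smooth_right h1 hb hy) (hr b hb).1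
          (fun y hy => hG.smooth_right h1 hb hy) (hr' b hb).1 (hr b hb).2 (hr' b hb).2⟩⟩
  | congr _ h h' h'' ih =>
    obtain ⟨F', hF', hr⟩ := ih
    exact ⟨F', hF'.congr (fun _ _ _ _ => rfl) (fun b hb => by rw [h' b hb])
      (fun b hb => by rw [h' b hb, h'' b hb]),
      fun b hb => ⟨(hr b hb).1, hcongr _ _ _ (h b hb) (hr b hb).2⟩⟩

theorem coefS {b0 : ℝ} {n : ℕ} (hF : Sep (CoefS b0 (logw n)) 𝒬 F p q) :
    CoefS b0 (logw n) p ∧ CoefS b0 (logw n) q := by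
  induction hF with
  | zero => exact ⟨CoefS.zero n, CoefS.zero n⟩
  | @term h φ α β hh hφ =>
    exact ⟨(hh.const_mul α).congr fun b _ => mul_comm _ _,
      (hh.const_mul β).congr fun b _ => mul_comm _ _⟩
  | add _ _ ih ih' => exact ⟨ih.1.add ih'.1, ih.2.add ih'.2⟩
  | congr _ h h' h'' ih => exact ⟨ih.1.congr h', ih.2.congr h''⟩

/-- The expansion at infinity of a separated function, uniformly in `b`. -/
theorem remainder {b0 : ℝ} {m : ℕ} {n : ℤ} (hF : Sep (CoefS b0 (logw m)) (Expn n) F p q) :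
    ∃ c₀ : ℕ, ∀ c, c₀ ≤ c → SymOn (strip b0) (fun b y => logw m b * (y ^ (n - 2) * (1 + log y) ^ c))
      (fun b y => F b y - y ^ n * (p b * log y + q b)) := by
  have hp : ∀ z ∈ strip b0, 0 < z.2 := fun z hz => one_pos.trans_le hz.2
  have hw : ∀ c : ℕ, ∀ z ∈ strip b0,
      0 ≤ logw m z.1 * (z.2 ^ (n - 2) * (1 + log z.2) ^ c) := fun c z hz =>
    mul_nonneg (logw_nonneg _ _) (weight_nonneg _ _ hz.2)
  induction hF with
  | zero =>
    exact ⟨0, fun c _ => (SymTo.zero hp (hw c)).congr fun z _ =>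
      Eventually.of_forall fun y => by simp⟩
  | @term h φ α β hh hφ =>
    obtain ⟨c₀, hc₀⟩ := SymInf.exists_of_le hφ
    obtain ⟨C, hC, hb⟩ := hh.2.bound_zero
    refine ⟨c₀, fun c hc => ?_⟩
    have h1 := (((hc₀ c hc).comp_param (fun _ : ℝ => ())).mono_set
      (D' := strip b0) fun z hz => hz.2).coeff_mul h
    refine (h1.weaken hC (hw c) fun z hz => ?_).congr fun z _ => Eventually.of_forall fun y => by
      beta_reduce; ring
    have := mul_le_mul_of_nonneg_right (hb ((), z.1) hz.1) (weight_nonneg (n - 2) c hz.2)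
    rwa [mul_assoc] at this
  | add _ _ ih ih' =>
    obtain ⟨c, hc⟩ := ih
    obtain ⟨c', hc'⟩ := ih'
    exact ⟨max c c', fun k hk => ((hc k ((le_max_left _ _).trans hk)).add
      (hc' k ((le_max_right _ _).trans hk))).congr fun z _ => Eventually.of_forall fun y => by
        beta_reduce; ring⟩
  | congr _ h h' h'' ih =>
    obtain ⟨c, hc⟩ := ih
    exact ⟨c, fun k hk => (hc k hk).congr fun z hz => eventuallyEq_of_nonneg (fun y hy => by
      rw [h _ hz.1.1 y hy, h' _ hz.1.1, h'' _ hz.1.1]) (hp z hz)⟩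

/-- A separated sum as an indexed sum. -/
theorem exists_fin (hF : Sep 𝒞 𝒬 F p q) : ∃ (J : ℕ) (h φ : Fin J → ℝ → ℝ), (∀ j, 𝒞 (h j)) ∧
    (∀ j, ∃ α β, 𝒬 (φ j) α β) ∧ ∀ b, 0 < b → ∀ y, 0 ≤ y → F b y = ∑ j, h j b * φ j y := by
  induction hF with
  | zero => exact ⟨0, Fin.elim0, Fin.elim0, fun j => j.elim0, fun j => j.elim0, fun _ _ _ _ => by simp⟩
  | @term h φ α β hh hφ =>
    exact ⟨1, fun _ => h, fun _ => φ, fun _ => hh, fun _ => ⟨α, β, hφ⟩, fun _ _ _ _ => by simp⟩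
  | add _ _ ih ih' =>
    obtain ⟨J, h, φ, h1, h2, h3⟩ := ih
    obtain ⟨J', h', φ', h1', h2', h3'⟩ := ih'
    refine ⟨J + J', Fin.append h h', Fin.append φ φ', fun j => ?_, fun j => ?_, fun b hb y hy => ?_⟩
    · refine Fin.addCases (fun i => ?_) (fun i => ?_) j
      · rw [Fin.append_left]; exact h1 i
      · rw [Fin.append_right]; exact h1' i
    · refine Fin.addCases (fun i => ?_) (fun i => ?_) j
      · rw [Fin.append_left]; exact h2 i
      · rw [Fin.append_right]; exact h2' i
    · beta_reduce
      rw [Fin.sum_univ_add, h3 b hb y hy, h3' b hb y hy]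
      simp only [Fin.append_left, Fin.append_right]
  | congr _ h _ _ ih =>
    obtain ⟨J, k, φ, h1, h2, h3⟩ := ih
    exact ⟨J, k, φ, h1, h2, fun b hb y hy => by rw [← h b hb y hy, h3 b hb y hy]⟩

end Sep

/-- Functions without leading terms: products of `Coef` and of functions which vanish to order `s`
at the origin and are symbols of order `n` at infinity. -/
def LowProf (s : ℕ) (n : ℤ) (u : ℝ → ℝ) (α β : ℝ) : Prop := ZeroOrd s u ∧ SymInf n u ∧ α = 0 ∧ β = 0

def Low (b0 : ℝ) (s : ℕ) (n : ℤ) (F : ℝ → ℝ → ℝ) : Prop := ∃ p q, Sep (Coef b0) (LowProf s n) F p q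

/-- Profiles of degree `d` with good leading coefficients. -/
def Lead (b0 : ℝ) (d : ℕ) (F : ℝ → ℝ → ℝ) : Prop :=
  ∃ p q, Sep (Coef b0) (Prof d) F p q ∧ Good b0 p q

section
variable {b0 : ℝ} {s t d : ℕ} {n m : ℤ} {F G : ℝ → ℝ → ℝ}

theorem Coef.smooth {h : ℝ → ℝ} (hh : Coef b0 h) : ∀ b, 0 < b → SmoothAt h b := hh.1.1

theorem Low.zero : Low b0 s n fun _ _ => 0 := ⟨_, _, Sep.zero⟩

theorem Low.add (hF : Low b0 s n F) (hG : Low b0 s n G) : Low b0 s n fun b y => F b y + G b y :=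
  let ⟨_, _, h⟩ := hF; let ⟨_, _, h'⟩ := hG; ⟨_, _, h.add h'⟩

theorem Low.congr (hF : Low b0 s n F) (h : ∀ b, 0 < b → ∀ y, 0 ≤ y → F b y = G b y) :
    Low b0 s n G := let ⟨_, _, h'⟩ := hF; ⟨_, _, h'.congr h (fun _ _ => rfl) fun _ _ => rfl⟩

theorem Low.mono (hF : Low b0 (s + 2 * t) m F) (hm : m ≤ n) : Low b0 s n F := let ⟨_, _, h⟩ := hF
  ⟨_, _, h.mono (fun _ h => h) fun _ _ _ h => ⟨h.1.of_le, h.2.1.mono hm, h.2.2⟩⟩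

theorem Low.mul_fun (hF : Low b0 s m F) {G : ℝ → ℝ} (hG0 : ZeroOrd t G) (hG : SymInf n G) :
    Low b0 (t + s) (n + m) fun b y => G y * F b y := by
  obtain ⟨p, q, h⟩ := hF
  refine ⟨p, q, ?_⟩
  induction h with
  | zero => simpa using Sep.zero
  | @term h φ α β hh hφ =>
    have hφ' : LowProf (t + s) (n + m) (fun y => G y * φ y) α β :=
      ⟨hG0.mul hφ.1, hG.mul hφ.2.1, hφ.2.2⟩
    exact (Sep.term hh hφ').congr (fun b _ y _ => by ring) (fun _ _ => rfl) fun _ _ => rfl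
  | add _ _ ih ih' => simpa only [mul_add] using ih.add ih'
  | congr _ h h' h'' ih => exact ih.congr (fun b hb y hy => by rw [h b hb y hy]) h' h''

theorem Low.coef_mul (hF : Low b0 s n F) {h : ℝ → ℝ} (hh : Coef b0 h) :
    Low b0 s n fun b y => h b * F b y :=
  let ⟨_, _, hF⟩ := hF; ⟨_, _, hF.coef_mul h fun _ hk => hh.mul hk⟩

theorem Low.mul (hF : Low b0 s n F) (hG : Low b0 t m G) :
    Low b0 (s + t) (n + m) fun b y => F b y * G b y := by
  obtain ⟨p, q, h⟩ := hF
  induction h with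
  | zero => simpa using Low.zero
  | term hh hφ =>
    exact ((hG.mul_fun hφ.1 hφ.2.1).coef_mul hh).congr fun b _ y _ => by ring
  | add _ _ ih ih' => simpa only [add_mul] using ih.add ih'
  | congr _ h h' h'' ih => exact ih.congr fun b hb y hy => by rw [h b hb y hy]

theorem Low.of_fun {φ : ℝ → ℝ} (h1 : ZeroOrd s φ) (h2 : SymInf n φ) : Low b0 s n fun _ => φ :=
  ⟨_, _, (Sep.term (Coef.const 1) (𝒬 := LowProf s n) ⟨h1, h2, rfl, rfl⟩).congr
    (fun b _ y _ => by rw [one_mul]) (fun _ _ => rfl) fun _ _ => rfl⟩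

theorem Prof.contDiff {u : ℝ → ℝ} {α β : ℝ} (h : Prof d u α β) : Smooth u := h.1.contDiff

theorem Lead.low (hF : Lead b0 d F) : Low b0 (2 * d + 1) (2 * d - 1) F := by
  obtain ⟨p, q, h, -⟩ := hF
  induction h with
  | zero => exact Low.zero
  | term hh hφ => exact (Low.of_fun hφ.1 hφ.2.symInf).coef_mul hh
  | add _ _ ih ih' => exact ih.add ih'
  | congr _ h h' h'' ih => exact ih.congr h

theorem Low.lead (hF : Low b0 (2 * d + 1) (2 * d - 3) F) : Lead b0 d F := by
  obtain ⟨p, q, h⟩ := hF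
  refine ⟨fun _ => 0, fun _ => 0, ?_, Good.zero⟩
  induction h with
  | zero => exact Sep.zero
  | @term h φ α β hh hφ =>
    have : Prof d φ 0 0 := ⟨hφ.1, SymInf.expn (by rw [show (2 * d - 1 - 2 : ℤ) = 2 * d - 3 by ring]; exact hφ.2.1)⟩
    exact (Sep.term hh this).congr (fun _ _ _ _ => rfl) (fun _ _ => by simp) fun _ _ => by simp
  | add _ _ ih ih' => simpa using ih.add ih'
  | congr _ h h' h'' ih => exact ih.congr h (fun _ _ => rfl) fun _ _ => rfl

theorem Lead.zero : Lead b0 d fun _ _ => 0 := ⟨_, _, Sep.zero, Good.zero⟩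

theorem Lead.add (hF : Lead b0 d F) (hG : Lead b0 d G) : Lead b0 d fun b y => F b y + G b y :=
  let ⟨_, _, h, hg⟩ := hF; let ⟨_, _, h', hg'⟩ := hG; ⟨_, _, h.add h', hg.add hg'⟩

theorem Lead.coef_mul (hb0 : b0 ≤ 1 / 16) (hF : Lead b0 d F) {h : ℝ → ℝ} (hh : Coef b0 h) :
    Lead b0 d fun b y => h b * F b y :=
  let ⟨_, _, hF, hg⟩ := hF; ⟨_, _, hF.coef_mul h fun _ hk => hh.mul hk, Good.mul hb0 hh hg⟩

theorem Lead.scal_left (hb0 : b0 ≤ 1 / 16) (hF : Lead b0 d F) :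
    Lead b0 d fun b y => scal (fun b => F b y) b :=
  let ⟨_, _, h, hg⟩ := hF
  ⟨_, _, h.scal_left (fun _ h => h.smooth) fun _ h => h.scal hb0, hg.scal hb0⟩

theorem Prof.scal {u : ℝ → ℝ} {α β : ℝ} (h : Prof d u α β) :
    Prof d (scal u) ((2 * d - 1 : ℝ) * α) ((2 * d - 1 : ℝ) * β + 1 * α) := by
  refine ⟨h.1.scal, ?_⟩
  have := h.2.deriv.mul (Expn.zpow 1 1)
  rw [show (1 : ℤ) + (2 * d - 1 - 1) = 2 * d - 1 by ring] at this
  convert this.congr (v := HarmonicHeatFlow.scal u) fun y _ => by simp [HarmonicHeatFlow.scal] using 1 <;> push_cast <;> ring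

theorem Sep.scal_right {𝒞 : (ℝ → ℝ) → Prop} {p q : ℝ → ℝ} (hF : Sep 𝒞 (Prof d) F p q) :
    Sep 𝒞 (Prof d) (fun b => scal (F b)) (fun b => (2 * d - 1 : ℝ) * p b)
      (fun b => (2 * d - 1 : ℝ) * q b + 1 * p b) := by
  obtain ⟨F', hF', hr⟩ := hF.map (𝒬' := Prof d) (κ := 2 * d - 1) (κ' := 1)
    (R := fun φ ψ => ∀ y, 0 ≤ y → ψ y = scal φ y)
    (fun φ α β h y _ => h.contDiff.contDiffAt)
    (fun φ α β h => ⟨scal φ, h.scal, fun y _ => h.scal.contDiff.contDiffAt, fun y _ => rfl⟩)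
    (fun y _ => by simp [HarmonicHeatFlow.scal])
    (fun c φ ψ hφ _ h y hy => by
      rcases hy.eq_or_lt with rfl | hy
      · have := h 0 le_rfl
        simp only [HarmonicHeatFlow.scal, zero_mul] at this ⊢
        rw [this, mul_zero]
      · beta_reduce; rw [h y hy.le, scal_const_mul_eq c (hφ y hy)])
    (fun φ ψ φ' ψ' hφ _ hφ' _ h h' y hy => by
      rcases hy.eq_or_lt with rfl | hy
      · have h1 := h 0 le_rfl
        have h2 := h' 0 le_rfl
        simp only [HarmonicHeatFlow.scal, zero_mul] at h1 h2 ⊢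
        rw [h1, h2, add_zero]
      · beta_reduce; rw [h y hy.le, h' y hy.le, scal_add_eq (hφ y hy) (hφ' y hy)])
    (fun φ φ' ψ he h y hy => by
      rcases hy.eq_or_lt with rfl | hy
      · simpa [HarmonicHeatFlow.scal] using h 0 le_rfl
      · rw [h y hy.le]; exact scal_congr (eventuallyEq_of_nonneg he hy))
  exact hF'.congr (fun b hb y hy => (hr b hb).2 y hy) (fun _ _ => rfl) fun _ _ => rfl

theorem Lead.scal_right (hb0 : b0 ≤ 1 / 16) (hF : Lead b0 d F) : Lead b0 d fun b => scal (F b) :=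
  let ⟨_, _, h, hg⟩ := hF; ⟨_, _, h.scal_right, hg.lin hb0 _ _⟩

theorem Lead.smooth_left (hF : Lead b0 d F) {b y : ℝ} (hb : 0 < b) (hy : 0 ≤ y) :
    SmoothAt (fun b => F b y) b :=
  let ⟨_, _, h, _⟩ := hF; (h.smooth_left (fun _ h => h.smooth) hb).1 y hy

theorem Lead.smooth_right (hF : Lead b0 d F) {b y : ℝ} (hb : 0 < b) (hy : 0 < y) :
    SmoothAt (F b) y :=
  let ⟨_, _, h, _⟩ := hF; h.smooth_right (fun _ _ _ h _ _ => h.contDiff.contDiffAt) hb hy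

variable {g Q q : ℝ → ℝ}

/-- Inversion of `H` on profiles. -/
theorem IsExt.exists_lead_inverse (h : IsExt g Q q) (hb0 : b0 ≤ 1 / 16) (hd : 1 ≤ d)
    (hF : Lead b0 d F) : ∃ F', Lead b0 (d + 1) F' ∧
      ∀ b, 0 < b → ∀ y, 0 < y → opH g Q (F' b) y = F b y := by
  obtain ⟨p, r, hF, hg⟩ := hF
  obtain ⟨κ, κ', H⟩ := h.exists_inverse d hd
  obtain ⟨F', hF', hr⟩ := hF.map (𝒬' := Prof (d + 1)) (κ := κ) (κ' := κ')
    (R := fun φ ψ => ∀ y, 0 < y → opH g Q ψ y = φ y)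
    (fun φ α β h y _ => h.contDiff.contDiffAt)
    (fun φ α β hφ => by
      obtain ⟨ψ, hψ, hr⟩ := H φ α β hφ
      exact ⟨ψ, hψ, fun y _ => hψ.contDiff.contDiffAt, hr⟩)
    (fun y _ => opH_zero y)
    (fun c φ ψ _ hψ h y hy => by rw [opH_const_mul _ _ (hψ y hy), h y hy])
    (fun φ ψ φ' ψ' _ hψ _ hψ' h h' y hy => by
      rw [opH_add (hψ y hy) (hψ' y hy), h y hy, h' y hy])
    (fun φ φ' ψ he h y hy => by rw [h y hy, he y hy.le])
  exact ⟨F', ⟨_, _, hF', hg.lin hb0 _ _⟩, fun b hb => (hr b hb).2⟩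

/-- `Θ_i = Λ T_i - (2i - 1 + c) T_i`, where the leading terms cancel at the scale `B₀`. -/
noncomputable def theta (q c : ℝ → ℝ) (i : ℕ) (b y : ℝ) : ℝ :=
  scal (fun y => (-1) ^ i * (y * profV q i y)) y
    - (2 * i - 1 + c b) * ((-1) ^ i * (y * profV q i y))

theorem IsExt.lead_theta (h : IsExt g Q q) (hb0 : b0 ≤ 1 / 16) {c : ℝ → ℝ} (hc : IsSpeed b0 c)
    (i : ℕ) (hi : 1 ≤ i) : Lead b0 i (theta q c i) := by
  obtain ⟨α, β, hP⟩ := h.profV_prof i hi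
  set T : ℝ → ℝ := fun y => (-1) ^ i * (y * profV q i y) with hT
  have hcc : Coef b0 c := ⟨hc.small.log_of_le hb0 (by omega), hc.scal⟩
  have h1 := (Sep.term (Coef.const (b0 := b0) 1) hP.scal).add
    ((Sep.term (((Coef.const (2 * i - 1)).add hcc).const_mul (-1)) hP))
  refine ⟨fun b => -α * c b, fun b => α - β * c b, h1.congr (fun b _ y _ => ?_) (fun b _ => ?_)
    (fun b _ => ?_), ?_⟩
  · simp only [theta, hT]; ring
  · ring
  · ring
  · obtain ⟨C, hC, hb⟩ := hc.balance
    have hg1 : Good b0 (fun b => -1 * c b) (fun _ => 1) := by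
      refine ⟨hc.small.const_mul _, (hc.scal.const_mul (-1)).congr fun b hb =>
        (scal_const_mul_eq _ (hc.small.1 b hb)).symm, Coef.const 1, C, hC, fun b hbb => ?_⟩
      have := hb b hbb
      rwa [show (1 : ℝ) + -1 * c b * (|log b| / 2) = 1 - c b * (|log b| / 2) by ring]
    have hg2 := Good.of_small hb0 (hc.small.const_mul (-β)) ((hc.scal.const_mul (-β)).congr
      fun b hb => (scal_const_mul_eq _ (hc.small.1 b hb)).symm)
    refine ((hg1.mul hb0 (Coef.const α)).add hg2).congr (fun b _ => ?_) (fun b _ => ?_) <;> ring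

end


/-! ### Homogeneous sums -/

/-- Finite sums of functions of the class `𝒢`, on `b ∈ U`, `y ≥ 0`. -/
inductive SumOf {A : Type} (U : Set A) (𝒢 : (A → ℝ → ℝ) → Prop) : (A → ℝ → ℝ) → Prop
  | zero : SumOf U 𝒢 fun _ _ => 0
  | of {S : A → ℝ → ℝ} : 𝒢 S → SumOf U 𝒢 S
  | add {S S' : A → ℝ → ℝ} : SumOf U 𝒢 S → SumOf U 𝒢 S' → SumOf U 𝒢 fun b y => S b y + S' b y
  | congr {S S' : A → ℝ → ℝ} : SumOf U 𝒢 S → (∀ b ∈ U, ∀ y, 0 ≤ y → S b y = S' b y) → SumOf U 𝒢 S'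

namespace SumOf
variable {A : Type} {U : Set A} {𝒢 𝒢' : (A → ℝ → ℝ) → Prop} {S : A → ℝ → ℝ}

theorem bind (hS : SumOf U 𝒢 S) (h : ∀ S, 𝒢 S → SumOf U 𝒢' S) : SumOf U 𝒢' S := by
  induction hS with
  | zero => exact zero
  | of hS => exact h _ hS
  | add _ _ ih ih' => exact ih.add ih'
  | congr _ he ih => exact ih.congr he

theorem mul_left (hS : SumOf U 𝒢 S) (k : A → ℝ → ℝ)
    (h : ∀ S, 𝒢 S → SumOf U 𝒢' fun b y => k b y * S b y) : SumOf U 𝒢' fun b y => k b y * S b y := by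
  induction hS with
  | zero => simpa using zero
  | of hS => exact h _ hS
  | add _ _ ih ih' => simpa only [mul_add] using ih.add ih'
  | congr _ he ih => exact ih.congr fun b hb y hy => by rw [he b hb y hy]

theorem sum {ι : Type*} (s : Finset ι) {f : ι → A → ℝ → ℝ} (h : ∀ i ∈ s, SumOf U 𝒢 (f i)) :
    SumOf U 𝒢 fun b y => ∑ i ∈ s, f i b y := by
  classical
  induction s using Finset.induction_on with
  | empty => simpa using zero
  | insert a s ha ih =>
    simp only [sum_insert ha]
    exact (h a (mem_insert_self _ _)).add (ih fun i hi => h i (mem_insert_of_mem hi))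

theorem smooth_right (hS : SumOf U 𝒢 S)
    (h : ∀ S, 𝒢 S → ∀ b ∈ U, ∀ y, 0 < y → SmoothAt (S b) y) {b : A} (hb : b ∈ U) {y : ℝ}
    (hy : 0 < y) : SmoothAt (S b) y := by
  induction hS with
  | zero => exact contDiffAt_const
  | of hS => exact h _ hS b hb y hy
  | add _ _ ih ih' => exact ih.add ih'
  | congr _ he ih =>
    exact ih.congr_of_eventuallyEq (eventuallyEq_of_nonneg (fun y hy => (he b hb y hy).symm) hy)

theorem symOn (hS : SumOf U 𝒢 S) {D : Set (A × ℝ)} {w : A → ℝ → ℝ} (hD : ∀ z ∈ D, z.1 ∈ U)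
    (hp : ∀ z ∈ D, 0 < z.2) (hw : ∀ z ∈ D, 0 ≤ w z.1 z.2) (h : ∀ S, 𝒢 S → SymOn D w S) :
    SymOn D w S := by
  induction hS with
  | zero => exact SymTo.zero hp hw
  | of hS => exact h _ hS
  | add _ _ ih ih' => exact ih.add ih'
  | congr _ he ih =>
    exact ih.congr fun z hz => eventuallyEq_of_nonneg (he _ (hD z hz)) (hp z hz)

end SumOf

section
variable {L : ℕ} [NeZero L]

/-- The monomial `∏ b_k^{J_k}`. -/
noncomputable def mon (b : Par L) (J : Fin L → ℤ) : ℝ := ∏ k, b k ^ J k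

/-- Exponents of degree `d` which involve only `b_1, …, b_r`, the first one of any sign. -/
structure MonOK (d : ℤ) (r : ℕ) (J : Fin L → ℤ) : Prop where
  nonneg : ∀ k : Fin L, k ≠ 0 → 0 ≤ J k
  degree : ∑ k : Fin L, ((k : ℕ) + 1 : ℤ) * J k = d
  range : ∀ k : Fin L, k ≠ 0 → r < (k : ℕ) + 1 → J k = 0

/-- Homogeneous sums of degree `d` in `b_1, …, b_r`, with coefficients in the class `𝒦`. -/
def HomSum (𝒦 : (ℝ → ℝ → ℝ) → Prop) (d : ℤ) (r : ℕ) : (Par L → ℝ → ℝ) → Prop :=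
  SumOf {b | 0 < b 0} fun S => ∃ J F, MonOK d r J ∧ 𝒦 F ∧ S = fun b y => mon b J * F (b 0) y

theorem mon_add {b : Par L} (hb : 0 < b 0) {J J' : Fin L → ℤ}
    (h : ∀ k : Fin L, k ≠ 0 → 0 ≤ J k) (h' : ∀ k : Fin L, k ≠ 0 → 0 ≤ J' k) :
    mon b (J + J') = mon b J * mon b J' := by
  rw [mon, mon, mon, ← Finset.prod_mul_distrib]
  refine prod_congr rfl fun k _ => ?_
  rw [Pi.add_apply]
  refine zpow_add' ?_
  by_cases hk : k = 0
  · left; rw [hk]; exact hb.ne'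
  · have := h k hk
    have := h' k hk
    right; omega

theorem mon_single (b : Par L) (k : Fin L) : mon b (Pi.single k 1) = b k := by
  rw [mon, Finset.prod_eq_single k]
  · simp
  · intro j _ hj; simp [hj]
  · simp

theorem sum_single (k : Fin L) : ∑ j : Fin L, ((j : ℕ) + 1 : ℤ) * (Pi.single k 1 : Fin L → ℤ) j
    = (k : ℕ) + 1 := by
  rw [Finset.sum_eq_single k]
  · simp
  · intro j _ hj; simp [hj]
  · simp

theorem MonOK.add {d d' : ℤ} {r r' r'' : ℕ} {J J' : Fin L → ℤ} (h : MonOK d r J)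
    (h' : MonOK d' r' J') (hr : r ≤ r'') (hr' : r' ≤ r'') : MonOK (d + d') r'' (J + J') :=
  ⟨fun k hk => add_nonneg (h.nonneg k hk) (h'.nonneg k hk), by
    simp only [Pi.add_apply, mul_add, sum_add_distrib, h.degree, h'.degree],
    fun k hk hlt => by
      rw [Pi.add_apply, h.range k hk (by omega), h'.range k hk (by omega), add_zero]⟩

theorem MonOK.single {r : ℕ} (k : Fin L) (hk : k = 0 ∨ (k : ℕ) + 1 ≤ r) :
    MonOK (↑k + 1) r (Pi.single k 1) :=
  ⟨fun j _ => by by_cases h : j = k <;> simp [h], sum_single k, fun j hj hlt => by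
    have : j ≠ k := by
      rintro rfl
      rcases hk with h | h
      · exact hj h
      · omega
    simp [this]⟩

theorem MonOK.zero {r : ℕ} : MonOK 0 r (0 : Fin L → ℤ) :=
  ⟨fun _ _ => le_rfl, by simp, fun _ _ _ => rfl⟩

/-- The exponents of `∂_{b_j}` of a monomial. -/
theorem MonOK.sub_single {d : ℤ} {r : ℕ} {J : Fin L → ℤ} (h : MonOK d r J) (j : Fin L)
    (hj : j = 0 ∨ J j ≠ 0) : MonOK (d - (↑j + 1)) r (J - Pi.single j 1) := by
  refine ⟨fun k hk => ?_, ?_, fun k hk hlt => ?_⟩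
  · rw [Pi.sub_apply]
    have := h.nonneg k hk
    by_cases hkj : k = j
    · subst hkj
      have := hj.resolve_left hk
      simp only [Pi.single_eq_same]; omega
    · simpa [hkj] using this
  · simp only [Pi.sub_apply, mul_sub, sum_sub_distrib, h.degree, sum_single]
  · have := h.range k hk hlt
    have hkj : k ≠ j := by rintro rfl; exact (hj.resolve_left hk) this
    rw [Pi.sub_apply, this]; simp [hkj]

namespace HomSum
variable {𝒦 𝒦' 𝒦'' : (ℝ → ℝ → ℝ) → Prop} {d d' : ℤ} {r r' r'' : ℕ} {S S' : Par L → ℝ → ℝ}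

theorem zero : HomSum (L := L) 𝒦 d r fun _ _ => 0 := SumOf.zero

theorem term {J : Fin L → ℤ} {F : ℝ → ℝ → ℝ} (hJ : MonOK d r J) (hF : 𝒦 F) :
    HomSum 𝒦 d r fun b y => mon b J * F (b 0) y := SumOf.of ⟨J, F, hJ, hF, rfl⟩

theorem add (hS : HomSum 𝒦 d r S) (hS' : HomSum 𝒦 d r S') :
    HomSum 𝒦 d r fun b y => S b y + S' b y := SumOf.add hS hS'

theorem congr (hS : HomSum 𝒦 d r S) (h : ∀ b : Par L, 0 < b 0 → ∀ y, 0 ≤ y → S b y = S' b y) :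
    HomSum 𝒦 d r S' := SumOf.congr hS h

theorem mono (hS : HomSum 𝒦 d r S) (h : ∀ F, 𝒦 F → 𝒦' F) (hr : r ≤ r') : HomSum 𝒦' d r' S :=
  hS.bind fun _ ⟨J, F, hJ, hF, e⟩ => SumOf.of ⟨J, F,
    ⟨hJ.nonneg, hJ.degree, fun k hk hlt => hJ.range k hk (by omega)⟩, h F hF, e⟩

theorem mul (hS : HomSum 𝒦 d r S) (hS' : HomSum 𝒦' d' r' S') (hr : r ≤ r'') (hr' : r' ≤ r'')
    (h : ∀ F F', 𝒦 F → 𝒦' F' → 𝒦'' fun b y => F b y * F' b y) :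
    HomSum 𝒦'' (d + d') r'' fun b y => S b y * S' b y := by
  induction hS with
  | zero => simpa using zero
  | of hS =>
    obtain ⟨J, F, hJ, hF, rfl⟩ := hS
    refine SumOf.mul_left hS' _ fun T hT => ?_
    obtain ⟨J', F', hJ', hF', rfl⟩ := hT
    refine (term (hJ.add hJ' hr hr') (h F F' hF hF')).congr fun b hb y _ => ?_
    rw [mon_add hb hJ.nonneg hJ'.nonneg]; ring
  | add _ _ ih ih' => simpa only [add_mul] using add ih ih'
  | congr _ he ih => exact congr ih fun b hb y hy => by rw [he b hb y hy]

theorem coef_mul (hS : HomSum 𝒦 d r S) {k : ℝ → ℝ → ℝ} (h : ∀ F, 𝒦 F → 𝒦' fun b y => k b y * F b y) :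
    HomSum 𝒦' d r fun b y => k (b 0) y * S b y :=
  SumOf.mul_left hS _ fun _ ⟨_, F, hJ, hF, e⟩ => e ▸ (term hJ (h F hF)).congr fun b _ y _ => by ring

theorem mul_coord (hS : HomSum 𝒦 d r S) (k : Fin L) (hr : r ≤ r') (hk : k = 0 ∨ (k : ℕ) + 1 ≤ r') :
    HomSum 𝒦 (d + (↑k + 1)) r' fun b y => b k * S b y :=
  SumOf.mul_left hS _ fun _ ⟨J, _, hJ, hF, e⟩ => e ▸
    (term (hJ.add (MonOK.single k hk) hr le_rfl) hF).congr fun b hb y _ => by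
      rw [mon_add hb hJ.nonneg (MonOK.single k hk).nonneg, mon_single]; ring

theorem differentiableAt_mon {b : Par L} (hb : 0 < b 0) {J : Fin L → ℤ}
    (hJ : ∀ k : Fin L, k ≠ 0 → 0 ≤ J k) : DifferentiableAt ℝ (fun b => mon b J) b := by
  unfold mon
  have : ∀ k ∈ Finset.univ, DifferentiableAt ℝ (fun b : Par L => b k ^ J k) b := fun k _ => by
    refine (differentiableAt_apply k b).zpow ?_
    by_cases hk : k = 0
    · left; rw [hk]; exact hb.ne'
    · exact Or.inr (hJ k hk)
  exact (HasFDerivAt.finsetProd fun k hk => (this k hk).hasFDerivAt).differentiableAt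

theorem isOpen_pos : IsOpen {b : Par L | 0 < b 0} :=
  isOpen_lt continuous_const (continuous_apply 0)

theorem differentiableAt (hS : HomSum 𝒦 d r S)
    (h : ∀ F, 𝒦 F → ∀ b y, 0 < b → 0 ≤ y → SmoothAt (fun b => F b y) b) {b : Par L}
    (hb : 0 < b 0) {y : ℝ} (hy : 0 ≤ y) : DifferentiableAt ℝ (fun b => S b y) b := by
  induction hS with
  | zero => exact differentiableAt_const _
  | of hS =>
    obtain ⟨J, F, hJ, hF, rfl⟩ := hS
    have h1 : DifferentiableAt ℝ (fun b : Par L => F (b 0) y) b :=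
      DifferentiableAt.comp (g := fun t => F t y) (f := fun b : Par L => b 0) b
        ((h F hF (b 0) y hb hy).differentiableAt (by simp)) (differentiableAt_apply 0 b)
    exact (differentiableAt_mon hb hJ.nonneg).mul h1
  | add _ _ ih ih' => exact ih.add ih'
  | congr _ he ih =>
    refine ih.congr_of_eventuallyEq ?_
    filter_upwards [isOpen_pos.mem_nhds hb] with x hx using (he x hx y hy).symm

end HomSum

theorem hasDerivAt_update_comp {f : Par L → ℝ} {b : Par L} (hf : DifferentiableAt ℝ f b)
    (j : Fin L) : HasDerivAt (fun t => f (Function.update b j t)) (fderiv ℝ f b (Pi.single j 1))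
      (b j) := by
  have h1 := hasDerivAt_update b j (b j)
  have h2 : HasFDerivAt f (fderiv ℝ f b) (Function.update b j (b j)) := by
    rw [Function.update_eq_self]; exact hf.hasFDerivAt
  exact h2.comp_hasDerivAt (b j) h1

theorem eventually_update_pos {b : Par L} (hb : 0 < b 0) (j : Fin L) :
    ∀ᶠ t in 𝓝 (b j), 0 < Function.update b j t 0 := by
  have h1 : ContinuousAt (fun t => Function.update b j t 0) (b j) :=
    (continuous_apply 0).continuousAt.comp (hasDerivAt_update b j (b j)).continuousAt
  exact h1.eventually (lt_mem_nhds (by simpa using hb))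

theorem partialB_congr {S S' : Par L → ℝ → ℝ} {b : Par L} (hb : 0 < b 0) {y : ℝ}
    (h : ∀ b : Par L, 0 < b 0 → S b y = S' b y) (j : Fin L) :
    partialB j S b y = partialB j S' b y := by
  have : (fun t => S (Function.update b j t) y) =ᶠ[𝓝 (b j)] fun t => S' (Function.update b j t) y := by
    filter_upwards [eventually_update_pos hb j] with t ht using h _ ht
  exact this.deriv_eq

theorem hasDerivAt_mon {b : Par L} (hb : 0 < b 0) {J : Fin L → ℤ}
    (hJ : ∀ k : Fin L, k ≠ 0 → 0 ≤ J k) (j : Fin L) :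
    HasDerivAt (fun t => mon (Function.update b j t) J) (J j * mon b (J - Pi.single j 1)) (b j) := by
  have e1 : ∀ t, mon (Function.update b j t) J = t ^ J j * ∏ k ∈ Finset.univ.erase j, b k ^ J k := by
    intro t
    rw [mon, ← Finset.mul_prod_erase _ _ (Finset.mem_univ j), Function.update_self]
    congr 1
    refine prod_congr rfl fun k hk => ?_
    rw [Function.update_of_ne (Finset.ne_of_mem_erase hk)]
  have e2 : mon b (J - Pi.single j 1) = b j ^ (J j - 1) * ∏ k ∈ Finset.univ.erase j, b k ^ J k := by
    rw [mon, ← Finset.mul_prod_erase _ _ (Finset.mem_univ j)]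
    congr 1
    · simp
    · refine prod_congr rfl fun k hk => ?_
      simp [Finset.ne_of_mem_erase hk]
  simp only [e1, e2]
  have : b j ≠ 0 ∨ 0 ≤ J j := by
    by_cases hk : j = 0
    · left; rw [hk]; exact hb.ne'
    · exact Or.inr (hJ j hk)
  exact ((hasDerivAt_zpow (J j) (b j) this).mul_const _).congr_deriv (by ring)

/-- Classes of coefficients which are stable under the operations in `b₁`. -/
structure CoefClass (b0 : ℝ) (𝒦 : (ℝ → ℝ → ℝ) → Prop) : Prop where
  add : ∀ F G, 𝒦 F → 𝒦 G → 𝒦 fun b y => F b y + G b y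
  coef_mul : ∀ h F, Coef b0 h → 𝒦 F → 𝒦 fun b y => h b * F b y
  scal_left : ∀ F, 𝒦 F → 𝒦 fun b y => scal (fun b => F b y) b
  smooth_left : ∀ F, 𝒦 F → ∀ b y, 0 < b → 0 ≤ y → SmoothAt (fun b => F b y) b

theorem CoefClass.lead {b0 : ℝ} (hb0 : b0 ≤ 1 / 16) (d : ℕ) : CoefClass b0 (Lead b0 d) :=
  ⟨fun _ _ h h' => h.add h', fun _ _ h h' => h'.coef_mul hb0 h, fun _ h => h.scal_left hb0,
    fun _ h _ _ hb hy => h.smooth_left hb hy⟩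

namespace HomSum
variable {𝒦 𝒦' 𝒦'' : (ℝ → ℝ → ℝ) → Prop} {d d' : ℤ} {r r' r'' : ℕ} {S S' : Par L → ℝ → ℝ}
  {b0 : ℝ}

theorem hasDerivAt (h𝒦 : CoefClass b0 𝒦) (hS : HomSum 𝒦 d r S) {b : Par L} (hb : 0 < b 0)
    {y : ℝ} (hy : 0 ≤ y) (j : Fin L) :
    HasDerivAt (fun t => S (Function.update b j t) y) (partialB j S b y) (b j) :=
  (hasDerivAt_update_comp (hS.differentiableAt h𝒦.smooth_left hb hy) j).differentiableAt.hasDerivAt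

theorem partialB (h𝒦 : CoefClass b0 𝒦) (hS : HomSum 𝒦 d r S) (j : Fin L) :
    HomSum 𝒦 (d - (↑j + 1)) r (partialB j S) := by
  induction hS with
  | zero => exact zero.congr fun b _ y _ => by simp [HarmonicHeatFlow.partialB]
  | of hS =>
    obtain ⟨J, F, hJ, hF, rfl⟩ := hS
    by_cases hj : j = 0
    · subst hj
      have hG := h𝒦.add _ _ (h𝒦.coef_mul _ _ (Coef.const (J 0 : ℝ)) hF) (h𝒦.scal_left _ hF)
      refine (term (hJ.sub_single 0 (Or.inl rfl)) hG).congr fun b hb y hy => ?_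
      have h1 := hasDerivAt_mon hb hJ.nonneg (0 : Fin L)
      have h2 := ((h𝒦.smooth_left F hF (b 0) y hb hy).differentiableAt (by simp)).hasDerivAt
      have h3 := h1.fun_mul h2
      have h4 := mon_add hb (hJ.sub_single 0 (Or.inl rfl)).nonneg
        (MonOK.single (r := 1) (0 : Fin L) (Or.inl rfl)).nonneg
      rw [sub_add_cancel, mon_single] at h4; simp only [Function.update_eq_self] at h3
      simp only [HarmonicHeatFlow.partialB, Function.update_self, h3.deriv, scal]
      rw [h4]; ring
    · have e : ∀ b : Par L, 0 < b 0 → ∀ y, 0 ≤ y → HarmonicHeatFlow.partialB j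
          (fun b y => mon b J * F (b 0) y) b y = J j * mon b (J - Pi.single j 1) * F (b 0) y := by
        intro b hb y _
        have h1 := (hasDerivAt_mon hb hJ.nonneg j).mul_const (F (b 0) y)
        simp only [HarmonicHeatFlow.partialB, Function.update_of_ne (Ne.symm hj), h1.deriv]
      by_cases hJj : J j = 0
      · exact zero.congr fun b hb y hy => by rw [e b hb y hy, hJj]; simp
      · have hG := h𝒦.coef_mul _ _ (Coef.const (J j : ℝ)) hF
        refine (term (hJ.sub_single j (Or.inr hJj)) hG).congr fun b hb y hy => ?_
        rw [e b hb y hy]; ring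
  | add hS hS' ih ih' =>
    refine (add ih ih').congr fun b hb y hy => ?_
    exact ((hasDerivAt h𝒦 hS hb hy j).fun_add (hasDerivAt h𝒦 hS' hb hy j)).deriv.symm
  | congr _ he ih =>
    exact congr ih fun b hb y hy => partialB_congr hb (fun b hb => he b hb y hy) j

theorem partialB_eq_zero (h𝒦 : CoefClass b0 𝒦) (hS : HomSum 𝒦 d r S) {j : Fin L} (hj : j ≠ 0)
    (hr : r < (j : ℕ) + 1) {b : Par L} (hb : 0 < b 0) {y : ℝ} (hy : 0 ≤ y) :
    HarmonicHeatFlow.partialB j S b y = 0 := by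
  induction hS with
  | zero => simp [HarmonicHeatFlow.partialB]
  | of hS =>
    obtain ⟨J, F, hJ, hF, rfl⟩ := hS
    have h1 := (hasDerivAt_mon hb hJ.nonneg j).mul_const (F (b 0) y)
    simp only [HarmonicHeatFlow.partialB, Function.update_of_ne (Ne.symm hj), h1.deriv]
    rw [hJ.range j hj hr]; simp
  | add hS hS' ih ih' =>
    have := ((hasDerivAt h𝒦 hS hb hy j).fun_add (hasDerivAt h𝒦 hS' hb hy j)).deriv
    rwa [ih, ih', add_zero] at this
  | congr _ he ih =>
    exact (partialB_congr hb (fun b hb => he b hb y hy) j).symm.trans ih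

end HomSum

/-- The components of the vector field `b_i' = -(2i - 1 + c) b_1 b_i + b_{i+1}`. -/
noncomputable def field (c : ℝ → ℝ) (b : Par L) (j : Fin L) : ℝ :=
  -((2 * ((j : ℕ) + 1 : ℝ) - 1 + c (b 0)) * b 0 * b j) + coord b (↑j + 2)

/-- The derivative along the vector field. -/
noncomputable def vecX (c : ℝ → ℝ) (S : Par L → ℝ → ℝ) (b : Par L) (y : ℝ) : ℝ :=
  ∑ j, field c b j * partialB j S b y

theorem coord_one (b : Par L) : coord b 1 = b 0 := by
  have : 1 ≤ L := NeZero.one_le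
  simp only [coord, le_refl, true_and, this, dite_true]; rfl

theorem coord_succ (b : Par L) (j : Fin L) : coord b (↑j + 1) = b j := by
  have : (j : ℕ) + 1 ≤ L := j.2
  simp [coord, this]

theorem coord_of_lt (b : Par L) {k : ℕ} (hk : L < k) : coord b k = 0 := by
  rw [coord, dif_neg (by omega)]

theorem HomSum.vecX {𝒦 : (ℝ → ℝ → ℝ) → Prop} {d : ℤ} {r : ℕ} {S : Par L → ℝ → ℝ} {b0 : ℝ}
    (h𝒦 : CoefClass b0 𝒦) (hS : HomSum 𝒦 d r S) (hr : 1 ≤ r) {c : ℝ → ℝ} (hc : Coef b0 c) :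
    HomSum 𝒦 (d + 1) (r + 1) (vecX c S) := by
  refine SumOf.sum _ fun j _ => ?_
  by_cases hj : j ≠ 0 ∧ r < (j : ℕ) + 1
  · exact HomSum.zero.congr fun b hb y hy => by
      rw [hS.partialB_eq_zero h𝒦 hj.1 hj.2 hb hy, mul_zero]
  have hj' : j = 0 ∨ (j : ℕ) + 1 ≤ r := by
    by_cases h : j = 0
    · exact Or.inl h
    · right; by_contra hc; exact hj ⟨h, by omega⟩
  have hp := hS.partialB h𝒦 j
  have h1 := ((hp.mul_coord (r' := r + 1) j (by omega) (hj'.imp id fun h => by omega)).mul_coord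
    (r' := r + 1) 0 le_rfl (Or.inl rfl)).coef_mul
      (k := fun b _ => -1 * ((2 * ((j : ℕ) + 1 : ℝ) - 1) + c b))
      (fun F hF => h𝒦.coef_mul _ F (((Coef.const _).add hc).const_mul (-1)) hF)
  have e1 : d - (↑j + 1) + (↑j + 1) + (((0 : Fin L) : ℕ) + 1) = d + 1 := by simp
  rw [e1] at h1
  by_cases hL : (j : ℕ) + 1 < L
  · have h2 := hp.mul_coord (r' := r + 1) ⟨(j : ℕ) + 1, hL⟩ (by omega) (Or.inr (by
      rcases hj' with h | h
      · subst h; simpa using hr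
      · simpa using h))
    have e2 : d - (↑j + 1) + ((((⟨(j : ℕ) + 1, hL⟩ : Fin L) : ℕ) : ℤ) + 1) = d + 1 := by
      push_cast; ring
    rw [e2] at h2
    refine (h1.add h2).congr fun b hb y hy => ?_
    have := coord_succ b ⟨(j : ℕ) + 1, hL⟩
    simp only at this
    rw [field, this]; ring
  · refine h1.congr fun b hb y hy => ?_
    rw [field, coord_of_lt b (by omega)]; ring

end


/-! ### Homogeneous parts of the powers of a series -/

/-- The part of degree `d` of `(∑ u_i)^m`, where `u_i` has degree `i`. -/
noncomputable def pw (u : ℕ → ℝ) : ℕ → ℕ → ℝ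
  | 0, d => if d = 0 then 1 else 0
  | m + 1, d => ∑ i ∈ Finset.range (d + 1), u i * pw u m (d - i)

theorem pw_succ (u : ℕ → ℝ) (m d : ℕ) :
    pw u (m + 1) d = ∑ i ∈ Finset.range (d + 1), u i * pw u m (d - i) := rfl

theorem pw_congr {u v : ℕ → ℝ} (m : ℕ) : ∀ d, (∀ i ≤ d, u i = v i) → pw u m d = pw v m d := by
  induction m with
  | zero => exact fun _ _ => rfl
  | succ m ih =>
    intro d h
    rw [pw_succ, pw_succ]
    refine sum_congr rfl fun i hi => ?_
    have hi := mem_range.mp hi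
    rw [h i (by omega), ih (d - i) fun j hj => h j (by omega)]

theorem pw_succ_zero {u : ℕ → ℝ} (h0 : u 0 = 0) (m : ℕ) : pw u (m + 1) 0 = 0 := by
  simp [pw_succ, h0]

theorem pw_congr_of_lt {u v : ℕ → ℝ} (hu : u 0 = 0) (hv : v 0 = 0) (m : ℕ) {d : ℕ}
    (h : ∀ i < d, u i = v i) : pw u (m + 2) d = pw v (m + 2) d := by
  rw [pw_succ, pw_succ]
  refine sum_congr rfl fun i hi => ?_
  have hi := mem_range.mp hi
  rcases Nat.eq_zero_or_pos i with rfl | hi0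
  · rw [hu, hv, zero_mul, zero_mul]
  · rcases (Nat.lt_succ_iff.mp hi).eq_or_lt with rfl | hlt
    · rw [Nat.sub_self, pw_succ_zero hu, pw_succ_zero hv, mul_zero, mul_zero]
    · rw [h i hlt, pw_congr (m + 1) (d - i) fun j hj => h j (by omega)]

theorem sum_pow_eq_sum_pw {u : ℕ → ℝ} {n : ℕ} (hu : ∀ i, n < i → u i = 0) (m : ℕ) :
    (∑ i ∈ Finset.range (n + 1), u i) ^ m = ∑ d ∈ Finset.range (m * n + 1), pw u m d := by
  set P : Polynomial ℝ := ∑ i ∈ Finset.range (n + 1), Polynomial.C (u i) * Polynomial.X ^ i with hP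
  have hc : ∀ i, P.coeff i = u i := by
    intro i; simp only [hP, Polynomial.finsetSum_coeff, Polynomial.coeff_C_mul_X_pow]
    rw [Finset.sum_ite_eq]
    split_ifs with h
    · rfl
    · rw [hu i]; simpa using h
  have hcm : ∀ m d, (P ^ m).coeff d = pw u m d := by
    intro m
    induction m with
    | zero => intro d; simp [pw, Polynomial.coeff_one]
    | succ m ih =>
      intro d
      rw [pow_succ', Polynomial.coeff_mul, Finset.Nat.sum_antidiagonal_eq_sum_range_succ
        (fun i j => P.coeff i * (P ^ m).coeff j), pw_succ]
      simp only [hc, ih]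
  have hdeg : P.natDegree ≤ n := by
    rw [Polynomial.natDegree_le_iff_coeff_eq_zero]
    intro i hi; rw [hc, hu i hi]
  have h1 : (P ^ m).eval 1 = (∑ i ∈ Finset.range (n + 1), u i) ^ m := by
    rw [Polynomial.eval_pow, hP, Polynomial.eval_finset_sum]; simp
  rw [← h1, Polynomial.eval_eq_sum_range' (n := m * n + 1)]
  · simp [hcm]
  · exact Nat.lt_succ_of_le ((Polynomial.natDegree_pow_le).trans (Nat.mul_le_mul_left m hdeg))

section
variable {L : ℕ} [NeZero L] {b0 : ℝ} {U : ℕ → Par L → ℝ → ℝ}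

theorem homSum_pw (h0 : ∀ b y, U 0 b y = 0) (D : ℕ)
    (hU : ∀ i, 1 ≤ i → i ≤ D → HomSum (Low b0 (2 * i + 1) (2 * i - 1)) i i (U i)) (m : ℕ) :
    ∀ d ≤ D, HomSum (Low b0 (2 * d + m) (2 * d - m)) d d fun b y => pw (fun i => U i b y) m d := by
  induction m with
  | zero =>
    intro d _
    rcases Nat.eq_zero_or_pos d with rfl | hd
    · have h1 : Low b0 (2 * 0 + 0) (2 * (0 : ℕ) - (0 : ℕ)) fun _ _ => 1 :=
        Low.of_fun ⟨fun _ => 1, contDiff_const, fun _ => rfl, fun y => by simp⟩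
          (by simpa using SymInf.const 1)
      refine (HomSum.term MonOK.zero h1).congr fun b _ y _ => ?_
      simp [pw, mon]
    · exact HomSum.zero.congr fun b _ y _ => by simp [pw, hd.ne']
  | succ m ih =>
    intro d hd; simp only [pw_succ]
    refine SumOf.sum _ fun i hi => ?_
    have hi := Nat.lt_succ_iff.mp (mem_range.mp hi)
    rcases Nat.eq_zero_or_pos i with rfl | hi0
    · exact HomSum.zero.congr fun b _ y _ => by rw [h0, zero_mul]
    · obtain ⟨k, rfl⟩ := Nat.exists_eq_add_of_le hi
      have := (hU i hi0 (by omega)).mul (ih k (by omega)) (r'' := i + k) (by omega) (by omega)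
        (𝒦'' := Low b0 (2 * (i + k) + (m + 1)) (2 * ((i + k : ℕ) : ℤ) - ((m + 1 : ℕ) : ℤ)))
        fun F F' hF hF' => by
          have := hF.mul hF'
          rw [show 2 * i + 1 + (2 * k + m) = 2 * (i + k) + (m + 1) by ring,
            show (2 * (i : ℤ) - 1 + (2 * k - m)) = 2 * ((i + k : ℕ) : ℤ) - ((m + 1 : ℕ) : ℤ) by
              push_cast; ring] at this
          exact this
      rw [Nat.add_sub_cancel_left]; push_cast at this ⊢; exact this

theorem homSum_pw_of_lt (h0 : ∀ b y, U 0 b y = 0) (D : ℕ)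
    (hU : ∀ i, 1 ≤ i → i ≤ D → HomSum (Low b0 (2 * i + 1) (2 * i - 1)) i i (U i)) (m : ℕ) :
    HomSum (Low b0 (2 * (D + 1) + (m + 2)) (2 * (D + 1) - (m + 2))) (D + 1) D
      fun b y => pw (fun i => U i b y) (m + 2) (D + 1) := by
  simp only [pw_succ _ (m + 1) (D + 1)]
  refine SumOf.sum _ fun i hi => ?_
  have hi := Nat.lt_succ_iff.mp (mem_range.mp hi)
  rcases Nat.eq_zero_or_pos i with rfl | hi0
  · exact HomSum.zero.congr fun b _ y _ => by rw [h0, zero_mul]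
  · rcases hi.eq_or_lt with rfl | hlt
    · exact HomSum.zero.congr fun b _ y _ => by rw [Nat.sub_self, pw_succ_zero (h0 b y), mul_zero]
    obtain ⟨k, hk⟩ := Nat.exists_eq_add_of_le hi
    have := (hU i hi0 (by omega)).mul (homSum_pw h0 D hU (m + 1) k (by omega)) (r'' := D)
      (by omega) (by omega)
      (𝒦'' := Low b0 (2 * (D + 1) + (m + 2)) (2 * ((D : ℤ) + 1) - (m + 2)))
      fun F F' hF hF' => by
        have := hF.mul hF'
        rw [show 2 * i + 1 + (2 * k + (m + 1)) = 2 * (D + 1) + (m + 2) by rw [hk]; ring,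
          show (2 * (i : ℤ) - 1 + (2 * k - ((m + 1 : ℕ) : ℤ))) = 2 * ((D : ℤ) + 1) - (m + 2) by
            have : ((D : ℤ) + 1) = i + k := by exact_mod_cast hk
            rw [this]; push_cast; ring] at this
        exact this
    rw [show D + 1 - i = k by omega]
    have e : (i : ℤ) + k = D + 1 := by exact_mod_cast hk.symm
    rwa [e] at this

end

/-! ### The derivatives of the nonlinearity along `Q` -/

section
variable {g Q q : ℝ → ℝ}

theorem ZeroOrd.of_odd {u : ℝ → ℝ} (hu : Smooth u) (ho : ∀ y, u (-y) = -u y) : ZeroOrd 1 u := by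
  refine ⟨avg (fun _ => 1) (deriv u), contDiff_avg continuous_const (contDiff_infty_iff_deriv.mp hu).2,
    avg_neg_of_even (deriv_odd ho), fun y => ?_⟩
  have h0 : u 0 = 0 := by have := ho 0; simp at this; linarith
  have := sub_eq_mul_avg_deriv hu y
  rw [h0, sub_zero] at this
  rw [this, pow_one]

theorem Low.div_sq {b0 : ℝ} {s : ℕ} {n : ℤ} {F : ℝ → ℝ → ℝ} (hs : 1 ≤ s) (hF : Low b0 (s + 2) n F) :
    Low b0 s (n - 2) fun b y => F b y / y ^ 2 := by
  obtain ⟨p, r, h⟩ := hF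
  refine ⟨p, r, ?_⟩
  induction h with
  | zero => simpa using Sep.zero
  | @term h φ α β hh hφ =>
    obtain ⟨v, hv, hve, hφv⟩ := hφ.1
    have e : ∀ y, φ y / y ^ 2 = y ^ s * v y := fun y => by
      rw [hφv, pow_add]
      by_cases hy : y = 0
      · have : s ≠ 0 := by omega
        simp [hy, this]
      · field_simp
    have h2 : SymInf (n - 2) fun y => φ y / y ^ 2 :=
      ((SymInf.mul hφ.2.1 (SymInf.zpow (-2))).congr fun y _ => by
        rw [zpow_neg, div_eq_mul_inv]; norm_cast)
    have h1 : LowProf s (n - 2) (fun y => φ y / y ^ 2) α β := ⟨⟨v, hv, hve, e⟩, h2, hφ.2.2⟩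
    exact (Sep.term hh h1).congr (fun b _ y _ => by ring) (fun _ _ => rfl) fun _ _ => rfl
  | add _ _ ih ih' => simpa only [add_div] using ih.add ih'
  | congr _ h h' h'' ih => exact ih.congr (fun b hb y hy => by rw [h b hb y hy]) h' h''

theorem IsTargetProfile.contDiff_nonlin (hg : IsTargetProfile g) : Smooth (nonlin g) :=
  hg.smooth.mul hg.contDiff_deriv

theorem contDiff_iteratedDeriv {f : ℝ → ℝ} (hf : Smooth f) (m : ℕ) :
    Smooth (iteratedDeriv m f) := by
  induction m with
  | zero => simpa using hf
  | succ m ih => rw [iteratedDeriv_succ]; exact (contDiff_infty_iff_deriv.mp ih).2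

theorem IsTargetProfile.nonlin_neg (hg : IsTargetProfile g) (u : ℝ) :
    nonlin g (-u) = -nonlin g u := by
  simp only [nonlin, hg.odd, deriv_odd hg.odd]; ring

theorem IsTargetProfile.nonlin_periodic (hg : IsTargetProfile g) (u : ℝ) :
    nonlin g (u + 2 * π) = nonlin g u := by
  have h1 : deriv g (u + 2 * π) = deriv g u := by
    rw [← deriv_comp_add_const]
    congr 1; funext x; exact hg.periodic x
  simp only [nonlin, hg.periodic, h1]

theorem IsTargetProfile.iteratedDeriv_nonlin_neg (hg : IsTargetProfile g) (m : ℕ) (u : ℝ) :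
    iteratedDeriv m (nonlin g) (-u) = (-1) ^ (m + 1) * iteratedDeriv m (nonlin g) u := by
  have h1 := iteratedDeriv_comp_neg m (nonlin g) u
  rw [show (fun x => nonlin g (-x)) = fun x => -nonlin g x from funext hg.nonlin_neg,
    iteratedDeriv_fun_neg, smul_eq_mul] at h1
  rw [pow_succ]
  have h2 : ((-1 : ℝ) ^ m) * (-1) ^ m = 1 := by rw [← mul_pow]; simp
  calc _ = ((-1 : ℝ) ^ m * (-1) ^ m) * iteratedDeriv m (nonlin g) (-u) := by rw [h2, one_mul]
    _ = (-1) ^ m * (-iteratedDeriv m (nonlin g) u) := by rw [h1]; ring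
    _ = _ := by ring

theorem IsTargetProfile.iteratedDeriv_nonlin_pi (hg : IsTargetProfile g) {m : ℕ} (hm : Even m) :
    iteratedDeriv m (nonlin g) π = 0 := by
  have h1 : iteratedDeriv m (nonlin g) (-π + 2 * π) = iteratedDeriv m (nonlin g) (-π) := by
    have := congrFun (iteratedDeriv_comp_add_const m (nonlin g) (2 * π)) (-π)
    rw [show (fun x => nonlin g (x + 2 * π)) = nonlin g from funext hg.nonlin_periodic] at this
    exact this.symm
  rw [hg.iteratedDeriv_nonlin_neg, pow_succ, hm.neg_one_pow, show -π + 2 * π = π by ring] at h1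
  linarith

theorem IsExt.low_mul_nonlin (h : IsExt g Q q) {b0 : ℝ} {d m : ℕ} (hm : 2 ≤ m) {F : ℝ → ℝ → ℝ}
    (hF : Low b0 (2 * (d + 1) + m) (2 * (d + 1) - m) F) : Low b0 (2 * d + 1) (2 * d - 3)
      fun b y => iteratedDeriv m (nonlin g) (q y) / y ^ 2 * F b y := by
  have hF' : Low b0 (2 * d + m) (2 * d - m) fun b y => F b y / y ^ 2 := by
    have := Low.div_sq (b0 := b0) (s := 2 * d + m) (n := 2 * (d + 1) - m) (by omega) (by
      rw [show 2 * d + m + 2 = 2 * (d + 1) + m by ring]; exact hF)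
    rwa [show (2 * ((d : ℤ) + 1) - m - 2) = 2 * d - m by ring] at this
  have hs := contDiff_iteratedDeriv h.target.contDiff_nonlin m
  have hcomp : Smooth fun y => iteratedDeriv m (nonlin g) (q y) := hs.comp h.smooth
  have hD : ∀ z ∈ {z : Unit × ℝ | 1 ≤ z.2}, 1 ≤ z.2 := fun _ hz => hz
  rcases Nat.even_or_odd m with he | ho
  · obtain ⟨k, hk⟩ := he
    obtain ⟨G, hG, hGe⟩ := hadamard hs (h.target.iteratedDeriv_nonlin_pi ⟨k, hk⟩)
    have h1 : ZeroOrd 1 fun y => iteratedDeriv m (nonlin g) (q y) := ZeroOrd.of_odd hcomp fun y => by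
      rw [h.odd, h.target.iteratedDeriv_nonlin_neg, pow_succ, Even.neg_one_pow ⟨k, hk⟩]; ring
    have h2 : SymInf (-1) fun y => iteratedDeriv m (nonlin g) (q y) := by
      have := h.symOn_vanishing hD 1 hG
      simp only [pow_one, ← hGe] at this; exact SymTo.symInf this
    obtain ⟨l, rfl⟩ : ∃ l, k = l + 1 := ⟨k - 1, by omega⟩
    refine Low.congr (Low.mono (t := l + 1) (m := -1 + (2 * d - m)) ?_ ?_) (fun b _ y _ => ?_)
      (F := fun b y => iteratedDeriv m (nonlin g) (q y) * (F b y / y ^ 2))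
    · rw [show 2 * d + 1 + 2 * (l + 1) = 1 + (2 * d + m) by omega]; exact hF'.mul_fun h1 h2
    · omega
    · ring
  · obtain ⟨k, hk⟩ := ho
    have h1 : ZeroOrd 0 fun y => iteratedDeriv m (nonlin g) (q y) := ⟨_, hcomp, fun y => by
        beta_reduce
        rw [h.odd, h.target.iteratedDeriv_nonlin_neg, pow_succ, Odd.neg_one_pow ⟨k, hk⟩]; ring,
        fun y => by simp⟩
    have h2 : SymInf 0 fun y => iteratedDeriv m (nonlin g) (q y) :=
      SymTo.symInf (by simpa using h.symOn_comp (fun z hz => mem_one_le hz) hs)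
    refine Low.congr (Low.mono (t := k) (m := 0 + (2 * d - m)) ?_ ?_) (fun b _ y _ => ?_)
      (F := fun b y => iteratedDeriv m (nonlin g) (q y) * (F b y / y ^ 2))
    · rw [show 2 * d + 1 + 2 * k = 0 + (2 * d + m) by omega]; exact hF'.mul_fun h1 h2
    · omega
    · ring

end

/-! ### The recursion for the profiles -/

section
variable {L : ℕ} [NeZero L] {b0 : ℝ} {g Q q : ℝ → ℝ}

/-- The component of degree `i` of the perturbation: `b_i T_i + S_i`. -/
noncomputable def comp (q : ℝ → ℝ) (S : ℕ → Par L → ℝ → ℝ) (b : Par L) (y : ℝ) (i : ℕ) : ℝ :=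
  coord b i * ((-1) ^ i * (y * profV q i y)) + S i b y

/-- The part of degree `d` of the nonlinear term, for the Taylor polynomial of degree `n`. -/
noncomputable def nonlinPart (g q : ℝ → ℝ) (n : ℕ) (S : ℕ → Par L → ℝ → ℝ) (d : ℕ)
    (b : Par L) (y : ℝ) : ℝ :=
  ∑ m ∈ Finset.Icc 2 n, 1 / (m.factorial : ℝ) *
    (iteratedDeriv m (nonlin g) (q y) / y ^ 2 * pw (comp q S b y) m d)

theorem HomSum.lead_smooth {d r : ℕ} {D : ℤ} {S : Par L → ℝ → ℝ}
    (hS : HomSum (Lead b0 d) D r S) {b : Par L} (hb : 0 < b 0) {y : ℝ} (hy : 0 < y) :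
    SmoothAt (S b) y :=
  hS.smooth_right (fun T ⟨_, F, _, hF, e⟩ b hb y hy => e ▸
    contDiffAt_const.mul (hF.smooth_right hb hy)) hb hy

theorem HomSum.scal_right (hb0 : b0 ≤ 1 / 16) {d r : ℕ} {D : ℤ} {S : Par L → ℝ → ℝ}
    (hS : HomSum (Lead b0 d) D r S) : HomSum (Lead b0 d) D r fun b y => scal (S b) y := by
  have hy0 : ∀ u : ℝ → ℝ, scal u 0 = 0 := fun u => by simp [scal]
  induction hS with
  | zero => exact HomSum.zero.congr fun b _ y _ => by simp [scal]
  | of hT =>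
    obtain ⟨J, F, hJ, hF, rfl⟩ := hT
    refine (HomSum.term hJ (hF.scal_right hb0)).congr fun b hb y hy => ?_
    rcases hy.eq_or_lt with rfl | hy
    · rw [hy0, hy0, mul_zero]
    · rw [scal_const_mul_eq _ (hF.smooth_right hb hy)]
  | add hT hT' ih ih' =>
    refine (ih.add ih').congr fun b hb y hy => ?_
    rcases hy.eq_or_lt with rfl | hy
    · rw [hy0, hy0, hy0, add_zero]
    · rw [scal_add_eq (HomSum.lead_smooth hT hb hy) (HomSum.lead_smooth hT' hb hy)]
  | congr _ he ih =>
    refine ih.congr fun b hb y hy => ?_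
    rcases hy.eq_or_lt with rfl | hy
    · rw [hy0, hy0]
    · exact scal_congr (eventuallyEq_of_nonneg (he b hb) hy)

theorem HomSum.exists_inverse (h : IsExt g Q q) (hb0 : b0 ≤ 1 / 16) {d r : ℕ} {D : ℤ} (hd : 1 ≤ d)
    {S : Par L → ℝ → ℝ} (hS : HomSum (Lead b0 d) D r S) :
    ∃ S', HomSum (Lead b0 (d + 1)) D r S' ∧
      ∀ b : Par L, 0 < b 0 → ∀ y, 0 < y → opH g Q (S' b) y = S b y := by
  induction hS with
  | zero => exact ⟨_, HomSum.zero, fun b _ y _ => opH_zero y⟩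
  | of hS =>
    obtain ⟨J, F, hJ, hF, rfl⟩ := hS
    obtain ⟨F', hF', he⟩ := h.exists_lead_inverse hb0 hd hF
    exact ⟨_, HomSum.term hJ hF', fun b hb y hy => by
      rw [opH_const_mul _ _ (hF'.smooth_right hb hy), he _ hb y hy]⟩
  | add _ _ ih ih' =>
    obtain ⟨S', hS', he⟩ := ih
    obtain ⟨T', hT', he'⟩ := ih'
    exact ⟨_, hS'.add hT', fun b hb y hy => by
      rw [opH_add (hS'.lead_smooth hb hy) (hT'.lead_smooth hb hy), he b hb y hy, he' b hb y hy]⟩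
  | congr _ hc ih =>
    obtain ⟨S', hS', he⟩ := ih
    exact ⟨S', hS', fun b hb y hy => by rw [he b hb y hy, hc b hb y hy.le]⟩

/-- The right hand side of the recursion. -/
noncomputable def source (g q c : ℝ → ℝ) (n : ℕ) (S : ℕ → Par L → ℝ → ℝ) (d : ℕ)
    (b : Par L) (y : ℝ) : ℝ :=
  b 0 * coord b d * theta q c d (b 0) y + (b 0 * scal (S d b) y + vecX c (S d) b y)
    + nonlinPart g q n S (d + 1) b y

/-- The profiles `S_d`, up to degree `D`, without cut off. -/
structure IsProfiles (g Q q c : ℝ → ℝ) (b0 : ℝ) (n D : ℕ) (S : ℕ → Par L → ℝ → ℝ) : Prop where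
  zero : ∀ d, d < 2 ∨ D < d → S d = fun _ _ => 0
  homSum : ∀ d, 2 ≤ d → HomSum (Lead b0 d) d (d - 1) (S d)
  eq : ∀ d, 1 ≤ d → d < D → ∀ b : Par L, 0 < b 0 → ∀ y, 0 < y →
    opH g Q (S (d + 1) b) y = -source g q c n S d b y

theorem IsExt.homSum_linear (h : IsExt g Q q) (i : ℕ) (hi : 1 ≤ i) :
    HomSum (L := L) (Low b0 (2 * i + 1) (2 * i - 1)) i i fun b y =>
      coord b i * ((-1) ^ i * (y * profV q i y)) := by
  by_cases hL : i ≤ L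
  · obtain ⟨α, β, hP⟩ := h.profV_prof i hi
    have := HomSum.term (r := i) (MonOK.single (L := L) ⟨i - 1, by omega⟩ (Or.inr (by simp; omega)))
      (Low.of_fun (b0 := b0) hP.1 hP.2.symInf)
    have e : (((⟨i - 1, by omega⟩ : Fin L) : ℕ) : ℤ) + 1 = i := by simp only; omega
    rw [e] at this
    refine this.congr fun b _ y _ => ?_
    rw [mon_single, coord, dif_pos ⟨hi, hL⟩]
  · exact HomSum.zero.congr fun b _ y _ => by rw [coord_of_lt b (by omega), zero_mul]

theorem IsExt.homSum_comp (h : IsExt g Q q) {c : ℝ → ℝ} {n D : ℕ}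
    {S : ℕ → Par L → ℝ → ℝ} (hS : IsProfiles g Q q c b0 n D S) (i : ℕ) (hi : 1 ≤ i) :
    HomSum (Low b0 (2 * i + 1) (2 * i - 1)) i i fun b y => comp q S b y i := by
  refine (h.homSum_linear i hi).add ?_
  rcases lt_or_ge i 2 with hi2 | hi2
  · rw [hS.zero i (Or.inl hi2)]; exact HomSum.zero
  · exact (hS.homSum i hi2).mono (fun F hF => hF.low) (by omega)

theorem comp_zero {S : ℕ → Par L → ℝ → ℝ} (h0 : S 0 = fun _ _ => 0) (b : Par L) (y : ℝ) :
    comp q S b y 0 = 0 := by simp [comp, coord, h0]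

theorem IsExt.homSum_nonlinPart (h : IsExt g Q q) {c : ℝ → ℝ} {n D : ℕ}
    {S : ℕ → Par L → ℝ → ℝ} (hS : IsProfiles g Q q c b0 n D S) (d : ℕ) :
    HomSum (Low b0 (2 * d + 1) (2 * d - 3)) (d + 1) d (nonlinPart g q n S (d + 1)) := by
  refine SumOf.sum _ fun m hm => ?_
  obtain ⟨k, rfl⟩ := Nat.exists_eq_add_of_le' (Finset.mem_Icc.mp hm).1
  have h1 := homSum_pw_of_lt (U := fun i b y => comp q S b y i)
    (comp_zero (hS.zero 0 (Or.inl (by omega)))) d (fun i hi _ => h.homSum_comp hS i hi) k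
  have h2 := h1.coef_mul (𝒦' := Low b0 (2 * d + 1) (2 * d - 3)) (k := fun _ y => iteratedDeriv (k + 2) (nonlin g) (q y) / y ^ 2)
    fun F hF => h.low_mul_nonlin (m := k + 2) (by omega) (by exact_mod_cast hF)
  exact h2.coef_mul (k := fun _ _ => 1 / ((k + 2).factorial : ℝ)) fun F hF => hF.coef_mul (Coef.const _)

theorem IsExt.homSum_source (h : IsExt g Q q) (hb0 : b0 ≤ 1 / 16) {c : ℝ → ℝ} (hc : IsSpeed b0 c)
    {n D : ℕ} {S : ℕ → Par L → ℝ → ℝ} (hS : IsProfiles g Q q c b0 n D S) (d : ℕ)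
    (hd : 1 ≤ d) : HomSum (Lead b0 d) (d + 1) d (source g q c n S d) := by
  have hcc : Coef b0 c := ⟨hc.small.log_of_le hb0 (by omega), hc.scal⟩
  have h1 : HomSum (L := L) (Lead b0 d) (d + 1) d fun b y =>
      b 0 * coord b d * theta q c d (b 0) y := by
    by_cases hL : d ≤ L
    · have hJ := (MonOK.single (L := L) (r := d) ⟨d - 1, by omega⟩ (Or.inr (by simp; omega)))
      have := (HomSum.term hJ (h.lead_theta hb0 hc d hd)).mul_coord (r' := d) 0 le_rfl (Or.inl rfl)
      have e : (((⟨d - 1, by omega⟩ : Fin L) : ℕ) : ℤ) + 1 + (((0 : Fin L) : ℕ) + 1) = d + 1 := by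
        simp only [Fin.val_zero]; omega
      rw [e] at this
      refine this.congr fun b _ y _ => ?_
      rw [mon_single, coord, dif_pos ⟨hd, hL⟩]; ring
    · exact HomSum.zero.congr fun b _ y _ => by rw [coord_of_lt b (by omega)]; simp
  have h2 : HomSum (L := L) (Lead b0 d) (d + 1) d fun b y =>
      b 0 * scal (S d b) y + vecX c (S d) b y := by
    rcases lt_or_ge d 2 with hd2 | hd2
    · rw [hS.zero d (Or.inl hd2)]
      exact HomSum.zero.congr fun b _ y _ => by simp [scal, vecX, partialB]
    · have hSd := hS.homSum d hd2
      refine HomSum.add ?_ ?_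
      · have hs := hSd.scal_right hb0
        have := hs.mul_coord (r' := d) 0 (by omega) (Or.inl rfl)
        simpa using this
      · have := hSd.vecX (CoefClass.lead hb0 d) (by omega) hcc
        rwa [show d - 1 + 1 = d by omega] at this
  exact (h1.add h2).add ((h.homSum_nonlinPart hS d).mono (fun F hF => hF.lead) le_rfl)

theorem IsExt.exists_profiles (h : IsExt g Q q) (hb0 : b0 ≤ 1 / 16) {c : ℝ → ℝ} (hc : IsSpeed b0 c)
    (n D : ℕ) (hD : 1 ≤ D) : ∃ S : ℕ → Par L → ℝ → ℝ, IsProfiles g Q q c b0 n D S := by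
  induction D, hD using Nat.le_induction with
  | base => exact ⟨fun _ _ _ => 0, fun _ _ => rfl, fun _ _ => HomSum.zero, fun d h1 h2 => by omega⟩
  | succ D hD ih =>
    obtain ⟨S, hS⟩ := ih
    obtain ⟨T, hT, he⟩ := (h.homSum_source hb0 hc hS D hD).exists_inverse h hb0 hD
    have hT' : HomSum (Lead b0 (D + 1)) (D + 1) D fun b y => -1 * T b y :=
      hT.coef_mul (k := fun _ _ => -1) fun F hF => hF.coef_mul hb0 (Coef.const (-1))
    set S' := Function.update S (D + 1) fun b y => -1 * T b y with hS'
    have hne : ∀ d, d ≠ D + 1 → S' d = S d := fun d hd => Function.update_of_ne hd _ _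
    have hsrc : ∀ d, d ≤ D → source g q c n S' d = source g q c n S d := by
      intro d hd
      have h1 : S' d = S d := hne d (by omega)
      have h2 : nonlinPart g q n S' (d + 1) = nonlinPart g q n S (d + 1) := by
        funext b y
        refine sum_congr rfl fun m hm => ?_
        obtain ⟨k, rfl⟩ := Nat.exists_eq_add_of_le' (Finset.mem_Icc.mp hm).1
        have hz : S' 0 = fun _ _ => 0 := (hne 0 (by omega)).trans (hS.zero 0 (Or.inl (by omega)))
        rw [pw_congr_of_lt (comp_zero hz b y) (comp_zero (hS.zero 0 (Or.inl (by omega))) b y)]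
        intro i hi; simp only [comp, hne i (by omega)]
      funext b y; simp only [source, h1, h2]
    refine ⟨S', fun d hd => ?_, fun d hd => ?_, fun d hd1 hd2 b hb y hy => ?_⟩
    · rw [hne d (by omega)]; exact hS.zero d (by omega)
    · by_cases hd' : d = D + 1
      · subst hd'
        rw [hS', Function.update_self]; simpa using hT'
      · rw [hne d hd']; exact hS.homSum d hd
    · rw [hsrc d (by omega)]
      rcases Nat.lt_succ_iff_lt_or_eq.mp hd2 with hlt | rfl
      · rw [hne (d + 1) (by omega)]; exact hS.eq d hd1 hlt b hb y hy
      · rw [hS', Function.update_self]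
        rw [opH_const_mul _ _ (hT.lead_smooth hb hy), he b hb y hy]; ring

end


/-! ### Cut offs at the scale `B₀` -/

section
variable {χ : ℝ → ℝ}

/-- `((z ∂_z)^m χ) (√b y)`. -/
noncomputable def cutoff (χ : ℝ → ℝ) (m : ℕ) (b y : ℝ) : ℝ := (scal^[m] χ) (√b * y)

namespace IsCutoff
variable (hχ : IsCutoff χ)
include hχ

theorem contDiff_scal (m : ℕ) : Smooth (scal^[m] χ) := by
  induction m with
  | zero => exact hχ.smooth
  | succ m ih =>
    rw [Function.iterate_succ_apply']; exact contDiff_id.mul (contDiff_infty_iff_deriv.mp ih).2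

theorem scal_eq_of_lt_one (m : ℕ) {z : ℝ} (hz : z < 1) :
    (scal^[m] χ) z = if m = 0 then 1 else 0 := by
  induction m generalizing z with
  | zero => simpa using hχ.eq_one z hz.le
  | succ m ih =>
    have : scal^[m] χ =ᶠ[𝓝 z] fun _ => if m = 0 then 1 else 0 := by
      filter_upwards [gt_mem_nhds hz] with x hx using ih hx
    rw [Function.iterate_succ_apply', scal, this.deriv_eq]; simp

theorem scal_eq_of_two_lt (m : ℕ) {z : ℝ} (hz : 2 < z) : (scal^[m] χ) z = 0 := by
  induction m generalizing z with
  | zero => exact hχ.eq_zero z hz.le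
  | succ m ih =>
    have : scal^[m] χ =ᶠ[𝓝 z] fun _ => 0 := by filter_upwards [lt_mem_nhds hz] with x hx using ih hx
    rw [Function.iterate_succ_apply', scal, this.deriv_eq]; simp

theorem exists_scal_bound (m : ℕ) : ∃ C, 0 ≤ C ∧ ∀ z, 0 ≤ z →
    |(scal^[m] χ) z| ≤ C * if z ≤ 2 then 1 else 0 := by
  obtain ⟨C, hC0, hC⟩ := exists_abs_le_Icc (hχ.contDiff_scal m).continuous 0 2
  refine ⟨C, hC0, fun z hz => ?_⟩
  split_ifs with h
  · rw [mul_one]; exact hC z ⟨hz, h⟩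
  · rw [hχ.scal_eq_of_two_lt m (not_le.mp h)]; simp

theorem cutoff_eq_of_lt {m : ℕ} {b y : ℝ} (h : √b * y < 1) :
    cutoff χ m b y = if m = 0 then 1 else 0 := hχ.scal_eq_of_lt_one m h

theorem contDiff_cutoff (m : ℕ) (b : ℝ) : Smooth (cutoff χ m b) :=
  (hχ.contDiff_scal m).comp (contDiff_const.mul contDiff_id)

theorem contDiffAt_cutoff_left (m : ℕ) {b : ℝ} (hb : 0 < b) (y : ℝ) :
    SmoothAt (fun b => cutoff χ m b y) b :=
  (hχ.contDiff_scal m).contDiffAt.comp b ((Real.contDiffAt_sqrt hb.ne').mul contDiffAt_const)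

theorem contDiffOn_cutoff (m : ℕ) :
    ContDiffOn ℝ ∞ (fun z : ℝ × ℝ => cutoff χ m z.1 z.2) (Ioi 0 ×ˢ Ici 0) := fun z hz =>
  ((hχ.contDiff_scal m).contDiffAt.comp z (((Real.contDiffAt_sqrt (ne_of_gt hz.1)).comp z
    contDiffAt_fst).mul contDiffAt_snd)).contDiffWithinAt

theorem scal_cutoff (m : ℕ) (b y : ℝ) : scal (cutoff χ m b) y = cutoff χ (m + 1) b y := by
  have h1 : HasDerivAt (fun y : ℝ => √b * y) (√b) y := by
    simpa using (hasDerivAt_id y).const_mul (√b)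
  have h2 := ((hχ.contDiff_scal m).differentiable (by simp) (√b * y)).hasDerivAt.comp y h1
  have h3 : deriv (cutoff χ m b) y = _ := h2.deriv
  rw [cutoff, Function.iterate_succ_apply', scal, h3, scal]; ring

theorem scal_cutoff_left (m : ℕ) {b : ℝ} (hb : 0 < b) (y : ℝ) :
    scal (fun b => cutoff χ m b y) b = 1 / 2 * cutoff χ (m + 1) b y := by
  have h1 := (Real.hasDerivAt_sqrt hb.ne').mul_const y
  have h2 := ((hχ.contDiff_scal m).differentiable (by simp) (√b * y)).hasDerivAt.comp b h1
  have h3 : deriv (fun b => cutoff χ m b y) b = _ := h2.deriv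
  have hs : 0 < √b := sqrt_pos.mpr hb
  rw [cutoff, Function.iterate_succ_apply', scal, h3, scal]
  nth_rewrite 1 [← Real.mul_self_sqrt hb.le]
  field_simp

theorem symOn_cutoff (m : ℕ) : SymOn {z : ℝ × ℝ | 0 < z.1 ∧ 0 < z.2}
    (fun b y => if √b * y ≤ 2 then 1 else 0) (cutoff χ m) := by
  refine SymTo.of_scal_closed (fun m => cutoff χ m) (fun m => m + 1) (fun z hz => hz.2)
    (fun z _ => by split_ifs <;> simp) (fun m z _ => (hχ.contDiff_cutoff m z.1).contDiffAt)
    (fun m => ?_) (fun m z _ => Eventually.of_forall fun y => hχ.scal_cutoff m z.1 y) m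
  obtain ⟨C, hC, hb⟩ := hχ.exists_scal_bound m
  exact ⟨C, hC, fun z hz => hb _ (mul_nonneg (sqrt_nonneg _) hz.2.le)⟩

end IsCutoff

/-- Profiles of degree `d`, multiplied by cut offs at the scale `B₀`. -/
def Cut (b0 : ℝ) (χ : ℝ → ℝ) (d : ℕ) : (ℝ → ℝ → ℝ) → Prop :=
  SumOf (Ioi 0) fun f => ∃ F m, Lead b0 d F ∧ f = fun b y => F b y * cutoff χ m b y

variable {b0 : ℝ} {d : ℕ} {F G f : ℝ → ℝ → ℝ}

theorem Cut.term (hF : Lead b0 d F) (m : ℕ) : Cut b0 χ d fun b y => F b y * cutoff χ m b y :=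
  SumOf.of ⟨F, m, hF, rfl⟩

theorem Lead.contDiffOn (hF : Lead b0 d F) :
    ContDiffOn ℝ ∞ (fun z : ℝ × ℝ => F z.1 z.2) (Ioi 0 ×ˢ Ici 0) :=
  let ⟨_, _, h, _⟩ := hF; h.smooth_joint (fun _ h => h.smooth) fun _ _ _ h => h.contDiff

theorem Cut.contDiffOn (hχ : IsCutoff χ) (hf : Cut b0 χ d f) :
    ContDiffOn ℝ ∞ (fun z : ℝ × ℝ => f z.1 z.2) (Ioi 0 ×ˢ Ici 0) := by
  induction hf with
  | zero => exact contDiffOn_const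
  | of h =>
    obtain ⟨F, m, hF, rfl⟩ := h
    exact hF.contDiffOn.mul (hχ.contDiffOn_cutoff m)
  | add _ _ ih ih' => exact ih.add ih'
  | congr _ he ih => exact ih.congr fun z hz => (he z.1 hz.1 z.2 hz.2).symm

theorem Cut.smooth_left (hχ : IsCutoff χ) (hf : Cut b0 χ d f) {b y : ℝ} (hb : 0 < b) (hy : 0 ≤ y) :
    SmoothAt (fun b => f b y) b := by
  induction hf with
  | zero => exact contDiffAt_const
  | of h =>
    obtain ⟨F, m, hF, rfl⟩ := h
    exact (hF.smooth_left hb hy).mul (hχ.contDiffAt_cutoff_left m hb y)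
  | add _ _ ih ih' => exact ih.add ih'
  | congr _ he ih =>
    exact ih.congr_of_eventuallyEq (eventuallyEq_of_pos (fun b hb => (he b hb y hy).symm) hb)

theorem Cut.scal_left (hb0 : b0 ≤ 1 / 16) (hχ : IsCutoff χ) (hf : Cut b0 χ d f) :
    Cut b0 χ d fun b y => scal (fun b => f b y) b := by
  induction hf with
  | zero => exact SumOf.zero.congr fun b _ y _ => by simp [scal]
  | of h =>
    obtain ⟨F, m, hF, rfl⟩ := h
    refine ((Cut.term (hF.scal_left hb0) m).add (Cut.term (hF.coef_mul hb0 (Coef.const (1 / 2)))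
      (m + 1))).congr fun b hb y hy => ?_
    rw [scal_mul_eq (hF.smooth_left hb hy) (hχ.contDiffAt_cutoff_left m hb y),
      hχ.scal_cutoff_left m hb y]
    ring
  | add hf hf' ih ih' =>
    exact (ih.add ih').congr fun b hb y hy =>
      (scal_add_eq (Cut.smooth_left hχ hf hb hy) (Cut.smooth_left hχ hf' hb hy)).symm
  | congr _ he ih =>
    exact SumOf.congr ih fun b hb y hy =>
      scal_congr (eventuallyEq_of_pos (fun b hb => he b hb y hy) hb)

theorem CoefClass.cut (hb0 : b0 ≤ 1 / 16) (hχ : IsCutoff χ) (d : ℕ) : CoefClass b0 (Cut b0 χ d) :=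
  ⟨fun _ _ h h' => h.add h', fun h _ hh hf => hf.mul_left (fun b _ => h b)
    fun _ ⟨_, m, hF, e⟩ => e ▸ (Cut.term (hF.coef_mul hb0 hh) m).congr fun b _ y _ => by ring,
    fun _ hf => hf.scal_left hb0 hχ, fun _ hf _ _ hb hy => hf.smooth_left hχ hb hy⟩

end

/-! ### Symbol bounds -/

section
variable {χ : ℝ → ℝ} {b0 : ℝ} {d s : ℕ} {n : ℤ} {F f : ℝ → ℝ → ℝ}

/-- The size `(1 + |log (√b y)|) / |log b|`. -/
noncomputable def ell (b y : ℝ) : ℝ := (1 + |log (√b * y)|) / |log b|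

theorem ell_nonneg (b y : ℝ) : 0 ≤ ell b y := by unfold ell; positivity

theorem logw_one_eq (b : ℝ) : logw 1 b = 1 / |log b| := by simp [logw]

theorem logw_one_le_ell (b y : ℝ) : logw 1 b ≤ ell b y := by
  rw [logw_one_eq, ell]
  gcongr; linarith [abs_nonneg (log (√b * y))]

theorem Good.symOn (hb0 : b0 ≤ 1 / 16) {p q : ℝ → ℝ} (hg : Good b0 p q) :
    SymOn (strip b0) ell fun b y => p b * log y + q b := by
  obtain ⟨C, hC, hb⟩ := hg.balance
  obtain ⟨C', hC', hb'⟩ := hg.p_small.2.bound_zero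
  have hpos : ∀ z ∈ strip b0, 0 < z.2 := fun z hz => one_pos.trans_le hz.2
  refine SymTo.of_deriv (fun z hz => ?_) ⟨C + C', by positivity, fun z hz => ?_⟩
    (fun z _ => ell_nonneg _ _) ?_
  · exact (contDiffAt_const.mul (contDiffAt_log.mpr (hpos z hz).ne')).add contDiffAt_const
  · have hz0 := hpos z hz
    have h1 := hb z.1 hz.1
    have h2 := hb' ((), z.1) hz.1
    simp only at h2
    have hlog : log (√z.1 * z.2) = log z.2 - |log z.1| / 2 := by
      rw [log_mul (sqrt_pos.mpr hz.1.1).ne' hz0.ne', log_sqrt hz.1.1.le,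
        abs_of_neg (Real.log_neg hz.1.1 (by linarith [hz.1.2]))]
      ring
    have e : p z.1 * log z.2 + q z.1 = p z.1 * log (√z.1 * z.2)
        + (q z.1 + p z.1 * (|log z.1| / 2)) := by rw [hlog]; ring
    rw [e]
    have h3 : |p z.1| * |log (√z.1 * z.2)| ≤ C' * ell z.1 z.2 := by
      refine (mul_le_mul_of_nonneg_right h2 (abs_nonneg _)).trans ?_
      rw [mul_assoc]
      refine mul_le_mul_of_nonneg_left ?_ hC'
      rw [logw_one_eq, ell, div_mul_eq_mul_div, one_mul]
      gcongr; linarith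
    calc _ ≤ |p z.1 * log (√z.1 * z.2)| + |q z.1 + p z.1 * (|log z.1| / 2)| :=
          abs_add_le _ _
      _ ≤ C' * ell z.1 z.2 + C * ell z.1 z.2 := by
          rw [abs_mul]
          exact add_le_add h3 (h1.trans (mul_le_mul_of_nonneg_left (logw_one_le_ell _ _) hC))
      _ = _ := by ring
  · have h1 := ((SymTo.zpow hpos (-1)).coeff_mul p).weaken (w' := fun b y => ell b y / y) hC'
      (fun z hz => div_nonneg (ell_nonneg _ _) (hpos z hz).le) fun z hz => by
        have h2 := hb' ((), z.1) hz.1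
        rw [zpow_neg_one, ← div_eq_mul_inv, ← mul_div_assoc]
        exact div_le_div_of_nonneg_right (h2.trans (mul_le_mul_of_nonneg_left
          (logw_one_le_ell _ _) hC')) (hpos z hz).le
    refine h1.congr fun z hz => ?_
    filter_upwards [lt_mem_nhds (hpos z hz)] with y hy
    rw [(((Real.hasDerivAt_log (ne_of_gt hy)).const_mul (p z.1)).add_const (q z.1)).deriv,
      zpow_neg_one]

/-- The size of profiles of degree `d`. -/
noncomputable def leadW (d c : ℕ) (b y : ℝ) : ℝ :=
  y ^ (2 * d - 1 : ℤ) * ell b y + y ^ (2 * d - 3 : ℤ) * (1 + log y) ^ c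

theorem leadW_nonneg (d c : ℕ) (b : ℝ) {y : ℝ} (hy : 1 ≤ y) : 0 ≤ leadW d c b y :=
  add_nonneg (mul_nonneg (zpow_nonneg (by linarith) _) (ell_nonneg _ _)) (weight_nonneg _ _ hy)

theorem Lead.symOn (hb0 : b0 ≤ 1 / 16) (hF : Lead b0 d F) : ∃ c₀ : ℕ, ∀ c, c₀ ≤ c →
    SymOn (strip b0) (leadW d c) F := by
  obtain ⟨p, q, h, hg⟩ := hF
  have h' : Sep (CoefS b0 (logw 0)) (Expn (2 * d - 1)) F p q :=
    h.mono (fun _ h => h.1) fun _ _ _ h => h.2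
  obtain ⟨c₀, hc₀⟩ := h'.remainder
  refine ⟨c₀, fun c hc => ?_⟩
  have h1 := hc₀ c hc
  have h2 := (SymTo.zpow h1.pos (2 * d - 1)).mul (hg.symOn hb0)
  have h3 := (h1.of_le (w' := leadW d c) fun z hz => by
    rw [logw_zero, one_mul, leadW, show (2 * (d : ℤ) - 1 - 2) = 2 * d - 3 by ring]
    have := mul_nonneg (zpow_nonneg (h1.pos z hz).le (2 * d - 1 : ℤ)) (ell_nonneg z.1 z.2)
    linarith).add (h2.of_le fun z hz => by
      have := weight_nonneg (2 * d - 3) c hz.2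
      rw [leadW]; linarith)
  exact h3.congr fun z _ => Eventually.of_forall fun y => by beta_reduce; ring

theorem Low.symOn (hF : Low b0 s n F) : ∃ c₀ : ℕ, ∀ c, c₀ ≤ c →
    SymOn (strip b0) (fun _ y => y ^ n * (1 + log y) ^ c) F := by
  obtain ⟨p, q, h⟩ := hF
  have h' : Sep (CoefS b0 (logw 0)) (Expn (n + 2)) F (fun _ => 0) fun _ => 0 := by
    induction h with
    | zero => exact Sep.zero
    | term hh hφ =>
      have := hφ.2.1
      have h3 : Expn (n + 2) _ 0 0 := SymInf.expn (n := n + 2) (by simpa using this)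
      exact (Sep.term hh.1 h3).congr (fun _ _ _ _ => rfl) (fun _ _ => by simp) fun _ _ => by simp
    | add _ _ ih ih' => simpa using ih.add ih'
    | congr _ h h' h'' ih => exact ih.congr h (fun _ _ => rfl) fun _ _ => rfl
  obtain ⟨c₀, hc₀⟩ := h'.remainder
  refine ⟨c₀, fun c hc => ((hc₀ c hc).congr_weight fun z hz => ?_).congr fun z _ =>
    Eventually.of_forall fun y => by simp⟩
  rw [logw_zero, one_mul, add_sub_cancel_right]

theorem symOn_of_contDiff {P : Type} {D : Set (P × ℝ)} (hD : ∀ z ∈ D, z.2 ∈ Ioc (0 : ℝ) 1)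
    {v : ℝ → ℝ} (hv : Smooth v) : SymOn D (fun _ _ => 1) fun _ => v := by
  refine ⟨fun z hz => (hD z hz).1, fun _ _ => zero_le_one, fun _ _ => hv.contDiffAt, fun k _ => ?_⟩
  obtain ⟨C, hC0, hC⟩ := exists_abs_le_Icc (contDiff_iteratedDeriv hv k).continuous 0 1
  refine ⟨C, hC0, fun z hz => ?_⟩
  have h1 := hD z hz
  rw [mul_one]
  exact (mul_le_of_le_one_right (abs_nonneg _) (pow_le_one₀ h1.1.le h1.2)).trans
    (hC z.2 ⟨h1.1.le, h1.2⟩)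

theorem Low.symOn_zero (hF : Low b0 s n F) :
    SymOn {z : ℝ × ℝ | z.1 ∈ Ioo 0 b0 ∧ z.2 ∈ Ioc (0 : ℝ) 1} (fun _ y => y ^ s) F := by
  obtain ⟨p, q, h⟩ := hF
  have hp : ∀ z ∈ {z : ℝ × ℝ | z.1 ∈ Ioo 0 b0 ∧ z.2 ∈ Ioc (0 : ℝ) 1}, 0 < z.2 := fun z hz => hz.2.1
  induction h with
  | zero => exact SymTo.zero hp fun z hz => pow_nonneg (hp z hz).le _
  | @term h φ α β hh hφ =>
    obtain ⟨v, hv, -, hφv⟩ := hφ.1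
    obtain ⟨C, hC, hb⟩ := hh.1.2.bound_zero
    refine ((((SymTo.id hp).pow s).mul (symOn_of_contDiff (fun z hz => hz.2) hv)).coeff_mul
      h |>.weaken hC (fun z hz => pow_nonneg (hp z hz).le _) fun z hz => ?_).congr fun z _ =>
        Eventually.of_forall fun y => by beta_reduce; rw [hφv]
    have := hb ((), z.1) hz.1
    rw [mul_one]
    rw [logw_zero, mul_one] at this
    exact mul_le_mul_of_nonneg_right this (pow_nonneg (hp z hz).le _)
  | add _ _ ih ih' => exact ih.add ih'
  | congr _ h h' h'' ih =>
    exact ih.congr fun z hz => eventuallyEq_of_nonneg (h _ hz.1.1) (hp z hz)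

theorem one_add_log_pow_le (c : ℕ) : ∃ C, 0 ≤ C ∧ ∀ y : ℝ, 1 ≤ y → (1 + log y) ^ c ≤ C * y := by
  refine ⟨(2 * c + 1 : ℝ) ^ c * 1, by positivity, fun y hy => ?_⟩
  have hy0 : 0 < y := by linarith
  rcases Nat.eq_zero_or_pos c with rfl | hc
  · simpa using hy
  have hc' : (0 : ℝ) < c := by exact_mod_cast hc
  set t := y ^ (1 / (c : ℝ)) with ht
  have h1 : 1 ≤ t := Real.one_le_rpow hy (by positivity)
  have h2 : t ^ c = y := by rw [ht, ← rpow_natCast, ← Real.rpow_mul hy0.le]; field_simp; simp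
  have h3 : log y = c * log t := by rw [ht, Real.log_rpow hy0]; field_simp
  have h4 : log t ≤ t := (log_le_sub_one_of_pos (by linarith)).trans (by linarith)
  have h5 : 1 + log y ≤ (2 * c + 1) * t := by rw [h3]; nlinarith
  calc (1 + log y) ^ c ≤ ((2 * c + 1) * t) ^ c :=
        pow_le_pow_left₀ (by linarith [log_nonneg hy]) h5 c
    _ = _ := by rw [mul_pow, h2]; ring

theorem abs_log_le_of_le {b y : ℝ} (hb : 0 < b) (hb1 : b ≤ 1) (hy : 1 ≤ y)
    (h : 1 / 2 ≤ √b * y) : |log b| ≤ 2 * (1 + log y) := by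
  have hs : 0 < √b := sqrt_pos.mpr hb
  have h1 : log (1 / 2) ≤ log (√b * y) := log_le_log (by norm_num) h
  rw [log_mul hs.ne' (by linarith), log_sqrt hb.le, one_div, log_inv] at h1
  rw [abs_of_nonpos (log_nonpos hb.le hb1)]
  have := Real.log_two_lt_d9
  linarith

/-- At the scale `B₀`, profiles are smaller by a factor `|log b|`. -/
theorem exists_leadW_le (hb0 : b0 ≤ 1 / 16) (d c : ℕ) : ∃ C, 0 ≤ C ∧ ∀ b ∈ Ioo 0 b0, ∀ y, 1 ≤ y →
    1 / 2 ≤ √b * y → √b * y ≤ 2 →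
    leadW d c b y ≤ C * (y ^ (2 * d - 1 : ℤ) * logw 1 b) := by
  obtain ⟨C, hC, hb⟩ := one_add_log_pow_le (c + 1)
  refine ⟨2 + 2 * C, by positivity, fun b hbb y hy h1 h2 => ?_⟩
  have hy0 : 0 < y := by linarith
  have hn := zpow_nonneg hy0.le (2 * d - 1 : ℤ)
  have hl := one_le_abs_log hb0 hbb
  have hL := abs_log_le_of_le hbb.1 (by linarith [hbb.2]) hy h1
  have h3 : ell b y ≤ 2 * logw 1 b := by
    rw [ell, logw_one_eq, ← mul_div_assoc]
    have hz : 0 < √b * y := by linarith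
    have : |log (√b * y)| ≤ 1 := by
      rw [abs_le]
      have ha : log (1 / 2) ≤ log (√b * y) := log_le_log (by norm_num) h1
      have hb : log (√b * y) ≤ log 2 := log_le_log hz h2
      rw [one_div, log_inv] at ha
      have := Real.log_two_lt_d9
      constructor <;> linarith
    gcongr; linarith
  have h4 : y ^ (2 * d - 3 : ℤ) * (1 + log y) ^ c ≤ y ^ (2 * d - 1 : ℤ) * (2 * C * logw 1 b) := by
    rw [show (2 * d - 3 : ℤ) = (2 * d - 1) + (-2) by ring, zpow_add₀ hy0.ne', mul_assoc]
    refine mul_le_mul_of_nonneg_left ?_ hn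
    have h5 := hb y hy
    have h6 : |log b| * (1 + log y) ^ c ≤ 2 * C * y ^ 2 := by
      calc _ ≤ 2 * (1 + log y) * (1 + log y) ^ c := by
            gcongr; exact pow_nonneg (by linarith [log_nonneg hy]) _
        _ = 2 * (1 + log y) ^ (c + 1) := by ring
        _ ≤ 2 * (C * y) := by linarith
        _ ≤ 2 * C * y ^ 2 := by
            have : y ≤ y ^ 2 := by nlinarith
            have := mul_le_mul_of_nonneg_left this hC
            linarith
    have e : y ^ (-2 : ℤ) = (y ^ 2)⁻¹ := by rw [zpow_neg]; norm_cast
    rw [e, logw_one_eq, inv_mul_le_iff₀ (by positivity), mul_one_div, ← mul_div_assoc,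
      le_div_iff₀ (by positivity)]
    linarith
  calc leadW d c b y ≤ y ^ (2 * d - 1 : ℤ) * (2 * logw 1 b)
        + y ^ (2 * d - 1 : ℤ) * (2 * C * logw 1 b) :=
        add_le_add (mul_le_mul_of_nonneg_left h3 hn) h4
    _ = _ := by ring

/-- The size of cut off profiles. -/
noncomputable def cutW (d : ℕ) (b y : ℝ) : ℝ :=
  y ^ (2 * d - 1 : ℤ) * logw 1 b * if √b * y ≤ 2 then 1 else 0

theorem cutW_nonneg (d : ℕ) (b : ℝ) {y : ℝ} (hy : 0 ≤ y) : 0 ≤ cutW d b y :=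
  mul_nonneg (mul_nonneg (zpow_nonneg hy _) (logw_nonneg _ _)) (by split_ifs <;> simp)

theorem Cut.symOn (hb0 : b0 ≤ 1 / 16) (hχ : IsCutoff χ) (hf : Cut b0 χ d f) :
    SymOn {z : ℝ × ℝ | z.1 ∈ Ioo 0 b0 ∧ 1 ≤ z.2 ∧ 1 / 2 ≤ √z.1 * z.2} (cutW d) f := by
  refine SumOf.symOn hf (fun z hz => hz.1.1) (fun z hz => one_pos.trans_le hz.2.1)
    (fun z hz => cutW_nonneg _ _ (zero_le_one.trans hz.2.1)) ?_
  rintro _ ⟨F, m, hF, rfl⟩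
  obtain ⟨c, hc⟩ := hF.symOn hb0
  obtain ⟨C, hC, hb⟩ := exists_leadW_le hb0 d c
  have h1 := ((hc c le_rfl).mono_set (D' := {z : ℝ × ℝ | z.1 ∈ Ioo 0 b0 ∧ 1 ≤ z.2 ∧
    1 / 2 ≤ √z.1 * z.2}) fun z hz => ⟨hz.1, hz.2.1⟩).mul ((hχ.symOn_cutoff m).mono_set
      fun z hz => ⟨hz.1.1, one_pos.trans_le hz.2.1⟩)
  refine h1.weaken hC (fun z hz => cutW_nonneg _ _ (zero_le_one.trans hz.2.1)) fun z hz => ?_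
  rw [cutW]
  split_ifs with h
  · rw [mul_one, mul_one]; exact hb z.1 hz.1 z.2 hz.2.1 hz.2.2 h
  · simp

end

section
variable {L : ℕ} [NeZero L]

/-- The parameters `b` under the a priori bounds `|b_k| ≤ K b_1^k`. -/
def parSet (L : ℕ) [NeZero L] (b0 K : ℝ) : Set (Par L) :=
  {b | b 0 ∈ Ioo 0 b0 ∧ ∀ k : Fin L, k ≠ 0 → |b k| ≤ K * b 0 ^ ((k : ℕ) + 1)}

theorem prod_zpow_eq {ι : Type*} (s : Finset ι) {a : ℝ} (ha : a ≠ 0) (f : ι → ℤ) :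
    ∏ i ∈ s, a ^ f i = a ^ ∑ i ∈ s, f i := by
  classical
  induction s using Finset.induction_on with
  | empty => simp
  | insert i s hi ih => rw [Finset.prod_insert hi, sum_insert hi, zpow_add₀ ha, ih]

theorem exists_mon_bound {b0 K : ℝ} (hK : 0 ≤ K) {d : ℤ} {r : ℕ} {J : Fin L → ℤ} (hJ : MonOK d r J) :
    ∃ C, 0 ≤ C ∧ ∀ b ∈ parSet L b0 K, |mon b J| ≤ C * b 0 ^ d := by
  refine ⟨∏ k : Fin L, if k = 0 then 1 else K ^ J k, Finset.prod_nonneg fun k _ => by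
    split_ifs
    · exact zero_le_one
    · exact zpow_nonneg hK _, fun b hb => ?_⟩
  have hp0 : 0 < b 0 := hb.1.1
  rw [mon, Finset.abs_prod, ← hJ.degree, ← prod_zpow_eq _ hp0.ne', ← Finset.prod_mul_distrib]
  refine Finset.prod_le_prod (fun _ _ => abs_nonneg _) fun k _ => ?_
  rw [abs_zpow]
  split_ifs with hk
  · rw [hk, abs_of_pos hp0]; simp
  · have h1 := hb.2 k hk
    obtain ⟨n, hn⟩ := Int.eq_ofNat_of_zero_le (hJ.nonneg k hk)
    rw [hn, zpow_mul, ← mul_zpow]; simp only [zpow_natCast]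
    exact pow_le_pow_left₀ (abs_nonneg _) (by exact_mod_cast h1) n

theorem HomSum.symOn {𝒦 : (ℝ → ℝ → ℝ) → Prop} {d : ℤ} {r : ℕ} {S : Par L → ℝ → ℝ}
    (hS : HomSum 𝒦 d r S) {b0 K : ℝ} (hK : 0 ≤ K) {D : Set (ℝ × ℝ)} {w : ℕ → ℝ → ℝ → ℝ}
    (hD : ∀ z ∈ D, z.1 ∈ Ioo 0 b0 ∧ 0 < z.2) (hw : ∀ c, ∀ z ∈ D, 0 ≤ w c z.1 z.2)
    (h : ∀ F, 𝒦 F → ∃ c₀ : ℕ, ∀ c, c₀ ≤ c → SymOn D (w c) F) : ∃ c₀ : ℕ, ∀ c, c₀ ≤ c →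
    SymOn {z : Par L × ℝ | z.1 ∈ parSet L b0 K ∧ (z.1 0, z.2) ∈ D}
      (fun b y => b 0 ^ d * w c (b 0) y) S := by
  have hp : ∀ z ∈ {z : Par L × ℝ | z.1 ∈ parSet L b0 K ∧ (z.1 0, z.2) ∈ D}, 0 < z.2 :=
    fun z hz => (hD _ hz.2).2
  have hw' : ∀ c, ∀ z ∈ {z : Par L × ℝ | z.1 ∈ parSet L b0 K ∧ (z.1 0, z.2) ∈ D},
      0 ≤ z.1 0 ^ d * w c (z.1 0) z.2 := fun c z hz =>
    mul_nonneg (zpow_nonneg hz.1.1.1.le _) (hw c _ hz.2)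
  induction hS with
  | zero => exact ⟨0, fun c _ => SymTo.zero hp (hw' c)⟩
  | of hS =>
    obtain ⟨J, F, hJ, hF, rfl⟩ := hS
    obtain ⟨c₀, hc₀⟩ := h F hF
    obtain ⟨C, hC, hb⟩ := exists_mon_bound (b0 := b0) hK hJ
    refine ⟨c₀, fun c hc => ?_⟩
    have h1 := (((hc₀ c hc).comp_param (fun b : Par L => b 0)).mono_set
      (D' := {z : Par L × ℝ | z.1 ∈ parSet L b0 K ∧ (z.1 0, z.2) ∈ D})
      fun z hz => hz.2).coeff_mul fun b => mon b J
    refine h1.weaken hC (hw' c) fun z hz => ?_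
    rw [← mul_assoc]; exact mul_le_mul_of_nonneg_right (hb z.1 hz.1) (hw c _ hz.2)
  | add _ _ ih ih' =>
    obtain ⟨c, hc⟩ := ih
    obtain ⟨c', hc'⟩ := ih'
    exact ⟨max c c', fun k hk => (hc k ((le_max_left _ _).trans hk)).add
      (hc' k ((le_max_right _ _).trans hk))⟩
  | congr _ he ih =>
    obtain ⟨c, hc⟩ := ih
    exact ⟨c, fun k hk => (hc k hk).congr fun z hz =>
      eventuallyEq_of_nonneg (he _ hz.1.1.1) (hp z hz)⟩

end


/-! ### Linearity of the suitable derivatives -/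

section
variable {g Q q : ℝ → ℝ}

theorem opA_congr {u v : ℝ → ℝ} {y : ℝ} (h : u =ᶠ[𝓝 y] v) : opA g Q u y = opA g Q v y := by
  simp only [opA, h.deriv_eq, h.eq_of_nhds]

theorem opAstar_congr {u v : ℝ → ℝ} {y : ℝ} (h : u =ᶠ[𝓝 y] v) :
    opAstar g Q u y = opAstar g Q v y := by
  simp only [opAstar, h.deriv_eq, h.eq_of_nhds]

theorem suitable_congr (k : ℕ) {u v : ℝ → ℝ} {y : ℝ} (h : u =ᶠ[𝓝 y] v) :
    suitable g Q k u =ᶠ[𝓝 y] suitable g Q k v := by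
  induction k with
  | zero => exact h
  | succ k ih =>
    filter_upwards [ih.eventuallyEq_nhds] with x hx
    simp only [suitable]
    split_ifs
    · exact opA_congr hx
    · exact opAstar_congr hx

theorem opA_add {u v : ℝ → ℝ} {y : ℝ} (hu : DifferentiableAt ℝ u y) (hv : DifferentiableAt ℝ v y) :
    opA g Q (fun y => u y + v y) y = opA g Q u y + opA g Q v y := by
  simp only [opA]; rw [deriv_fun_add hu hv]; ring

theorem opAstar_add {u v : ℝ → ℝ} {y : ℝ} (hu : DifferentiableAt ℝ u y)
    (hv : DifferentiableAt ℝ v y) :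
    opAstar g Q (fun y => u y + v y) y = opAstar g Q u y + opAstar g Q v y := by
  simp only [opAstar]; rw [deriv_fun_add hu hv]; ring

theorem IsExt.suitable_add (h : IsExt g Q q) {s : Set ℝ} (hso : IsOpen s) (hs : ∀ y ∈ s, 0 < y)
    {u v : ℝ → ℝ} (hu : ∀ y ∈ s, SmoothAt u y) (hv : ∀ y ∈ s, SmoothAt v y) (k : ℕ) :
    ∀ y ∈ s, suitable g Q k (fun y => u y + v y) y = suitable g Q k u y + suitable g Q k v y := by
  induction k with
  | zero => intro y _; rfl
  | succ k ih =>
    intro y hy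
    have he : suitable g Q k (fun y => u y + v y) =ᶠ[𝓝 y]
        fun y => suitable g Q k u y + suitable g Q k v y := by
      filter_upwards [hso.mem_nhds hy] with x hx using ih x hx
    have h1 := (h.contDiffAt_suitable (hs y hy) (hu y hy) k).differentiableAt (by simp)
    have h2 := (h.contDiffAt_suitable (hs y hy) (hv y hy) k).differentiableAt (by simp)
    simp only [suitable]
    split_ifs
    · rw [opA_congr he, opA_add h1 h2]
    · rw [opAstar_congr he, opAstar_add h1 h2]

end

/-! ### Expansions at infinity of the suitable derivatives -/

/-- `u = y^n (p log y + q)` up to symbols of size `w y^{n-2} (1 + log y)^c`, uniformly in `b`. -/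
structure ExpU (b0 : ℝ) (w : ℝ → ℝ) (c : ℕ) (n : ℤ) (u : ℝ → ℝ → ℝ) (p q : ℝ → ℝ) : Prop where
  sym : SymOn (strip b0) (fun b y => w b * (y ^ (n - 2) * (1 + log y) ^ c))
    (fun b y => u b y - y ^ n * (p b * log y + q b))
  p_le : ∃ C, 0 ≤ C ∧ ∀ b ∈ Ioo 0 b0, |p b| ≤ C * w b
  q_le : ∃ C, 0 ≤ C ∧ ∀ b ∈ Ioo 0 b0, |q b| ≤ C * w b

namespace ExpU
variable {b0 : ℝ} {w : ℝ → ℝ} {c : ℕ} {n : ℤ} {u : ℝ → ℝ → ℝ} {p q p' q' : ℝ → ℝ}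
  {g Q qq : ℝ → ℝ}

theorem lead_symOn (h : ExpU b0 w c n u p q) (hw : ∀ b, 0 ≤ w b) :
    SymOn (strip b0) (fun b y => w b * (y ^ n * (1 + log y)))
      (fun b y => y ^ n * (p b * log y + q b)) := by
  obtain ⟨C, hC, hp⟩ := h.p_le
  obtain ⟨C', hC', hq⟩ := h.q_le
  have hlog : ∀ z ∈ strip b0, 0 ≤ w z.1 * (1 + log z.2) :=
    fun z hz => mul_nonneg (hw _) (zero_le_one.trans (one_le_one_add_log hz.2))
  have h1 := ((SymTo.log (D := strip b0) fun z hz => hz.2).coeff_mul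
    p).weaken (w' := fun b y => w b * (1 + log y)) hC hlog fun z hz => by
      rw [← mul_assoc]
      exact mul_le_mul_of_nonneg_right (hp _ hz.1) (zero_le_one.trans (one_le_one_add_log hz.2))
  have h2 := (SymTo.coeff (n := ⊤) (D := strip b0) q h.sym.pos).weaken
    (w' := fun b y => w b * (1 + log y)) hC' hlog fun z hz => by
      refine (hq _ hz.1).trans (mul_le_mul_of_nonneg_left ?_ hC')
      exact le_mul_of_one_le_right (hw _) (one_le_one_add_log hz.2)
  exact ((SymTo.zpow h.sym.pos n).mul (h1.add h2)).congr_weight fun z _ => by ring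

theorem congr_coef (h : ExpU b0 w c n u p q) (hp : p = p') (hq : q = q') :
    ExpU b0 w c n u p' q' := hp ▸ hq ▸ h

theorem hasDerivAt_lead (n : ℤ) (p q : ℝ) {y : ℝ} (hy : 0 < y) :
    HasDerivAt (fun y : ℝ => y ^ n * (p * log y + q))
      (y ^ (n - 1) * (n * p * log y + (n * q + p))) y := by
  refine ((hasDerivAt_zpow n y (Or.inl hy.ne')).fun_mul
    (((Real.hasDerivAt_log hy.ne').const_mul p).add_const q)).congr_deriv ?_
  rw [zpow_sub_one₀ hy.ne']; ring

theorem step (h : ExpU b0 w c n u p q) (hw : ∀ b, 0 ≤ w b) (hc : 1 ≤ c) (hq : IsExt g Q qq)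
    {T : (ℝ → ℝ) → ℝ → ℝ} (σ τ : ℝ) (hT : ∀ {w u : ℝ → ℝ → ℝ}, SymOn (strip b0) w u →
      SymOn (strip b0) (fun b y => w b y / y) fun b => T (u b))
    (hadd : ∀ {u v : ℝ → ℝ} {y : ℝ}, DifferentiableAt ℝ u y → DifferentiableAt ℝ v y →
      T (fun y => u y + v y) y = T u y + T v y)
    (hlead : ∀ u y, 0 < y → T u y = σ * deriv u y + (τ + (deriv g (qq y) + 1)) * y⁻¹ * u y) :
    ExpU b0 w c (n - 1) (fun b => T (u b)) (fun b => (σ * n + τ) * p b)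
      (fun b => (σ * n + τ) * q b + σ * p b) := by
  obtain ⟨C, hC, hp⟩ := h.p_le
  obtain ⟨C', hC', hq'⟩ := h.q_le
  refine ⟨?_, ⟨|σ * n + τ| * C, by positivity, fun b hb => ?_⟩,
    ⟨|σ * n + τ| * C' + |σ| * C, by positivity, fun b hb => ?_⟩⟩
  · have hZ := hq.symOn_deriv_g (D := strip b0) fun z hz => hz.2
    have h1 := (hT h.sym).congr_weight
      (w' := fun b y => w b * (y ^ (n - 1 - 2) * (1 + log y) ^ c)) fun z hz => by
        have hz0 := h.sym.pos z hz
        rw [show n - 1 - 2 = n - 2 - 1 by ring, zpow_sub_one₀ hz0.ne' (n - 2)]; field_simp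
    have h2 := ((hZ.mul (SymTo.zpow h.sym.pos (-1))).mul (h.lead_symOn hw)).of_le
      (w' := fun b y => w b * (y ^ (n - 1 - 2) * (1 + log y) ^ c)) fun z hz => by
        have hz0 := h.sym.pos z hz
        have e : z.2 ^ (-2 : ℤ) * z.2 ^ (-1 : ℤ) * (w z.1 * (z.2 ^ n * (1 + log z.2)))
            = w z.1 * (z.2 ^ (n - 1 - 2) * (1 + log z.2) ^ 1) := by
          rw [show n - 1 - 2 = -2 + (-1) + n by ring, zpow_add₀ hz0.ne', zpow_add₀ hz0.ne']; ring
        rw [e]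
        refine mul_le_mul_of_nonneg_left (mul_le_mul_of_nonneg_left ?_
          (zpow_nonneg hz0.le _)) (hw _)
        exact pow_le_pow_right₀ (one_le_one_add_log hz.2) hc
    refine (h1.add h2).congr fun z hz => ?_
    have hz0 := h.sym.pos z hz
    filter_upwards [lt_mem_nhds hz0, eventually_differentiableAt (h.sym.smooth z hz)] with y hy hd
    have hy : 0 < y := hy
    have hl := hasDerivAt_lead n (p z.1) (q z.1) hy
    have e1 : u z.1 = fun y => (u z.1 y - y ^ n * (p z.1 * log y + q z.1))
        + y ^ n * (p z.1 * log y + q z.1) := by funext y; ring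
    have e2 : T (u z.1) y = T (fun y => u z.1 y - y ^ n * (p z.1 * log y + q z.1)) y
        + T (fun y => y ^ n * (p z.1 * log y + q z.1)) y := by
      conv_lhs => rw [e1]
      exact hadd hd hl.differentiableAt
    rw [e2, hlead (fun y => y ^ n * (p z.1 * log y + q z.1)) y hy, hl.deriv,
      zpow_sub_one₀ hy.ne', zpow_neg_one]
    ring
  · exact abs_mul_le _ (hp b hb)
  · refine (abs_add_le _ _).trans ?_
    exact (add_le_add (abs_mul_le _ (hq' b hb)) (abs_mul_le _ (hp b hb))).trans_eq (by ring)

/-- The suitable derivatives kill the leading terms of a profile of degree `d`: the logarithm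
after `2d` steps and the remaining power after `2d + 1` steps. -/
theorem suitable {d : ℕ} (hd : 1 ≤ d) (h : ExpU b0 w c (2 * d - 1) u p q) (hw : ∀ b, 0 ≤ w b)
    (hc : 1 ≤ c) (hq : IsExt g Q qq) (k : ℕ) : ∃ κ κ' : ℝ, (2 * d ≤ k → κ = 0) ∧
      (2 * d + 1 ≤ k → κ' = 0) ∧
      ExpU b0 w c (2 * d - 1 - k) (fun b => suitable g Q k (u b)) (fun b => κ * p b)
        (fun b => κ * q b + κ' * p b) := by
  induction k with
  | zero =>
    refine ⟨1, 0, fun h => by omega, fun _ => rfl, ?_⟩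
    simpa [HarmonicHeatFlow.suitable] using h
  | succ k ih =>
    obtain ⟨κ, κ', h1, h2, h3⟩ := ih
    have e : (2 * (d : ℤ) - 1 - (k + 1 : ℕ)) = 2 * d - 1 - k - 1 := by push_cast; ring
    by_cases hk : Even k
    · have := h3.step hw hc hq (T := opA g Q) (-1) (-1) hq.symOn_opA opA_add fun u y hy => by
        rw [opA, ← hq.eq y hy.le]; ring
      refine ⟨(-1 * ((2 * d - 1 - k : ℤ) : ℝ) + -1) * κ,
        (-1 * ((2 * d - 1 - k : ℤ) : ℝ) + -1) * κ' + -1 * κ, fun hk' => ?_, fun hk' => ?_, ?_⟩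
      · rw [h1 (by obtain ⟨l, rfl⟩ := hk; omega), mul_zero]
      · rw [h1 (by omega)]
        rcases (show 2 * d ≤ k by omega).eq_or_lt with hk2 | hk2
        · rw [← hk2]; push_cast; ring
        · rw [h2 (by omega)]; ring
      · rw [e]; simp only [HarmonicHeatFlow.suitable, if_pos hk]
        exact this.congr_coef (by funext b; ring) (by funext b; ring)
    · have := h3.step hw hc hq (T := opAstar g Q) 1 0 hq.symOn_opAstar opAstar_add fun u y hy => by
        rw [opAstar, ← hq.eq y hy.le]; ring
      refine ⟨(1 * ((2 * d - 1 - k : ℤ) : ℝ) + 0) * κ,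
        (1 * ((2 * d - 1 - k : ℤ) : ℝ) + 0) * κ' + 1 * κ, fun hk' => ?_, fun hk' => ?_, ?_⟩
      · rcases (show 2 * d - 1 ≤ k by omega).eq_or_lt with hk2 | hk2
        · have : (k : ℤ) = 2 * d - 1 := by omega
          rw [this]; simp
        · rw [h1 (by omega), mul_zero]
      · rw [h1 (by omega), h2 (by
          rcases Nat.not_even_iff_odd.mp hk with ⟨l, rfl⟩; omega)]; ring
      · rw [e]; simp only [HarmonicHeatFlow.suitable, if_neg hk]
        exact this.congr_coef (by funext b; ring) (by funext b; ring)

end ExpU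

/-- Profiles with a fixed power of the logarithm in the remainder. -/
def ProfC (c d : ℕ) (u : ℝ → ℝ) (α β : ℝ) : Prop := Prof d u α β ∧ SymOn (P := Unit) {z | 1 ≤ z.2}
    (fun _ y => y ^ (2 * d - 1 - 2 : ℤ) * (1 + log y) ^ c)
    (fun _ y => u y - y ^ (2 * d - 1 : ℤ) * (α * log y + β))

section
variable {𝒞 : (ℝ → ℝ) → Prop} {d : ℕ} {F : ℝ → ℝ → ℝ} {p q : ℝ → ℝ} {b0 : ℝ}

theorem Sep.exists_profC (hF : Sep 𝒞 (Prof d) F p q) :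
    ∃ c₀ : ℕ, ∀ c, c₀ ≤ c → Sep 𝒞 (ProfC c d) F p q := by
  induction hF with
  | zero => exact ⟨0, fun _ _ => Sep.zero⟩
  | term hh hφ =>
    obtain ⟨c₀, hc⟩ := SymInf.exists_of_le hφ.2
    exact ⟨c₀, fun c hc' => Sep.term hh ⟨hφ, hc c hc'⟩⟩
  | add _ _ ih ih' =>
    obtain ⟨c, hc⟩ := ih
    obtain ⟨c', hc'⟩ := ih'
    exact ⟨max c c', fun k hk => (hc k ((le_max_left _ _).trans hk)).add
      (hc' k ((le_max_right _ _).trans hk))⟩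
  | congr _ h h' h'' ih =>
    obtain ⟨c, hc⟩ := ih
    exact ⟨c, fun k hk => (hc k hk).congr h h' h''⟩

theorem Sep.expU {m c : ℕ} (hF : Sep (CoefS b0 (logw m)) (ProfC c d) F p q) :
    ExpU b0 (logw m) c (2 * d - 1) F p q := by
  obtain ⟨hp, hq⟩ := hF.coefS
  obtain ⟨C, hC, hb⟩ := hp.2.bound_zero
  obtain ⟨C', hC', hb'⟩ := hq.2.bound_zero
  refine ⟨?_, ⟨C, hC, fun b hbb => hb ((), b) hbb⟩, ⟨C', hC', fun b hbb => hb' ((), b) hbb⟩⟩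
  have hpos : ∀ z ∈ strip b0, 0 < z.2 := fun z hz => one_pos.trans_le hz.2
  have hw : ∀ z ∈ strip b0,
      0 ≤ logw m z.1 * (z.2 ^ (2 * d - 1 - 2 : ℤ) * (1 + log z.2) ^ c) := fun z hz =>
    mul_nonneg (logw_nonneg _ _) (weight_nonneg _ _ hz.2)
  clear hp hq hb hb'
  induction hF with
  | zero => exact (SymTo.zero hpos hw).congr fun z _ => Eventually.of_forall fun y => by simp
  | @term h φ α β hh hφ =>
    obtain ⟨C, hC, hb⟩ := hh.2.bound_zero
    have h1 := ((hφ.2.comp_param (fun _ : ℝ => ())).mono_set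
      (D' := strip b0) fun z hz => hz.2).coeff_mul h
    refine (h1.weaken hC hw fun z hz => ?_).congr fun z _ => Eventually.of_forall fun y => by
      beta_reduce; ring
    have := mul_le_mul_of_nonneg_right (hb ((), z.1) hz.1) (weight_nonneg (2 * d - 1 - 2) c hz.2)
    rwa [mul_assoc] at this
  | add _ _ ih ih' =>
    exact (ih.add ih').congr fun z _ => Eventually.of_forall fun y => by beta_reduce; ring
  | congr _ h h' h'' ih =>
    exact ih.congr fun z hz => eventuallyEq_of_nonneg (fun y hy => by
      rw [h _ hz.1.1 y hy, h' _ hz.1.1, h'' _ hz.1.1]) (hpos z hz)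

end

/-! ### The derivatives in `b₁` commute with those in `y` -/

/-- Joint smoothness for `b, y > 0`. -/
def JointSmooth (f : ℝ → ℝ → ℝ) : Prop :=
  ∀ b y, 0 < b → 0 < y → SmoothAt (fun z : ℝ × ℝ => f z.1 z.2) (b, y)

namespace JointSmooth
variable {f k : ℝ → ℝ → ℝ} {g Q q : ℝ → ℝ}

theorem of_contDiffOn (h : ContDiffOn ℝ ∞ (fun z : ℝ × ℝ => f z.1 z.2) (Ioi 0 ×ˢ Ici 0)) :
    JointSmooth f := fun _ _ hb hy =>
  h.contDiffAt (prod_mem_nhds (Ioi_mem_nhds hb) (Ici_mem_nhds hy))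

theorem add (hf : JointSmooth f) (hk : JointSmooth k) : JointSmooth fun b y => f b y + k b y :=
  fun b y hb hy => (hf b y hb hy).add (hk b y hb hy)

theorem neg (hf : JointSmooth f) : JointSmooth fun b y => -f b y :=
  fun b y hb hy => (hf b y hb hy).neg

theorem mul_fun (hf : JointSmooth f) {φ : ℝ → ℝ} (hφ : ∀ y, 0 < y → SmoothAt φ y) :
    JointSmooth fun b y => φ y * f b y :=
  fun b y hb hy => ((hφ y hy).comp (b, y) contDiffAt_snd).mul (hf b y hb hy)

theorem congr (hf : JointSmooth f) (h : ∀ b y, 0 < b → 0 < y → f b y = k b y) : JointSmooth k :=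
  fun b y hb hy => (hf b y hb hy).congr_of_eventuallyEq (by
    filter_upwards [prod_mem_nhds (Ioi_mem_nhds hb) (Ioi_mem_nhds hy)] with z hz
      using (h z.1 z.2 hz.1 hz.2).symm)

theorem left (hf : JointSmooth f) {b y : ℝ} (hb : 0 < b) (hy : 0 < y) :
    SmoothAt (fun b => f b y) b :=
  (hf b y hb hy).comp b (contDiffAt_id.prodMk contDiffAt_const)

theorem right (hf : JointSmooth f) {b y : ℝ} (hb : 0 < b) (hy : 0 < y) : SmoothAt (f b) y :=
  (hf b y hb hy).comp y (contDiffAt_const.prodMk contDiffAt_id)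

theorem deriv_right_eq (hf : JointSmooth f) {b y : ℝ} (hb : 0 < b) (hy : 0 < y) :
    deriv (f b) y = fderiv ℝ (fun z : ℝ × ℝ => f z.1 z.2) (b, y) (0, 1) := by
  have h1 : HasDerivAt (fun y : ℝ => (b, y)) ((0 : ℝ), (1 : ℝ)) y :=
    (hasDerivAt_const y b).prodMk (hasDerivAt_id y)
  exact (((hf b y hb hy).differentiableAt (by simp)).hasFDerivAt.comp_hasDerivAt y h1).deriv

theorem deriv_left_eq (hf : JointSmooth f) {b y : ℝ} (hb : 0 < b) (hy : 0 < y) :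
    deriv (fun b => f b y) b = fderiv ℝ (fun z : ℝ × ℝ => f z.1 z.2) (b, y) (1, 0) := by
  have h1 : HasDerivAt (fun b : ℝ => (b, y)) ((1 : ℝ), (0 : ℝ)) b :=
    (hasDerivAt_id b).prodMk (hasDerivAt_const b y)
  exact (((hf b y hb hy).differentiableAt (by simp)).hasFDerivAt.comp_hasDerivAt b h1).deriv

theorem fderiv_apply (hf : JointSmooth f) (v : ℝ × ℝ) :
    JointSmooth fun b y => fderiv ℝ (fun z : ℝ × ℝ => f z.1 z.2) (b, y) v := fun b y hb hy =>
  ((hf b y hb hy).fderiv_right (m := ∞) (by simp)).clm_apply contDiffAt_const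

theorem deriv_right (hf : JointSmooth f) : JointSmooth fun b => deriv (f b) :=
  (hf.fderiv_apply (0, 1)).congr fun _ _ hb hy => (hf.deriv_right_eq hb hy).symm

theorem deriv_left (hf : JointSmooth f) : JointSmooth fun b y => deriv (fun b => f b y) b :=
  (hf.fderiv_apply (1, 0)).congr fun _ _ hb hy => (hf.deriv_left_eq hb hy).symm

theorem deriv_comm (hf : JointSmooth f) {b y : ℝ} (hb : 0 < b) (hy : 0 < y) :
    deriv (fun b => deriv (f b) y) b = deriv (fun y => deriv (fun b => f b y) b) y := by
  have e1 : (fun b => deriv (f b) y) =ᶠ[𝓝 b]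
      fun b => fderiv ℝ (fun z : ℝ × ℝ => f z.1 z.2) (b, y) (0, 1) :=
    eventuallyEq_of_pos (fun b hb => hf.deriv_right_eq hb hy) hb
  have e2 : (fun y => deriv (fun b => f b y) b) =ᶠ[𝓝 y]
      fun y => fderiv ℝ (fun z : ℝ × ℝ => f z.1 z.2) (b, y) (1, 0) :=
    eventuallyEq_of_pos (fun y hy => hf.deriv_left_eq hb hy) hy
  rw [e1.deriv_eq, e2.deriv_eq, (hf.fderiv_apply (0, 1)).deriv_left_eq hb hy,
    (hf.fderiv_apply (1, 0)).deriv_right_eq hb hy]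
  have hd : DifferentiableAt ℝ (fderiv ℝ fun z : ℝ × ℝ => f z.1 z.2) (b, y) :=
    ((hf b y hb hy).fderiv_right (m := ∞) (by simp)).differentiableAt (by simp)
  have e3 : ∀ v w : ℝ × ℝ, fderiv ℝ (fun z : ℝ × ℝ => fderiv ℝ (fun z : ℝ × ℝ => f z.1 z.2) (z.1, z.2) v)
      (b, y) w = fderiv ℝ (fderiv ℝ fun z : ℝ × ℝ => f z.1 z.2) (b, y) w v := fun v w => by
    have := hd.hasFDerivAt.clm_apply (hasFDerivAt_const v (b, y))
    have h2 := this.fderiv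
    simp only [Prod.mk.eta]
    rw [h2]; simp
  rw [e3, e3]
  exact ((hf b y hb hy).isSymmSndFDerivAt (by simpa using (WithTop.coe_le_coe.mpr le_top : ((2 : ℕ∞) : WithTop ℕ∞) ≤ ((⊤ : ℕ∞) : WithTop ℕ∞)))).eq _ _

theorem opA (h : IsExt g Q q) (hf : JointSmooth f) : JointSmooth fun b => opA g Q (f b) := by
  have hZ : ∀ y, 0 < y → SmoothAt (fun y => deriv g (q y) / y) y := fun y hy =>
    (h.target.contDiff_deriv.comp h.smooth).contDiffAt.div contDiffAt_id hy.ne'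
  exact (hf.deriv_right.neg.add (hf.mul_fun hZ)).congr fun b y _ hy => by
    rw [HarmonicHeatFlow.opA, h.eq y hy.le]

theorem opAstar (h : IsExt g Q q) (hf : JointSmooth f) : JointSmooth fun b => opAstar g Q (f b) := by
  have hZ : ∀ y, 0 < y → SmoothAt (fun y => (1 + deriv g (q y)) / y) y := fun y hy =>
    (contDiff_const.add (h.target.contDiff_deriv.comp h.smooth)).contDiffAt.div contDiffAt_id hy.ne'
  exact (hf.deriv_right.add (hf.mul_fun hZ)).congr fun b y _ hy => by
    rw [HarmonicHeatFlow.opAstar, h.eq y hy.le]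

theorem suitable (h : IsExt g Q q) (hf : JointSmooth f) (k : ℕ) :
    JointSmooth fun b => suitable g Q k (f b) := by
  induction k with
  | zero => exact hf
  | succ k ih =>
    simp only [HarmonicHeatFlow.suitable]
    split_ifs
    · exact ih.opA h
    · exact ih.opAstar h

theorem scal_deriv_comm (hf : JointSmooth f) {b y : ℝ} (hb : 0 < b) (hy : 0 < y) :
    b * deriv (fun b => deriv (f b) y) b = deriv (fun y => scal (fun b => f b y) b) y := by
  rw [hf.deriv_comm hb hy]
  exact (deriv_const_mul b ((hf.deriv_left.right hb hy).differentiableAt (by simp))).symm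

theorem scal_suitable (h : IsExt g Q q) (hf : JointSmooth f) (k : ℕ) {b : ℝ} (hb : 0 < b) :
    ∀ y, 0 < y → scal (fun b => HarmonicHeatFlow.suitable g Q k (f b) y) b
      = HarmonicHeatFlow.suitable g Q k (fun y => scal (fun b => f b y) b) y := by
  induction k with
  | zero => intro y _; rfl
  | succ k ih =>
    intro y hy
    have hs := hf.suitable h k
    have he := eventuallyEq_of_pos ih hy
    have hd1 := (hs.deriv_right.left hb hy).differentiableAt (by simp)
    have hd2 := (hs.left hb hy).differentiableAt (by simp)
    simp only [HarmonicHeatFlow.suitable]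
    split_ifs
    · rw [← opA_congr he]; simp only [HarmonicHeatFlow.opA]
      rw [← hs.scal_deriv_comm hb hy]; simp only [scal]
      rw [deriv_fun_add hd1.fun_neg (hd2.const_mul _), deriv.fun_neg, deriv_const_mul _ hd2]; ring
    · rw [← opAstar_congr he]; simp only [HarmonicHeatFlow.opAstar]
      rw [← hs.scal_deriv_comm hb hy]; simp only [scal]
      rw [deriv_fun_add hd1 (hd2.const_mul _), deriv_const_mul _ hd2]; ring

end JointSmooth


/-! ### Taylor expansions at the origin -/

theorem exists_even_quotient {v : ℝ → ℝ} (hv : Smooth v) (he : ∀ y, v (-y) = v y) :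
    ∃ w : ℝ → ℝ, (Smooth w ∧ ∀ y, w (-y) = w y) ∧ ∀ y, v y = v 0 + y ^ 2 * w y := by
  have hd := (contDiff_infty_iff_deriv.mp hv).2
  obtain ⟨w, hw, hwe, hww⟩ := ZeroOrd.of_odd (contDiff_avg (ψ := fun _ => 1) continuous_const hd)
    (avg_neg_of_odd (deriv_even he))
  refine ⟨w, ⟨hw, hwe⟩, fun y => ?_⟩
  have := sub_eq_mul_avg_deriv hv y
  rw [hww] at this
  linear_combination this

theorem exists_even_taylor {v : ℝ → ℝ} (hv : Smooth v) (he : ∀ y, v (-y) = v y) :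
    ∃ (a : ℕ → ℝ) (w : ℕ → ℝ → ℝ), (∀ n, Smooth (w n)) ∧
      ∀ n y, v y = ∑ j ∈ Finset.range n, a j * y ^ (2 * j) + y ^ (2 * n) * w n y := by
  have hex : ∀ v : {v : ℝ → ℝ // Smooth v ∧ ∀ y, v (-y) = v y},
      ∃ w : {v : ℝ → ℝ // Smooth v ∧ ∀ y, v (-y) = v y}, ∀ y, v.1 y = v.1 0 + y ^ 2 * w.1 y :=
    fun v => let ⟨w, hw, h⟩ := exists_even_quotient v.2.1 v.2.2; ⟨⟨w, hw⟩, h⟩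
  choose σ hσ using hex
  refine ⟨fun n => (σ^[n] ⟨v, hv, he⟩).1 0, fun n => (σ^[n] ⟨v, hv, he⟩).1,
    fun n => (σ^[n] ⟨v, hv, he⟩).2.1, fun n y => ?_⟩
  induction n with
  | zero => simp
  | succ n ih =>
    rw [ih, sum_range_succ]
    beta_reduce
    rw [Function.iterate_succ_apply']
    have := hσ (σ^[n] ⟨v, hv, he⟩) y
    rw [this]; ring

theorem ZeroOrd.hasOddTaylor {d : ℕ} {u : ℝ → ℝ} (hu : ZeroOrd (2 * d + 1) u) : HasOddTaylor d u := by
  refine ⟨hu.contDiff.contDiffOn, ?_⟩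
  obtain ⟨v, hv, he, huv⟩ := hu
  obtain ⟨a, w, hw, hav⟩ := exists_even_taylor hv he
  refine ⟨fun k => a (k - d), fun p => ?_⟩
  rcases lt_or_ge p d with hp | hp
  · obtain ⟨K, -, hK⟩ := exists_abs_le_Icc hv.continuous 0 1
    refine ⟨K, fun y hy => ?_⟩
    rw [Finset.Icc_eq_empty (by omega), Finset.sum_empty, sub_zero, huv, abs_mul,
      abs_of_nonneg (pow_nonneg hy.1 _), mul_comm]
    exact mul_le_mul (hK y hy) (pow_le_pow_of_le_one hy.1 hy.2 (by omega)) (pow_nonneg hy.1 _)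
      ((abs_nonneg _).trans (hK y hy))
  · obtain ⟨K, -, hK⟩ := exists_abs_le_Icc (hw (p + 1 - d)).continuous 0 1
    refine ⟨K, fun y hy => ?_⟩
    have e : ∑ k ∈ Finset.Icc d p, a (k - d) * y ^ (2 * k + 1)
        = y ^ (2 * d + 1) * ∑ j ∈ Finset.range (p + 1 - d), a j * y ^ (2 * j) := by
      rw [← Finset.Ico_add_one_right_eq_Icc, sum_Ico_eq_sum_range, mul_sum]
      refine sum_congr rfl fun j _ => ?_
      rw [show d + j - d = j by omega]; ring
    have e2 : y ^ (2 * d + 1) * y ^ (2 * (p + 1 - d)) = y ^ (2 * p + 3) := by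
      rw [← pow_add]; congr 1; omega
    rw [e, huv, hav (p + 1 - d) y, mul_add, add_sub_cancel_left, ← mul_assoc, e2, abs_mul,
      abs_of_nonneg (pow_nonneg hy.1 _), mul_comm]
    exact mul_le_mul_of_nonneg_right (hK y hy) (pow_nonneg hy.1 _)

/-! ### Bounds for the suitable derivatives of profiles -/

section
variable {g Q q χ : ℝ → ℝ} {b0 : ℝ} {d : ℕ} {F : ℝ → ℝ → ℝ}

/-- The size of the leading terms which survive after `k` suitable derivatives. -/
noncomputable def kerW (d k : ℕ) (w w' : ℝ) : ℝ := if k < 2 * d then w else if k = 2 * d then w' else 0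

theorem kerW_nonneg (d k : ℕ) {w w' : ℝ} (hw : 0 ≤ w) (hw' : 0 ≤ w') : 0 ≤ kerW d k w w' := by
  unfold kerW; split_ifs <;> first | assumption | exact le_rfl

theorem Lead.exists_profC (hF : Lead b0 d F) : ∃ c₀ : ℕ, ∃ p r, Good b0 p r ∧
    ∀ c, c₀ ≤ c → Sep (Coef b0) (ProfC c d) F p r :=
  let ⟨p, r, h, hg⟩ := hF; let ⟨c₀, hc⟩ := h.exists_profC; ⟨c₀, p, r, hg, hc⟩

theorem zpow_div_pow {y : ℝ} (hy : 0 < y) (n : ℤ) (k : ℕ) : y ^ n / y ^ k = y ^ (n - k) := by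
  rw [zpow_sub₀ hy.ne', zpow_natCast]

theorem Lead.suitable_le (h : IsExt g Q q) (hb0 : b0 ≤ 1 / 16) (hd : 1 ≤ d) (hF : Lead b0 d F) :
    ∃ c₀ : ℕ, ∀ c, c₀ ≤ c → ∀ k, ∃ C, 0 ≤ C ∧ ∀ b ∈ Ioo 0 b0, ∀ y, 1 ≤ y →
      |suitable g Q k (F b) y| ≤ C * (y ^ (2 * d - 1 - k : ℤ) * kerW d k (ell b y) (logw 1 b)
        + y ^ (2 * d - 3 - k : ℤ) * (1 + log y) ^ c) := by
  obtain ⟨c₁, h1⟩ := hF.symOn hb0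
  obtain ⟨c₂, p, r, hg, h2⟩ := hF.exists_profC
  refine ⟨max (max c₁ c₂) 1, fun c hc k => ?_⟩
  have hc1 : c₁ ≤ c := (le_max_left _ _).trans ((le_max_left _ _).trans hc)
  have hc2 : c₂ ≤ c := (le_max_right _ _).trans ((le_max_left _ _).trans hc)
  by_cases hk : k < 2 * d
  · obtain ⟨C, hC, hb⟩ := (h.symOn_suitable (h1 c hc1) k).bound_zero
    refine ⟨C, hC, fun b hbb y hy => (hb (b, y) ⟨hbb, hy⟩).trans (le_of_eq ?_)⟩
    have hy0 : 0 < y := by linarith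
    rw [kerW, if_pos hk, leadW, add_div, mul_div_right_comm, mul_div_right_comm, zpow_div_pow hy0,
      zpow_div_pow hy0]
  · have hE := ((h2 c hc2).mono (𝒞' := CoefS b0 (logw 0)) (fun _ h => h.1) fun _ _ _ h => h).expU
    obtain ⟨κ, κ', hκ, hκ', hS⟩ := hE.suitable hd (logw_nonneg 0) ((le_max_right _ _).trans hc) h k
    obtain ⟨C, hC, hb⟩ := hS.sym.bound_zero
    obtain ⟨C', hC', hb'⟩ := hg.p_small.2.bound_zero
    refine ⟨C + |κ'| * C', by positivity, fun b hbb y hy => ?_⟩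
    have hy0 : 0 < y := by linarith
    have h3 := hb (b, y) ⟨hbb, hy⟩
    have h4 := hb' ((), b) hbb
    have hn := zpow_nonneg hy0.le (2 * d - 1 - k : ℤ)
    simp only [hκ (by omega), zero_mul, zero_add, logw_zero, one_mul] at h3
    rw [show (2 * d - 1 - k - 2 : ℤ) = 2 * d - 3 - k by ring] at h3
    have hm := weight_nonneg (2 * d - 3 - k) c hy
    have hker : |κ' * p b| ≤ |κ'| * C' * kerW d k (ell b y) (logw 1 b) := by
      rw [kerW, if_neg hk]
      split_ifs with hk2
      · rw [abs_mul, mul_assoc]; exact mul_le_mul_of_nonneg_left h4 (abs_nonneg _)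
      · rw [hκ' (by omega)]; simp
    have hk0 := kerW_nonneg d k (ell_nonneg b y) (logw_nonneg 1 b)
    have e : suitable g Q k (F b) y = (suitable g Q k (F b) y - y ^ (2 * d - 1 - k : ℤ) * (κ' * p b))
      + y ^ (2 * d - 1 - k : ℤ) * (κ' * p b) := by ring
    rw [e]
    refine (abs_add_le _ _).trans ?_
    rw [abs_mul, abs_of_nonneg hn]
    have h5 := mul_le_mul_of_nonneg_left hker hn
    have h6 : 0 ≤ C * (y ^ (2 * d - 1 - k : ℤ) * kerW d k (ell b y) (logw 1 b)) := by positivity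
    have h7 : 0 ≤ |κ'| * C' * (y ^ (2 * d - 3 - k : ℤ) * (1 + log y) ^ c) := by positivity
    linarith

theorem Sep.suitable_le (h : IsExt g Q q) (hd : 1 ≤ d) {c m : ℕ} (hc : 1 ≤ c) {p r : ℝ → ℝ}
    (hF : Sep (CoefS b0 (logw m)) (ProfC c d) F p r) (k : ℕ) : ∃ C, 0 ≤ C ∧ ∀ b ∈ Ioo 0 b0, ∀ y, 1 ≤ y →
      |suitable g Q k (F b) y| ≤ C * (logw m b * (y ^ (2 * d - 1 - k : ℤ) * kerW d k (1 + log y) 1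
        + y ^ (2 * d - 3 - k : ℤ) * (1 + log y) ^ c)) := by
  obtain ⟨κ, κ', hκ, hκ', hS⟩ := hF.expU.suitable hd (logw_nonneg m) hc h k
  obtain ⟨C, hC, hb⟩ := hS.sym.bound_zero
  obtain ⟨C₁, hC₁, hp⟩ := hF.expU.p_le
  obtain ⟨C₂, hC₂, hr⟩ := hF.expU.q_le
  refine ⟨C + (|κ| * C₁ + |κ| * C₂ + |κ'| * C₁), by positivity, fun b hbb y hy => ?_⟩
  have hy0 : 0 < y := by linarith
  have h3 := hb (b, y) ⟨hbb, hy⟩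
  simp only at h3
  have hn := zpow_nonneg hy0.le (2 * d - 1 - k : ℤ)
  have hl := log_nonneg hy
  have hw := logw_nonneg m b
  rw [show (2 * d - 1 - k - 2 : ℤ) = 2 * d - 3 - k by ring] at h3
  have hm := weight_nonneg (2 * d - 3 - k) c hy
  have hk0 := kerW_nonneg d k (show 0 ≤ 1 + log y by linarith) zero_le_one
  have hpb := hp b hbb
  have hrb := hr b hbb
  have hker : |κ * p b * log y + (κ * r b + κ' * p b)|
      ≤ (|κ| * C₁ + |κ| * C₂ + |κ'| * C₁) * (logw m b * kerW d k (1 + log y) 1) := by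
    have t1 : |κ * p b| ≤ |κ| * C₁ * logw m b := abs_mul_le _ hpb
    have t2 : |κ * r b| ≤ |κ| * C₂ * logw m b := abs_mul_le _ hrb
    have t3 : |κ' * p b| ≤ |κ'| * C₁ * logw m b := abs_mul_le _ hpb
    have t4 : |κ * p b * log y + (κ * r b + κ' * p b)|
        ≤ |κ * p b| * log y + (|κ * r b| + |κ' * p b|) := by
      refine (abs_add_le _ _).trans (add_le_add ?_ (abs_add_le _ _))
      rw [abs_mul, abs_of_nonneg hl]
    refine t4.trans ?_
    rw [kerW]
    split_ifs with hk hk2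
    · have s1 := mul_le_mul_of_nonneg_right t1 hl
      have s2 : 0 ≤ |κ| * C₁ * logw m b := by positivity
      have s3 : 0 ≤ |κ| * C₂ * logw m b * log y := by positivity
      have s4 : 0 ≤ |κ'| * C₁ * logw m b * log y := by positivity
      linarith
    · rw [hκ (by omega)]; simp only [zero_mul, abs_zero, zero_add]; linarith
    · rw [hκ (by omega), hκ' (by omega)]; simp
  have e : suitable g Q k (F b) y = (suitable g Q k (F b) y
      - y ^ (2 * d - 1 - k : ℤ) * (κ * p b * log y + (κ * r b + κ' * p b)))
    + y ^ (2 * d - 1 - k : ℤ) * (κ * p b * log y + (κ * r b + κ' * p b)) := by ring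
  rw [e]
  refine (abs_add_le _ _).trans ?_
  rw [abs_mul, abs_of_nonneg hn]
  have h5 := mul_le_mul_of_nonneg_left hker hn
  have h6 : 0 ≤ C * (logw m b * (y ^ (2 * d - 1 - k : ℤ) * kerW d k (1 + log y) 1)) := by positivity
  have h7 : 0 ≤ (|κ| * C₁ + |κ| * C₂ + |κ'| * C₁) *
    (logw m b * (y ^ (2 * d - 3 - k : ℤ) * (1 + log y) ^ c)) := by positivity
  linarith

theorem Sep.jointSmooth {c m : ℕ} {p r : ℝ → ℝ} (hF : Sep (CoefS b0 (logw m)) (ProfC c d) F p r) :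
    JointSmooth F :=
  JointSmooth.of_contDiffOn (hF.smooth_joint (fun _ h => h.1) fun _ _ _ h => h.1.contDiff)

/-- Symbol bounds in `b₁` for a class which is stable under `b₁ ∂_{b₁}`. -/
theorem symOn_left (h : IsExt g Q q) {𝒦 : (ℝ → ℝ → ℝ) → Prop} {D : Set (ℝ × ℝ)} {w : ℝ → ℝ → ℝ} (k : ℕ)
    (hD : ∀ z ∈ D, 0 < z.1 ∧ 0 < z.2) (hw : ∀ z ∈ D, 0 ≤ w z.1 z.2)
    (hj : ∀ F, 𝒦 F → JointSmooth F) (hs : ∀ F, 𝒦 F → 𝒦 fun b y => scal (fun b => F b y) b)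
    (hb : ∀ F, 𝒦 F → ∃ C, 0 ≤ C ∧ ∀ z ∈ D, |suitable g Q k (F z.2) z.1| ≤ C * w z.1 z.2)
    (hF : 𝒦 F) : SymOn D w fun y b => suitable g Q k (F b) y :=
  SymTo.of_scal_closed (ι := {F : ℝ → ℝ → ℝ // 𝒦 F}) (fun F y b => suitable g Q k (F.1 b) y)
    (fun F => ⟨_, hs F.1 F.2⟩) (fun z hz => (hD z hz).2) hw
    (fun F z hz => ((hj F.1 F.2).suitable h k).left (hD z hz).2 (hD z hz).1)
    (fun F => hb F.1 F.2) (fun F z hz => by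
      filter_upwards [lt_mem_nhds (hD z hz).2] with b hb
      exact (hj F.1 F.2).scal_suitable h k hb z.1 (hD z hz).1) ⟨F, hF⟩

theorem Lead.jointSmooth (hF : Lead b0 d F) : JointSmooth F := JointSmooth.of_contDiffOn hF.contDiffOn

/-- The derivatives in `b₁` of profiles gain `|log b₁|^{-2}`. -/
theorem Lead.iteratedDeriv_suitable_le (h : IsExt g Q q) (hd : 1 ≤ d)
    (hF : Lead b0 d F) : ∃ c₀ : ℕ, ∀ c, c₀ ≤ c → ∀ k l, 1 ≤ l → ∃ C, 0 ≤ C ∧ ∀ b ∈ Ioo 0 b0, ∀ y, 1 ≤ y →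
      |iteratedDeriv l (fun β => suitable g Q k (F β) y) b| * b ^ l ≤
        C * (logw 2 b * (y ^ (2 * d - 1 - k : ℤ) * kerW d k (1 + log y) 1
          + y ^ (2 * d - 3 - k : ℤ) * (1 + log y) ^ c)) := by
  obtain ⟨c₂, p, r, -, h2⟩ := hF.exists_profC
  refine ⟨max c₂ 1, fun c hc k l hl => ?_⟩
  obtain ⟨l, rfl⟩ := Nat.exists_eq_add_of_le' hl
  have hE := (h2 c ((le_max_left _ _).trans hc)).scal_left (𝒞' := CoefS b0 (logw 2))
    (fun _ h => h.smooth) fun _ h => h.2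
  have hj := hF.jointSmooth
  set D : Set (ℝ × ℝ) := {z | z.2 ∈ Ioo 0 b0 ∧ 1 ≤ z.1} with hD
  have hDp : ∀ z ∈ D, 0 < z.1 ∧ 0 < z.2 := fun z hz => ⟨one_pos.trans_le hz.2, hz.1.1⟩
  have hsym := symOn_left h (D := D)
    (w := fun y b => logw 2 b * (y ^ (2 * d - 1 - k : ℤ) * kerW d k (1 + log y) 1
          + y ^ (2 * d - 3 - k : ℤ) * (1 + log y) ^ c))
    (𝒦 := fun E => ∃ p r, Sep (CoefS b0 (logw 2)) (ProfC c d) E p r) k hDp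
    (fun z hz => mul_nonneg (logw_nonneg _ _) (add_nonneg (mul_nonneg
      (zpow_nonneg (hDp z hz).1.le _) (kerW_nonneg _ _ (by linarith [log_nonneg hz.2])
        zero_le_one)) (weight_nonneg _ _ hz.2)))
    (fun _ ⟨_, _, h⟩ => h.jointSmooth)
    (fun _ ⟨_, _, h⟩ => ⟨_, _, h.scal_left (fun _ h => h.1) fun _ h => h.scal⟩)
    (fun _ ⟨_, _, hs⟩ => by
      obtain ⟨C, hC, hb⟩ := hs.suitable_le h hd ((le_max_right _ _).trans hc) k
      exact ⟨C, hC, fun z hz => hb z.2 hz.1 z.1 hz.2⟩) ⟨_, _, hE⟩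
  have hinv := (SymTo.zpow (D := D) (fun z hz => (hDp z hz).2) (-1)).mul hsym
  have hder := hinv.congr (v := fun y b => deriv (fun β => suitable g Q k (F β) y) b) fun z hz => by
    filter_upwards [lt_mem_nhds (hDp z hz).2] with b hb
    have := hj.scal_suitable h k hb z.1 (hDp z hz).1
    rw [← this, scal, zpow_neg_one, inv_mul_cancel_left₀ (ne_of_gt hb)]
  obtain ⟨C, hC, hb⟩ := hder.bound l le_top
  refine ⟨C, hC, fun b hbb y hy => ?_⟩
  have h3 := hb (y, b) ⟨hbb, hy⟩
  simp only [zpow_neg_one] at h3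
  rw [iteratedDeriv_succ', pow_succ, ← mul_assoc]
  refine (mul_le_mul_of_nonneg_right h3 hbb.1.le).trans (le_of_eq ?_)
  have := hbb.1.ne'
  field_simp

theorem Cut.jointSmooth (hχ : IsCutoff χ) (hF : Cut b0 χ d F) : JointSmooth F :=
  JointSmooth.of_contDiffOn (hF.contDiffOn hχ)

theorem Cut.iteratedDeriv_suitable_le (h : IsExt g Q q) (hb0 : b0 ≤ 1 / 16) (hχ : IsCutoff χ)
    (hF : Cut b0 χ d F) (k l : ℕ) : ∃ C, 0 ≤ C ∧ ∀ b ∈ Ioo 0 b0, ∀ y, 1 ≤ y → 1 / 2 ≤ √b * y →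
      |iteratedDeriv l (fun β => suitable g Q k (F β) y) b| * b ^ l ≤ C * (cutW d b y / y ^ k) := by
  have hsym := symOn_left h (D := {z | z.2 ∈ Ioo 0 b0 ∧ 1 ≤ z.1 ∧ 1 / 2 ≤ √z.2 * z.1})
    (w := fun y b => cutW d b y / y ^ k) (𝒦 := Cut b0 χ d) k
    (fun z hz => ⟨one_pos.trans_le hz.2.1, hz.1.1⟩)
    (fun z hz => div_nonneg (cutW_nonneg _ _ (zero_le_one.trans hz.2.1))
      (pow_nonneg (zero_le_one.trans hz.2.1) _))
    (fun _ h => h.jointSmooth hχ) (fun _ h => h.scal_left hb0 hχ) (fun _ hs => by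
      obtain ⟨C, hC, hb⟩ := (h.symOn_suitable (hs.symOn hb0 hχ) k).bound_zero
      exact ⟨C, hC, fun z hz => hb (z.2, z.1) hz⟩) hF
  obtain ⟨C, hC, hb⟩ := hsym.bound l le_top
  exact ⟨C, hC, fun b hbb y hy hz => hb (y, b) ⟨hbb, hy, hz⟩⟩

theorem Lead.suitable_cutoff (hχ : IsCutoff χ) (k : ℕ) {b y : ℝ} (hy : √b * y < 1) :
    suitable g Q k (fun y => F b y * cutoff χ 0 b y) y = suitable g Q k (F b) y := by
  refine (suitable_congr k ?_).eq_of_nhds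
  have : ∀ᶠ x in 𝓝 y, √b * x < 1 :=
    (continuous_const.mul continuous_id).continuousAt.eventually (gt_mem_nhds hy)
  filter_upwards [this] with x hx
  rw [hχ.cutoff_eq_of_lt hx, if_pos rfl, mul_one]

/-! ### Admissibility -/

theorem one_add_log_le {y : ℝ} (hy : 2 ≤ y) : 1 + log y ≤ 3 * |log y| := by
  have h1 : log 2 ≤ log y := log_le_log (by norm_num) hy
  have := Real.log_two_gt_d9
  rw [abs_of_nonneg (by linarith)]; linarith

theorem one_add_log_pow_le_rpow {y : ℝ} (hy : 2 ≤ y) (c : ℕ) :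
    (1 + log y) ^ c ≤ 3 ^ c * |log y| ^ (c : ℝ) := by
  rw [rpow_natCast, ← mul_pow]
  exact pow_le_pow_left₀ (by linarith [log_nonneg (show (1 : ℝ) ≤ y by linarith)])
    (one_add_log_le hy) c

theorem le_three_B0 {b y : ℝ} (hb : 0 < b) (h : √b * y ≤ 2) : y ≤ 3 * B0 b := by
  have hs : 0 < √b := sqrt_pos.mpr hb
  rw [B0, mul_one_div, le_div_iff₀ hs]; linarith

theorem B0_div_four_le {b y : ℝ} (hb : 0 < b) (h : 1 ≤ √b * y) : B0 b / 4 ≤ y := by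
  have hs : 0 < √b := sqrt_pos.mpr hb
  rw [B0, div_div, div_le_iff₀ (by positivity)]; nlinarith

theorem gw_eq (d k : ℕ) {b y : ℝ} (h : y ≤ 3 * B0 b) :
    gw (2 * d - k) b y = if k < 2 * d then ell b y else logw 1 b := by
  rw [gw, if_pos h, logw_one_eq, ell]
  by_cases hk : k < 2 * d
  · rw [if_pos hk, if_pos (by omega)]
  · rw [if_neg hk, if_neg (by omega)]

theorem gw_nonneg (l : ℤ) (b y : ℝ) : 0 ≤ gw l b y := by unfold gw; split_ifs <;> positivity

theorem gtw_nonneg (l : ℤ) (b y : ℝ) : 0 ≤ gtw l b y := by unfold gtw; split_ifs <;> positivity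

theorem kerW_le_gtw (d k : ℕ) {b y : ℝ} (hy : 1 ≤ y) (h : y ≤ 3 * B0 b) :
    logw 1 b * kerW d k (1 + log y) 1 ≤ gtw (2 * d - k) b y := by
  rw [gtw, if_pos h, logw_one_eq, kerW]
  by_cases hk : k < 2 * d
  · rw [if_pos hk, if_pos (by omega), abs_of_nonneg (log_nonneg hy)]; exact le_of_eq (by ring)
  · rw [if_neg hk, if_neg (show ¬ (1 : ℤ) ≤ 2 * d - k by omega)]
    have h1 : 0 ≤ 1 / |log b| := by positivity
    have h2 : 0 ≤ (if B0 b / 4 ≤ y then (1 : ℝ) else 0) := by split_ifs <;> simp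
    by_cases h3 : k = 2 * d
    · rw [if_pos h3, mul_one]; linarith
    · rw [if_neg h3, mul_zero]; linarith

theorem one_le_gtw (hb0 : b0 ≤ 1 / 16) (d k : ℕ) {b y : ℝ} (hb : b ∈ Ioo 0 b0) (hy : 1 ≤ y)
    (h : y ≤ 3 * B0 b) (h1 : 1 ≤ √b * y) : 1 ≤ 2 * gtw (2 * d - k) b y := by
  rw [gtw, if_pos h]
  have hl := one_le_abs_log hb0 hb
  split_ifs with h2 h3
  · rw [← mul_div_assoc, le_div_iff₀ (by linarith), one_mul, abs_of_nonneg (log_nonneg hy)]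
    exact abs_log_le_of_le hb.1 (by linarith [hb.2]) hy (by linarith)
  · have : 0 ≤ 1 / |log b| := by positivity
    linarith
  · exact absurd (B0_div_four_le hb.1 h1) h3

theorem Fc_nonneg (p₂ : ℤ) (k l : ℕ) {b : ℝ} (hb : 0 < b) : 0 ≤ Fc p₂ k l b := by
  unfold Fc; split_ifs <;> positivity

theorem Lead.isB1Admissible (h : IsExt g Q q) (hb0' : 0 < b0) (hb0 : b0 ≤ 1 / 16) (hχ : IsCutoff χ)
    (hd : 1 ≤ d) (hF : Lead b0 d F) :
    IsB1Admissible g Q d d fun b y => F b y * cutoff χ 0 b y := by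
  have hcut := Cut.term (χ := χ) hF 0
  refine ⟨hcut.contDiffOn hχ, b0, ⟨hb0', by linarith⟩, ?_, ?_⟩
  · obtain ⟨p, r, hS, -⟩ := hF
    obtain ⟨J, hh, φ, h1, h2, h3⟩ := hS.exists_fin
    refine ⟨J, hh, φ, fun j b hb => ((h1 j).smooth b hb.1).contDiffWithinAt, fun j l => ?_, fun j => ?_,
      fun b hb y hy => ?_⟩
    · obtain ⟨C, hC, hb⟩ := (h1 j).1.2.bound l le_top
      refine ⟨C, fun b hbb => ?_⟩
      have := hb ((), b) hbb
      rw [logw_zero, mul_one] at this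
      rwa [le_div_iff₀ (pow_pos hbb.1 l)]
    · obtain ⟨α, β, hP⟩ := h2 j
      exact hP.1.hasOddTaylor
    · have hs : √b * y < 1 := by
        have : √b < 1 := by rw [sqrt_lt' one_pos]; linarith [hb.2]
        have h0 := sqrt_nonneg b
        nlinarith [hy.1, hy.2]
      beta_reduce
      rw [hχ.cutoff_eq_of_lt hs, if_pos rfl, mul_one, h3 b hb.1 y hy.1]
  · obtain ⟨c₁, h1⟩ := hF.suitable_le h hb0 hd
    obtain ⟨c₂, h2⟩ := hF.iteratedDeriv_suitable_le h hd
    set c := max (max c₁ c₂) 1 with hc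
    have hc1 : c₁ ≤ c := (le_max_left _ _).trans (le_max_left _ _)
    have hc2 : c₂ ≤ c := (le_max_right _ _).trans (le_max_left _ _)
    have hFt : ∀ (k l : ℕ) (b y : ℝ), 0 < b → 0 < y →
        0 ≤ (if 3 * B0 b ≤ y then Fc d k l b * y ^ (2 * (d : ℤ) - k - 3) else 0) := fun k l b y hb hy => by
      split_ifs
      · exact mul_nonneg (Fc_nonneg _ _ _ hb) (zpow_nonneg hy.le _)
      · exact le_rfl
    refine ⟨c, by exact_mod_cast (le_max_right _ _ : 1 ≤ c), fun k => ?_, fun k l hl => ?_⟩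
    · obtain ⟨C, hC, hb⟩ := h1 c hc1 k
      obtain ⟨C', hC', hb'⟩ := hcut.iteratedDeriv_suitable_le h hb0 hχ k 0
      refine ⟨C * 3 ^ c + C', fun b hbb y hy => ?_⟩
      have hy1 : 1 ≤ y := by linarith
      have hy0 : 0 < y := by linarith
      have hF0 := hFt k 0 b y hbb.1 hy0
      have hn := zpow_nonneg hy0.le (2 * (d : ℤ) - k - 1)
      have hm := mul_nonneg (zpow_nonneg hy0.le (2 * (d : ℤ) - k - 3))
        (Real.rpow_nonneg (abs_nonneg (log y)) (c : ℝ))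
      have hng := mul_nonneg hn (gw_nonneg (2 * d - k) b y)
      have h3c : (1 : ℝ) ≤ 3 ^ c := one_le_pow₀ (by norm_num)
      set G := y ^ (2 * (d : ℤ) - k - 1) * gw (2 * d - k) b y with hG
      set T := y ^ (2 * (d : ℤ) - k - 3) * |log y| ^ (c : ℝ) with hT
      have hGT := add_nonneg hng hm
      suffices H : |suitable g Q k (fun y => F b y * cutoff χ 0 b y) y| ≤ (C * 3 ^ c + C') * (G + T) from
        H.trans (mul_le_mul_of_nonneg_left (by linarith) (by positivity))
      rcases lt_or_ge (√b * y) 1 with hz | hz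
      · have hB := le_three_B0 (b := b) (y := y) hbb.1 (by linarith)
        rw [Lead.suitable_cutoff hχ k hz]
        refine (hb b hbb y hy1).trans ?_
        have hk : kerW d k (ell b y) (logw 1 b) ≤ gw (2 * d - k) b y := by
          rw [gw_eq d k hB, kerW]
          split_ifs
          exacts [le_rfl, le_rfl, logw_nonneg _ _]
        rw [sub_right_comm _ 1, sub_right_comm _ 3, add_mul, mul_assoc C]
        have t1 := mul_le_mul_of_nonneg_left hk hn
        have t2 := mul_le_mul_of_nonneg_left (one_add_log_pow_le_rpow hy c)
          (zpow_nonneg hy0.le (2 * (d : ℤ) - k - 3))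
        refine (mul_le_mul_of_nonneg_left ?_ hC).trans (le_add_of_nonneg_right (mul_nonneg hC' hGT))
        nlinarith
      · have t := hb' b hbb y hy1 (by linarith)
        rw [iteratedDeriv_zero, pow_zero, mul_one] at t
        have t1 : cutW d b y / y ^ k ≤ G := by
          rw [cutW]
          split_ifs with h2
          · rw [mul_one, mul_div_right_comm, zpow_div_pow hy0, sub_right_comm, hG,
              gw_eq d k (le_three_B0 hbb.1 h2)]
            refine mul_le_mul_of_nonneg_left ?_ hn
            split_ifs
            exacts [logw_one_le_ell _ _, le_rfl]
          · simpa using hng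
        rw [add_mul]
        exact (t.trans (mul_le_mul_of_nonneg_left (by linarith) hC')).trans
          (le_add_of_nonneg_left (by positivity))
    · obtain ⟨C, hC, hb⟩ := h2 c hc2 k l hl
      obtain ⟨C', hC', hb'⟩ := hcut.iteratedDeriv_suitable_le h hb0 hχ k l
      refine ⟨C * 3 ^ c + 2 * C', fun b hbb y hy => ?_⟩
      have hy1 : 1 ≤ y := by linarith
      have hy0 : 0 < y := by linarith
      have hF0 := hFt k l b y hbb.1 hy0
      have hn := zpow_nonneg hy0.le (2 * (d : ℤ) - k - 1)
      have hm := mul_nonneg (zpow_nonneg hy0.le (2 * (d : ℤ) - k - 3))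
        (Real.rpow_nonneg (abs_nonneg (log y)) (c : ℝ))
      have hng := mul_nonneg hn (gtw_nonneg (2 * d - k) b y)
      have h3c : (1 : ℝ) ≤ 3 ^ c := one_le_pow₀ (by norm_num)
      have hbl : 0 < b ^ l := pow_pos hbb.1 l
      have hlog := logw_nonneg 1 b
      have hlog1 : logw 1 b ≤ 1 := logw_zero b ▸ logw_le hb0 hbb (show 0 ≤ 1 by omega)
      set G := y ^ (2 * (d : ℤ) - k - 1) * gtw (2 * d - k) b y with hG
      set T := y ^ (2 * (d : ℤ) - k - 3) * |log y| ^ (c : ℝ) with hT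
      have hGT := mul_nonneg hlog (add_nonneg hng hm)
      suffices H : |iteratedDeriv l (fun β => suitable g Q k (fun y => F β y * cutoff χ 0 β y) y) b| * b ^ l ≤
          (C * 3 ^ c + 2 * C') * (logw 1 b * (G + T)) by
        rw [← le_div_iff₀ hbl] at H
        refine H.trans ?_
        calc _ = (C * 3 ^ c + 2 * C') * (1 / (b ^ l * |log b|) * (G + T)) := by
              rw [logw_one_eq, mul_div_assoc, div_mul_eq_mul_div, one_mul, div_div, mul_comm |log b|,
                div_mul_eq_mul_div, one_mul]
          _ ≤ _ := mul_le_mul_of_nonneg_left (by linarith) (by positivity)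
      rw [add_mul]
      rcases lt_or_ge (√b * y) 1 with hz | hz
      · have hB := le_three_B0 (b := b) (y := y) hbb.1 (by linarith)
        have he : (fun β => suitable g Q k (fun y => F β y * cutoff χ 0 β y) y) =ᶠ[𝓝 b]
            fun β => suitable g Q k (F β) y := by
          filter_upwards [(Real.continuous_sqrt.mul continuous_const).continuousAt.eventually
            (gt_mem_nhds hz)] with β hβ using Lead.suitable_cutoff hχ k hβ
        rw [he.iteratedDeriv_eq]
        refine (hb b hbb y hy1).trans (le_trans ?_ (le_add_of_nonneg_right (by positivity)))
        rw [sub_right_comm _ 1, sub_right_comm _ 3, ← logw_mul 1 1]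
        have t1 := mul_le_mul_of_nonneg_left (kerW_le_gtw d k hy1 hB) hn
        have t2 := mul_le_mul_of_nonneg_left (one_add_log_pow_le_rpow hy c)
          (zpow_nonneg hy0.le (2 * (d : ℤ) - k - 3))
        have t4 := mul_le_of_le_one_left
          (weight_nonneg (2 * (d : ℤ) - k - 3) c hy1) hlog1
        calc _ = C * (logw 1 b * (y ^ (2 * (d : ℤ) - k - 1) * (logw 1 b * kerW d k (1 + log y) 1)
              + logw 1 b * (y ^ (2 * (d : ℤ) - k - 3) * (1 + log y) ^ c))) := by ring
          _ ≤ C * (logw 1 b * (3 ^ c * (G + T))) := by gcongr; nlinarith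
          _ = _ := by ring
      · refine (hb' b hbb y hy1 (by linarith)).trans
          (le_trans ?_ (le_add_of_nonneg_left (by positivity)))
        have t1 : cutW d b y / y ^ k ≤ 2 * (logw 1 b * G) := by
          rw [cutW]
          split_ifs with h2
          · have := mul_le_mul_of_nonneg_left (one_le_gtw hb0 d k hbb hy1 (le_three_B0 hbb.1 h2) hz)
              (mul_nonneg hn hlog)
            rw [mul_one, mul_div_right_comm, zpow_div_pow hy0, sub_right_comm]; linarith
          · simpa using mul_nonneg hlog hng
        have t2 := mul_le_mul_of_nonneg_left t1 hC'
        have t3 := mul_nonneg hC' (mul_nonneg hlog hm)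
        linarith

end


section
variable {L : ℕ} [NeZero L] {g Q q χ c : ℝ → ℝ} {b0 : ℝ}

/-! ### Homogeneity of the profiles -/

theorem HomSum.exists_finset {𝒦 : (ℝ → ℝ → ℝ) → Prop} (h𝒦 : CoefClass b0 𝒦) (h0 : 𝒦 fun _ _ => 0)
    {d : ℤ} {r : ℕ} {S : Par L → ℝ → ℝ} (hS : HomSum 𝒦 d r S) :
    ∃ (𝒥 : Finset (Fin L → ℤ)) (F : (Fin L → ℤ) → ℝ → ℝ → ℝ), (∀ J ∈ 𝒥, MonOK d r J) ∧
      (∀ J, 𝒦 (F J)) ∧ ∀ b : Par L, 0 < b 0 → ∀ y, 0 ≤ y →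
        S b y = ∑ J ∈ 𝒥, mon b J * F J (b 0) y := by
  classical
  induction hS with
  | zero => exact ⟨∅, fun _ _ _ => 0, by simp, fun _ => h0, by simp⟩
  | of hS =>
    obtain ⟨J, F, hJ, hF, rfl⟩ := hS
    exact ⟨{J}, fun _ => F, by simpa using hJ, fun _ => hF, by simp⟩
  | add _ _ ih ih' =>
    obtain ⟨𝒥, F, h1, h2, h3⟩ := ih
    obtain ⟨𝒥', F', h1', h2', h3'⟩ := ih'
    refine ⟨𝒥 ∪ 𝒥', fun J b y => (if J ∈ 𝒥 then F J b y else 0) + (if J ∈ 𝒥' then F' J b y else 0),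
      fun J hJ => ?_, fun J => ?_, fun b hb y hy => ?_⟩
    · exact (Finset.mem_union.mp hJ).elim (h1 J) (h1' J)
    · have e1 : 𝒦 fun b y => if J ∈ 𝒥 then F J b y else 0 := by
        split_ifs
        · exact h2 J
        · exact h0
      have e2 : 𝒦 fun b y => if J ∈ 𝒥' then F' J b y else 0 := by
        split_ifs
        · exact h2' J
        · exact h0
      exact h𝒦.add _ _ e1 e2
    · beta_reduce
      rw [h3 b hb y hy, h3' b hb y hy]
      simp only [mul_add, mul_ite, mul_zero, sum_add_distrib, Finset.sum_ite_mem,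
        Finset.union_inter_cancel_left, Finset.union_inter_cancel_right]
  | congr _ he ih =>
    obtain ⟨𝒥, F, h1, h2, h3⟩ := ih
    exact ⟨𝒥, F, h1, h2, fun b hb y hy => by rw [← he b hb y hy, h3 b hb y hy]⟩

/-- Profiles, cut off at the scale `B₀`. -/
noncomputable def cutProf (χ : ℝ → ℝ) (S : ℕ → Par L → ℝ → ℝ) (i : ℕ) (b : Par L) (y : ℝ) : ℝ :=
  S i b y * cutoff χ 0 (b 0) y

theorem HomSum.isHomogeneous (h : IsExt g Q q) (hb0' : 0 < b0) (hb0 : b0 ≤ 1 / 16) (hχ : IsCutoff χ)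
    {d r e : ℕ} (hd : 1 ≤ d) {S : ℕ → Par L → ℝ → ℝ} {i : ℕ} (hS : HomSum (Lead b0 d) e r (S i)) :
    IsHomogeneous g Q d d e (cutProf χ S i) := by
  obtain ⟨𝒥, F, h1, h2, h3⟩ := hS.exists_finset (CoefClass.lead hb0 d) Lead.zero
  refine ⟨𝒥, fun _ => 1, fun J b y => F J b y * cutoff χ 0 b y, fun J hJ => ⟨fun k hk =>
    (h1 J hJ).nonneg k fun h0 => ?_, (h1 J hJ).degree⟩,
    fun J _ => (h2 J).isB1Admissible h hb0' hb0 hχ hd, fun b hb y hy => ?_⟩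
  · rw [h0] at hk; simp at hk
  · rw [coord_one] at hb ⊢
    rw [cutProf, h3 b hb y hy, sum_mul]
    refine sum_congr rfl fun J _ => ?_
    rw [mon]; ring

theorem HomSum.cutProf {d r : ℕ} {e : ℤ} {S : ℕ → Par L → ℝ → ℝ} {i : ℕ}
    (hS : HomSum (Lead b0 d) e r (S i)) : HomSum (Cut b0 χ d) e r (cutProf χ S i) :=
  (hS.coef_mul (𝒦' := Cut b0 χ d) (k := cutoff χ 0) fun F hF =>
    (Cut.term hF 0).congr fun b _ y _ => mul_comm _ _).congr fun b _ y _ => mul_comm _ _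

theorem HomSum.cut_smooth (hχ : IsCutoff χ) {d r : ℕ} {D : ℤ} {S : Par L → ℝ → ℝ}
    (hS : HomSum (Cut b0 χ d) D r S) {b : Par L} (hb : 0 < b 0) {y : ℝ} (hy : 0 < y) :
    SmoothAt (S b) y :=
  hS.smooth_right (fun T ⟨_, F, _, hF, e⟩ b hb y hy => e ▸
    contDiffAt_const.mul ((hF.jointSmooth hχ).right hb hy)) hb hy

/-! ### Derivatives along the flow -/

theorem clm_apply_eq_sum (f : Par L →L[ℝ] ℝ) (v : Par L) :
    f v = ∑ j, v j * f (Pi.single j 1) := by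
  conv_lhs => rw [← Finset.univ_sum_single v, map_sum]
  refine sum_congr rfl fun j _ => ?_
  rw [← smul_eq_mul, ← map_smul, ← Pi.single_smul, smul_eq_mul, mul_one]

theorem hasDerivWithinAt_comp_param {S : Par L → ℝ → ℝ} {y : ℝ} {β : ℝ → Fin L → ℝ} {I : Set ℝ} {s : ℝ}
    {v : Par L} (hS : DifferentiableAt ℝ (fun b => S b y) (β s)) (hβ : HasDerivWithinAt β v I s) :
    HasDerivWithinAt (fun σ => S (β σ) y) (∑ j, v j * partialB j S (β s) y) I s := by
  refine (hS.hasFDerivAt.comp_hasDerivWithinAt s hβ).congr_deriv ?_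
  rw [clm_apply_eq_sum]
  refine sum_congr rfl fun j _ => ?_
  rw [partialB, (hasDerivAt_update_comp hS j).deriv]

/-- The Taylor remainder `f(a + e) - ∑_{m < n} f^{(m)}(a) e^m / m!`. -/
noncomputable def taylorRem (n : ℕ) (f : ℝ → ℝ) (a e : ℝ) : ℝ :=
  f (a + e) - ∑ m ∈ Finset.range n, 1 / (m.factorial : ℝ) * (iteratedDeriv m f a * e ^ m)

/-- The perturbation `∑ b_i T_i + ∑ S_i`. -/
noncomputable def pert (q : ℝ → ℝ) (S : ℕ → Par L → ℝ → ℝ) (b : Par L) (y : ℝ) : ℝ :=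
  ∑ i ∈ Finset.range (L + 3), comp q S b y i

/-- `T_i`, in terms of the extension `q`. -/
noncomputable def tprof (q : ℝ → ℝ) (i : ℕ) (y : ℝ) : ℝ := (-1) ^ i * (y * profV q i y)

/-- The error `Ψ_b`, as a function of the parameters `b`. -/
noncomputable def errModel (g Q q c : ℝ → ℝ) (S : ℕ → Par L → ℝ → ℝ) (b : Par L) (y : ℝ) : ℝ :=
  ∑ j : Fin L, b 0 * b j * theta q c (↑j + 1) (b 0) y
    + (∑ i ∈ Finset.Icc 2 (L + 2), (opH g Q (S i b) y + (b 0 * scal (S i b) y + vecX c (S i) b y))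
      + taylorRem 2 (nonlin g) (q y) (pert q S b y) / y ^ 2)

theorem sum_coord (b : Par L) (φ : ℕ → ℝ) :
    ∑ i ∈ Finset.Icc 1 L, coord b i * φ i = ∑ j : Fin L, b j * φ (↑j + 1) := by
  rw [← Finset.Ico_add_one_right_eq_Icc, sum_Ico_eq_sum_range, Nat.add_sub_cancel, Finset.sum_range]
  refine sum_congr rfl fun j _ => ?_
  rw [add_comm 1, coord_succ]

theorem pert_eq {S : ℕ → Par L → ℝ → ℝ} (h0 : ∀ i < 2, S i = fun _ _ => 0) (b : Par L) (y : ℝ) :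
    pert q S b y = ∑ j : Fin L, b j * tprof q (↑j + 1) y + ∑ i ∈ Finset.Icc 2 (L + 2), S i b y := by
  have e : ∀ i, comp q S b y i = coord b i * tprof q i y + S i b y := fun _ => rfl
  simp only [pert, e, sum_add_distrib]
  rw [← sum_coord b fun i => tprof q i y]
  congr 1
  · refine (sum_subset (fun i hi => ?_) fun i _ hi => ?_).symm
    · rw [Finset.mem_Icc] at hi; rw [Finset.mem_range]; omega
    · rw [Finset.mem_Icc] at hi
      rw [coord, dif_neg hi, zero_mul]
  · refine (sum_subset (fun i hi => ?_) fun i hi1 hi => ?_).symm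
    · rw [Finset.mem_Icc] at hi; rw [Finset.mem_range]; omega
    · rw [Finset.mem_Icc] at hi
      rw [Finset.mem_range] at hi1
      rw [h0 i (by omega)]

theorem scal_sum {ι : Type*} (s : Finset ι) {u : ι → ℝ → ℝ} {y : ℝ}
    (hu : ∀ i ∈ s, SmoothAt (u i) y) :
    scal (fun y => ∑ i ∈ s, u i y) y = ∑ i ∈ s, scal (u i) y := by
  simp only [scal]
  rw [deriv_fun_sum fun i hi => (hu i hi).differentiableAt (by simp), mul_sum]

theorem IsExt.lap_eq (h : IsExt g Q q) {y : ℝ} (hy : 0 < y) : lap q y = nonlin g (q y) / y ^ 2 := by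
  have h1 : deriv q =ᶠ[𝓝 y] fun y => g (q y) / y :=
    eventuallyEq_of_pos (fun y hy => (h.hasDerivAt hy).deriv) hy
  have h2 := ((h.target.smooth.differentiable (by simp) (q y)).hasDerivAt.comp y (h.hasDerivAt hy)).fun_div
    (hasDerivAt_id y) hy.ne'
  have h3 : deriv (fun y => g (q y) / y) y = _ := h2.deriv
  rw [lap, h1.deriv_eq, h1.eq_of_nhds, h3]; simp only [nonlin, Function.comp, id]; field_simp; ring

theorem IsExt.contDiff_tprof (h : IsExt g Q q) (i : ℕ) : Smooth (tprof q i) := by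
  have := h.contDiff_profV i
  unfold tprof; fun_prop

/-- The structure of the approximate profile which the computation of the error depends on. -/
structure IsCutProfiles (b0 : ℝ) (χ : ℝ → ℝ) (S : ℕ → Par L → ℝ → ℝ) : Prop where
  zero : ∀ i, i < 2 → S i = fun _ _ => 0
  homSum : ∀ i, 2 ≤ i → HomSum (Cut b0 χ i) i (i - 1) (S i)

theorem IsProfiles.cut {n : ℕ} {S : ℕ → Par L → ℝ → ℝ}
    (hS : IsProfiles g Q q c b0 n (L + 2) S) : IsCutProfiles b0 χ (cutProf χ S) :=
  ⟨fun i hi => by funext b y; simp [cutProf, hS.zero i (Or.inl hi)],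
    fun i hi => (hS.homSum i hi).cutProf⟩

variable {S : ℕ → Par L → ℝ → ℝ}

theorem IsCutProfiles.partialB_eq_zero (hb0 : b0 ≤ 1 / 16) (hχ : IsCutoff χ) (hS : IsCutProfiles b0 χ S)
    {i : ℕ} {j : Fin L} (hij : i ≤ (j : ℕ) + 1) {b : Par L} (hb : 0 < b 0) {y : ℝ}
    (hy : 0 ≤ y) : partialB j (S i) b y = 0 := by
  rcases lt_or_ge i 2 with hi | hi
  · rw [hS.zero i hi]; simp [partialB]
  · exact (hS.homSum i hi).partialB_eq_zero (CoefClass.cut hb0 hχ i)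
      (fun h0 => by rw [h0] at hij; simp at hij; omega) (by omega) hb hy

theorem IsCutProfiles.contDiffAt (hχ : IsCutoff χ) (hS : IsCutProfiles b0 χ S) (i : ℕ) {b : Par L}
    (hb : 0 < b 0) {y : ℝ} (hy : 0 < y) : SmoothAt (S i b) y := by
  rcases lt_or_ge i 2 with hi | hi
  · rw [hS.zero i hi]; exact contDiffAt_const
  · exact (hS.homSum i hi).cut_smooth hχ hb hy

theorem IsCutProfiles.differentiableAt (hb0 : b0 ≤ 1 / 16) (hχ : IsCutoff χ) (hS : IsCutProfiles b0 χ S)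
    (i : ℕ) {b : Par L} (hb : 0 < b 0) {y : ℝ} (hy : 0 < y) :
    DifferentiableAt ℝ (fun b => S i b y) b := by
  rcases lt_or_ge i 2 with hi | hi
  · rw [hS.zero i hi]; exact differentiableAt_const _
  · exact (hS.homSum i hi).differentiableAt (CoefClass.cut hb0 hχ i).smooth_left hb hy.le

theorem IsCutProfiles.contDiffAt_pert (h : IsExt g Q q) (hχ : IsCutoff χ) (hS : IsCutProfiles b0 χ S)
    {b : Par L} (hb : 0 < b 0) {y : ℝ} (hy : 0 < y) : SmoothAt (pert q S b) y :=
  ContDiffAt.sum fun i _ => (contDiffAt_const.mul (h.contDiff_tprof i).contDiffAt).add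
    (hS.contDiffAt hχ i hb hy)

theorem taylorRem_two (f : ℝ → ℝ) (a e : ℝ) : taylorRem 2 f a e = f (a + e) - f a - deriv f a * e := by
  simp [taylorRem, sum_range_succ, iteratedDeriv_one]; ring

theorem IsCutProfiles.spatial_eq (h : IsExt g Q q) (hχ : IsCutoff χ)
    (hS : IsCutProfiles b0 χ S) {b : Par L} (hb : 0 < b 0) {y : ℝ} (hy : 0 < y) :
    -lap (profQ Q S b) y + b 0 * scal (profQ Q S b) y + nonlin g (profQ Q S b y) / y ^ 2
      = opH g Q (pert q S b) y + b 0 * (tprof q 0 y + scal (pert q S b) y)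
        + taylorRem 2 (nonlin g) (q y) (pert q S b y) / y ^ 2 := by
  have e : ∀ y, 0 ≤ y → profQ Q S b y = q y + pert q S b y := fun y hy => by
    rw [profQ, pert_eq hS.zero, h.eq y hy, sum_coord b fun i => profT Q i y]
    simp only [h.profT_eq _ hy, tprof]
  have he := eventuallyEq_of_nonneg e hy
  have hp := hS.contDiffAt_pert h hχ hb hy
  have hq : SmoothAt q y := h.smooth.contDiffAt
  have hd : deriv (fun y => q y + pert q S b y) =ᶠ[𝓝 y] fun y => deriv q y + deriv (pert q S b) y := by
    filter_upwards [eventually_differentiableAt hp, eventually_differentiableAt hq] with x hx hx'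
      using deriv_fun_add hx' hx
  have hl := h.lap_eq hy
  have e1 : lap (profQ Q S b) y = lap q y + lap (pert q S b) y := by
    simp only [lap]
    rw [he.deriv.deriv_eq, he.deriv_eq, hd.deriv_eq, hd.eq_of_nhds,
      deriv_fun_add ((contDiffAt_deriv hq).differentiableAt (by simp))
        ((contDiffAt_deriv hp).differentiableAt (by simp))]
    ring
  have e2 : scal (profQ Q S b) y = tprof q 0 y + scal (pert q S b) y := by
    rw [scal_congr he, scal_add_eq hq hp]; simp [tprof, profV, scal]
  rw [e1, e2, hl, e y hy.le, taylorRem_two, opH, ← h.eq y hy.le]; ring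

theorem sum_shift (b : Par L) (T : ℕ → ℝ) :
    ∑ j : Fin L, b j * T j = b 0 * T 0 + ∑ j : Fin L, coord b (↑j + 2) * T (↑j + 1) := by
  have e1 : ∑ j : Fin L, b j * T j = ∑ j ∈ Finset.range L, coord b (j + 1) * T j := by
    rw [Finset.sum_range]; exact sum_congr rfl fun j _ => by rw [coord_succ]
  have e2 := sum_range_succ (fun j => coord b (j + 1) * T j) L
  rw [coord_of_lt b (Nat.lt_succ_self L), zero_mul, add_zero, sum_range_succ'] at e2
  rw [e1, ← e2, add_comm, zero_add, coord_one, Finset.sum_range]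

theorem IsCutProfiles.errorTerm_eq (h : IsExt g Q q) (hb0 : b0 ≤ 1 / 16) (hχ : IsCutoff χ)
    (hS : IsCutProfiles b0 χ S) {s₀ s₁ s : ℝ} (hs : s₀ < s₁) (hmem : s ∈ Icc s₀ s₁) {β : ℝ → Fin L → ℝ}
    (hβ : ContDiffOn ℝ 1 β (Icc s₀ s₁)) (hb : 0 < β s 0) {y : ℝ} (hy : 0 < y) :
    errorTerm g Q χ S (Icc s₀ s₁) β s y = errModel g Q q (cb Q χ) S (β s) y := by
  set b := β s with hbdef
  have hu : UniqueDiffWithinAt ℝ (Icc s₀ s₁) s := uniqueDiffOn_Icc hs s hmem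
  have hd : HasDerivWithinAt β (derivWithin β (Icc s₀ s₁) s) (Icc s₀ s₁) s :=
    ((hβ.differentiableOn (by simp)) s hmem).hasDerivWithinAt
  set v := derivWithin β (Icc s₀ s₁) s with hv
  have hvj : ∀ j, HasDerivWithinAt (fun σ => β σ j) (v j) (Icc s₀ s₁) s := hasDerivWithinAt_pi.mp hd
  have h1 : derivWithin (fun σ => profQ Q S (β σ) y) (Icc s₀ s₁) s
      = ∑ j, v j * tprof q (↑j + 1) y
        + ∑ i ∈ Finset.Icc 2 (L + 2), ∑ j, v j * partialB j (S i) b y := by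
    have e : (fun σ => profQ Q S (β σ) y) = fun σ => Q y + (∑ j : Fin L, β σ j * tprof q (↑j + 1) y
        + ∑ i ∈ Finset.Icc 2 (L + 2), S i (β σ) y) := by
      funext σ
      rw [profQ, sum_coord (β σ) fun i => profT Q i y]; simp only [h.profT_eq _ hy.le, tprof]
    rw [e]
    exact (((HasDerivWithinAt.fun_sum fun j _ => (hvj j).mul_const _).add
      (HasDerivWithinAt.fun_sum fun i _ => hasDerivWithinAt_comp_param
        (hS.differentiableAt hb0 hχ i hb hy) hd)).const_add (Q y)).derivWithin hu
  have h2 : modTerm Q χ S (Icc s₀ s₁) β s y = ∑ j, (v j - field (cb Q χ) b j) *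
      (tprof q (↑j + 1) y + ∑ i ∈ Finset.Icc 2 (L + 2), partialB j (S i) b y) := by
    rw [modTerm]
    refine sum_congr rfl fun j _ => ?_
    have e : ∑ i ∈ Finset.Icc ((j : ℕ) + 2) (L + 2), partialB j (S i) b y
        = ∑ i ∈ Finset.Icc 2 (L + 2), partialB j (S i) b y := by
      refine sum_subset (Finset.Icc_subset_Icc (by omega) le_rfl) fun i hi hi' => ?_
      rw [Finset.mem_Icc] at hi hi'; exact hS.partialB_eq_zero hb0 hχ (by omega) hb hy.le
    rw [← hbdef, e, h.profT_eq _ hy.le, (hvj j).derivWithin hu, coord_one, field]; simp only [tprof]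
    ring
  have hT : ∀ i, SmoothAt (tprof q i) y := fun i => (h.contDiff_tprof i).contDiffAt
  have hpe : pert q S b = fun y => ∑ j : Fin L, b j * tprof q (↑j + 1) y
      + ∑ i ∈ Finset.Icc 2 (L + 2), S i b y := funext fun y => pert_eq hS.zero b y
  have hs1 : ∀ j ∈ (Finset.univ : Finset (Fin L)),
      SmoothAt (fun y => b j * tprof q (↑j + 1) y) y := fun j _ => contDiffAt_const.mul (hT _)
  have hs2 : ∀ i ∈ Finset.Icc 2 (L + 2), SmoothAt (S i b) y := fun i _ => hS.contDiffAt hχ i hb hy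
  have h3 : opH g Q (pert q S b) y = -∑ j : Fin L, b j * tprof q j y
      + ∑ i ∈ Finset.Icc 2 (L + 2), opH g Q (S i b) y := by
    rw [hpe, opH_add (ContDiffAt.sum hs1) (ContDiffAt.sum hs2), opH_sum _ hs1, opH_sum _ hs2]
    congr 1
    rw [← Finset.sum_neg_distrib]
    refine sum_congr rfl fun j _ => ?_
    rw [opH_const_mul _ _ (hT _)]
    have : opH g Q (tprof q (↑j + 1)) y = -tprof q j y := h.opH_profT j hy
    rw [this]; ring
  have h4 : scal (pert q S b) y = ∑ j : Fin L, b j * scal (tprof q (↑j + 1)) y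
      + ∑ i ∈ Finset.Icc 2 (L + 2), scal (S i b) y := by
    rw [hpe, scal_add_eq (ContDiffAt.sum hs1) (ContDiffAt.sum hs2), scal_sum _ hs1, scal_sum _ hs2]
    congr 1; exact sum_congr rfl fun j _ => scal_const_mul_eq _ (hT _)
  have h5 := hS.spatial_eq h hχ hb hy
  have h6 := sum_shift b fun i => tprof q i y
  have h7 : ∑ i ∈ Finset.Icc 2 (L + 2), vecX (cb Q χ) (S i) b y
      = ∑ j, field (cb Q χ) b j * ∑ i ∈ Finset.Icc 2 (L + 2), partialB j (S i) b y := by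
    simp only [vecX, mul_sum]; exact sum_comm
  have h8 : ∑ i ∈ Finset.Icc 2 (L + 2), ∑ j, v j * partialB j (S i) b y
      = ∑ j, v j * ∑ i ∈ Finset.Icc 2 (L + 2), partialB j (S i) b y := by
    simp only [mul_sum]; exact sum_comm
  have h9 : ∑ j : Fin L, b 0 * b j * theta q (cb Q χ) (↑j + 1) (b 0) y
      = b 0 * ∑ j : Fin L, b j * scal (tprof q (↑j + 1)) y
        + ∑ j, field (cb Q χ) b j * tprof q (↑j + 1) y
        - ∑ j : Fin L, coord b (↑j + 2) * tprof q (↑j + 1) y := by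
    rw [mul_sum, ← sum_add_distrib, ← sum_sub_distrib]
    refine sum_congr rfl fun j _ => ?_
    have : theta q (cb Q χ) (↑j + 1) (b 0) y = scal (tprof q (↑j + 1)) y
        - (2 * (((j : ℕ) + 1 : ℕ) : ℝ) - 1 + cb Q χ (b 0)) * tprof q (↑j + 1) y := rfl
    rw [this, field]; push_cast; ring
  have h10 : ∑ j, (v j - field (cb Q χ) b j) *
      (tprof q (↑j + 1) y + ∑ i ∈ Finset.Icc 2 (L + 2), partialB j (S i) b y)
      = (∑ j, v j * tprof q (↑j + 1) y
        + ∑ j, v j * ∑ i ∈ Finset.Icc 2 (L + 2), partialB j (S i) b y)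
        - (∑ j, field (cb Q χ) b j * tprof q (↑j + 1) y
        + ∑ j, field (cb Q χ) b j * ∑ i ∈ Finset.Icc 2 (L + 2), partialB j (S i) b y) := by
    rw [← sum_add_distrib, ← sum_add_distrib, ← sum_sub_distrib]
    exact sum_congr rfl fun j _ => by ring
  rw [errorTerm, flow, h1, h2, errModel, ← hbdef, coord_one, sum_add_distrib,
    sum_add_distrib, ← mul_sum]
  rw [h3, h4] at h5
  linear_combination h5 - h10 - h7 + h8 - h9 - h6

end


/-! ### Taylor remainders -/

/-- Smooth functions with bounded derivatives. -/
def BddSmooth (f : ℝ → ℝ) : Prop := Smooth f ∧ ∀ m, ∃ C, 0 ≤ C ∧ ∀ u, |iteratedDeriv m f u| ≤ C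

theorem BddSmooth.deriv {f : ℝ → ℝ} (hf : BddSmooth f) : BddSmooth (deriv f) :=
  ⟨(contDiff_infty_iff_deriv.mp hf.1).2, fun m => by
    obtain ⟨C, hC, hb⟩ := hf.2 (m + 1)
    exact ⟨C, hC, fun u => by rw [← iteratedDeriv_succ']; exact hb u⟩⟩

theorem IsTargetProfile.bddSmooth_nonlin {g : ℝ → ℝ} (hg : IsTargetProfile g) : BddSmooth (nonlin g) :=
  ⟨hg.contDiff_nonlin, fun m => exists_bound_of_periodic
    (contDiff_iteratedDeriv hg.contDiff_nonlin m).continuous (T := 2 * π) (by positivity) fun u => by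
      have := congrFun (iteratedDeriv_comp_add_const m (nonlin g) (2 * π)) u
      rw [show (fun x => nonlin g (x + 2 * π)) = nonlin g from funext hg.nonlin_periodic] at this
      exact this.symm⟩

theorem taylorRem_zero (f : ℝ → ℝ) (a e : ℝ) : taylorRem 0 f a e = f (a + e) := by simp [taylorRem]

theorem taylorRem_succ (n : ℕ) (f : ℝ → ℝ) (a e : ℝ) : taylorRem (n + 1) f a e
    = taylorRem n f a e - 1 / (n.factorial : ℝ) * (iteratedDeriv n f a * e ^ n) := by
  rw [taylorRem, taylorRem, sum_range_succ]; ring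

theorem taylorRem_eq_add (f : ℝ → ℝ) (a e : ℝ) {m n : ℕ} (h : m ≤ n) : taylorRem m f a e
    = taylorRem n f a e + ∑ k ∈ Finset.Ico m n, 1 / (k.factorial : ℝ) * (iteratedDeriv k f a * e ^ k) := by
  rw [taylorRem, taylorRem, ← Finset.sum_range_add_sum_Ico _ h]; ring

theorem taylorRem_succ_zero (n : ℕ) (f : ℝ → ℝ) (a : ℝ) : taylorRem (n + 1) f a 0 = 0 := by
  simp [taylorRem, sum_range_succ']

theorem factorial_mul (n : ℕ) (x y : ℝ) : 1 / ((n + 1).factorial : ℝ) * (x * ((n + 1 : ℕ) * y))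
    = 1 / (n.factorial : ℝ) * (x * y) := by
  rw [Nat.factorial_succ]
  have : (n.factorial : ℝ) ≠ 0 := by exact_mod_cast n.factorial_ne_zero
  push_cast; field_simp

section
variable {f : ℝ → ℝ} {u ε : ℝ → ℝ} {u' ε' y : ℝ}

theorem hasDerivAt_taylorRem_zero (hf : Smooth f) (hu : HasDerivAt u u' y) (hε : HasDerivAt ε ε' y) :
    HasDerivAt (fun y => taylorRem 0 f (u y) (ε y)) ((u' + ε') * taylorRem 0 (deriv f) (u y) (ε y)) y := by
  simp only [taylorRem_zero]
  refine (((hf.differentiable (by simp) (u y + ε y)).hasDerivAt).comp y (hu.fun_add hε)).congr_deriv ?_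
  ring

theorem hasDerivAt_taylorRem_succ (hf : Smooth f) (n : ℕ) (hu : HasDerivAt u u' y)
    (hε : HasDerivAt ε ε' y) : HasDerivAt (fun y => taylorRem (n + 1) f (u y) (ε y))
      (u' * taylorRem (n + 1) (deriv f) (u y) (ε y) + ε' * taylorRem n (deriv f) (u y) (ε y)) y := by
  have hm : ∀ m, HasDerivAt (fun y => iteratedDeriv m f (u y)) (iteratedDeriv m (deriv f) (u y) * u') y :=
    fun m => by
      have := ((contDiff_iteratedDeriv hf m).differentiable (by simp) (u y)).hasDerivAt
      rw [← iteratedDeriv_succ, iteratedDeriv_succ'] at this; exact this.comp y hu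
  induction n with
  | zero =>
    have h1 := (hasDerivAt_taylorRem_zero hf hu hε).fun_sub (hm 0)
    have e : (fun y => taylorRem (0 + 1) f (u y) (ε y)) = fun y => taylorRem 0 f (u y) (ε y)
        - iteratedDeriv 0 f (u y) := by funext y; rw [taylorRem_succ]; simp
    rw [e]
    refine h1.congr_deriv ?_
    rw [taylorRem_succ]; simp; ring
  | succ n ih =>
    have h1 := ih.fun_sub (((hm (n + 1)).fun_mul (hε.fun_pow (n + 1))).const_mul (1 / ((n + 1).factorial : ℝ)))
    have e : (fun y => taylorRem (n + 1 + 1) f (u y) (ε y)) = fun y => taylorRem (n + 1) f (u y) (ε y)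
        - 1 / ((n + 1).factorial : ℝ) * (iteratedDeriv (n + 1) f (u y) * ε y ^ (n + 1)) := by
      funext y; rw [taylorRem_succ]
    rw [e]
    refine h1.congr_deriv ?_
    have h2 := factorial_mul n (iteratedDeriv n (deriv f) (u y)) (ε y ^ n * ε')
    rw [taylorRem_succ (n + 1) (deriv f), taylorRem_succ n (deriv f) _ _, iteratedDeriv_succ' (n := n) (f := f)]
    simp only [Nat.add_sub_cancel]
    linear_combination -h2

end

theorem abs_taylorRem_le {f : ℝ → ℝ} (hf : BddSmooth f) (n : ℕ) :
    ∃ C, 0 ≤ C ∧ ∀ a e, |taylorRem n f a e| ≤ C * |e| ^ n := by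
  induction n generalizing f with
  | zero =>
    obtain ⟨C, hC, hb⟩ := hf.2 0
    exact ⟨C, hC, fun a e => by simpa [taylorRem_zero] using hb (a + e)⟩
  | succ n ih =>
    obtain ⟨C, hC, hb⟩ := ih hf.deriv
    refine ⟨C, hC, fun a e => ?_⟩
    have hd : ∀ x ∈ Icc (-|e|) |e|, HasDerivWithinAt (taylorRem (n + 1) f a) (taylorRem n (deriv f) a x)
        (Icc (-|e|) |e|) x := fun x _ => by
      have := hasDerivAt_taylorRem_succ hf.1 n (hasDerivAt_const x a) (hasDerivAt_id x)
      simp only [zero_mul, zero_add, one_mul, id] at this; exact this.hasDerivWithinAt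
    have h1 := (convex_Icc (-|e|) |e|).norm_image_sub_le_of_norm_hasDerivWithin_le (C := C * |e| ^ n) hd
      (fun x hx => (hb a x).trans (mul_le_mul_of_nonneg_left
        (pow_le_pow_left₀ (abs_nonneg _) (abs_le.mpr ⟨hx.1, hx.2⟩) n) hC))
      (x := 0) (y := e) ⟨by simp, abs_nonneg e⟩ ⟨neg_abs_le e, le_abs_self e⟩
    rw [taylorRem_succ_zero, sub_zero, sub_zero, norm_eq_abs, norm_eq_abs] at h1
    rw [pow_succ, ← mul_assoc]; exact h1

theorem IsExt.symOn_taylorRem {g Q q : ℝ → ℝ} (h : IsExt g Q q) {P : Type} {D : Set (P × ℝ)}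
    {E ε : P → ℝ → ℝ} (hε : SymOn D E ε) {K : ℝ} (hK : 0 ≤ K) (hE : ∀ z ∈ D, E z.1 z.2 ≤ K) {f : ℝ → ℝ}
    (hf : BddSmooth f) (n : ℕ) :
    SymOn D (fun p y => E p y ^ n) fun p y => taylorRem n f (q y) (ε p y) := by
  have hp := hε.pos
  have hq : SymOn D (fun _ y => y ^ (-1 : ℤ)) fun _ => deriv q :=
    (((h.symOn_comp hp h.target.smooth).mul (SymTo.zpow hp (-1))).congr_weight fun z _ => one_mul _).congr
      fun z hz => by
        filter_upwards [lt_mem_nhds (hp z hz)] with y hy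
        rw [(h.hasDerivAt hy).deriv, zpow_neg_one]; rfl
  refine .top fun k => ?_
  induction k generalizing f n with
  | zero =>
    obtain ⟨C, hC, hb⟩ := abs_taylorRem_le hf n
    obtain ⟨C', hC', hb'⟩ := hε.bound_zero
    refine SymTo.of_bound hp (fun z hz => ?_) ⟨C * C' ^ n, by positivity, fun z hz => ?_⟩
      fun z hz => pow_nonneg (hε.nonneg z hz) n
    · have h1 := hε.smooth z hz
      have h2 : SmoothAt q z.2 := h.smooth.contDiffAt
      refine (hf.1.contDiffAt.comp z.2 (h2.add h1)).sub (ContDiffAt.sum fun m _ =>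
        contDiffAt_const.mul (((contDiff_iteratedDeriv hf.1 m).contDiffAt.comp z.2 h2).mul (h1.pow m)))
    · rw [mul_assoc, ← mul_pow]
      exact (hb _ _).trans (mul_le_mul_of_nonneg_left (pow_le_pow_left₀ (abs_nonneg _) (hb' z hz) n) hC)
  | succ k ih =>
    have hs : ∀ z ∈ D, SmoothAt (fun y => taylorRem n f (q y) (ε z.1 y)) z.2 := (ih hf n).smooth
    have hd : ∀ z ∈ D, ∀ᶠ y in 𝓝 z.2, HasDerivAt q (deriv q y) y ∧
        HasDerivAt (ε z.1) (deriv (ε z.1) y) y := fun z hz => by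
      filter_upwards [eventually_differentiableAt (hε.smooth z hz)] with y hy
      exact ⟨(h.smooth.differentiable (by simp) y).hasDerivAt, hy.hasDerivAt⟩
    refine SymTo.succ_of_deriv hs (ih hf n).bound_zero (fun z hz => pow_nonneg (hε.nonneg z hz) n) ?_
    rcases n with _ | n
    · have h1 := ((hq.restrict.weaken (w' := fun _ y => y ^ (-1 : ℤ)) zero_le_one
          (fun z hz => zpow_nonneg (hp z hz).le _) fun z _ => by rw [one_mul]).add
        (hε.deriv.restrict.weaken (w' := fun _ y => y ^ (-1 : ℤ)) hK (fun z hz => zpow_nonneg (hp z hz).le _)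
          fun z hz => by
            rw [zpow_neg_one, ← div_eq_mul_inv]
            exact div_le_div_of_nonneg_right (hE z hz) (hp z hz).le)).mul (ih hf.deriv 0)
      refine (h1.weaken zero_le_one (fun z hz => div_nonneg (by simp) (hp z hz).le) fun z hz => by
        simp).congr fun z hz => ?_
      filter_upwards [hd z hz] with y hy
      exact (hasDerivAt_taylorRem_zero hf.1 hy.1 hy.2).deriv.symm
    · have hw : ∀ z ∈ D, 0 ≤ E z.1 z.2 ^ (n + 1) / z.2 := fun z hz =>
        div_nonneg (pow_nonneg (hε.nonneg z hz) _) (hp z hz).le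
      have h1 := ((hq.restrict.mul (ih hf.deriv (n + 1))).weaken (w' := fun p y => E p y ^ (n + 1) / y)
        zero_le_one hw fun z _ => by
          rw [zpow_neg_one, one_mul, div_eq_mul_inv, mul_comm]).add
        ((hε.deriv.restrict.mul (ih hf.deriv n)).weaken (w' := fun p y => E p y ^ (n + 1) / y) zero_le_one hw
          fun z _ => by rw [one_mul, pow_succ]; exact le_of_eq (by ring))
      refine h1.congr fun z hz => ?_
      filter_upwards [hd z hz] with y hy
      exact (hasDerivAt_taylorRem_succ hf.1 n hy.1 hy.2).deriv.symm

/-! ### The error where the cut offs are trivial -/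

section
variable {L : ℕ} [NeZero L] {g Q q χ c : ℝ → ℝ} {b0 : ℝ} {S : ℕ → Par L → ℝ → ℝ}

/-- The error where the cut offs are trivial. -/
noncomputable def errInner (g q c : ℝ → ℝ) (S : ℕ → Par L → ℝ → ℝ) (b : Par L) (y : ℝ) : ℝ :=
  b 0 * scal (S (L + 2) b) y + vecX c (S (L + 2)) b y
    + (taylorRem (L + 3) (nonlin g) (q y) (pert q S b y) / y ^ 2
      + ∑ m ∈ Finset.Icc 2 (L + 2), ∑ d ∈ Finset.Ico (L + 3) (m * (L + 2) + 1),
        1 / (m.factorial : ℝ) * (iteratedDeriv m (nonlin g) (q y) / y ^ 2 * pw (comp q S b y) m d))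

theorem sum_Icc_two (n : ℕ) (φ : ℕ → ℝ) :
    ∑ i ∈ Finset.Icc 2 (n + 1), φ i = ∑ k ∈ Finset.range n, φ (k + 2) := by
  rw [← Finset.Ico_add_one_right_eq_Icc, sum_Ico_eq_sum_range]
  refine sum_congr (by congr 1) fun k _ => by rw [add_comm]

theorem partialB_cutProf (hχ : IsCutoff χ) (i : ℕ) (j : Fin L) {b : Par L} {y : ℝ}
    (hz : √(b 0) * y < 1) : partialB j (cutProf χ S i) b y = partialB j (S i) b y := by
  have h1 : ContinuousAt (fun t => √(Function.update b j t 0) * y) (b j) :=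
    ((Real.continuous_sqrt.continuousAt).comp ((continuous_apply 0).continuousAt.comp
      (hasDerivAt_update b j (b j)).continuousAt)).mul continuousAt_const
  have h2 : ∀ᶠ t in 𝓝 (b j), √(Function.update b j t 0) * y < 1 :=
    h1.eventually (gt_mem_nhds (by simpa using hz))
  refine Filter.EventuallyEq.deriv_eq ?_
  filter_upwards [h2] with t ht
  rw [cutProf, hχ.cutoff_eq_of_lt ht, if_pos rfl, mul_one]

theorem pw_add_two_one {u : ℕ → ℝ} (h0 : u 0 = 0) (k : ℕ) : pw u (k + 2) 1 = 0 := by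
  rw [pw_congr_of_lt (v := fun _ => 0) h0 rfl k fun i hi => by rw [Nat.lt_one_iff.mp hi, h0]]
  simp [pw_succ]

theorem sum_pow_eq {u : ℕ → ℝ} (h0 : u 0 = 0) {n : ℕ} (hn : ∀ i, n + 1 < i → u i = 0) {m : ℕ} (hm : 2 ≤ m) :
    (∑ i ∈ Finset.range (n + 2), u i) ^ m = ∑ k ∈ Finset.range n, pw u m (k + 2)
      + ∑ d ∈ Finset.Ico (n + 2) (m * (n + 1) + 1), pw u m d := by
  obtain ⟨k, rfl⟩ := Nat.exists_eq_add_of_le' hm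
  rw [sum_pow_eq_sum_pw hn, ← Finset.sum_range_add_sum_Ico _ (show n + 2 ≤ (k + 2) * (n + 1) + 1 by nlinarith),
    sum_range_succ', sum_range_succ', pw_succ_zero h0, zero_add, pw_add_two_one h0,
    add_zero, add_zero]

theorem IsProfiles.errModel_eq_errInner (hχ : IsCutoff χ)
    (hS : IsProfiles g Q q c b0 (L + 2) (L + 2) S) {b : Par L} (hb : 0 < b 0) {y : ℝ} (hy : 0 < y)
    (hz : √(b 0) * y < 1) : errModel g Q q c (cutProf χ S) b y = errInner g q c S b y := by
  have hev : ∀ᶠ x in 𝓝 y, √(b 0) * x < 1 :=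
    (continuous_const.mul continuous_id).continuousAt.eventually (gt_mem_nhds hz)
  have he : ∀ i, cutProf χ S i b =ᶠ[𝓝 y] S i b := fun i => by
    filter_upwards [hev] with x hx
    rw [cutProf, hχ.cutoff_eq_of_lt hx, if_pos rfl, mul_one]
  have h1 : ∀ i, opH g Q (cutProf χ S i b) y = opH g Q (S i b) y := fun i => opH_congr (he i)
  have h2 : ∀ i, scal (cutProf χ S i b) y = scal (S i b) y := fun i => scal_congr (he i)
  have h3 : ∀ i, vecX c (cutProf χ S i) b y = vecX c (S i) b y := fun i => by
    simp only [vecX, partialB_cutProf hχ i _ hz]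
  have h4 : comp q (cutProf χ S) b y = comp q S b y := by
    funext i
    rw [comp, comp, (he i).eq_of_nhds]
  have hu0 : comp q S b y 0 = 0 := comp_zero (hS.zero 0 (Or.inl (by omega))) b y
  have hun : ∀ i, L + 1 + 1 < i → comp q S b y i = 0 := fun i hi => by
    rw [comp, hS.zero i (Or.inr (by omega)), coord_of_lt b (by omega)]; simp
  rw [errModel, errInner, pert, h4, pert]; simp only [h1, h2, h3]
  set u := comp q S b y with hu
  set X : ℕ → ℝ := fun i => b 0 * scal (S i b) y + vecX c (S i) b y with hX
  have hX1 : X 1 = 0 := by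
    simp only [hX, hS.zero 1 (Or.inl (by omega))]; simp [scal, vecX, partialB]
  have h5 : ∑ j : Fin L, b 0 * b j * theta q c (↑j + 1) (b 0) y
      = ∑ k ∈ Finset.range (L + 1), b 0 * coord b (k + 1) * theta q c (k + 1) (b 0) y := by
    rw [sum_range_succ, coord_of_lt b (Nat.lt_succ_self L), mul_zero, zero_mul, add_zero,
      Finset.sum_range]
    exact sum_congr rfl fun j _ => by rw [coord_succ]
  have h6 : ∑ i ∈ Finset.Icc 2 (L + 2), (opH g Q (S i b) y + X i)
      = ∑ k ∈ Finset.range (L + 1), (-source g q c (L + 2) S (k + 1) b y + X (k + 2)) := by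
    rw [sum_Icc_two (L + 1)]
    refine sum_congr rfl fun k hk => ?_
    have := mem_range.mp hk
    rw [← hS.eq (k + 1) (by omega) (by omega) b hb y hy]
  have h7 : ∑ k ∈ Finset.range (L + 1), X (k + 2) = ∑ k ∈ Finset.range (L + 1), X (k + 1) + X (L + 2) := by
    have e1 := sum_range_succ (fun k => X (k + 1)) (L + 1)
    have e2 := sum_range_succ' (fun k => X (k + 1)) (L + 1)
    rw [hX1] at e2; linarith
  have h8 : taylorRem 2 (nonlin g) (q y) (∑ i ∈ Finset.range (L + 3), u i) / y ^ 2
      = taylorRem (L + 3) (nonlin g) (q y) (∑ i ∈ Finset.range (L + 3), u i) / y ^ 2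
        + (∑ k ∈ Finset.range (L + 1), nonlinPart g q (L + 2) S (k + 2) b y
          + ∑ m ∈ Finset.Icc 2 (L + 2), ∑ d ∈ Finset.Ico (L + 3) (m * (L + 2) + 1),
            1 / (m.factorial : ℝ) * (iteratedDeriv m (nonlin g) (q y) / y ^ 2 * pw u m d)) := by
    rw [taylorRem_eq_add _ _ _ (show 2 ≤ L + 3 by omega), add_div, Finset.sum_div,
      (show Finset.Ico 2 (L + 3) = Finset.Icc 2 (L + 2) from Finset.Ico_add_one_right_eq_Icc 2 (L + 2))]
    congr 1; simp only [nonlinPart]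
    rw [sum_comm, ← sum_add_distrib]
    refine sum_congr rfl fun m hm => ?_
    rw [sum_pow_eq hu0 hun (Finset.mem_Icc.mp hm).1, ← mul_sum, ← mul_sum, ← mul_sum, ← mul_sum]
    ring
  rw [h5, h6, h8, sum_add_distrib, h7, Finset.sum_neg_distrib]
  have h9 : ∑ k ∈ Finset.range (L + 1), source g q c (L + 2) S (k + 1) b y
      = ∑ k ∈ Finset.range (L + 1), b 0 * coord b (k + 1) * theta q c (k + 1) (b 0) y
        + ∑ k ∈ Finset.range (L + 1), X (k + 1)
        + ∑ k ∈ Finset.range (L + 1), nonlinPart g q (L + 2) S (k + 2) b y := by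
    rw [← sum_add_distrib, ← sum_add_distrib]; rfl
  linear_combination -h9

end


/-! ### The size of the error where the cut offs are trivial -/

section
variable {L : ℕ} [NeZero L] {g Q q χ c : ℝ → ℝ} {b0 K : ℝ} {S : ℕ → Par L → ℝ → ℝ}

/-- The zone `y ≤ 1`. -/
def zoneOrigin (L : ℕ) [NeZero L] (b0 K : ℝ) : Set (Par L × ℝ) :=
  {z | z.1 ∈ parSet L b0 K ∧ z.2 ∈ Ioc (0 : ℝ) 1}

/-- The zone `y ≥ 1`. -/
def zoneFar (L : ℕ) [NeZero L] (b0 K : ℝ) : Set (Par L × ℝ) :=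
  {z | z.1 ∈ parSet L b0 K ∧ 1 ≤ z.2}

/-- The zone `1 ≤ y < B₀`. -/
def zoneMid (L : ℕ) [NeZero L] (b0 K : ℝ) : Set (Par L × ℝ) :=
  {z | z.1 ∈ parSet L b0 K ∧ 1 ≤ z.2 ∧ √(z.1 0) * z.2 < 1}

theorem zoneMid_subset : zoneMid L b0 K ⊆ zoneFar L b0 K := fun _ h => ⟨h.1, h.2.1⟩

theorem HomSum.symOn_origin (hK : 0 ≤ K) {s : ℕ} {n d : ℤ} {r : ℕ} {S : Par L → ℝ → ℝ}
    (hS : HomSum (Low b0 s n) d r S) :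
    SymOn (zoneOrigin L b0 K) (fun b y => b 0 ^ d * y ^ s) S := by
  obtain ⟨c, hc⟩ := hS.symOn hK (D := {z : ℝ × ℝ | z.1 ∈ Ioo 0 b0 ∧ z.2 ∈ Ioc (0 : ℝ) 1})
    (w := fun _ _ y => y ^ s) (fun z hz => ⟨hz.1, hz.2.1⟩) (fun _ z hz => pow_nonneg hz.2.1.le _)
    fun F hF => ⟨0, fun _ _ => hF.symOn_zero⟩
  exact (hc c le_rfl).mono_set fun z hz => ⟨hz.1, hz.1.1, hz.2⟩

theorem HomSum.symOn_low (hK : 0 ≤ K) {s : ℕ} {n d : ℤ} {r : ℕ} {S : Par L → ℝ → ℝ}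
    (hS : HomSum (Low b0 s n) d r S) : ∃ c₀ : ℕ, ∀ c, c₀ ≤ c →
    SymOn (zoneFar L b0 K) (fun b y => b 0 ^ d * (y ^ n * (1 + log y) ^ c)) S := by
  obtain ⟨c₀, hc⟩ := hS.symOn hK (D := strip b0)
    (w := fun c _ y => y ^ n * (1 + log y) ^ c) (fun z hz => ⟨hz.1, one_pos.trans_le hz.2⟩)
    (fun _ z hz => weight_nonneg _ _ hz.2) fun F hF => hF.symOn
  exact ⟨c₀, fun c h => (hc c h).mono_set fun z hz => ⟨hz.1, hz.1.1, hz.2⟩⟩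

theorem HomSum.symOn_lead (hb0 : b0 ≤ 1 / 16) (hK : 0 ≤ K) {i : ℕ} {d : ℤ} {r : ℕ}
    {S : Par L → ℝ → ℝ} (hS : HomSum (Lead b0 i) d r S) : ∃ c₀ : ℕ, ∀ c, c₀ ≤ c →
    SymOn (zoneFar L b0 K) (fun b y => b 0 ^ d * leadW i c (b 0) y) S := by
  obtain ⟨c₀, hc⟩ := hS.symOn hK (D := strip b0)
    (w := leadW i) (fun z hz => ⟨hz.1, one_pos.trans_le hz.2⟩)
    (fun _ z hz => leadW_nonneg _ _ _ hz.2) fun F hF => hF.symOn hb0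
  exact ⟨c₀, fun c h => (hc c h).mono_set fun z hz => ⟨hz.1, hz.1.1, hz.2⟩⟩

theorem HomSum.drift (hb0 : b0 ≤ 1 / 16) (hc : IsSpeed b0 c) {i d r : ℕ} (hr : 1 ≤ r)
    {S : Par L → ℝ → ℝ} (hS : HomSum (Lead b0 i) d r S) :
    HomSum (Lead b0 i) (d + 1 : ℕ) (r + 1) fun b y => b 0 * scal (S b) y + HarmonicHeatFlow.vecX c S b y := by
  have hcc : Coef b0 c := ⟨hc.small.log_of_le hb0 (by omega), hc.scal⟩
  refine HomSum.add ?_ ?_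
  · have := (hS.scal_right hb0).mul_coord (r' := r + 1) 0 (by omega) (Or.inl rfl)
    simpa using this
  · simpa using hS.vecX (CoefClass.lead hb0 i) hr hcc

theorem IsExt.homSum_pw_mul (h : IsExt g Q q) {n D : ℕ} (hS : IsProfiles g Q q c b0 n D S) (d : ℕ)
    {m : ℕ} (hm : 2 ≤ m) : HomSum (Low b0 (2 * d + 1) (2 * d - 3)) (d + 1 : ℕ) d fun b y =>
      iteratedDeriv m (nonlin g) (q y) / y ^ 2 * pw (comp q S b y) m (d + 1) := by
  obtain ⟨k, rfl⟩ := Nat.exists_eq_add_of_le' hm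
  have h1 := homSum_pw_of_lt (U := fun i b y => comp q S b y i)
    (comp_zero (hS.zero 0 (Or.inl (by omega)))) d (fun i hi _ => h.homSum_comp hS i hi) k
  exact_mod_cast h1.coef_mul (𝒦' := Low b0 (2 * d + 1) (2 * d - 3))
    (k := fun _ y => iteratedDeriv (k + 2) (nonlin g) (q y) / y ^ 2)
    fun F hF => h.low_mul_nonlin (m := k + 2) (by omega) (by exact_mod_cast hF)

theorem IsExt.symOn_errInner (h : IsExt g Q q) {D : Set (Par L × ℝ)} {W E : Par L → ℝ → ℝ}
    (hW : SymOn D W fun b y => b 0 * scal (S (L + 2) b) y + vecX c (S (L + 2)) b y)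
    (hE : SymOn D E (pert q S)) {C₁ C₂ : ℝ} (hC₁ : 0 ≤ C₁) (hC₂ : 0 ≤ C₂)
    (hE₁ : ∀ z ∈ D, E z.1 z.2 ≤ C₁) (hE₂ : ∀ z ∈ D, E z.1 z.2 ^ (L + 3) / z.2 ^ 2 ≤ C₂ * W z.1 z.2)
    (hpw : ∀ m d : ℕ, 2 ≤ m → L + 2 ≤ d → SymOn D W fun b y =>
      iteratedDeriv m (nonlin g) (q y) / y ^ 2 * pw (comp q S b y) m (d + 1)) :
    SymOn D W (errInner g q c S) := by
  have h1 : SymOn D W fun b y => taylorRem (L + 3) (nonlin g) (q y) (pert q S b y) / y ^ 2 := by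
    refine (((h.symOn_taylorRem hE hC₁ hE₁ h.target.bddSmooth_nonlin (L + 3)).mul
      (SymTo.zpow hE.pos (-2))).weaken hC₂ hW.nonneg fun z hz => ?_).congr fun z hz =>
        Eventually.of_forall fun y => ?_
    · rw [zpow_neg, ← div_eq_mul_inv]; exact_mod_cast hE₂ z hz
    · beta_reduce; rw [zpow_neg, ← div_eq_mul_inv]; norm_cast
  have h2 : SymOn D W fun b y => ∑ m ∈ Finset.Icc 2 (L + 2), ∑ d ∈ Finset.Ico (L + 3) (m * (L + 2) + 1),
      1 / (m.factorial : ℝ) * (iteratedDeriv m (nonlin g) (q y) / y ^ 2 * pw (comp q S b y) m d) :=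
    SymTo.sum _ hE.pos hW.nonneg fun m hm => SymTo.sum _ hE.pos hW.nonneg fun d hd => by
      obtain ⟨k, rfl⟩ := Nat.exists_eq_add_of_le' (show 1 ≤ d by
        have := (Finset.mem_Ico.mp hd).1; omega)
      have := (Finset.mem_Ico.mp hd).1
      exact (hpw m k (Finset.mem_Icc.mp hm).1 (by omega)).const_mul _
  exact hW.add (h1.add h2)

theorem IsProfiles.symOn_pert_origin (h : IsExt g Q q) (hb0 : b0 ≤ 1 / 16) (hK : 0 ≤ K) {n D : ℕ}
    (hS : IsProfiles g Q q c b0 n D S) :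
    SymOn (zoneOrigin L b0 K) (fun b y => b 0 * y ^ 3) (pert q S) := by
  have hp : ∀ z ∈ zoneOrigin L b0 K, 0 < z.2 := fun z hz => hz.2.1
  have hw : ∀ z ∈ zoneOrigin L b0 K, 0 ≤ z.1 0 * z.2 ^ 3 := fun z hz =>
    mul_nonneg hz.1.1.1.le (pow_nonneg hz.2.1.le _)
  refine SymTo.sum _ hp hw fun i _ => ?_
  rcases Nat.eq_zero_or_pos i with rfl | hi
  · exact (SymTo.zero hp hw).congr fun z _ => Eventually.of_forall fun y =>
      (comp_zero (hS.zero 0 (Or.inl (by omega))) z.1 y).symm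
  · refine ((h.homSum_comp hS i hi).symOn_origin hK).of_le fun z hz => ?_
    obtain ⟨k, rfl⟩ := Nat.exists_eq_add_of_le' hi
    have h0 := hz.1.1.1
    have h1 : z.1 0 ≤ 1 := by linarith [hz.1.1.2]
    rw [zpow_natCast, show 2 * (k + 1) + 1 = 2 * k + 3 by ring, pow_succ, pow_add]
    have h2 := pow_le_one₀ h0.le h1 (n := k)
    have h3 := pow_le_one₀ hz.2.1.le hz.2.2 (n := 2 * k)
    have h4 := pow_nonneg hz.2.1.le 3
    calc z.1 0 ^ k * z.1 0 * (z.2 ^ (2 * k) * z.2 ^ 3)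
        = z.1 0 ^ k * z.2 ^ (2 * k) * (z.1 0 * z.2 ^ 3) := by ring
      _ ≤ 1 * (z.1 0 * z.2 ^ 3) := mul_le_mul_of_nonneg_right
          (mul_le_one₀ h2 (pow_nonneg hz.2.1.le _) h3) (hw z hz)
      _ = _ := one_mul _

theorem IsProfiles.symOn_errInner_origin (h : IsExt g Q q) (hb0 : b0 ≤ 1 / 16) (hK : 0 ≤ K)
    (hc : IsSpeed b0 c) {n : ℕ} (hS : IsProfiles g Q q c b0 n (L + 2) S) :
    SymOn (zoneOrigin L b0 K) (fun b y => b 0 ^ (L + 3) * y ^ (2 * L + 5)) (errInner g q c S) := by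
  have hb1 : ∀ z ∈ zoneOrigin L b0 K, 0 < z.1 0 ∧ z.1 0 ≤ 1 := fun z hz =>
    ⟨hz.1.1.1, by linarith [hz.1.1.2]⟩
  have hdr := ((hS.homSum (L + 2) (by omega)).drift hb0 hc (by omega)).mono (𝒦' := Low b0 _ _)
    (fun F hF => hF.low) le_rfl
  refine h.symOn_errInner ((hdr.symOn_origin hK).congr_weight fun z hz => ?_)
    (hS.symOn_pert_origin h hb0 hK) zero_le_one zero_le_one (fun z hz => ?_) (fun z hz => ?_)
    fun m d hm hd => ((h.homSum_pw_mul hS d hm).symOn_origin hK).of_le fun z hz => ?_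
  · rw [zpow_natCast]; rfl
  · exact mul_le_one₀ (hb1 z hz).2 (pow_nonneg hz.2.1.le _) (pow_le_one₀ hz.2.1.le hz.2.2)
  · have h0 := hz.2.1
    have h1 : (z.1 0 * z.2 ^ 3) ^ (L + 3) / z.2 ^ 2 = z.1 0 ^ (L + 3) * (z.2 ^ (2 * L + 5) * z.2 ^ (L + 2)) := by
      rw [div_eq_iff (by positivity)]; ring
    rw [h1, one_mul]
    refine mul_le_mul_of_nonneg_left ?_ (pow_nonneg (hb1 z hz).1.le _)
    exact mul_le_of_le_one_right (by positivity) (pow_le_one₀ h0.le hz.2.2)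
  · rw [zpow_natCast]
    exact mul_le_mul (pow_le_pow_of_le_one (hb1 z hz).1.le (hb1 z hz).2 (by omega))
      (pow_le_pow_of_le_one hz.2.1.le hz.2.2 (by omega)) (pow_nonneg hz.2.1.le _)
      (pow_nonneg (hb1 z hz).1.le _)

theorem zoneMid.mul_sq_le {z : Par L × ℝ} (hz : z ∈ zoneMid L b0 K) : z.1 0 * z.2 ^ 2 ≤ 1 := by
  have h0 := hz.1.1.1
  rw [← sq_sqrt h0.le, ← mul_pow]
  exact pow_le_one₀ (mul_nonneg (sqrt_nonneg _) (by linarith [hz.2.1])) hz.2.2.le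

theorem IsProfiles.symOn_pert_mid (h : IsExt g Q q) (hK : 0 ≤ K) {n D : ℕ}
    (hS : IsProfiles g Q q c b0 n D S) : ∃ e : ℕ,
    SymOn (zoneMid L b0 K) (fun b y => b 0 * y * (1 + log y) ^ e) (pert q S) := by
  choose! e he using fun i (hi : 1 ≤ i) => (h.homSum_comp hS i hi).symOn_low hK
  refine ⟨∑ i ∈ Finset.range (L + 3), e i, ?_⟩
  set E := ∑ i ∈ Finset.range (L + 3), e i
  have hp : ∀ z ∈ zoneMid L b0 K, 0 < z.2 := fun z hz => one_pos.trans_le hz.2.1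
  have hw : ∀ z ∈ zoneMid L b0 K, 0 ≤ z.1 0 * z.2 * (1 + log z.2) ^ E := fun z hz =>
    mul_nonneg (mul_nonneg hz.1.1.1.le (hp z hz).le)
      (pow_nonneg (zero_le_one.trans (one_le_one_add_log hz.2.1)) _)
  refine SymTo.sum _ hp hw fun i hi => ?_
  rcases Nat.eq_zero_or_pos i with rfl | hi0
  · exact (SymTo.zero hp hw).congr fun z _ => Eventually.of_forall fun y =>
      (comp_zero (hS.zero 0 (Or.inl (by omega))) z.1 y).symm
  · have hle : e i ≤ E := single_le_sum (f := e) (fun _ _ => Nat.zero_le _) hi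
    refine ((he i hi0 E hle).mono_set zoneMid_subset).of_le fun z hz => ?_
    obtain ⟨k, rfl⟩ := Nat.exists_eq_add_of_le' hi0
    have h0 := hz.1.1.1
    rw [zpow_natCast, show (2 * ((k + 1 : ℕ) : ℤ) - 1) = ((2 * k + 1 : ℕ) : ℤ) by push_cast; ring,
      zpow_natCast]
    calc z.1 0 ^ (k + 1) * (z.2 ^ (2 * k + 1) * (1 + log z.2) ^ E)
        = (z.1 0 * z.2 ^ 2) ^ k * (z.1 0 * z.2 * (1 + log z.2) ^ E) := by ring
      _ ≤ 1 * (z.1 0 * z.2 * (1 + log z.2) ^ E) := mul_le_mul_of_nonneg_right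
          (pow_le_one₀ (mul_nonneg h0.le (sq_nonneg _)) (zoneMid.mul_sq_le hz)) (hw z hz)
      _ = _ := one_mul _

theorem IsProfiles.symOn_errInner_mid (h : IsExt g Q q) (hb0 : b0 ≤ 1 / 16) (hK : 0 ≤ K)
    (hc : IsSpeed b0 c) {n : ℕ} (hS : IsProfiles g Q q c b0 n (L + 2) S) : SymOn (zoneMid L b0 K)
      (fun b y => b 0 ^ (L + 3) * (y ^ (2 * L + 3) * ell (b 0) y + y ^ (2 * L + 2)))
      (errInner g q c S) := by
  obtain ⟨e, he⟩ := hS.symOn_pert_mid h hK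
  have hp : ∀ z ∈ zoneMid L b0 K, 0 < z.2 := fun z hz => one_pos.trans_le hz.2.1
  have hw : ∀ z ∈ zoneMid L b0 K, 0 ≤ z.1 0 ^ (L + 3) *
      (z.2 ^ (2 * L + 3) * ell (z.1 0) z.2 + z.2 ^ (2 * L + 2)) := fun z hz =>
    mul_nonneg (pow_nonneg hz.1.1.1.le _) (add_nonneg (mul_nonneg (pow_nonneg (hp z hz).le _)
      (ell_nonneg _ _)) (pow_nonneg (hp z hz).le _))
  obtain ⟨c₁, h1⟩ := ((hS.homSum (L + 2) (by omega)).drift hb0 hc (by omega)).symOn_lead hb0 hK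
  obtain ⟨C₁, hC₁, hb₁⟩ := one_add_log_pow_le c₁
  obtain ⟨C₂, hC₂, hb₂⟩ := one_add_log_pow_le e
  obtain ⟨C₃, hC₃, hb₃⟩ := one_add_log_pow_le (e * (L + 3))
  refine h.symOn_errInner (((h1 c₁ le_rfl).mono_set zoneMid_subset).weaken (K := 1 + C₁)
    (by positivity) hw fun z hz => ?_) he hC₂ hC₃ (fun z hz => ?_) (fun z hz => ?_) fun m d hm hd => ?_
  · have hy := hp z hz
    rw [zpow_natCast, leadW, show 2 * ((L + 2 : ℕ) : ℤ) - 1 = ((2 * L + 3 : ℕ) : ℤ) by push_cast; ring,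
      show 2 * ((L + 2 : ℕ) : ℤ) - 3 = ((2 * L + 1 : ℕ) : ℤ) by push_cast; ring, zpow_natCast,
      zpow_natCast, mul_left_comm]
    refine mul_le_mul_of_nonneg_left ?_ (pow_nonneg hz.1.1.1.le _)
    have h2 := mul_le_mul_of_nonneg_left (hb₁ z.2 hz.2.1) (pow_nonneg hy.le (2 * L + 1))
    have h3 : z.2 ^ (2 * L + 1) * (C₁ * z.2) = C₁ * z.2 ^ (2 * L + 2) := by ring
    have h4 : 0 ≤ z.2 ^ (2 * L + 3) * ell (z.1 0) z.2 :=
      mul_nonneg (pow_nonneg hy.le _) (ell_nonneg _ _)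
    have h5 : 0 ≤ z.2 ^ (2 * L + 2) := pow_nonneg hy.le _
    have h6 := mul_nonneg hC₁ h4
    linarith
  · have h2 := hb₂ z.2 hz.2.1
    have h0 := hz.1.1.1
    have hy := hp z hz
    calc z.1 0 * z.2 * (1 + log z.2) ^ e ≤ z.1 0 * z.2 * (C₂ * z.2) := by gcongr
      _ = C₂ * (z.1 0 * z.2 ^ 2) := by ring
      _ ≤ C₂ * 1 := mul_le_mul_of_nonneg_left (zoneMid.mul_sq_le hz) hC₂
      _ = C₂ := mul_one _
  · have h0 := hz.1.1.1
    have hy := hp z hz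
    have h2 := hb₃ z.2 hz.2.1
    have h3 : z.2 ^ (L + 2) ≤ z.2 ^ (2 * L + 2) := pow_le_pow_right₀ hz.2.1 (by omega)
    have h4 : 0 ≤ z.2 ^ (2 * L + 3) * ell (z.1 0) z.2 :=
      mul_nonneg (pow_nonneg hy.le _) (ell_nonneg _ _)
    calc (z.1 0 * z.2 * (1 + log z.2) ^ e) ^ (L + 3) / z.2 ^ 2
        = z.1 0 ^ (L + 3) * z.2 ^ (L + 1) * (1 + log z.2) ^ (e * (L + 3)) := by
          rw [mul_pow, mul_pow, ← pow_mul, div_eq_iff (by positivity)]; ring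
      _ ≤ z.1 0 ^ (L + 3) * z.2 ^ (L + 1) * (C₃ * z.2) := by gcongr
      _ = C₃ * (z.1 0 ^ (L + 3) * z.2 ^ (L + 2)) := by ring
      _ ≤ _ := by gcongr; linarith
  · obtain ⟨c₂, h2⟩ := (h.homSum_pw_mul hS d hm).symOn_low hK
    obtain ⟨C, hC, hb⟩ := one_add_log_pow_le c₂
    refine ((h2 c₂ le_rfl).mono_set zoneMid_subset).weaken hC hw fun z hz => ?_
    obtain ⟨k, rfl⟩ := Nat.exists_eq_add_of_le hd
    have h0 := hz.1.1.1
    have hy := hp z hz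
    have h4 : 0 ≤ z.2 ^ (2 * L + 3) * ell (z.1 0) z.2 :=
      mul_nonneg (pow_nonneg hy.le _) (ell_nonneg _ _)
    rw [zpow_natCast, show 2 * ((L + 2 + k : ℕ) : ℤ) - 3 = ((2 * L + 1 + 2 * k : ℕ) : ℤ) by
      push_cast; ring, zpow_natCast]
    calc z.1 0 ^ (L + 2 + k + 1) * (z.2 ^ (2 * L + 1 + 2 * k) * (1 + log z.2) ^ c₂)
        ≤ z.1 0 ^ (L + 2 + k + 1) * (z.2 ^ (2 * L + 1 + 2 * k) * (C * z.2)) := by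
          gcongr; exact hb z.2 hz.2.1
      _ = C * (z.1 0 ^ (L + 3) * ((z.1 0 * z.2 ^ 2) ^ k * z.2 ^ (2 * L + 2))) := by ring
      _ ≤ C * (z.1 0 ^ (L + 3) * (1 * z.2 ^ (2 * L + 2))) := by
          gcongr; exact pow_le_one₀ (by positivity) (zoneMid.mul_sq_le hz)
      _ ≤ _ := by gcongr; linarith

end


/-! ### The size of the error at the scale of the cut offs -/

theorem exists_sqrt_mul_log_pow_le (m : ℕ) : ∃ C, 0 ≤ C ∧ ∀ b ∈ Ioc (0 : ℝ) 1,
    √b * |log b| ^ m ≤ C := by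
  obtain ⟨C, hC, hb⟩ := one_add_log_pow_le m
  refine ⟨2 ^ m * C, by positivity, fun b hbb => ?_⟩
  have ht : 0 < √b := sqrt_pos.mpr hbb.1
  have h1 := hb (√b)⁻¹ (one_le_inv_iff₀.mpr ⟨ht, Real.sqrt_le_one.mpr hbb.2⟩)
  have hl : |log b| = -log b := abs_of_nonpos (log_nonpos hbb.1.le hbb.2)
  rw [log_inv, log_sqrt hbb.1.le, ← div_eq_mul_inv, le_div_iff₀ ht] at h1
  have h2 : |log b| ^ m ≤ (2 * (1 + -(log b / 2))) ^ m :=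
    pow_le_pow_left₀ (abs_nonneg _) (by rw [hl]; linarith) m
  rw [mul_pow] at h2
  calc √b * |log b| ^ m ≤ √b * (2 ^ m * (1 + -(log b / 2)) ^ m) := by gcongr
    _ = 2 ^ m * ((1 + -(log b / 2)) ^ m * √b) := by ring
    _ ≤ _ := by gcongr

section
variable {L : ℕ} [NeZero L] {g Q q χ c : ℝ → ℝ} {b0 K : ℝ} {S : ℕ → Par L → ℝ → ℝ}

/-- The zone `B₀ / 2 < y < 3 B₁`. -/
def zoneCut (L : ℕ) [NeZero L] (b0 K : ℝ) : Set (Par L × ℝ) :=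
  {z | z.1 ∈ parSet L b0 K ∧ 1 / 2 < √(z.1 0) * z.2 ∧ √(z.1 0) * z.2 < 3 * |log (z.1 0)|}

/-- The relations between `t = √b₁`, `ℓ = |log b₁|` and `y` for `B₀ / 2 < y < 3 B₁`. -/
structure CutScale (t ℓ y : ℝ) : Prop where
  pos : 0 < t
  le_one : t ≤ 1
  one_le_log : 1 ≤ ℓ
  one_le : 1 ≤ y
  half_le : 1 / 2 ≤ t * y
  mul_le : t * y ≤ 3 * ℓ
  log_le : 1 + log y ≤ 4 * ℓ

theorem zoneCut.scale (hb0 : b0 ≤ 1 / 16) {z : Par L × ℝ} (hz : z ∈ zoneCut L b0 K) :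
    CutScale (√(z.1 0)) |log (z.1 0)| z.2 := by
  have h0 := hz.1.1.1
  have ht : 0 < √(z.1 0) := sqrt_pos.mpr h0
  have ht4 : √(z.1 0) ≤ 1 / 4 := by
    rw [show (1 / 4 : ℝ) = √(1 / 16) by rw [show (1 / 16 : ℝ) = (1 / 4) ^ 2 by norm_num,
      Real.sqrt_sq (by norm_num)]]
    exact Real.sqrt_le_sqrt (by linarith [hz.1.1.2])
  have hl := one_le_abs_log hb0 hz.1.1
  have hy : 1 ≤ z.2 := by
    by_contra! hlt
    have := hz.2.1
    have h1 : √(z.1 0) * z.2 ≤ √(z.1 0) * 1 := by gcongr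
    linarith
  refine ⟨ht, by linarith, hl, hy, hz.2.1.le, hz.2.2.le, ?_⟩
  have h1 : log (√(z.1 0) * z.2) ≤ √(z.1 0) * z.2 - 1 := log_le_sub_one_of_pos (by positivity)
  rw [log_mul ht.ne' (by positivity), log_sqrt h0.le] at h1
  have h2 : |log (z.1 0)| = -log (z.1 0) :=
    abs_of_nonpos (log_nonpos h0.le (by linarith [hz.1.1.2]))
  have := hz.2.2
  linarith

namespace CutScale
variable {t ℓ y : ℝ}

theorem inv_le (h : CutScale t ℓ y) : y⁻¹ ≤ 2 * t := by
  have := h.half_le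
  have hy : 0 < y := one_pos.trans_le h.one_le
  rw [inv_le_iff_one_le_mul₀ hy]; linarith

theorem log_pow_le (h : CutScale t ℓ y) (e : ℕ) : (1 + log y) ^ e ≤ 4 ^ e * ℓ ^ e := by
  rw [← mul_pow]
  exact pow_le_pow_left₀ (zero_le_one.trans (one_le_one_add_log h.one_le)) h.log_le e

theorem pow_mul_le (h : CutScale t ℓ y) (m n : ℕ) : t ^ (n + m) * y ^ m ≤ 3 ^ m * (t ^ n * ℓ ^ m) := by
  have := h.pos
  have hy : 0 < y := one_pos.trans_le h.one_le
  calc t ^ (n + m) * y ^ m = t ^ n * (t * y) ^ m := by ring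
    _ ≤ t ^ n * (3 * ℓ) ^ m := mul_le_mul_of_nonneg_left
        (pow_le_pow_left₀ (by positivity) h.mul_le m) (by positivity)
    _ = _ := by ring

end CutScale

theorem zoneCut.pos (hb0 : b0 ≤ 1 / 16) : ∀ z ∈ zoneCut L b0 K, 0 < z.2 := fun _ hz =>
  one_pos.trans_le (zoneCut.scale hb0 hz).one_le

theorem zoneCut_subset (hb0 : b0 ≤ 1 / 16) : zoneCut L b0 K ⊆ zoneFar L b0 K := fun _ hz =>
  ⟨hz.1, (zoneCut.scale hb0 hz).one_le⟩

theorem sqrt_pow_two_mul {b : ℝ} (hb : 0 < b) (n : ℕ) : √b ^ (2 * n) = b ^ n := by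
  rw [pow_mul, sq_sqrt hb.le]

theorem ell_le {b y : ℝ} (h : CutScale (√b) |log b| y) : ell b y ≤ 4 := by
  rw [ell, div_le_iff₀ (one_pos.trans_le h.one_le_log)]
  have hp : 0 < √b * y := by linarith [h.half_le]
  have h1 := log_le_sub_one_of_pos hp
  have h2 : log (1 / 2) ≤ log (√b * y) := log_le_log (by norm_num) h.half_le
  rw [one_div, log_inv] at h2
  have := Real.log_two_lt_d9
  have h3 := h.mul_le
  have h4 := h.one_le_log
  have : |log (√b * y)| ≤ 3 * |log b| := abs_le.mpr ⟨by linarith, by linarith⟩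
  linarith

/-- The part of the error which is not small at the scale `B₁`. -/
noncomputable def errTheta (q c : ℝ → ℝ) (b : Par L) (y : ℝ) : ℝ :=
  ∑ j : Fin L, b 0 * b j * theta q c (↑j + 1) (b 0) y

/-- The error without `errTheta`. -/
noncomputable def errRest (g Q q c : ℝ → ℝ) (S : ℕ → Par L → ℝ → ℝ) (b : Par L) (y : ℝ) : ℝ :=
  ∑ i ∈ Finset.Icc 2 (L + 2), (opH g Q (S i b) y + (b 0 * scal (S i b) y + vecX c (S i) b y))
    + taylorRem 2 (nonlin g) (q y) (pert q S b y) / y ^ 2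

theorem IsExt.homSum_theta (h : IsExt g Q q) (hb0 : b0 ≤ 1 / 16) (hc : IsSpeed b0 c) (j : Fin L) :
    HomSum (Lead b0 (↑j + 1)) ((j : ℕ) + 2 : ℕ) L fun b : Par L => fun y =>
      b 0 * b j * theta q c (↑j + 1) (b 0) y := by
  have h1 := (HomSum.term (MonOK.single (r := L) j (Or.inr j.2))
    (h.lead_theta hb0 hc (↑j + 1) (by omega))).mul_coord (r' := L) 0 le_rfl (Or.inl rfl)
  have e : (((j : ℕ) : ℤ) + 1 + (((0 : Fin L) : ℕ) + 1)) = ((j + 2 : ℕ) : ℤ) := by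
    simp only [Fin.val_zero]; push_cast; ring
  rw [e] at h1; exact h1.congr fun b _ y _ => by rw [mon_single]; ring

theorem IsExt.symOn_errTheta (h : IsExt g Q q) (hb0 : b0 ≤ 1 / 16) (hK : 0 ≤ K) (hc : IsSpeed b0 c) :
    SymOn (zoneCut L b0 K) (fun b _ => √(b 0) ^ 3 * |log (b 0)| ^ (2 * L))
      (errTheta q c) := by
  have hw : ∀ z ∈ zoneCut L b0 K, 0 ≤ √(z.1 0) ^ 3 * |log (z.1 0)| ^ (2 * L) :=
    fun z _ => by positivity
  refine SymTo.sum _ (zoneCut.pos hb0) hw fun j _ => ?_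
  obtain ⟨e, he⟩ := (h.homSum_theta hb0 hc j).symOn_lead (K := K) hb0 hK
  obtain ⟨C, hC, hb⟩ := one_add_log_pow_le e
  refine ((he e le_rfl).mono_set (zoneCut_subset hb0)).weaken
    (K := 4 * 3 ^ (2 * (j : ℕ) + 1) + C * 3 ^ (2 * (j : ℕ))) (by positivity) hw fun z hz => ?_
  have hs := zoneCut.scale hb0 hz
  have hell := ell_le hs
  have h0 := hz.1.1.1
  set t := √(z.1 0)
  set ℓ := |log (z.1 0)|
  have hy : 0 < z.2 := one_pos.trans_le hs.one_le
  have ht := hs.pos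
  have hℓ := hs.one_le_log
  have hj := j.2
  set m : ℕ := ↑j
  have e1 : z.1 0 ^ (m + 2) = t ^ (3 + (2 * m + 1)) := by
    rw [show 3 + (2 * m + 1) = 2 * (m + 2) by ring, sqrt_pow_two_mul h0]
  have e2 : z.1 0 ^ (m + 2) = t ^ (4 + 2 * m) := by
    rw [show 4 + 2 * m = 2 * (m + 2) by ring, sqrt_pow_two_mul h0]
  have h1 : z.1 0 ^ (m + 2) * (z.2 ^ (2 * m + 1) * ell (z.1 0) z.2)
      ≤ 4 * 3 ^ (2 * m + 1) * (t ^ 3 * ℓ ^ (2 * L)) := by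
    calc _ = t ^ (3 + (2 * m + 1)) * z.2 ^ (2 * m + 1) * ell (z.1 0) z.2 := by rw [e1]; ring
      _ ≤ (3 ^ (2 * m + 1) * (t ^ 3 * ℓ ^ (2 * m + 1))) * 4 :=
          mul_le_mul (hs.pow_mul_le _ _) hell (ell_nonneg _ _) (by positivity)
      _ ≤ (3 ^ (2 * m + 1) * (t ^ 3 * ℓ ^ (2 * L))) * 4 := by gcongr; omega
      _ = _ := by ring
  have h2 : z.1 0 ^ (m + 2) * (z.2 ^ (2 * (m : ℤ) - 1) * (1 + log z.2) ^ e)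
      ≤ C * 3 ^ (2 * m) * (t ^ 3 * ℓ ^ (2 * L)) := by
    calc _ ≤ z.1 0 ^ (m + 2) * (z.2 ^ (2 * (m : ℤ) - 1) * (C * z.2)) := by
          have := hb z.2 hs.one_le
          gcongr
      _ = C * (t ^ (4 + 2 * m) * z.2 ^ (2 * m)) := by
          rw [e2, zpow_sub_one₀ hy.ne', ← zpow_natCast z.2 (2 * m)]; push_cast; field_simp
      _ ≤ C * (3 ^ (2 * m) * (t ^ 4 * ℓ ^ (2 * m))) :=
          mul_le_mul_of_nonneg_left (hs.pow_mul_le _ _) hC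
      _ ≤ C * (3 ^ (2 * m) * (t ^ 3 * ℓ ^ (2 * L))) := by
          have ha : t ^ 4 ≤ t ^ 3 := pow_le_pow_of_le_one ht.le hs.le_one (by omega)
          have hb : ℓ ^ (2 * m) ≤ ℓ ^ (2 * L) := pow_le_pow_right₀ hℓ (by omega)
          gcongr
      _ = _ := by ring
  rw [zpow_natCast, leadW, show 2 * ((m + 1 : ℕ) : ℤ) - 1 = ((2 * m + 1 : ℕ) : ℤ) by
    push_cast; ring, zpow_natCast, show 2 * ((m + 1 : ℕ) : ℤ) - 3 = 2 * (m : ℤ) - 1 by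
    push_cast; ring, mul_add]
  linarith

/-- The size of the cut off profiles. -/
noncomputable def cutSize (b y : ℝ) : ℝ := √b * |log b|⁻¹ * if √b * y ≤ 2 then 1 else 0

theorem cutSize_nonneg (b y : ℝ) : 0 ≤ cutSize b y := by unfold cutSize; split_ifs <;> positivity

theorem HomSum.symOn_cut (hb0 : b0 ≤ 1 / 16) (hχ : IsCutoff χ) (hK : 0 ≤ K) {i n r : ℕ} (hi : 1 ≤ i)
    {S : Par L → ℝ → ℝ} (hS : HomSum (Cut b0 χ i) (i + n : ℕ) r S) :
    SymOn (zoneCut L b0 K) (fun b y => b 0 ^ n * cutSize (b 0) y) S := by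
  obtain ⟨e, he⟩ := hS.symOn hK (D := {z : ℝ × ℝ | z.1 ∈ Ioo 0 b0 ∧ 1 ≤ z.2 ∧ 1 / 2 ≤ √z.1 * z.2})
    (w := fun _ => cutW i) (fun z hz => ⟨hz.1, one_pos.trans_le hz.2.1⟩)
    (fun _ z hz => cutW_nonneg _ _ (zero_le_one.trans hz.2.1)) fun F hF => ⟨0, fun _ _ => hF.symOn hb0 hχ⟩
  refine ((he e le_rfl).mono_set fun z hz => ⟨hz.1, hz.1.1, (zoneCut.scale hb0 hz).one_le,
    hz.2.1.le⟩).weaken (K := 2 ^ (2 * i - 1)) (by positivity)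
    (fun z hz => mul_nonneg (pow_nonneg hz.1.1.1.le _) (cutSize_nonneg _ _)) fun z hz => ?_
  have hs := zoneCut.scale hb0 hz
  have h0 := hz.1.1.1
  rw [cutW, cutSize, logw_one_eq, one_div]
  split_ifs with hle
  · obtain ⟨k, rfl⟩ := Nat.exists_eq_add_of_le' hi
    have ht := hs.pos
    have hℓ := one_pos.trans_le hs.one_le_log
    have hy := one_pos.trans_le hs.one_le
    rw [zpow_natCast, show 2 * ((k + 1 : ℕ) : ℤ) - 1 = ((2 * k + 1 : ℕ) : ℤ) by push_cast; ring,
      zpow_natCast, show 2 * (k + 1) - 1 = 2 * k + 1 by omega, pow_add _ (k + 1) n,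
      ← sqrt_pow_two_mul h0 (k + 1)]
    set t := √(z.1 0)
    calc t ^ (2 * (k + 1)) * z.1 0 ^ n * (z.2 ^ (2 * k + 1) * |log (z.1 0)|⁻¹ * 1)
        = (t * z.2) ^ (2 * k + 1) * (z.1 0 ^ n * (t * |log (z.1 0)|⁻¹ * 1)) := by ring
      _ ≤ 2 ^ (2 * k + 1) * (z.1 0 ^ n * (t * |log (z.1 0)|⁻¹ * 1)) := by gcongr
  · simp

theorem IsCutProfiles.symOn_linear (h : IsExt g Q q) (hb0 : b0 ≤ 1 / 16) (hχ : IsCutoff χ) (hK : 0 ≤ K)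
    (hc : IsSpeed b0 c) (hS : IsCutProfiles b0 χ S) {i : ℕ} (hi : 2 ≤ i) :
    SymOn (zoneCut L b0 K) (fun b y => b 0 * cutSize (b 0) y)
      fun b y => opH g Q (S i b) y + (b 0 * scal (S i b) y + vecX c (S i) b y) := by
  have hcc : Coef b0 c := ⟨hc.small.log_of_le hb0 (by omega), hc.scal⟩
  have hw : ∀ z ∈ zoneCut L b0 K, 0 ≤ z.1 0 * cutSize (z.1 0) z.2 := fun z hz =>
    mul_nonneg hz.1.1.1.le (cutSize_nonneg _ _)
  have hSi := hS.homSum i hi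
  have h1 : SymOn (zoneCut L b0 K) (fun b y => cutSize (b 0) y) (S i) :=
    ((hSi.symOn_cut (n := 0) hb0 hχ hK (by omega)).congr_weight fun z _ => by rw [pow_zero, one_mul])
  have h2 : SymOn (zoneCut L b0 K) (fun b y => b 0 * cutSize (b 0) y) fun b y => opH g Q (S i b) y := by
    refine ((h.symOn_suitable h1 2).weaken (K := 4) (by norm_num) hw fun z hz => ?_).congr
      fun z hz => ?_
    · have hs := zoneCut.scale hb0 hz
      have hn := cutSize_nonneg (z.1 0) z.2
      have h3 : (z.2⁻¹) ^ 2 ≤ (2 * √(z.1 0)) ^ 2 :=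
        pow_le_pow_left₀ (inv_nonneg.mpr (zoneCut.pos hb0 z hz).le) hs.inv_le 2
      rw [mul_pow, sq_sqrt hz.1.1.1.le] at h3
      rw [div_eq_mul_inv, ← inv_pow]; nlinarith
    · refine eventuallyEq_of_pos (fun y hy => ?_) (zoneCut.pos hb0 z hz)
      rw [h.opH_eq hy (hS.contDiffAt hχ i hz.1.1.1 hy)]; simp [suitable]
  have h3 : SymOn (zoneCut L b0 K) (fun b y => b 0 * cutSize (b 0) y)
      fun b y => b 0 * scal (S i b) y := by
    refine (((SymTo.id h1.pos).mul h1.deriv).coeff_mul fun b => b 0).of_le fun z hz => ?_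
    have := zoneCut.pos hb0 z hz
    rw [abs_of_pos hz.1.1.1, mul_div_cancel₀ _ this.ne']
  have h4 : SymOn (zoneCut L b0 K) (fun b y => b 0 * cutSize (b 0) y)
      fun b y => vecX c (S i) b y := by
    have := HomSum.vecX (CoefClass.cut hb0 hχ i) hSi (by omega) hcc
    have h5 := HomSum.symOn_cut (i := i) (n := 1) (K := K) hb0 hχ hK (by omega) (by exact_mod_cast this)
    exact h5.congr_weight fun z _ => by rw [pow_one]
  exact h2.add (h3.add h4)

theorem IsCutProfiles.symOn_pert (h : IsExt g Q q) (hb0 : b0 ≤ 1 / 16) (hχ : IsCutoff χ) (hK : 0 ≤ K)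
    (hS : IsCutProfiles b0 χ S) : ∃ e : ℕ,
    SymOn (zoneCut L b0 K) (fun b _ => √(b 0) * |log (b 0)| ^ e) (pert q S) := by
  choose! e he using fun i (hi : 1 ≤ i) => (h.homSum_linear (L := L) (b0 := b0) i hi).symOn_low hK
  set E := 2 * (L + 3) + ∑ i ∈ Finset.range (L + 3), e i with hE
  have hw : ∀ z ∈ zoneCut L b0 K, 0 ≤ √(z.1 0) * |log (z.1 0)| ^ E := fun z _ => by positivity
  refine ⟨E, SymTo.sum _ (zoneCut.pos hb0) hw fun i hi => ?_⟩
  rcases Nat.eq_zero_or_pos i with rfl | hi0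
  · exact (SymTo.zero (zoneCut.pos hb0) hw).congr fun z _ => Eventually.of_forall fun y =>
      (comp_zero (hS.zero 0 (by omega)) z.1 y).symm
  refine SymTo.add ?_ ?_
  · have hle : e i ≤ ∑ i ∈ Finset.range (L + 3), e i :=
      single_le_sum (f := e) (fun _ _ => Nat.zero_le _) hi
    refine ((he i hi0 _ le_rfl).mono_set (zoneCut_subset hb0)).weaken
      (K := 3 ^ (2 * i - 1) * 4 ^ e i) (by positivity) hw fun z hz => ?_
    have hs := zoneCut.scale hb0 hz
    have h0 := hz.1.1.1
    have hy := one_pos.trans_le hs.one_le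
    have hi' := mem_range.mp hi
    obtain ⟨k, rfl⟩ := Nat.exists_eq_add_of_le' hi0
    change e (k + 1) ≤ _ at hle
    rw [zpow_natCast, show 2 * ((k + 1 : ℕ) : ℤ) - 1 = ((2 * k + 1 : ℕ) : ℤ) by push_cast; ring,
      zpow_natCast, show 2 * (k + 1) - 1 = 2 * k + 1 by omega, ← sqrt_pow_two_mul h0 (k + 1),
      show 2 * (k + 1) = 1 + (2 * k + 1) by ring, ← mul_assoc]
    have ht := hs.pos
    have hℓ := hs.one_le_log
    calc _ ≤ (3 ^ (2 * k + 1) * (√(z.1 0) ^ 1 * |log (z.1 0)| ^ (2 * k + 1))) *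
          (4 ^ e (k + 1) * |log (z.1 0)| ^ e (k + 1)) :=
          mul_le_mul (hs.pow_mul_le _ _) (hs.log_pow_le _)
            (pow_nonneg (zero_le_one.trans (one_le_one_add_log hs.one_le)) _) (by positivity)
      _ = 3 ^ (2 * k + 1) * 4 ^ e (k + 1) *
          (√(z.1 0) * |log (z.1 0)| ^ (2 * k + 1 + e (k + 1))) := by ring
      _ ≤ _ := by gcongr; omega
  · rcases lt_or_ge i 2 with hi2 | hi2
    · rw [hS.zero i hi2]; exact SymTo.zero (zoneCut.pos hb0) hw
    · refine ((hS.homSum i hi2).symOn_cut (n := 0) hb0 hχ hK (by omega)).of_le fun z hz => ?_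
      have hs := zoneCut.scale hb0 hz
      have ht := hs.pos
      have hℓ := hs.one_le_log
      rw [pow_zero, one_mul, cutSize]
      have h1 : |log (z.1 0)|⁻¹ ≤ |log (z.1 0)| ^ E :=
        (inv_le_one_of_one_le₀ hℓ).trans (one_le_pow₀ hℓ)
      have h2 : (if √(z.1 0) * z.2 ≤ 2 then (1 : ℝ) else 0) ≤ 1 := by split_ifs <;> norm_num
      calc _ ≤ √(z.1 0) * |log (z.1 0)|⁻¹ * 1 := by gcongr
        _ ≤ _ := by rw [mul_one]; gcongr

theorem IsCutProfiles.symOn_nonlin (h : IsExt g Q q) (hb0 : b0 ≤ 1 / 16) (hχ : IsCutoff χ) (hK : 0 ≤ K)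
    (hS : IsCutProfiles b0 χ S) : SymOn (zoneCut L b0 K) (fun b _ => b 0 ^ 2)
      fun b y => taylorRem 2 (nonlin g) (q y) (pert q S b y) / y ^ 2 := by
  obtain ⟨e, he⟩ := hS.symOn_pert h hb0 hχ hK
  obtain ⟨C, hC, hb⟩ := exists_sqrt_mul_log_pow_le e
  obtain ⟨C', hC', hb'⟩ := exists_sqrt_mul_log_pow_le (3 * e)
  have hbd : ∀ z ∈ zoneCut L b0 K, z.1 0 ∈ Ioc (0 : ℝ) 1 := fun z hz =>
    ⟨hz.1.1.1, by linarith [hz.1.1.2]⟩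
  have hs := fun z hz => zoneCut.scale (L := L) (K := K) hb0 (z := z) hz
  have h3 := h.symOn_taylorRem he hC (fun z hz => hb _ (hbd z hz)) h.target.bddSmooth_nonlin 3
  obtain ⟨G, hG, hGe⟩ := hadamard (contDiff_iteratedDeriv h.target.contDiff_nonlin 2)
    (h.target.iteratedDeriv_nonlin_pi even_two)
  have h2 : SymOn (zoneCut L b0 K) (fun _ y => y ^ (-1 : ℤ)) fun _ y => iteratedDeriv 2 (nonlin g) (q y) := by
    have := h.symOn_vanishing (fun z hz => (hs z hz).one_le) 1 hG
    simpa only [pow_one, ← hGe, Nat.cast_one] using this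
  set W : Par L → ℝ → ℝ := fun b _ => √(b 0) ^ 3 * |log (b 0)| ^ (3 * e) with hWd
  have hW : ∀ z ∈ zoneCut L b0 K, 0 ≤ W z.1 z.2 := fun z _ => by simp only [hWd]; positivity
  have h4 : SymOn (zoneCut L b0 K) W fun b y => 1 / 2 * (iteratedDeriv 2 (nonlin g) (q y) * pert q S b y ^ 2) := by
    refine ((h2.mul (he.pow 2)).const_mul (1 / 2)).weaken (K := 2) (by norm_num) hW fun z hz => ?_
    have hz' := hs z hz
    have ht := hz'.pos
    have hℓ := hz'.one_le_log
    have h5 : |log (z.1 0)| ^ (e * 2) ≤ |log (z.1 0)| ^ (3 * e) := pow_le_pow_right₀ hℓ (by omega)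
    rw [zpow_neg_one, mul_pow, ← pow_mul]
    calc _ ≤ (2 * √(z.1 0)) * (√(z.1 0) ^ 2 * |log (z.1 0)| ^ (3 * e)) := by
          have := hz'.inv_le
          gcongr
      _ = _ := by simp only [hWd]; ring
  have h5 : SymOn (zoneCut L b0 K) W fun b y => taylorRem 2 (nonlin g) (q y) (pert q S b y) := by
    refine ((h3.congr_weight (w' := W) fun z _ => by
      simp only [hWd]; rw [mul_pow, ← pow_mul, mul_comm e]).add h4).congr fun z _ =>
        Eventually.of_forall fun y => ?_
    beta_reduce
    rw [taylorRem_succ 2]; simp [Nat.factorial]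
  refine ((h5.mul (SymTo.zpow (zoneCut.pos hb0) (-2))).weaken (K := 4 * C') (by positivity)
    (fun z _ => sq_nonneg _) fun z hz => ?_).congr fun z _ => Eventually.of_forall fun y => ?_
  · have hz' := hs z hz
    have ht := hz'.pos
    have h6 : (z.2⁻¹) ^ 2 ≤ (2 * √(z.1 0)) ^ 2 :=
      pow_le_pow_left₀ (inv_nonneg.mpr (zoneCut.pos hb0 z hz).le) hz'.inv_le 2
    have e1 : z.2 ^ (-2 : ℤ) = (z.2⁻¹) ^ 2 := by rw [inv_pow, zpow_neg]; norm_cast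
    have h7 := hb' _ (hbd z hz)
    rw [e1, ← sqrt_pow_two_mul hz.1.1.1 2]; simp only [hWd]
    calc _ ≤ √(z.1 0) ^ 3 * |log (z.1 0)| ^ (3 * e) * (2 * √(z.1 0)) ^ 2 := by gcongr
      _ = 4 * (√(z.1 0) * |log (z.1 0)| ^ (3 * e)) * √(z.1 0) ^ (2 * 2) := by ring
      _ ≤ _ := by gcongr
  · beta_reduce; rw [zpow_neg, ← div_eq_mul_inv]; norm_cast

theorem IsCutProfiles.symOn_errRest (h : IsExt g Q q) (hb0 : b0 ≤ 1 / 16) (hχ : IsCutoff χ) (hK : 0 ≤ K)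
    (hc : IsSpeed b0 c) (hS : IsCutProfiles b0 χ S) :
    SymOn (zoneCut L b0 K) (fun b y => b 0 * cutSize (b 0) y + b 0 ^ 2) (errRest g Q q c S) := by
  have hw : ∀ z ∈ zoneCut L b0 K, 0 ≤ z.1 0 * cutSize (z.1 0) z.2 := fun z hz =>
    mul_nonneg hz.1.1.1.le (cutSize_nonneg _ _)
  refine SymTo.add (SymTo.of_le (SymTo.sum _ (zoneCut.pos hb0) hw fun i hi =>
    hS.symOn_linear h hb0 hχ hK hc (Finset.mem_Icc.mp hi).1) fun z _ => ?_)
    ((hS.symOn_nonlin h hb0 hχ hK).of_le fun z hz => ?_)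
  · linarith [sq_nonneg (z.1 0)]
  · linarith [hw z hz]

end


/-! ### Pointwise bounds for the suitable derivatives of the error -/

section
variable {g Q q : ℝ → ℝ}

theorem IsExt.suitable_const_mul (h : IsExt g Q q) (a : ℝ) {u : ℝ → ℝ}
    (hu : ∀ y ∈ Ioi (0 : ℝ), SmoothAt u y) (k : ℕ) :
    ∀ y ∈ Ioi (0 : ℝ), suitable g Q k (fun y => a * u y) y = a * suitable g Q k u y := by
  induction k with
  | zero => intro y _; rfl
  | succ k ih =>
    intro y hy
    have he : suitable g Q k (fun y => a * u y) =ᶠ[𝓝 y] fun y => a * suitable g Q k u y := by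
      filter_upwards [isOpen_Ioi.mem_nhds hy] with x hx using ih x hx
    have h1 := (h.contDiffAt_suitable hy (hu y hy) k).differentiableAt (by simp)
    simp only [suitable]
    split_ifs
    · rw [opA_congr he, opA, opA, deriv_const_mul _ h1]; ring
    · rw [opAstar_congr he, opAstar, opAstar, deriv_const_mul _ h1]; ring

theorem suitable_zero_fun (k : ℕ) : suitable g Q k (fun _ => 0) = fun _ => 0 := by
  induction k with
  | zero => rfl
  | succ k ih => funext y; simp only [suitable, ih]; split_ifs <;> simp [opA, opAstar]

theorem IsExt.suitable_sum (h : IsExt g Q q) {ι : Type*} (s : Finset ι) {u : ι → ℝ → ℝ}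
    (hu : ∀ i ∈ s, ∀ y ∈ Ioi (0 : ℝ), SmoothAt (u i) y) (k : ℕ) {y : ℝ} (hy : 0 < y) :
    suitable g Q k (fun y => ∑ i ∈ s, u i y) y = ∑ i ∈ s, suitable g Q k (u i) y := by
  classical
  induction s using Finset.induction_on with
  | empty => simp [suitable_zero_fun]
  | insert a s ha ih =>
    simp only [sum_insert ha]
    rw [h.suitable_add isOpen_Ioi (fun _ h => h) (hu a (mem_insert_self _ _))
      (fun y hy => ContDiffAt.sum fun i hi => hu i (mem_insert_of_mem hi) y hy) k y hy,
      ih fun i hi => hu i (mem_insert_of_mem hi)]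

end

section
variable {L : ℕ} [NeZero L] {g Q q χ c : ℝ → ℝ} {b0 K : ℝ} {S : ℕ → Par L → ℝ → ℝ}

theorem IsExt.contDiffAt_errTheta (h : IsExt g Q q) (hb0 : b0 ≤ 1 / 16) (hc : IsSpeed b0 c)
    {b : Par L} (hb : 0 < b 0) {y : ℝ} (hy : 0 < y) : SmoothAt (errTheta q c b) y :=
  ContDiffAt.sum fun _ _ => (h.homSum_theta hb0 hc _).lead_smooth hb hy

theorem IsCutProfiles.contDiffAt_errRest (h : IsExt g Q q) (hb0 : b0 ≤ 1 / 16) (hχ : IsCutoff χ)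
    (hc : IsSpeed b0 c) (hS : IsCutProfiles b0 χ S) {b : Par L} (hb : 0 < b 0) {y : ℝ} (hy : 0 < y) :
    SmoothAt (errRest g Q q c S b) y := by
  have hcc : Coef b0 c := ⟨hc.small.log_of_le hb0 (by omega), hc.scal⟩
  refine (ContDiffAt.sum fun i hi => ?_).add (ContDiffAt.div ?_ (by fun_prop) (by positivity))
  · have hs := hS.contDiffAt hχ i hb hy
    refine ContDiffAt.add ?_ ((contDiffAt_const.mul (contDiffAt_id.mul (contDiffAt_deriv hs))).add
      (HomSum.cut_smooth hχ (HomSum.vecX (CoefClass.cut hb0 hχ i) (hS.homSum i (Finset.mem_Icc.mp hi).1)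
        (by have := (Finset.mem_Icc.mp hi).1; omega) hcc) hb hy))
    refine (h.contDiffAt_suitable hy hs 2).congr_of_eventuallyEq (eventuallyEq_of_pos (fun x hx => ?_) hy)
    rw [h.opH_eq hx (hS.contDiffAt hχ i hb hx)]; simp [suitable]
  · have h1 := hS.contDiffAt_pert h hχ hb hy
    have h2 : SmoothAt q y := h.smooth.contDiffAt
    have hf := h.target.contDiff_nonlin
    exact (hf.contDiffAt.comp y (h2.add h1)).sub (ContDiffAt.sum fun m _ =>
        contDiffAt_const.mul (((contDiff_iteratedDeriv hf m).contDiffAt.comp y h2).mul (h1.pow m)))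

theorem IsCutProfiles.contDiffAt_errModel (h : IsExt g Q q) (hb0 : b0 ≤ 1 / 16) (hχ : IsCutoff χ)
    (hc : IsSpeed b0 c) (hS : IsCutProfiles b0 χ S) {b : Par L} (hb : 0 < b 0) {y : ℝ} (hy : 0 < y) :
    SmoothAt (errModel g Q q c S b) y :=
  (h.contDiffAt_errTheta hb0 hc hb hy).add (hS.contDiffAt_errRest h hb0 hχ hc hb hy)

theorem IsProfiles.suitable_errModel (hχ : IsCutoff χ) (hS : IsProfiles g Q q c b0 (L + 2) (L + 2) S)
    {b : Par L} (hb : 0 < b 0) {y : ℝ} (hy : 0 < y) (hz : √(b 0) * y < 1) (k : ℕ) :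
    suitable g Q k (errModel g Q q c (cutProf χ S) b) y = suitable g Q k (errInner g q c S b) y := by
  refine (suitable_congr k ?_).eq_of_nhds
  filter_upwards [lt_mem_nhds hy,
    (continuous_const.mul continuous_id).continuousAt.eventually (gt_mem_nhds hz)] with x hx hx'
  exact hS.errModel_eq_errInner hχ hb hx hx'

theorem sqrt_lt_one {b : ℝ} (hb0 : b0 ≤ 1 / 16) (hb : b ∈ Ioo 0 b0) : √b < 1 := by
  rw [sqrt_lt' one_pos]; linarith [hb.2]

theorem IsProfiles.suitable_le_origin (h : IsExt g Q q) (hb0 : b0 ≤ 1 / 16) (hK : 0 ≤ K) (hχ : IsCutoff χ)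
    (hc : IsSpeed b0 c) (hS : IsProfiles g Q q c b0 (L + 2) (L + 2) S) {k : ℕ} (hk : k ≤ 2 * L + 2) :
    ∃ C, 0 ≤ C ∧ ∀ b ∈ parSet L b0 K, ∀ y ∈ Ioc (0 : ℝ) 1,
      |suitable g Q k (errModel g Q q c (cutProf χ S) b) y| ≤ C * (√(b 0) ^ (2 * L + 6) * y) := by
  obtain ⟨C, hC, hb⟩ := (h.symOn_suitable (hS.symOn_errInner_origin (K := K) h hb0 hK hc) k).bound_zero
  refine ⟨C, hC, fun b hbp y hy => ?_⟩
  have h0 := hbp.1.1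
  rw [hS.suitable_errModel hχ h0 hy.1 ((mul_le_of_le_one_right (sqrt_nonneg _) hy.2).trans_lt
    (sqrt_lt_one hb0 hbp.1))]
  refine (hb (b, y) ⟨hbp, hy⟩).trans (mul_le_mul_of_nonneg_left ?_ hC)
  dsimp only
  rw [show 2 * L + 6 = 2 * (L + 3) by ring, sqrt_pow_two_mul h0, mul_div_assoc]
  refine mul_le_mul_of_nonneg_left ?_ (pow_nonneg h0.le _)
  rw [div_le_iff₀ (pow_pos hy.1 _), ← pow_succ']; exact pow_le_pow_of_le_one hy.1.le hy.2 (by omega)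

theorem ell_le_of_lt_one {b y : ℝ} (hb : b ∈ Ioc (0 : ℝ) 1) (hl : 1 ≤ |log b|) (hy : 1 ≤ y)
    (hz : √b * y < 1) :
    ell b y ≤ (√b * y)⁻¹ * |log b|⁻¹ ∧ ell b y ≤ 2 := by
  have ht : 0 < √b := sqrt_pos.mpr hb.1
  have hp : 0 < √b * y := by positivity
  have h1 : |log (√b * y)| = -log (√b * y) := abs_of_nonpos (log_nonpos hp.le hz.le)
  have h2 := log_le_sub_one_of_pos (inv_pos.mpr hp)
  rw [log_inv] at h2
  rw [ell, h1]
  constructor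
  · rw [← div_eq_mul_inv]
    gcongr; linarith
  · rw [div_le_iff₀ (by linarith), log_mul ht.ne' (by positivity), log_sqrt hb.1.le]
    have : |log b| = -log b := abs_of_nonpos (log_nonpos hb.1.le hb.2)
    have := log_nonneg hy
    linarith

theorem IsProfiles.suitable_le_mid (h : IsExt g Q q) (hb0 : b0 ≤ 1 / 16) (hK : 0 ≤ K) (hχ : IsCutoff χ)
    (hc : IsSpeed b0 c) (hS : IsProfiles g Q q c b0 (L + 2) (L + 2) S) {k : ℕ} (hk : k ≤ 2 * L + 2) :
    ∃ C, 0 ≤ C ∧ ∀ b ∈ parSet L b0 K, ∀ y, 1 ≤ y → √(b 0) * y < 1 →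
      |suitable g Q k (errModel g Q q c (cutProf χ S) b) y|
        ≤ C * (√(b 0) ^ (2 * L + 5) * |log (b 0)|⁻¹ * y ^ (2 * L + 2 - k)) ∧
      |suitable g Q k (errModel g Q q c (cutProf χ S) b) y|
        ≤ C * (√(b 0) ^ (2 * L + 6) * y ^ (2 * L + 3 - k)) := by
  obtain ⟨C, hC, hb⟩ := (h.symOn_suitable (hS.symOn_errInner_mid (K := K) h hb0 hK hc) k).bound_zero
  obtain ⟨C', hC', hb'⟩ := exists_sqrt_mul_log_pow_le 1
  refine ⟨C * (1 + C') + C * 3, by positivity, fun b hbp y hy hz => ?_⟩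
  have h0 := hbp.1.1
  have hy0 : 0 < y := by linarith
  have hb1 : b 0 ∈ Ioc (0 : ℝ) 1 := ⟨h0, by linarith [hbp.1.2]⟩
  have hl := one_le_abs_log hb0 hbp.1
  obtain ⟨hl1, hl2⟩ := ell_le_of_lt_one hb1 hl hy hz
  have h1 := hb (b, y) ⟨hbp, hy, hz⟩
  have h2 := hb' _ hb1
  dsimp only at h1
  rw [hS.suitable_errModel hχ h0 hy0 hz]
  obtain ⟨n, hn⟩ := Nat.exists_eq_add_of_le hk
  rw [show 2 * L + 2 - k = n by omega, show 2 * L + 3 - k = n + 1 by omega]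
  have e1 : b 0 ^ (L + 3) * (y ^ (2 * L + 3) * ell (b 0) y + y ^ (2 * L + 2)) / y ^ k
      = √(b 0) ^ (2 * L + 6) * (y ^ (n + 1) * ell (b 0) y + y ^ n) := by
    rw [show 2 * L + 3 = k + (n + 1) by omega, hn, show 2 * L + 6 = 2 * (L + 3) by ring, sqrt_pow_two_mul h0]
    field_simp; ring
  rw [e1] at h1
  set t := √(b 0) with ht
  have ht0 : 0 < t := sqrt_pos.mpr h0
  have hl0 : 0 < |log (b 0)| := by linarith
  rw [pow_one] at h2
  have h3 : t ≤ C' * |log (b 0)|⁻¹ := by rwa [← div_eq_mul_inv, le_div_iff₀ hl0]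
  constructor
  · refine h1.trans ?_
    calc C * (t ^ (2 * L + 6) * (y ^ (n + 1) * ell (b 0) y + y ^ n))
        ≤ C * (t ^ (2 * L + 6) * (y ^ (n + 1) * ((t * y)⁻¹ * |log (b 0)|⁻¹) + y ^ n)) := by gcongr
      _ = C * (t ^ (2 * L + 5) * |log (b 0)|⁻¹ * y ^ n + t ^ (2 * L + 5) * t * y ^ n) := by
          field_simp; ring
      _ ≤ C * (t ^ (2 * L + 5) * |log (b 0)|⁻¹ * y ^ n
          + t ^ (2 * L + 5) * (C' * |log (b 0)|⁻¹) * y ^ n) := by gcongr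
      _ = (C * (1 + C')) * (t ^ (2 * L + 5) * |log (b 0)|⁻¹ * y ^ n) := by ring
      _ ≤ _ := by gcongr; linarith
  · refine h1.trans ?_
    calc C * (t ^ (2 * L + 6) * (y ^ (n + 1) * ell (b 0) y + y ^ n))
        ≤ C * (t ^ (2 * L + 6) * (y ^ (n + 1) * 2 + y ^ (n + 1))) := by gcongr; omega
      _ = (C * 3) * (t ^ (2 * L + 6) * y ^ (n + 1)) := by ring
      _ ≤ _ := by
          gcongr
          have : 0 ≤ C * (1 + C') := by positivity
          linarith

theorem zoneCut.mem_of_le {b : Par L} (hb : b ∈ parSet L b0 K) {y : ℝ}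
    (h1 : 1 ≤ √(b 0) * y) (h2 : √(b 0) * y < 3 * |log (b 0)|) :
    (b, y) ∈ zoneCut L b0 K := ⟨hb, by dsimp only; linarith, h2⟩

theorem inv_pow_le {t ℓ y : ℝ} (h : CutScale t ℓ y) (k : ℕ) : 1 / y ^ k ≤ 2 ^ k * t ^ k := by
  rw [one_div, ← inv_pow, ← mul_pow]
  exact pow_le_pow_left₀ (inv_nonneg.mpr (zero_le_one.trans h.one_le)) h.inv_le k

theorem IsCutProfiles.suitable_le_cut (h : IsExt g Q q) (hb0 : b0 ≤ 1 / 16) (hK : 0 ≤ K) (hχ : IsCutoff χ)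
    (hc : IsSpeed b0 c) (hS : IsCutProfiles b0 χ S) (k : ℕ) :
    ∃ C, 0 ≤ C ∧ ∀ b ∈ parSet L b0 K, ∀ y, 1 ≤ √(b 0) * y → √(b 0) * y < 3 * |log (b 0)| →
      |suitable g Q k (errModel g Q q c S b) y|
        ≤ C * (√(b 0) ^ (3 + k) * |log (b 0)| ^ (2 * L)) := by
  have h1 := h.symOn_errTheta (L := L) (K := K) hb0 hK hc
  have h2 := (hS.symOn_errRest h hb0 hχ hK hc).weaken (K := 2)
    (w' := fun b _ => √(b 0) ^ 3 * |log (b 0)| ^ (2 * L)) (by norm_num) h1.nonneg fun z hz => by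
      have hs := zoneCut.scale hb0 hz
      have ht := hs.pos
      have hl := hs.one_le_log
      have e1 : z.1 0 = √(z.1 0) ^ 2 := (sq_sqrt hz.1.1.1.le).symm
      have h3 : z.1 0 * cutSize (z.1 0) z.2 ≤ √(z.1 0) ^ 3 * |log (z.1 0)| ^ (2 * L) := by
        rw [cutSize]
        calc _ ≤ z.1 0 * (√(z.1 0) * 1 * 1) := by
              gcongr
              · exact hz.1.1.1.le
              · exact inv_le_one_of_one_le₀ hl
              · split_ifs <;> norm_num
          _ = √(z.1 0) ^ 3 * 1 := by rw [pow_succ _ 2, ← e1]; ring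
          _ ≤ _ := by gcongr; exact one_le_pow₀ hl
      have h4 : z.1 0 ^ 2 ≤ √(z.1 0) ^ 3 * |log (z.1 0)| ^ (2 * L) := by
        calc z.1 0 ^ 2 = √(z.1 0) ^ 4 := by rw [← sqrt_pow_two_mul hz.1.1.1 2]
          _ ≤ √(z.1 0) ^ 3 * 1 := by
              rw [mul_one]; exact pow_le_pow_of_le_one ht.le hs.le_one (by omega)
          _ ≤ _ := by gcongr; exact one_le_pow₀ hl
      linarith
  have h3 : SymOn (zoneCut L b0 K) (fun b _ => √(b 0) ^ 3 * |log (b 0)| ^ (2 * L))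
    (errModel g Q q c S) := h1.add h2
  obtain ⟨C, hC, hb⟩ := (h.symOn_suitable h3 k).bound_zero
  refine ⟨C * 2 ^ k, by positivity, fun b hbp y hy hy' => ?_⟩
  have hm := zoneCut.mem_of_le hbp hy hy'
  have hs := zoneCut.scale hb0 hm
  refine (hb _ hm).trans ?_
  have := inv_pow_le hs k
  have ht := hs.pos
  dsimp only at this ⊢
  calc _ = C * (√(b 0) ^ 3 * |log (b 0)| ^ (2 * L)) * (1 / y ^ k) := by ring
    _ ≤ C * (√(b 0) ^ 3 * |log (b 0)| ^ (2 * L)) * (2 ^ k * √(b 0) ^ k) := by gcongr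
    _ = _ := by ring

theorem IsExt.suitable_errTheta_le (h : IsExt g Q q) (hb0 : b0 ≤ 1 / 16) (hK : 0 ≤ K)
    (hc : IsSpeed b0 c) {k : ℕ} (hk : 2 * L < k) :
    ∃ C, 0 ≤ C ∧ ∀ b ∈ parSet L b0 K, ∀ y, 1 ≤ √(b 0) * y → √(b 0) * y < 3 * |log (b 0)| →
      |suitable g Q k (errTheta q c b) y| ≤ C * √(b 0) ^ (4 + k) := by
  have h1 : ∀ j : Fin L, ∃ C, 0 ≤ C ∧ ∀ b ∈ parSet L b0 K, ∀ y, 1 ≤ √(b 0) * y →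
      √(b 0) * y < 3 * |log (b 0)| →
      |b 0 * b j * suitable g Q k (theta q c (↑j + 1) (b 0)) y| ≤ C * √(b 0) ^ (4 + k) := by
    intro j
    have hF := h.lead_theta hb0 hc (↑j + 1) (by omega)
    obtain ⟨e, he⟩ := hF.suitable_le h hb0 (by omega)
    obtain ⟨C, hC, hb⟩ := he e le_rfl k
    obtain ⟨C', hC', hb'⟩ := exists_sqrt_mul_log_pow_le e
    obtain ⟨C'', hC'', hb''⟩ := exists_mon_bound (b0 := b0) hK (MonOK.single (r := L) j (Or.inr j.2))
    refine ⟨C'' * (C * (2 ^ (k + 1) * (4 ^ e * C'))), by positivity, fun b hbp y hy hy' => ?_⟩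
    have hm := zoneCut.mem_of_le hbp hy hy'
    have hs := zoneCut.scale hb0 hm
    dsimp only at hs
    have h0 := hbp.1.1
    have h2 := hb (b 0) hbp.1 y hs.one_le
    have h3 := hb'' b hbp
    have h4 := hb' (b 0) ⟨h0, by linarith [hbp.1.2]⟩
    have hj := j.2
    set m : ℕ := ↑j
    rw [kerW, if_neg (show ¬ k < 2 * (m + 1) by omega), if_neg (show ¬ k = 2 * (m + 1) by omega),
      mul_zero, zero_add] at h2
    rw [mon_single] at h3
    have e1 : (b 0) ^ ((m : ℤ) + 1) = b 0 ^ (m + 1) := by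
      rw [← zpow_natCast]; push_cast; rfl
    rw [e1] at h3
    have ht := hs.pos
    have hy0 : 0 < y := one_pos.trans_le hs.one_le
    obtain ⟨n, hn⟩ := Nat.exists_eq_add_of_le (show 2 * m ≤ k by omega)
    have e2 : y ^ (2 * ((m + 1 : ℕ) : ℤ) - 3 - k) = 1 / y ^ (n + 1) := by
      rw [one_div, ← zpow_natCast, ← zpow_neg]
      congr 1
      rw [hn]; push_cast; ring
    rw [e2] at h2
    have h5 := inv_pow_le hs (n + 1)
    have h6 := hs.log_pow_le e
    have e3 : b 0 * b 0 ^ (m + 1) = √(b 0) ^ (2 * m + 4) := by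
      rw [show 2 * m + 4 = 2 * (m + 2) by ring, sqrt_pow_two_mul h0]; ring
    set t := √(b 0)
    set ℓ := |log (b 0)|
    have hlog : 0 ≤ (1 + log y) ^ e := pow_nonneg (zero_le_one.trans (one_le_one_add_log hs.one_le)) _
    rw [abs_mul, abs_mul, abs_of_pos h0]
    calc b 0 * |b j| * |suitable g Q k (theta q c (m + 1) (b 0)) y|
        ≤ b 0 * (C'' * b 0 ^ (m + 1)) * (C * (1 / y ^ (n + 1) * (1 + log y) ^ e)) := by gcongr
      _ ≤ b 0 * (C'' * b 0 ^ (m + 1)) * (C * ((2 ^ (n + 1) * t ^ (n + 1)) * (4 ^ e * ℓ ^ e))) := by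
          gcongr
      _ = C'' * (b 0 * b 0 ^ (m + 1)) * (C * (2 ^ (n + 1) * t ^ n * (4 ^ e * (t * ℓ ^ e)))) := by ring
      _ ≤ C'' * (b 0 * b 0 ^ (m + 1)) * (C * (2 ^ (k + 1) * t ^ n * (4 ^ e * C'))) := by
          gcongr
          · norm_num
          · omega
      _ = _ := by rw [e3, hn]; ring
  choose C hC hb using h1
  refine ⟨∑ j, C j, sum_nonneg fun j _ => hC j, fun b hbp y hy hy' => ?_⟩
  have hs := zoneCut.scale hb0 (zoneCut.mem_of_le hbp hy hy')
  have hy0 : 0 < y := one_pos.trans_le hs.one_le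
  have hth : ∀ j : Fin L, ∀ x ∈ Ioi (0 : ℝ), SmoothAt (theta q c (↑j + 1) (b 0)) x := fun j x hx =>
    (h.lead_theta hb0 hc (↑j + 1) (by omega)).smooth_right hbp.1.1 hx
  have e : suitable g Q k (errTheta q c b) y
      = ∑ j : Fin L, b 0 * b j * suitable g Q k (theta q c (↑j + 1) (b 0)) y := by
    have h2 := h.suitable_sum Finset.univ (u := fun (j : Fin L) y => b 0 * b j * theta q c (↑j + 1) (b 0) y)
      (fun j _ x hx => contDiffAt_const.mul (hth j x hx)) k hy0
    refine h2.trans (sum_congr rfl fun j _ => ?_)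
    exact h.suitable_const_mul _ (hth j) k y hy0
  rw [e, sum_mul]
  exact (Finset.abs_sum_le_sum_abs _ _).trans (Finset.sum_le_sum fun j _ => hb j b hbp y hy hy')

theorem IsCutProfiles.suitable_le_cut_of_lt (h : IsExt g Q q) (hb0 : b0 ≤ 1 / 16) (hK : 0 ≤ K)
    (hχ : IsCutoff χ) (hc : IsSpeed b0 c) (hS : IsCutProfiles b0 χ S) {k : ℕ} (hk : 2 * L < k) :
    ∃ C, 0 ≤ C ∧ ∀ b ∈ parSet L b0 K, ∀ y, 1 ≤ √(b 0) * y → √(b 0) * y < 3 * |log (b 0)| →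
      |suitable g Q k (errModel g Q q c S b) y| ≤ C * (√(b 0) ^ (3 + k) *
        (|log (b 0)|⁻¹ * (if √(b 0) * y ≤ 2 then 1 else 0) + √(b 0))) := by
  obtain ⟨C, hC, hb⟩ := h.suitable_errTheta_le (L := L) (K := K) hb0 hK hc hk
  obtain ⟨C', hC', hb'⟩ := (h.symOn_suitable (hS.symOn_errRest (K := K) h hb0 hχ hK hc) k).bound_zero
  refine ⟨C + C' * 2 ^ k, by positivity, fun b hbp y hy hy' => ?_⟩
  have hm := zoneCut.mem_of_le hbp hy hy'
  have hs := zoneCut.scale hb0 hm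
  have h0 := hbp.1.1
  have h1 := hb b hbp y hy hy'
  have h2 := hb' _ hm
  have h3 := inv_pow_le hs k
  dsimp only at hs h2 h3
  have hy0 : 0 < y := one_pos.trans_le hs.one_le
  have ht := hs.pos
  have e : suitable g Q k (errModel g Q q c S b) y
      = suitable g Q k (errTheta q c b) y + suitable g Q k (errRest g Q q c S b) y :=
    h.suitable_add isOpen_Ioi (fun _ h => h) (fun x hx => h.contDiffAt_errTheta hb0 hc h0 hx)
      (fun x hx => hS.contDiffAt_errRest h hb0 hχ hc h0 hx) k y hy0
  have e1 : b 0 = √(b 0) ^ 2 := (sq_sqrt h0.le).symm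
  have e2 : b 0 * cutSize (b 0) y + b 0 ^ 2 = √(b 0) ^ 3 *
      (|log (b 0)|⁻¹ * (if √(b 0) * y ≤ 2 then 1 else 0) + √(b 0)) := by
    rw [cutSize]
    linear_combination (√(b 0) * |log (b 0)|⁻¹ * (if √(b 0) * y ≤ 2 then 1 else 0)
      + b 0 + √(b 0) ^ 2) * e1
  rw [e2] at h2
  set X := |log (b 0)|⁻¹ * (if √(b 0) * y ≤ 2 then 1 else 0) with hX
  have hX0 : 0 ≤ X := by rw [hX]; split_ifs <;> positivity
  set t := √(b 0)
  rw [e]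
  refine (abs_add_le _ _).trans ?_
  have h4 : |suitable g Q k (errRest g Q q c S b) y| ≤ C' * 2 ^ k * (t ^ (3 + k) * (X + t)) := by
    calc _ ≤ C' * (t ^ 3 * (X + t)) * (1 / y ^ k) := by rw [mul_one_div, ← mul_div_assoc] at *; exact h2
      _ ≤ C' * (t ^ 3 * (X + t)) * (2 ^ k * t ^ k) := by gcongr
      _ = _ := by ring
  have h5 : C * t ^ (4 + k) ≤ C * (t ^ (3 + k) * (X + t)) := by
    calc C * t ^ (4 + k) = C * (t ^ (3 + k) * (0 + t)) := by ring
      _ ≤ _ := by gcongr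
  linarith

end


/-! ### Integral bounds for the error -/

theorem sqInt_le_of_const {R P : ℝ} (hP : 0 ≤ P) {w u : ℝ → ℝ}
    (h : ∀ y ∈ Ioc 0 R, w y * u y ^ 2 * y ≤ P) : sqInt R w u ≤ ofReal (P * R) := by
  calc sqInt R w u ≤ ∫⁻ _ in Ioc 0 R, ofReal P :=
        setLIntegral_mono' measurableSet_Ioc fun y hy => ofReal_le_ofReal (h y hy)
    _ = ofReal (P * R) := by
        rw [setLIntegral_const, Real.volume_Ioc, sub_zero, ENNReal.ofReal_mul hP]

theorem sqInt_le_of_two_scales {t ℓ P : ℝ} (ht : 0 < t) (hℓ : 1 ≤ ℓ) (hP : 0 ≤ P) {w u : ℝ → ℝ}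
    (h : ∀ y ∈ Ioc 0 (2 * (ℓ / t)), w y * u y ^ 2 * y ≤ P * t * (if t * y ≤ 2 then 1 else ℓ⁻¹)) :
    sqInt (2 * (ℓ / t)) w u ≤ ofReal (4 * P) := by
  have hℓ0 : 0 < ℓ := by linarith
  have hu : Ioc 0 (2 * (ℓ / t)) ⊆ Ioc 0 (2 / t) ∪ Ioc 0 (2 * (ℓ / t)) := subset_union_right
  calc sqInt (2 * (ℓ / t)) w u
      ≤ ∫⁻ y in Ioc 0 (2 * (ℓ / t)), ((Ioc 0 (2 / t)).indicator (fun _ => ofReal (P * t)) y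
          + ofReal (P * t * ℓ⁻¹)) := by
        refine setLIntegral_mono' measurableSet_Ioc fun y hy => ?_
        refine (ofReal_le_ofReal (h y hy)).trans ?_
        split_ifs with hle
        · rw [indicator_of_mem (show y ∈ Ioc 0 (2 / t) from ⟨hy.1, by rwa [le_div_iff₀' ht]⟩), mul_one]
          exact le_self_add
        · exact le_add_self
    _ = (∫⁻ y in Ioc 0 (2 * (ℓ / t)), (Ioc 0 (2 / t)).indicator (fun _ => ofReal (P * t)) y)
          + ofReal (P * t * ℓ⁻¹) * ofReal (2 * (ℓ / t)) := by
        rw [lintegral_add_right _ measurable_const, setLIntegral_const, Real.volume_Ioc, sub_zero]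
    _ ≤ ofReal (P * t) * ofReal (2 / t) + ofReal (P * t * ℓ⁻¹) * ofReal (2 * (ℓ / t)) := by
        gcongr
        refine (setLIntegral_le_lintegral _ _).trans ?_
        rw [lintegral_indicator measurableSet_Ioc, setLIntegral_const, Real.volume_Ioc, sub_zero]
    _ = ofReal (4 * P) := by
        rw [← ENNReal.ofReal_mul (by positivity), ← ENNReal.ofReal_mul (by positivity),
          ← ENNReal.ofReal_add (by positivity) (by positivity)]
        congr 1; field_simp; ring

section
variable {L : ℕ} [NeZero L] {g Q q χ c : ℝ → ℝ} {b0 K : ℝ} {S : ℕ → Par L → ℝ → ℝ}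

theorem exists_sqInt_le_of_zones (hb0 : b0 ≤ 1 / 16) {U : Par L → ℝ → ℝ} {w P : ℝ → ℝ}
    (hP : ∀ b, 0 < b → 0 ≤ P b) (hA : ∃ C, 0 ≤ C ∧ ∀ b ∈ parSet L b0 K, ∀ y ∈ Ioc (0 : ℝ) 1,
      w y * U b y ^ 2 * y ≤ C * (P (b 0) * √(b 0)))
    (hB : ∃ C, 0 ≤ C ∧ ∀ b ∈ parSet L b0 K, ∀ y, 1 ≤ y → √(b 0) * y < 1 →
      w y * U b y ^ 2 * y ≤ C * (P (b 0) * √(b 0)))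
    (hC : ∃ C, 0 ≤ C ∧ ∀ b ∈ parSet L b0 K, ∀ y, 1 ≤ √(b 0) * y → √(b 0) * y < 3 * |log (b 0)| →
      w y * U b y ^ 2 * y ≤ C * (P (b 0) * √(b 0) *
        (if √(b 0) * y ≤ 2 then 1 else |log (b 0)|⁻¹))) :
    ∃ C, 0 ≤ C ∧ ∀ b ∈ parSet L b0 K, sqInt (2 * B1 (b 0)) w (U b) ≤ ofReal (C * P (b 0)) := by
  obtain ⟨C₁, hC₁, h1⟩ := hA
  obtain ⟨C₂, hC₂, h2⟩ := hB
  obtain ⟨C₃, hC₃, h3⟩ := hC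
  refine ⟨4 * (C₁ + C₂ + C₃), by positivity, fun b hb => ?_⟩
  have h0 := hb.1.1
  have ht : 0 < √(b 0) := sqrt_pos.mpr h0
  have hl := one_le_abs_log hb0 hb.1
  have ht1 := sqrt_lt_one hb0 hb.1
  have hPb := hP (b 0) h0
  rw [mul_assoc]
  refine sqInt_le_of_two_scales ht hl (mul_nonneg (by positivity) hPb) fun y hy => ?_
  have hty : √(b 0) * y ≤ 2 * |log (b 0)| := by
    have := mul_le_mul_of_nonneg_left hy.2 ht.le
    rwa [mul_left_comm, mul_div_cancel₀ _ ht.ne'] at this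
  set t := √(b 0)
  have hX : 0 ≤ P (b 0) * t := by positivity
  rcases le_or_gt y 1 with hy1 | hy1
  · rw [if_pos (show t * y ≤ 2 by nlinarith [hy.1])]
    refine (h1 b hb y ⟨hy.1, hy1⟩).trans ?_
    rw [mul_one, mul_assoc]
    gcongr; linarith
  rcases lt_or_ge (t * y) 1 with hz | hz
  · rw [if_pos (by linarith)]
    refine (h2 b hb y hy1.le hz).trans ?_
    rw [mul_one, mul_assoc]
    gcongr; linarith
  · refine (h3 b hb y hz (by linarith)).trans ?_
    rw [mul_assoc (C₁ + C₂ + C₃), mul_assoc (C₁ + C₂ + C₃)]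
    have : 0 ≤ P (b 0) * t * (if t * y ≤ 2 then 1 else |log (b 0)|⁻¹) := by split_ifs <;> positivity
    gcongr; linarith

theorem sq_le_of_abs_le {x A : ℝ} (h : |x| ≤ A) : x ^ 2 ≤ A ^ 2 := by
  rw [← sq_abs]; exact pow_le_pow_left₀ (abs_nonneg x) h 2

theorem IsProfiles.weighted_le_origin (h : IsExt g Q q) (hb0 : b0 ≤ 1 / 16) (hK : 0 ≤ K) (hχ : IsCutoff χ)
    (hc : IsSpeed b0 c) (hS : IsProfiles g Q q c b0 (L + 2) (L + 2) S) {k : ℕ} (hk : k ≤ 2 * L + 2) :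
    ∃ C, 0 ≤ C ∧ ∀ b ∈ parSet L b0 K, ∀ y ∈ Ioc (0 : ℝ) 1, ∀ w, 0 ≤ w → w ≤ 1 + |log y| ^ 2 →
      w * suitable g Q k (errModel g Q q c (cutProf χ S) b) y ^ 2 * y
        ≤ C * (√(b 0) ^ (4 * L + 9) * |log (b 0)|⁻¹ ^ 2) := by
  obtain ⟨C, hC, hb⟩ := hS.suitable_le_origin (K := K) h hb0 hK hχ hc hk
  obtain ⟨C', hC', hb'⟩ := exists_sqrt_mul_log_pow_le 2
  refine ⟨2 * C ^ 2 * C', by positivity, fun b hbp y hy w hw hw' => ?_⟩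
  have h1 := sq_le_of_abs_le (hb b hbp y hy)
  have h0 := hbp.1.1
  have h2 := hb' (b 0) ⟨h0, by linarith [hbp.1.2]⟩
  have hl := one_le_abs_log hb0 hbp.1
  have ht1 := sqrt_lt_one hb0 hbp.1
  have hy0 := hy.1
  have ht : 0 < √(b 0) := sqrt_pos.mpr h0
  set t := √(b 0)
  have hl0 : 0 < |log (b 0)| := by linarith
  have h3 : t ≤ C' * |log (b 0)|⁻¹ ^ 2 := by
    rwa [inv_pow, ← div_eq_mul_inv, le_div_iff₀ (by positivity)]
  have h4 : (1 + |log y| ^ 2) * y ^ 2 ≤ 2 := by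
    have h5 : (log y * y) ^ 2 ≤ 1 := by
      have := (abs_lt.mp (Real.abs_log_mul_self_lt y hy.1 hy.2))
      nlinarith
    have h6 := pow_le_one₀ hy.1.le hy.2 (n := 2)
    rw [sq_abs]; nlinarith
  calc _ ≤ (1 + |log y| ^ 2) * (C * (t ^ (2 * L + 6) * y)) ^ 2 * 1 := by gcongr; exact hy.2
    _ = C ^ 2 * (t ^ (4 * L + 9) * (t * t ^ 2)) * ((1 + |log y| ^ 2) * y ^ 2) := by ring
    _ ≤ C ^ 2 * (t ^ (4 * L + 9) * ((C' * |log (b 0)|⁻¹ ^ 2) * 1)) * 2 := by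
        gcongr; exact pow_le_one₀ ht.le ht1.le
    _ = _ := by ring

theorem IsProfiles.sq_le_mid (h : IsExt g Q q) (hb0 : b0 ≤ 1 / 16) (hK : 0 ≤ K) (hχ : IsCutoff χ)
    (hc : IsSpeed b0 c) (hS : IsProfiles g Q q c b0 (L + 2) (L + 2) S) {k : ℕ} (hk : k ≤ 2 * L + 2) :
    ∃ C, 0 ≤ C ∧ ∀ b ∈ parSet L b0 K, ∀ y, 1 ≤ y → √(b 0) * y < 1 →
      suitable g Q k (errModel g Q q c (cutProf χ S) b) y ^ 2 * y
        ≤ C * (√(b 0) ^ (2 * k + 5) * |log (b 0)|⁻¹ ^ 2) := by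
  obtain ⟨C, hC, hb⟩ := hS.suitable_le_mid (K := K) h hb0 hK hχ hc hk
  refine ⟨C ^ 2, by positivity, fun b hbp y hy hz => ?_⟩
  have h1 := sq_le_of_abs_le (hb b hbp y hy hz).1
  have ht : 0 < √(b 0) := sqrt_pos.mpr hbp.1.1
  set t := √(b 0)
  have hy0 : 0 < y := by linarith
  obtain ⟨n, hn⟩ := Nat.exists_eq_add_of_le hk
  rw [show 2 * L + 2 - k = n by omega, show 2 * L + 5 = k + n + 3 by omega] at h1
  calc _ ≤ (C * (t ^ (k + n + 3) * |log (b 0)|⁻¹ * y ^ n)) ^ 2 * y := by gcongr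
    _ = C ^ 2 * (t ^ (2 * k + 5) * |log (b 0)|⁻¹ ^ 2) * (t * y) ^ (2 * n + 1) := by ring
    _ ≤ C ^ 2 * (t ^ (2 * k + 5) * |log (b 0)|⁻¹ ^ 2) * 1 := by
        gcongr; exact pow_le_one₀ (by positivity) hz.le
    _ = _ := by ring

theorem IsProfiles.weighted_le_mid (h : IsExt g Q q) (hb0 : b0 ≤ 1 / 16) (hK : 0 ≤ K) (hχ : IsCutoff χ)
    (hc : IsSpeed b0 c) (hS : IsProfiles g Q q c b0 (L + 2) (L + 2) S) {k : ℕ} (hk : k ≤ 2 * L + 2) :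
    ∃ C, 0 ≤ C ∧ ∀ b ∈ parSet L b0 K, ∀ y, 1 ≤ y → √(b 0) * y < 1 →
      ∀ w, 0 ≤ w → w * y ^ (2 * (2 * L + 2 - k)) ≤ 1 + |log y| ^ 2 →
      w * suitable g Q k (errModel g Q q c (cutProf χ S) b) y ^ 2 * y
        ≤ C * (√(b 0) ^ (4 * L + 7) * |log (b 0)|⁻¹ ^ 2) := by
  obtain ⟨C, hC, hb⟩ := hS.suitable_le_mid (K := K) h hb0 hK hχ hc hk
  obtain ⟨C', hC', hb'⟩ := exists_sqrt_mul_log_pow_le 2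
  refine ⟨2 * C ^ 2 * C', by positivity, fun b hbp y hy hz w hw hw' => ?_⟩
  have h1 := sq_le_of_abs_le (hb b hbp y hy hz).1
  have h0 := hbp.1.1
  have ht : 0 < √(b 0) := sqrt_pos.mpr h0
  have h2 := hb' (b 0) ⟨h0, by linarith [hbp.1.2]⟩
  have hl := one_le_abs_log hb0 hbp.1
  have ht1 := sqrt_lt_one hb0 hbp.1
  have hy0 : 0 < y := by linarith
  have hlog : log y ≤ |log (b 0)| := by
    have h5 := log_nonpos (by positivity) hz.le
    rw [log_mul ht.ne' hy0.ne', log_sqrt h0.le] at h5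
    have := neg_abs_le (log (b 0))
    linarith
  have hlog2 : 1 + |log y| ^ 2 ≤ 2 * |log (b 0)| ^ 2 := by
    rw [abs_of_nonneg (log_nonneg hy)]
    have h5 := pow_le_pow_left₀ (log_nonneg hy) hlog 2
    have h6 := one_le_pow₀ hl (n := 2)
    linarith
  set t := √(b 0)
  have hl0 : 0 < |log (b 0)| := by linarith
  have h3 : t ≤ C' * |log (b 0)|⁻¹ ^ 2 := by
    rwa [inv_pow, ← div_eq_mul_inv, le_div_iff₀ (by positivity)]
  set n := 2 * L + 2 - k
  set ℓ := |log (b 0)|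
  calc _ ≤ w * (C * (t ^ (2 * L + 5) * ℓ⁻¹ * y ^ n)) ^ 2 * y := by gcongr
    _ = C ^ 2 * (t ^ (4 * L + 10) * ℓ⁻¹ ^ 2) * (w * y ^ (2 * n)) * y := by ring
    _ ≤ C ^ 2 * (t ^ (4 * L + 10) * ℓ⁻¹ ^ 2) * (2 * ℓ ^ 2) * y :=
        mul_le_mul_of_nonneg_right (mul_le_mul_of_nonneg_left (hw'.trans hlog2) (by positivity)) hy0.le
    _ = 2 * C ^ 2 * (t ^ (4 * L + 7) * t * (t * (t * y))) := by field_simp; ring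
    _ ≤ 2 * C ^ 2 * (t ^ (4 * L + 7) * (C' * ℓ⁻¹ ^ 2) * (1 * 1)) := by gcongr
    _ = _ := by ring

theorem IsCutProfiles.sq_le_cut (h : IsExt g Q q) (hb0 : b0 ≤ 1 / 16) (hK : 0 ≤ K) (hχ : IsCutoff χ)
    (hc : IsSpeed b0 c) (hS : IsCutProfiles b0 χ S) (k : ℕ) :
    ∃ C, 0 ≤ C ∧ ∀ b ∈ parSet L b0 K, ∀ y, 1 ≤ √(b 0) * y → √(b 0) * y < 3 * |log (b 0)| →
      suitable g Q k (errModel g Q q c S b) y ^ 2 * y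
        ≤ C * (√(b 0) ^ (2 * k + 5) * |log (b 0)| ^ (4 * L + 1)) := by
  obtain ⟨C, hC, hb⟩ := hS.suitable_le_cut (K := K) h hb0 hK hχ hc k
  refine ⟨3 * C ^ 2, by positivity, fun b hbp y hy hy' => ?_⟩
  have hs := zoneCut.scale hb0 (zoneCut.mem_of_le hbp hy hy')
  dsimp only at hs
  have h1 := sq_le_of_abs_le (hb b hbp y hy hy')
  have ht := hs.pos
  have hy0 : 0 < y := one_pos.trans_le hs.one_le
  set t := √(b 0)
  set ℓ := |log (b 0)|
  calc _ ≤ (C * (t ^ (3 + k) * ℓ ^ (2 * L))) ^ 2 * y := by gcongr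
    _ = C ^ 2 * (t ^ (2 * k + 5) * ℓ ^ (4 * L)) * (t * y) := by ring
    _ ≤ C ^ 2 * (t ^ (2 * k + 5) * ℓ ^ (4 * L)) * (3 * ℓ) := by gcongr
    _ = _ := by ring

theorem IsCutProfiles.weighted_le_cut (h : IsExt g Q q) (hb0 : b0 ≤ 1 / 16) (hK : 0 ≤ K) (hχ : IsCutoff χ)
    (hc : IsSpeed b0 c) (hS : IsCutProfiles b0 χ S) {k : ℕ} (hk : k ≤ 2 * L + 2) :
    ∃ C, 0 ≤ C ∧ ∀ b ∈ parSet L b0 K, ∀ y, 1 ≤ √(b 0) * y → √(b 0) * y < 3 * |log (b 0)| →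
      ∀ w, 0 ≤ w → w * y ^ (2 * (2 * L + 2 - k)) ≤ 1 + |log y| ^ 2 →
      w * suitable g Q k (errModel g Q q c S b) y ^ 2 * y
        ≤ C * (√(b 0) ^ (4 * L + 7) * |log (b 0)|⁻¹ ^ 3) := by
  obtain ⟨C, hC, hb⟩ := hS.sq_le_cut (K := K) h hb0 hK hχ hc k
  obtain ⟨C', hC', hb'⟩ := exists_sqrt_mul_log_pow_le (4 * L + 6)
  set n := 2 * L + 2 - k with hn
  refine ⟨C * 17 * 2 ^ (2 * n) * C', by positivity, fun b hbp y hy hy' w hw hw' => ?_⟩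
  have hs := zoneCut.scale hb0 (zoneCut.mem_of_le hbp hy hy')
  dsimp only at hs
  have h1 := hb b hbp y hy hy'
  have h2 := hb' (b 0) ⟨hbp.1.1, by linarith [hbp.1.2]⟩
  have ht := hs.pos
  have hl := hs.one_le_log
  have ht1 := hs.le_one
  have hy0 : 0 < y := one_pos.trans_le hs.one_le
  have h3 := inv_pow_le hs (2 * n)
  have hlog : 1 + |log y| ^ 2 ≤ 17 * |log (b 0)| ^ 2 := by
    have h4 := log_nonneg hs.one_le
    rw [abs_of_nonneg h4]
    have h5 := hs.log_le
    nlinarith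
  set t := √(b 0)
  set ℓ := |log (b 0)|
  have hl0 : 0 < ℓ := by linarith
  have hw2 : w ≤ 17 * ℓ ^ 2 * (2 ^ (2 * n) * t ^ (2 * n)) := by
    calc w = w * y ^ (2 * n) * (1 / y ^ (2 * n)) := by field_simp
      _ ≤ _ := mul_le_mul (hw'.trans hlog) h3 (by positivity) (by positivity)
  have e : t ^ (2 * k + 5) * t ^ (2 * n) = t ^ (4 * L + 7) * (t * t) := by
    rw [← pow_add, ← pow_two, ← pow_add]; congr 1; omega
  have h6 : t * ℓ ^ (4 * L + 3) ≤ C' * ℓ⁻¹ ^ 3 := by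
    rw [inv_pow, ← div_eq_mul_inv, le_div_iff₀ (by positivity), mul_assoc, ← pow_add]; exact h2
  calc _ = w * (suitable g Q k (errModel g Q q c S b) y ^ 2 * y) := by ring
    _ ≤ (17 * ℓ ^ 2 * (2 ^ (2 * n) * t ^ (2 * n))) * (C * (t ^ (2 * k + 5) * ℓ ^ (4 * L + 1))) := by
        gcongr
    _ = C * 17 * 2 ^ (2 * n) * ((t ^ (2 * k + 5) * t ^ (2 * n)) * ℓ ^ (4 * L + 3)) := by ring
    _ = C * 17 * 2 ^ (2 * n) * (t ^ (4 * L + 7) * t * (t * ℓ ^ (4 * L + 3))) := by rw [e]; ring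
    _ ≤ C * 17 * 2 ^ (2 * n) * (t ^ (4 * L + 7) * 1 * (C' * ℓ⁻¹ ^ 3)) := by gcongr
    _ = _ := by ring

theorem IsCutProfiles.sq_le_cut_of_lt (h : IsExt g Q q) (hb0 : b0 ≤ 1 / 16) (hK : 0 ≤ K) (hχ : IsCutoff χ)
    (hc : IsSpeed b0 c) (hS : IsCutProfiles b0 χ S) {k : ℕ} (hk : 2 * L < k) :
    ∃ C, 0 ≤ C ∧ ∀ b ∈ parSet L b0 K, ∀ y, 1 ≤ √(b 0) * y → √(b 0) * y < 3 * |log (b 0)| →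
      suitable g Q k (errModel g Q q c S b) y ^ 2 * y
        ≤ C * (√(b 0) ^ (2 * k + 5) * |log (b 0)|⁻¹ ^ 2 *
          (if √(b 0) * y ≤ 2 then 1 else |log (b 0)|⁻¹)) := by
  obtain ⟨C, hC, hb⟩ := hS.suitable_le_cut_of_lt (K := K) h hb0 hK hχ hc hk
  obtain ⟨C', hC', hb'⟩ := exists_sqrt_mul_log_pow_le 4
  refine ⟨C ^ 2 * (4 * (1 + C') + 3 * C'), by positivity, fun b hbp y hy hy' => ?_⟩
  have hs := zoneCut.scale hb0 (zoneCut.mem_of_le hbp hy hy')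
  dsimp only at hs
  have h1 := sq_le_of_abs_le (hb b hbp y hy hy')
  have h2 := hb' (b 0) ⟨hbp.1.1, by linarith [hbp.1.2]⟩
  have ht := hs.pos
  have hl := hs.one_le_log
  have ht1 := hs.le_one
  have hm := hs.mul_le
  have hy0 : 0 < y := one_pos.trans_le hs.one_le
  set t := √(b 0)
  set ℓ := |log (b 0)|
  have hl0 : 0 < ℓ := by linarith
  have h6 : t ^ 2 * ℓ ≤ C' * ℓ⁻¹ ^ 3 := by
    rw [inv_pow, ← div_eq_mul_inv, le_div_iff₀ (by positivity)]
    calc t ^ 2 * ℓ * ℓ ^ 3 = t * (t * ℓ ^ 4) := by ring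
      _ ≤ 1 * C' := by gcongr
      _ = C' := one_mul _
  split_ifs at h1 ⊢ with hle
  · have h7 : t ^ 2 ≤ C' * ℓ⁻¹ ^ 2 := by
      calc t ^ 2 ≤ t ^ 2 * ℓ := le_mul_of_one_le_right (by positivity) hl
        _ ≤ C' * ℓ⁻¹ ^ 3 := h6
        _ ≤ C' * ℓ⁻¹ ^ 2 := mul_le_mul_of_nonneg_left (pow_le_pow_of_le_one (by positivity)
            (inv_le_one_of_one_le₀ hl) (by omega)) hC'
    have h8 : (ℓ⁻¹ * 1 + t) ^ 2 ≤ 2 * (1 + C') * ℓ⁻¹ ^ 2 := by nlinarith [sq_nonneg (ℓ⁻¹ - t)]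
    calc _ ≤ (C * (t ^ (3 + k) * (ℓ⁻¹ * 1 + t))) ^ 2 * y := by gcongr
      _ = C ^ 2 * t ^ (2 * k + 5) * (ℓ⁻¹ * 1 + t) ^ 2 * (t * y) := by ring
      _ ≤ C ^ 2 * t ^ (2 * k + 5) * (2 * (1 + C') * ℓ⁻¹ ^ 2) * 2 := by gcongr
      _ = C ^ 2 * (4 * (1 + C')) * (t ^ (2 * k + 5) * ℓ⁻¹ ^ 2 * 1) := by ring
      _ ≤ _ := by gcongr; linarith
  · calc _ ≤ (C * (t ^ (3 + k) * (ℓ⁻¹ * 0 + t))) ^ 2 * y := by gcongr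
      _ = C ^ 2 * t ^ (2 * k + 5) * t ^ 2 * (t * y) := by ring
      _ ≤ C ^ 2 * t ^ (2 * k + 5) * t ^ 2 * (3 * ℓ) := by gcongr
      _ = C ^ 2 * 3 * t ^ (2 * k + 5) * (t ^ 2 * ℓ) := by ring
      _ ≤ C ^ 2 * 3 * t ^ (2 * k + 5) * (C' * ℓ⁻¹ ^ 3) := by gcongr
      _ = C ^ 2 * (3 * C') * (t ^ (2 * k + 5) * ℓ⁻¹ ^ 2 * ℓ⁻¹) := by ring
      _ ≤ _ := by gcongr; linarith

end


section
variable {L : ℕ} [NeZero L] {g Q q χ c : ℝ → ℝ} {b0 K : ℝ} {S : ℕ → Par L → ℝ → ℝ}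

theorem inv_le_ite {ℓ : ℝ} (hℓ : 1 ≤ ℓ) (p : Prop) [Decidable p] : ℓ⁻¹ ≤ if p then 1 else ℓ⁻¹ := by
  split_ifs
  · exact inv_le_one_of_one_le₀ hℓ
  · exact le_rfl

theorem pow_mul_sqrt {b : ℝ} (hb : 0 < b) (n : ℕ) : b ^ n * √b = √b ^ (2 * n + 1) := by
  rw [pow_succ, sqrt_pow_two_mul hb]

theorem IsProfiles.sqInt_le (h : IsExt g Q q) (hb0 : b0 ≤ 1 / 16) (hK : 0 ≤ K) (hχ : IsCutoff χ)
    (hc : IsSpeed b0 c) (hS : IsProfiles g Q q c b0 (L + 2) (L + 2) S) {k : ℕ} (hk : k ≤ L) :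
    ∃ C, 0 ≤ C ∧ ∀ b ∈ parSet L b0 K,
      sqInt (2 * B1 (b 0)) (fun _ => 1) (suitable g Q (2 * k) (errModel g Q q c (cutProf χ S) b))
        ≤ ofReal (C * (b 0 ^ (2 * k + 2) * |log (b 0)| ^ (4 * L + 8))) := by
  have hS' : IsCutProfiles b0 χ (cutProf χ S) := hS.cut
  refine exists_sqInt_le_of_zones (P := fun b => b ^ (2 * k + 2) * |log b| ^ (4 * L + 8)) hb0
    (fun b hb => by positivity) ?_ ?_ ?_
  · obtain ⟨C, hC, hb⟩ := hS.weighted_le_origin (K := K) h hb0 hK hχ hc (k := 2 * k) (by omega)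
    refine ⟨C, hC, fun b hbp y hy => (hb b hbp y hy 1 zero_le_one (by
      linarith [sq_nonneg |log y|])).trans (mul_le_mul_of_nonneg_left ?_ hC)⟩
    have hl := one_le_abs_log hb0 hbp.1
    have ht1 := sqrt_lt_one hb0 hbp.1
    rw [mul_right_comm, pow_mul_sqrt hbp.1.1]
    exact mul_le_mul (pow_le_pow_of_le_one (sqrt_nonneg _) ht1.le (by omega))
      ((pow_le_one₀ (by positivity) (inv_le_one_of_one_le₀ hl)).trans (one_le_pow₀ hl))
      (by positivity) (by positivity)
  · obtain ⟨C, hC, hb⟩ := hS.sq_le_mid (K := K) h hb0 hK hχ hc (k := 2 * k) (by omega)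
    refine ⟨C, hC, fun b hbp y hy hz => ?_⟩
    rw [one_mul]
    refine (hb b hbp y hy hz).trans (mul_le_mul_of_nonneg_left ?_ hC)
    have hl := one_le_abs_log hb0 hbp.1
    rw [mul_right_comm, pow_mul_sqrt hbp.1.1]
    exact mul_le_mul (le_of_eq (by ring))
      ((pow_le_one₀ (by positivity) (inv_le_one_of_one_le₀ hl)).trans (one_le_pow₀ hl))
      (by positivity) (by positivity)
  · obtain ⟨C, hC, hb⟩ := hS'.sq_le_cut (K := K) h hb0 hK hχ hc (2 * k)
    refine ⟨C, hC, fun b hbp y hy hy' => ?_⟩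
    rw [one_mul]
    refine (hb b hbp y hy hy').trans (mul_le_mul_of_nonneg_left ?_ hC)
    have hl := one_le_abs_log hb0 hbp.1
    have hl0 : 0 < |log (b 0)| := by linarith
    rw [mul_right_comm (b 0 ^ (2 * k + 2)), pow_mul_sqrt hbp.1.1]
    calc _ = √(b 0) ^ (2 * (2 * k + 2) + 1) *
          |log (b 0)| ^ (4 * L + 2) * |log (b 0)|⁻¹ := by
          rw [show 2 * (2 * k + 2) + 1 = 2 * (2 * k) + 5 by ring, pow_succ _ (4 * L + 1)]
          field_simp
      _ ≤ _ := by
          gcongr ?_ * ?_ * ?_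
          · exact pow_le_pow_right₀ hl (by omega)
          · exact inv_le_ite hl _

theorem IsProfiles.sqInt_weighted_le (h : IsExt g Q q) (hb0 : b0 ≤ 1 / 16) (hK : 0 ≤ K) (hχ : IsCutoff χ)
    (hc : IsSpeed b0 c) (hS : IsProfiles g Q q c b0 (L + 2) (L + 2) S) {k : ℕ} (hk : k ≤ 2 * L + 2)
    {w : ℝ → ℝ} (hw : ∀ y, 0 < y → 0 ≤ w y) (hw1 : ∀ y, 0 < y → w y ≤ 1 + |log y| ^ 2)
    (hw2 : ∀ y, 0 < y → w y * y ^ (2 * (2 * L + 2 - k)) ≤ 1 + |log y| ^ 2) :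
    ∃ C, 0 ≤ C ∧ ∀ b ∈ parSet L b0 K,
      sqInt (2 * B1 (b 0)) w (suitable g Q k (errModel g Q q c (cutProf χ S) b))
        ≤ ofReal (C * (b 0 ^ (2 * L + 3) / |log (b 0)| ^ 2)) := by
  have hS' : IsCutProfiles b0 χ (cutProf χ S) := hS.cut
  have e : ∀ b : ℝ, 0 < b → b ^ (2 * L + 3) / |log b| ^ 2 * √b
      = √b ^ (4 * L + 7) * |log b|⁻¹ ^ 2 := fun b hb => by
    rw [div_mul_eq_mul_div, pow_mul_sqrt hb, inv_pow, div_eq_mul_inv]; congr 2; ring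
  refine exists_sqInt_le_of_zones (P := fun b => b ^ (2 * L + 3) / |log b| ^ 2) hb0
    (fun b hb => by positivity) ?_ ?_ ?_
  · obtain ⟨C, hC, hb⟩ := hS.weighted_le_origin (K := K) h hb0 hK hχ hc hk
    refine ⟨C, hC, fun b hbp y hy => (hb b hbp y hy _ (hw y hy.1) (hw1 y hy.1)).trans
      (mul_le_mul_of_nonneg_left ?_ hC)⟩
    rw [e _ hbp.1.1]
    gcongr ?_ * _; exact pow_le_pow_of_le_one (sqrt_nonneg _) (sqrt_lt_one hb0 hbp.1).le (by omega)
  · obtain ⟨C, hC, hb⟩ := hS.weighted_le_mid (K := K) h hb0 hK hχ hc hk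
    refine ⟨C, hC, fun b hbp y hy hz => ?_⟩
    rw [e _ hbp.1.1]
    have hy0 : 0 < y := by linarith
    exact hb b hbp y hy hz _ (hw y hy0) (hw2 y hy0)
  · obtain ⟨C, hC, hb⟩ := hS'.weighted_le_cut (K := K) h hb0 hK hχ hc hk
    refine ⟨C, hC, fun b hbp y hy hy' => ?_⟩
    have hy0 := zoneCut.pos hb0 _ (zoneCut.mem_of_le hbp hy hy')
    refine (hb b hbp y hy hy' _ (hw y hy0) (hw2 y hy0)).trans (mul_le_mul_of_nonneg_left ?_ hC)
    rw [e _ hbp.1.1, pow_succ _ 2, ← mul_assoc]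
    gcongr; exact inv_le_ite (one_le_abs_log hb0 hbp.1) _

theorem IsProfiles.sqInt_top_le (h : IsExt g Q q) (hb0 : b0 ≤ 1 / 16) (hK : 0 ≤ K) (hχ : IsCutoff χ)
    (hc : IsSpeed b0 c) (hS : IsProfiles g Q q c b0 (L + 2) (L + 2) S) :
    ∃ C, 0 ≤ C ∧ ∀ b ∈ parSet L b0 K,
      sqInt (2 * B1 (b 0)) (fun _ => 1) (suitable g Q (2 * (L + 1)) (errModel g Q q c (cutProf χ S) b))
        ≤ ofReal (C * (b 0 ^ (2 * L + 4) / |log (b 0)| ^ 2)) := by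
  have hS' : IsCutProfiles b0 χ (cutProf χ S) := hS.cut
  have e : ∀ b : ℝ, 0 < b → b ^ (2 * L + 4) / |log b| ^ 2 * √b
      = √b ^ (4 * L + 9) * |log b|⁻¹ ^ 2 := fun b hb => by
    rw [div_mul_eq_mul_div, pow_mul_sqrt hb, inv_pow, div_eq_mul_inv]; congr 2; ring
  have e' : 2 * (2 * (L + 1)) + 5 = 4 * L + 9 := by ring
  refine exists_sqInt_le_of_zones (P := fun b => b ^ (2 * L + 4) / |log b| ^ 2) hb0
    (fun b hb => by positivity) ?_ ?_ ?_
  · obtain ⟨C, hC, hb⟩ := hS.weighted_le_origin (K := K) h hb0 hK hχ hc (k := 2 * (L + 1)) (by omega)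
    refine ⟨C, hC, fun b hbp y hy => ?_⟩
    rw [e _ hbp.1.1]; exact hb b hbp y hy 1 zero_le_one (by linarith [sq_nonneg |log y|])
  · obtain ⟨C, hC, hb⟩ := hS.sq_le_mid (K := K) h hb0 hK hχ hc (k := 2 * (L + 1)) (by omega)
    refine ⟨C, hC, fun b hbp y hy hz => ?_⟩
    rw [e _ hbp.1.1, one_mul, ← e']; exact hb b hbp y hy hz
  · obtain ⟨C, hC, hb⟩ := hS'.sq_le_cut_of_lt (K := K) h hb0 hK hχ hc (k := 2 * (L + 1)) (by omega)
    refine ⟨C, hC, fun b hbp y hy hy' => ?_⟩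
    rw [e _ hbp.1.1, one_mul, ← e']; exact hb b hbp y hy hy'

theorem IsProfiles.sqInt_local_le (h : IsExt g Q q) (hb0 : b0 ≤ 1 / 16) (hK : 0 ≤ K) (hχ : IsCutoff χ)
    (hc : IsSpeed b0 c) (hS : IsProfiles g Q q c b0 (L + 2) (L + 2) S) {k : ℕ} (hk : k ≤ 2 * L + 2) :
    ∃ C, 0 ≤ C ∧ ∀ M, 1 ≤ M → ∀ b ∈ parSet L b0 K, √(b 0) * (2 * M) < 1 →
      sqInt (2 * M) (fun _ => 1) (suitable g Q k (errModel g Q q c (cutProf χ S) b))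
        ≤ ofReal (C * (M ^ (4 * L + 8) * b 0 ^ (2 * L + 6))) := by
  obtain ⟨C₁, hC₁, h1⟩ := hS.suitable_le_origin (K := K) h hb0 hK hχ hc hk
  obtain ⟨C₂, hC₂, h2⟩ := hS.suitable_le_mid (K := K) h hb0 hK hχ hc hk
  refine ⟨(C₁ ^ 2 + C₂ ^ 2) * 2 ^ (4 * L + 8), by positivity, fun M hM b hb hbM => ?_⟩
  have ht : 0 < √(b 0) := sqrt_pos.mpr hb.1.1
  have e : b 0 ^ (2 * L + 6) = √(b 0) ^ (4 * L + 12) := by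
    rw [show 4 * L + 12 = 2 * (2 * L + 6) by ring, sqrt_pow_two_mul hb.1.1]
  have h3 : ∀ y ∈ Ioc 0 (2 * M), 1 * suitable g Q k (errModel g Q q c (cutProf χ S) b) y ^ 2 * y
      ≤ (C₁ ^ 2 + C₂ ^ 2) * (√(b 0) ^ (4 * L + 12) * (2 * M) ^ (4 * L + 7)) := by
    intro y hy
    have hy0 := hy.1
    rw [one_mul]
    rcases le_or_gt y 1 with hy1 | hy1
    · have h4 := sq_le_of_abs_le (h1 b hb y ⟨hy.1, hy1⟩)
      calc _ ≤ (C₁ * (√(b 0) ^ (2 * L + 6) * y)) ^ 2 * y := by gcongr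
        _ = C₁ ^ 2 * (√(b 0) ^ (4 * L + 12) * y ^ 3) := by ring
        _ ≤ C₁ ^ 2 * (√(b 0) ^ (4 * L + 12) * (2 * M) ^ (4 * L + 7)) := by
            gcongr; exact (pow_le_one₀ hy0.le hy1).trans (one_le_pow₀ (by linarith))
        _ ≤ _ := by gcongr; linarith [sq_nonneg C₂]
    · have h4 := sq_le_of_abs_le (h2 b hb y hy1.le
        ((mul_le_mul_of_nonneg_left hy.2 ht.le).trans_lt hbM)).2
      calc _ ≤ (C₂ * (√(b 0) ^ (2 * L + 6) * y ^ (2 * L + 3 - k))) ^ 2 * y := by gcongr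
        _ = C₂ ^ 2 * (√(b 0) ^ (4 * L + 12) * y ^ (2 * (2 * L + 3 - k) + 1)) := by ring
        _ ≤ C₂ ^ 2 * (√(b 0) ^ (4 * L + 12) * (2 * M) ^ (4 * L + 7)) := by
            gcongr
            exact (pow_le_pow_right₀ hy1.le (by omega)).trans (pow_le_pow_left₀ hy0.le hy.2 _)
        _ ≤ _ := by gcongr; linarith [sq_nonneg C₁]
  refine (sqInt_le_of_const (by positivity) h3).trans (ofReal_le_ofReal (le_of_eq ?_))
  rw [e]; ring

theorem sqInt_congr {R : ℝ} {w u v : ℝ → ℝ} (h : ∀ y, 0 < y → u y = v y) : sqInt R w u = sqInt R w v :=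
  setLIntegral_congr_fun measurableSet_Ioc fun y hy => by rw [h y hy.1]

theorem IsExt.opH_iterate_eq (h : IsExt g Q q) {Ψ Φ : ℝ → ℝ} (he : ∀ y, 0 < y → Ψ y = Φ y)
    (hΦ : ∀ y, 0 < y → SmoothAt Φ y) (k : ℕ) :
    ∀ y, 0 < y → (opH g Q)^[k] Ψ y = suitable g Q (2 * k) Φ y := fun y hy => by
  rw [h.opH_iterate (s := Ioi 0) (fun _ h => h) (fun x hx =>
    (hΦ x hx).congr_of_eventuallyEq (eventuallyEq_of_pos he hx)) isOpen_Ioi k y hy]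
  exact (suitable_congr _ (eventuallyEq_of_pos he hy)).eq_of_nhds

theorem IsExt.opA_opH_iterate_eq (h : IsExt g Q q) {Ψ Φ : ℝ → ℝ} (he : ∀ y, 0 < y → Ψ y = Φ y)
    (hΦ : ∀ y, 0 < y → SmoothAt Φ y) (k : ℕ) :
    ∀ y, 0 < y → opA g Q ((opH g Q)^[k] Ψ) y = suitable g Q (2 * k + 1) Φ y := fun y hy => by
  rw [opA_congr (eventuallyEq_of_pos (h.opH_iterate_eq he hΦ k) hy), suitable, if_pos (even_two_mul k)]

theorem mem_parSet {b : Par L} (h0 : 0 < coord b 1) (h1 : ∀ k, |b k| < b0)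
    (h2 : ∀ k : ℕ, 2 ≤ k → k ≤ L → |coord b k| ≤ K * coord b 1 ^ k) : b ∈ parSet L b0 K := by
  rw [coord_one] at h0
  refine ⟨⟨h0, (le_abs_self _).trans_lt (h1 0)⟩, fun k hk => ?_⟩
  have hk0 : (k : ℕ) ≠ 0 := fun h => hk (Fin.ext h)
  have := h2 (↑k + 1) (by omega) k.2
  rwa [coord_succ, coord_one] at this

theorem sqrt_mul_lt_one {b M : ℝ} (hM : 0 < M) (h : b < 1 / (4 * M ^ 2)) : √b * (2 * M) < 1 := by
  rw [← lt_div_iff₀ (by positivity), sqrt_lt' (by positivity)]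
  refine h.trans_eq ?_
  field_simp
  norm_num

end

end HarmonicHeatFlow

open HarmonicHeatFlow
theorem proposition2p9 (L : ℕ) (hL : 1 ≤ L) :
    -- the exponent `C` depends on `L` only
    ∃ C : ℝ, 0 < C ∧
    ∀ g Q χ : ℝ → ℝ, IsTargetProfile g → IsHarmonicMap g Q → IsCutoff χ →
    ∃ S : ℕ → (Fin L → ℝ) → ℝ → ℝ,
      S 1 = 0 ∧
      (∀ i : ℕ, 2 ≤ i → i ≤ L + 2 → IsHomogeneous g Q i (i : ℤ) i (S i)) ∧
      -- `∂S_i/∂b_j = 0` for `2 ≤ i ≤ j ≤ L`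
      (∀ (i : ℕ) (j : Fin L), 2 ≤ i → i ≤ (j : ℕ) + 1 →
        ∀ b : Fin L → ℝ, 0 < coord b 1 → ∀ y, 0 ≤ y → partialB j (S i) b y = 0) ∧
      ∃ M₀ : ℝ, 0 < M₀ ∧
      -- `K` is the constant of the a priori bounds, `K'` that of the estimates
      ∀ K : ℝ, 0 < K → ∃ K' : ℝ, 0 < K' ∧
      ∀ M : ℝ, M₀ ≤ M → ∃ bstar : ℝ, 0 < bstar ∧
      ∀ (s₀ s₁ : ℝ) (b : ℝ → Fin L → ℝ), s₀ < s₁ → ContDiffOn ℝ 1 b (Icc s₀ s₁) →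
        (∀ s ∈ Icc s₀ s₁, (∀ k, |b s k| < bstar) ∧ 0 < coord (b s) 1 ∧
          ∀ k : ℕ, 2 ≤ k → k ≤ L → |coord (b s) k| ≤ K * coord (b s) 1 ^ k) →
        ∀ s ∈ Icc s₀ s₁, ∀ (b1 : ℝ) (Ψ : ℝ → ℝ), b1 = coord (b s) 1 →
          Ψ = errorTerm g Q χ S (Icc s₀ s₁) b s →
          (∀ k : ℕ, 1 ≤ k → k ≤ L →
            sqInt (2 * B1 b1) (fun _ => 1) ((opH g Q)^[k] Ψ) ≤
              ENNReal.ofReal (K' * (b1 ^ (2 * k + 2) * |Real.log b1| ^ C))) ∧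
          sqInt (2 * B1 b1) (fun y => (1 + |Real.log y| ^ 2) / (1 + y ^ 4)) ((opH g Q)^[L] Ψ)
              + sqInt (2 * B1 b1) (fun y => (1 + |Real.log y| ^ 2) / (1 + y ^ 2))
                (opA g Q ((opH g Q)^[L] Ψ)) ≤
            ENNReal.ofReal (K' * (b1 ^ (2 * L + 3) / |Real.log b1| ^ 2)) ∧
          sqInt (2 * B1 b1) (fun _ => 1) ((opH g Q)^[L + 1] Ψ) ≤
            ENNReal.ofReal (K' * (b1 ^ (2 * L + 4) / |Real.log b1| ^ 2)) ∧
          (∀ k : ℕ, k ≤ L + 1 →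
            sqInt (2 * M) (fun _ => 1) ((opH g Q)^[k] Ψ) ≤
              ENNReal.ofReal (K' * (M ^ C * b1 ^ (2 * L + 6)))) := by
  have : NeZero L := ⟨by omega⟩
  refine ⟨((4 * L + 8 : ℕ) : ℝ), by positivity, fun g Q χ hg hQ hχ => ?_⟩
  obtain ⟨q, hq⟩ := hQ.exists_odd_extension hg
  have h : IsExt g Q q := ⟨hg, hQ, hq.1, hq.2.1, hq.2.2.1, hq.2.2.2⟩
  obtain ⟨b0, hb00, hb0, hc⟩ := h.exists_isSpeed hχ
  obtain ⟨S, hS⟩ := h.exists_profiles (L := L) hb0 hc (L + 2) (L + 2) (by omega)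
  have hS' : IsCutProfiles b0 χ (cutProf χ S) := hS.cut
  refine ⟨cutProf χ S, hS'.zero 1 (by omega), fun i hi _ =>
    (hS.homSum i hi).isHomogeneous h hb00 hb0 hχ (by omega), fun i j _ hij b hb y hy =>
    hS'.partialB_eq_zero hb0 hχ hij (by rwa [coord_one] at hb) hy, 1, one_pos, fun K hK => ?_⟩
  choose! C₁ hC₁ h1 using fun k (hk : k ≤ L) => hS.sqInt_le (K := K) h hb0 hK.le hχ hc hk
  obtain ⟨C₂, hC₂, h2⟩ := hS.sqInt_weighted_le (K := K) h hb0 hK.le hχ hc (k := 2 * L) (by omega)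
    (w := fun y => (1 + |log y| ^ 2) / (1 + y ^ 4)) (fun y _ => by positivity)
    (fun y _ => div_le_self (by positivity) (by linarith [show 0 ≤ y ^ 4 by positivity])) fun y hy => by
      rw [show 2 * (2 * L + 2 - 2 * L) = 4 by omega, div_mul_eq_mul_div, div_le_iff₀ (by positivity)]
      have : 0 ≤ 1 + |log y| ^ 2 := by positivity
      nlinarith
  obtain ⟨C₃, hC₃, h3⟩ := hS.sqInt_weighted_le (K := K) h hb0 hK.le hχ hc (k := 2 * L + 1) (by omega)
    (w := fun y => (1 + |log y| ^ 2) / (1 + y ^ 2)) (fun y _ => by positivity)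
    (fun y _ => div_le_self (by positivity) (by linarith [show 0 ≤ y ^ 2 by positivity])) fun y hy => by
      rw [show 2 * (2 * L + 2 - (2 * L + 1)) = 2 by omega, div_mul_eq_mul_div, div_le_iff₀ (by positivity)]
      have : 0 ≤ 1 + |log y| ^ 2 := by positivity
      nlinarith
  obtain ⟨C₄, hC₄, h4⟩ := hS.sqInt_top_le (K := K) h hb0 hK.le hχ hc
  choose! C₅ hC₅ h5 using fun k (hk : 2 * k ≤ 2 * L + 2) => hS.sqInt_local_le (K := K) h hb0 hK.le hχ hc hk
  set A := ∑ k ∈ Finset.range (L + 1), C₁ k with hA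
  set B := ∑ k ∈ Finset.range (L + 2), C₅ k with hB
  have hA0 : 0 ≤ A := sum_nonneg fun k hk => hC₁ k (by have := mem_range.mp hk; omega)
  have hB0 : 0 ≤ B := sum_nonneg fun k hk => hC₅ k (by have := mem_range.mp hk; omega)
  have hA1 : ∀ k, k ≤ L → C₁ k ≤ A := fun k hk => single_le_sum (f := C₁)
    (fun k hk => hC₁ k (by have := mem_range.mp hk; omega)) (mem_range.mpr (by omega))
  have hB1 : ∀ k, k ≤ L + 1 → C₅ k ≤ B := fun k hk => single_le_sum (f := C₅)
    (fun k hk => hC₅ k (by have := mem_range.mp hk; omega)) (mem_range.mpr (by omega))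
  refine ⟨1 + A + (C₂ + C₃) + C₄ + B, by positivity, fun M hM => ?_⟩
  have hM0 : 0 < M := by linarith
  refine ⟨min b0 (1 / (4 * M ^ 2)), lt_min hb00 (by positivity), ?_⟩
  intro s₀ s₁ b hs hb hbb s hmem b1 Ψ hb1 hΨ
  obtain ⟨hsmall, hpos, hbd⟩ := hbb s hmem
  have hp : b s ∈ parSet L b0 K :=
    mem_parSet hpos (fun k => (hsmall k).trans_le (min_le_left _ _)) hbd
  have hbM : √(b s 0) * (2 * M) < 1 := sqrt_mul_lt_one hM0
    ((le_abs_self _).trans_lt ((hsmall 0).trans_le (min_le_right _ _)))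
  rw [coord_one] at hb1
  rw [hb1]
  have h0 : 0 < b s 0 := hp.1.1
  have he : ∀ y, 0 < y → Ψ y = errModel g Q q (cb Q χ) (cutProf χ S) (b s) y := fun y hy => by
    rw [hΨ, hS'.errorTerm_eq h hb0 hχ hs hmem hb h0 hy]
  have hsm : ∀ y, 0 < y → SmoothAt (errModel g Q q (cb Q χ) (cutProf χ S) (b s)) y := fun y hy =>
    hS'.contDiffAt_errModel h hb0 hχ hc h0 hy
  have hH := h.opH_iterate_eq he hsm
  refine ⟨fun k _ hk => ?_, ?_, ?_, fun k hk => ?_⟩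
  · rw [sqInt_congr (hH k), rpow_natCast]
    refine (h1 k hk (b s) hp).trans (ofReal_le_ofReal (mul_le_mul_of_nonneg_right ?_ (by positivity)))
    linarith [hA1 k hk]
  · rw [sqInt_congr (hH L), sqInt_congr (h.opA_opH_iterate_eq he hsm L)]
    refine (add_le_add (h2 (b s) hp) (h3 (b s) hp)).trans ?_
    rw [← ENNReal.ofReal_add (by positivity) (by positivity), ← add_mul]
    refine ofReal_le_ofReal (mul_le_mul_of_nonneg_right ?_ (by positivity))
    linarith
  · rw [sqInt_congr (hH (L + 1))]
    refine (h4 (b s) hp).trans (ofReal_le_ofReal (mul_le_mul_of_nonneg_right ?_ (by positivity)))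
    linarith
  · rw [sqInt_congr (hH k), rpow_natCast]
    refine (h5 k (by omega) M hM (b s) hp hbM).trans
      (ofReal_le_ofReal (mul_le_mul_of_nonneg_right ?_ (by positivity)))
    linarith [hB1 k hk]
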